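/- For $g\in L^2(\mathbb R)$ real-valued let $\|g\|_{H^2}=\|(1-\partial_x^2)g\|_{L^2}$, and let $\widehat g(\xi)=\frac1{\sqrt{2\pi}}\int_{\mathbb R}g(x)e^{-ix\xi}\,dx$. For $C\ge 0$ and $\varepsilon_0>0$ put $\gamma=\frac15\big(\frac1{10}-C\varepsilon_0^{2/5}\big)$. For every $C\ge0$ there are $\overline\varepsilon>0$ (so small that $\gamma>0$ whenever $0<\varepsilon_0\le\overline\varepsilon$), $T\ge1$ and $K>0$ such that the following holds for all $0<\varepsilon_0\le\overline\varepsilon$, all real-valued $u_0$ with $$\|u_0\|_{H^2}+\|xu_0\|_{L^2}\le\varepsilon_0,$$ and every real-valued solution $u\in C(\mathbb R;H^2(\mathbb R))$ of $$u_t=\partial_x^5u-u^4u_x,\qquad u(x,0)=u_0(x).$$ Let $f(t)=e^{-t\partial_x^5}u(t)$ be the profile of $u$. For $t\ge1$ one has $f(t)\in L^1(\mathbb R)$, so that $\widehat f(t,\xi)$ is defined for every $\xi$, and $t\mapsto\widehat f(t,\xi)$ is continuous on $[1,\infty)$. For $t\geq 1$ and $\xi\neq 0$ let $$B(t,\xi)=\frac1{40\xi^5}\int_1^t|\widehat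 f(s,\xi)|^4\,\frac{ds}{s^2},\qquad \tilde w(t,\xi)=e^{iB(t,\xi)}\widehat f(t,\xi).$$ Then for every $\delta\in(0,1/2)$: (i) there is $w_\infty\in L^\infty(\mathbb R)$ such that $$|\tilde w(t,\xi)-w_\infty(\xi)|\le K\varepsilon_0\,(|\xi|t^{1/5})^{-(\frac12-\delta)}\quad\text{for all }t\ge T,\ |\xi|\ge2^{-10}t^{-\frac15+\gamma};$$ (ii) there is $f_\infty\in L^\infty(\mathbb R)$ such that $$\Big|\widehat f(t,\xi)-\exp\Big(\frac{i}{40t\xi^5}|f_\infty(\xi)|^4\Big)f_\infty(\xi)\Big|\le K\varepsilon_0\,(|\xi|t^{1/5})^{-(\frac12-\delta)}\quad\text{for all }t\ge T,\ |\xi|\ge2^{-10}t^{-\frac15+\gamma}.$$ -/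

import Mathlib

open MeasureTheory Filter Topology FourierTransform
open scoped ENNReal ContDiff

noncomputable section

namespace FifthKdV

/-- A real `L²` function on the line, regarded as a complex-valued one. -/
def toComplex (g : Lp ℝ 2 (volume : Measure ℝ)) : Lp ℂ 2 (volume : Measure ℝ) :=
  Complex.ofRealCLM.compLp g

/-- The `H²` norm `‖(1 - ∂ₓ²) g‖_{L²}` (possibly `∞`) of a real `L²` function, computed on the
Fourier side. In Mathlib's unitary normalisation `𝓕 g (η) = ∫ g(x) e^{-2πixη} dx`, the variable
`η` corresponds to the frequency `ξ = 2πη`, so the symbol of `1 - ∂ₓ²` is `1 + (2πη)²`. -/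
def h2Norm (g : Lp ℝ 2 (volume : Measure ℝ)) : ℝ≥0∞ :=
  eLpNorm (fun η : ℝ => ((1 + (2 * Real.pi * η) ^ 2 : ℝ) : ℂ) *
    (𝓕 (toComplex g) : Lp ℂ 2 (volume : Measure ℝ)) η) 2 volume

/-- The weighted norm `‖x g‖_{L²}` (possibly `∞`). -/
def weightedNorm (g : Lp ℝ 2 (volume : Measure ℝ)) : ℝ≥0∞ :=
  eLpNorm (fun x : ℝ => x * g x) 2 volume

/-- `u ∈ C(ℝ; H²(ℝ))`. -/
def ContinuousInH2 (u : ℝ → Lp ℝ 2 (volume : Measure ℝ)) : Prop :=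
  (∀ t, h2Norm (u t) < ⊤) ∧
    ∀ t₀, Tendsto (fun t => h2Norm (u t - u t₀)) (𝓝 t₀) (𝓝 0)

/-- `u ∈ C(ℝ; H²(ℝ))` solves `u_t = ∂ₓ⁵ u - u⁴ uₓ` on `ℝ × ℝ` with `u(·, 0) = u₀`. The equation,
with `u⁴ uₓ = ∂ₓ(u⁵) / 5`, holds at every time in the sense of distributions in `x`. -/
structure IsSolution (u₀ : Lp ℝ 2 (volume : Measure ℝ))
    (u : ℝ → Lp ℝ 2 (volume : Measure ℝ)) : Prop where
  continuousInH2 : ContinuousInH2 u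
  initial : u 0 = u₀
  equation : ∀ φ : ℝ → ℝ, ContDiff ℝ ∞ φ → HasCompactSupport φ → ∀ t : ℝ,
    HasDerivAt (fun s : ℝ => ∫ x, u s x * φ x)
      (∫ x, (-(u t x * iteratedDeriv 5 φ x) + (u t x) ^ 5 / 5 * deriv φ x)) t

/-- The symbol `e^{-t (iξ)⁵}` of `e^{-t∂ₓ⁵}` at the frequency `ξ = 2πη`. -/
def propagatorSymbol (t η : ℝ) : ℂ :=
  Complex.exp (-(t : ℂ) * (Complex.I * ((2 * Real.pi * η : ℝ) : ℂ)) ^ 5)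

theorem norm_propagatorSymbol (t η : ℝ) : ‖propagatorSymbol t η‖ = 1 := by
  have h : -(t : ℂ) * (Complex.I * ((2 * Real.pi * η : ℝ) : ℂ)) ^ 5 =
      ((-t * (2 * Real.pi * η) ^ 5 : ℝ) : ℂ) * Complex.I := by
    have h5 : Complex.I ^ 5 = Complex.I := by
      rw [show (5 : ℕ) = 4 + 1 from rfl, pow_add, Complex.I_pow_four]; simp
    rw [mul_pow, h5]; push_cast; ring
  rw [propagatorSymbol, h, Complex.norm_exp_ofReal_mul_I]

theorem memLp_propagatorSymbol_mul (t : ℝ) (g : Lp ℂ 2 (volume : Measure ℝ)) :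
    MemLp (fun η : ℝ => propagatorSymbol t η * g η) 2 volume := by
  have hc : Continuous (propagatorSymbol t) := by
    unfold propagatorSymbol; fun_prop
  refine (Lp.memLp g).of_le (hc.aestronglyMeasurable.mul (Lp.aestronglyMeasurable g)) ?_
  filter_upwards with η
  rw [norm_mul, norm_propagatorSymbol, one_mul]

/-- The profile `f(t) = e^{-t∂ₓ⁵} u(t)`, an `L²` function of `x`. -/
def profile (u : ℝ → Lp ℝ 2 (volume : Measure ℝ)) (t : ℝ) : Lp ℂ 2 (volume : Measure ℝ) :=
  𝓕⁻ ((memLp_propagatorSymbol_mul t (𝓕 (toComplex (u t)))).toLp)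

/-- The Fourier transform
`f̂(t, ξ) = (2π)^{-1/2} ∫ f(t, x) e^{-ixξ} dx` of the profile, at every point `ξ`. -/
def profileHat (u : ℝ → Lp ℝ 2 (volume : Measure ℝ)) (t ξ : ℝ) : ℂ :=
  ((1 / Real.sqrt (2 * Real.pi) : ℝ) : ℂ) *
    ∫ x : ℝ, profile u t x * Complex.exp (-(Complex.I * ((x * ξ : ℝ) : ℂ)))

/-- The phase `B(t, ξ) = (40 ξ⁵)⁻¹ ∫₁ᵗ |f̂(s, ξ)|⁴ ds / s²`. -/
def phaseB (u : ℝ → Lp ℝ 2 (volume : Measure ℝ)) (t ξ : ℝ) : ℝ :=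
  1 / (40 * ξ ^ 5) * ∫ s in (1 : ℝ)..t, ‖profileHat u s ξ‖ ^ 4 / s ^ 2

/-- The modified profile `w̃(t, ξ) = e^{iB(t, ξ)} f̂(t, ξ)`. -/
def modifiedProfile (u : ℝ → Lp ℝ 2 (volume : Measure ℝ)) (t ξ : ℝ) : ℂ :=
  Complex.exp (Complex.I * (phaseB u t ξ : ℂ)) * profileHat u t ξ

/-- The exponent `γ = (1/5) (1/10 - C ε₀^{2/5})`. -/
def gammaExp (C ε₀ : ℝ) : ℝ := 1 / 5 * (1 / 10 - C * ε₀ ^ (2 / 5 : ℝ))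

end FifthKdV

end

/-! Work in the self-similar time variable `s = t^{1/5}`. If `f̂` is bounded by `N` and `‖x f‖_{L²}`
by `N √s`, stationary phase for `x ξ + ξ⁵` gives `|u| ≲ N s⁻¹ ⟨x/s⟩^{-3/8}` and `|u_x| ≲ N s⁻²
⟨x/s⟩^{-1/8}`, each further derivative costing `s⁻¹ ⟨x/s⟩^{1/4}` (`norm_integral_osc_le`,
`norm_integral_osc_fourier_le`). So `u⁵` and `∂ₓ²(u⁵)` are controlled in `L¹`, and the transform of
`u⁵` is `O(N⁵ s⁻⁴ (1 + (ξ s)²)⁻¹)` (`ProfileBound.norm_quinticHat_le`). Since `∂ₜ f̂` is `iξ/5`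
times this transform up to a unimodular factor, `|∂ₛ f̂| ≲ N⁵ |ξ| / (1 + (ξ s)²)`, which is the
`s`-derivative of `arctan (|ξ| s)` (`norm_profileF_sub_le_arctan`). The total variation of `f̂` is
therefore bounded uniformly in `ξ`, and the variation after `s` is at most a multiple of `N⁵ / (|ξ|
s)`.

Consequently `f̂` itself converges, at the rate `(|ξ| t^{1/5})⁻¹`; no resonant term has to be
removed. The increments of `B` after time `t`, and the phase `|f_∞|⁴ / (40 t ξ⁵)`, are `O(ε⁴ (|ξ|
t^{1/5})⁻⁵)`, hence part of the error. As `γ ≥ 0`, the region lies in `|ξ| t^{1/5} ≥ 2⁻¹⁰`, where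
these rates imply the exponent `1/2 - δ`.

The hypotheses on `f` are closed by continuity (`SmallData.profileSize_le`). The bound of `f̂` comes
from the arctangent. The weighted bound comes from scaling: `c u(c⁵ t, c x)` is again a solution,
the antiderivative of its difference with `u` satisfies an `L²` energy estimate
(`sqrt_integral_dilation_le`), and dividing by `c - 1` with `c ↓ 1` yields `‖x f‖ ≤ ε e^E + t
‖u⁵‖_{L²}`, where `E = ∫ 2 ‖u‖_∞³ ‖u_x‖_∞` (`memLp_mul_profileRep`). The decay makes `E` grow at
most like `(log s) / 2`, so `e^E` like `√s`, which is exactly what the hypothesis allows. On `0 ≤ t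
≤ 1` the same role is played by `H¹` energy bounds (`SmallData.energyExponent_le`).

The equation is only known weakly in `x` and `u` is only of class `H²`. The equation is therefore
turned into Duhamel's formula on the Fourier side (`propagator_mul_hat_ae`), energy estimates are
run for finite differences (translations, dilations) instead of derivatives, and second derivatives
are estimated on frequency-truncated waves before passing to the limit. -/

noncomputable section
namespace FifthKdV

/-! ### Stationary phase for the phase `x ξ + ξ⁵` -/

/-- The denominator `1 + i (ξ - l) (x + 5 ξ⁴)` produced by differentiating
`(ξ - l) e^{i (x ξ + ξ⁵)}`. -/
def oscDen (l x ξ : ℝ) : ℂ := 1 + Complex.I * (((ξ - l) * (x + 5 * ξ ^ 4) : ℝ) : ℂ)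

theorem one_le_norm_oscDen (l x ξ : ℝ) : 1 ≤ ‖oscDen l x ξ‖ := by
  refine le_trans ?_ (Complex.abs_re_le_norm _)
  simp only [oscDen, Complex.add_re, Complex.one_re, Complex.mul_re, Complex.I_re, Complex.I_im,
    Complex.ofReal_re, Complex.ofReal_im]
  norm_num

theorem abs_le_norm_oscDen (l x ξ : ℝ) : |(ξ - l) * (x + 5 * ξ ^ 4)| ≤ ‖oscDen l x ξ‖ := by
  refine le_trans (le_of_eq ?_) (Complex.abs_im_le_norm _)
  simp only [oscDen, Complex.add_im, Complex.one_im, Complex.mul_im, Complex.I_re, Complex.I_im,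
    Complex.ofReal_re, Complex.ofReal_im]
  norm_num

theorem oscDen_ne_zero (l x ξ : ℝ) : oscDen l x ξ ≠ 0 := by
  have := one_le_norm_oscDen l x ξ
  intro h
  rw [h, norm_zero] at this
  linarith

/-- For `x = -5 l⁴` the point `l` is stationary and `(ξ - l)(x + 5 ξ⁴) = 5 (ξ - l)² (ξ + l)(ξ² +
l²)`, comparable to `(ξ - l)² (ξ + l)³` because `(ξ + l)² ≤ 2 (ξ² + l²)`. For `x = 5 l⁴` nothing is
stationary and `|ξ - l| ≤ ξ + l` suffices. For `|x| ≤ 5` the scale is frozen at `l = 1`. -/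
theorem one_add_le_norm_oscDen {l x ξ : ℝ} (hl : 1 ≤ l) (hξ : 0 ≤ ξ)
    (h : |x| = 5 * l ^ 4 ∨ (l = 1 ∧ |x| ≤ 5)) :
    1 + (ξ - l) ^ 2 * (ξ + l) ^ 3 ≤ 28 * ‖oscDen l x ξ‖ := by
  have h1 := one_le_norm_oscDen l x ξ
  have h2 := abs_le_norm_oscDen l x ξ
  -- The first alternative is only needed for `l = 1`, `ξ ≤ 2`, where `(ξ + 1)³ ≤ 27`; the bound
  -- `|D| ≥ 1` absorbs it, whence `28 = 1 + 27`.
  have key : (ξ - l) ^ 2 * (ξ + l) ^ 3 ≤ 27 ∨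
      (ξ - l) ^ 2 * (ξ + l) ^ 3 ≤ 8 / 5 * |(ξ - l) * (x + 5 * ξ ^ 4)| := by
    have hS : 0 ≤ ξ + l := by linarith
    have neg_case : ∀ y : ℝ, -(5 * l ^ 4) ≤ y → l ≤ ξ →
        (ξ - l) ^ 2 * (ξ + l) ^ 3 ≤ 8 / 5 * ((ξ - l) * (y + 5 * ξ ^ 4)) := by
      intro y hy hlξ
      have e1 : (ξ - l) * (5 * ξ ^ 4 - 5 * l ^ 4) ≤ (ξ - l) * (y + 5 * ξ ^ 4) :=
        mul_le_mul_of_nonneg_left (by linarith) (by linarith)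
      have e2 : (ξ - l) ^ 2 * (ξ + l) ^ 3 ≤ (ξ - l) ^ 2 * (2 * (ξ + l) * (ξ ^ 2 + l ^ 2)) := by
        refine mul_le_mul_of_nonneg_left ?_ (sq_nonneg _)
        nlinarith [mul_nonneg hS (sq_nonneg (ξ - l))]
      have e3 : 0 ≤ (ξ - l) ^ 2 * ((ξ + l) * (ξ ^ 2 + l ^ 2)) := by positivity
      nlinarith
    rcases h with h | ⟨rfl, h⟩
    · right
      rcases abs_choice x with hx | hx
      · have hx' : x = 5 * l ^ 4 := by linarith
        subst hx'
        rw [abs_mul, abs_of_nonneg (by positivity : (0 : ℝ) ≤ 5 * l ^ 4 + 5 * ξ ^ 4)]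
        have hab : |ξ - l| ≤ ξ + l := by rw [abs_le]; constructor <;> linarith
        have e1 : (ξ - l) ^ 2 * (ξ + l) ^ 3 ≤ |ξ - l| * (ξ + l) ^ 4 := by
          rw [← sq_abs]
          have : |ξ - l| * |ξ - l| * (ξ + l) ^ 3 ≤ |ξ - l| * (ξ + l) * (ξ + l) ^ 3 := by
            gcongr
          calc _ = |ξ - l| * |ξ - l| * (ξ + l) ^ 3 := by ring
            _ ≤ _ := this
            _ = _ := by ring
        have e2 : (ξ + l) ^ 4 ≤ 8 * (l ^ 4 + ξ ^ 4) := by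
          nlinarith [sq_nonneg (ξ ^ 2 - l ^ 2), sq_nonneg (ξ - l),
            mul_nonneg (sq_nonneg (ξ - l)) (sq_nonneg (ξ + l)), sq_nonneg ((ξ - l) ^ 2)]
        have e3 : |ξ - l| * (ξ + l) ^ 4 ≤ |ξ - l| * (8 * (l ^ 4 + ξ ^ 4)) := by gcongr
        linarith
      · have hx' : x = -(5 * l ^ 4) := by linarith
        subst hx'
        refine le_trans ?_ (mul_le_mul_of_nonneg_left (le_abs_self _) (by norm_num))
        have e2 : (ξ - l) ^ 2 * (ξ + l) ^ 3 ≤ (ξ - l) ^ 2 * (2 * (ξ + l) * (ξ ^ 2 + l ^ 2)) := by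
          refine mul_le_mul_of_nonneg_left ?_ (sq_nonneg _)
          nlinarith [mul_nonneg hS (sq_nonneg (ξ - l))]
        have e3 : 0 ≤ (ξ - l) ^ 2 * ((ξ + l) * (ξ ^ 2 + l ^ 2)) := by positivity
        nlinarith
    · by_cases hξ2 : ξ ≤ 2
      · left
        have a1 : (ξ - 1) ^ 2 ≤ 1 := by nlinarith
        have a2 : (ξ + 1) ^ 3 ≤ 3 ^ 3 := by gcongr; linarith
        have a3 : 0 ≤ (ξ + 1) ^ 3 := by positivity
        nlinarith
      · right
        refine le_trans ?_ (mul_le_mul_of_nonneg_left (le_abs_self _) (by norm_num))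
        exact neg_case x (by rw [abs_le] at h; linarith) (by linarith)
  rcases key with h3 | h3
  · linarith
  · linarith

/-- Here `m²` is the stationary point. With `s = ξ - m²` and `S = ξ + m²`, the bound `S² ≤ 8 m⁴ + 2
s²` splits the weight into a Lorentzian of width `m⁻³` (using `S ≥ m²`) and a tail `2 S⁻³`. Both
have explicit primitives; the arctangent contributes `8 π m`. -/
theorem integral_weight_le {m R : ℝ} (hm : 1 ≤ m) (hR : 0 ≤ R) :
    ∫ ξ in (0 : ℝ)..R, (ξ + m ^ 2) ^ 2 / (1 + (ξ - m ^ 2) ^ 2 * (ξ + m ^ 2) ^ 3) ≤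
      (8 * Real.pi + 1) * m := by
  have hm2 : 1 ≤ m ^ 2 := one_le_pow₀ hm
  have hder : ∀ ξ ∈ Set.uIcc 0 R, HasDerivAt
      (fun ξ => 8 * m * Real.arctan (m ^ 3 * (ξ - m ^ 2)) - ((ξ + m ^ 2) ^ 2)⁻¹)
      (8 * m ^ 4 / (1 + m ^ 6 * (ξ - m ^ 2) ^ 2) + 2 / (ξ + m ^ 2) ^ 3) ξ := by
    intro ξ hξ
    rw [Set.uIcc_of_le hR] at hξ
    have hS : 0 < ξ + m ^ 2 := by linarith [hξ.1]
    have h1 : HasDerivAt (fun ξ => m ^ 3 * (ξ - m ^ 2)) (m ^ 3) ξ := by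
      simpa using ((hasDerivAt_id ξ).sub_const (m ^ 2)).const_mul (m ^ 3)
    have h2 := (h1.arctan).const_mul (8 * m)
    have h3 : HasDerivAt (fun ξ => (ξ + m ^ 2) ^ 2) (2 * (ξ + m ^ 2)) ξ := by
      refine (((hasDerivAt_id' ξ).add_const (m ^ 2)).fun_pow 2).congr_deriv (by simp)
    have h4 := h3.inv (by positivity)
    refine (h2.sub h4).congr_deriv ?_
    have : 1 + m ^ 6 * (ξ - m ^ 2) ^ 2 = 1 + (m ^ 3 * (ξ - m ^ 2)) ^ 2 := by ring
    rw [this]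
    field_simp
    ring
  have hcont : ContinuousOn (fun ξ : ℝ => 8 * m ^ 4 / (1 + m ^ 6 * (ξ - m ^ 2) ^ 2) +
      2 / (ξ + m ^ 2) ^ 3) (Set.uIcc 0 R) := by
    rw [Set.uIcc_of_le hR]
    refine ContinuousOn.add ?_ ?_
    · refine Continuous.continuousOn ?_
      refine Continuous.div (by fun_prop) (by fun_prop) fun ξ => by positivity
    · refine ContinuousOn.div (by fun_prop) (by fun_prop) fun ξ hξ => ?_
      have : 0 < ξ + m ^ 2 := by linarith [hξ.1]
      positivity
  have hFTC := intervalIntegral.integral_eq_sub_of_hasDerivAt hder hcont.intervalIntegrable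
  have hmono : ∫ ξ in (0 : ℝ)..R,
      (ξ + m ^ 2) ^ 2 / (1 + (ξ - m ^ 2) ^ 2 * (ξ + m ^ 2) ^ 3) ≤
      ∫ ξ in (0 : ℝ)..R, (8 * m ^ 4 / (1 + m ^ 6 * (ξ - m ^ 2) ^ 2) + 2 / (ξ + m ^ 2) ^ 3) := by
    refine intervalIntegral.integral_mono_on hR ?_ hcont.intervalIntegrable ?_
    · refine ContinuousOn.intervalIntegrable ?_
      rw [Set.uIcc_of_le hR]
      refine ContinuousOn.div (by fun_prop) (by fun_prop) fun ξ hξ => ?_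
      have : 0 < ξ + m ^ 2 := by linarith [hξ.1]
      positivity
    · intro ξ hξ
      have hS : m ^ 2 ≤ ξ + m ^ 2 := by linarith [hξ.1]
      have hS0 : 0 < ξ + m ^ 2 := by linarith
      set s := ξ - m ^ 2 with hs
      set S := ξ + m ^ 2 with hSdef
      have hSs : S ^ 2 ≤ 8 * m ^ 4 + 2 * s ^ 2 := by
        have : S = s + 2 * m ^ 2 := by rw [hs, hSdef]; ring
        rw [this]
        nlinarith [sq_nonneg (s - 2 * m ^ 2)]
      have hQ : 0 < 1 + s ^ 2 * S ^ 3 := by positivity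
      calc S ^ 2 / (1 + s ^ 2 * S ^ 3) ≤ (8 * m ^ 4 + 2 * s ^ 2) / (1 + s ^ 2 * S ^ 3) := by gcongr
        _ = 8 * m ^ 4 / (1 + s ^ 2 * S ^ 3) + 2 * s ^ 2 / (1 + s ^ 2 * S ^ 3) := by
          rw [add_div]
        _ ≤ 8 * m ^ 4 / (1 + m ^ 6 * s ^ 2) + 2 / S ^ 3 := by
          refine add_le_add ?_ ?_
          · gcongr 8 * m ^ 4 / (1 + ?_)
            have : (m ^ 2) ^ 3 ≤ S ^ 3 := by gcongr
            calc m ^ 6 * s ^ 2 = s ^ 2 * (m ^ 2) ^ 3 := by ring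
              _ ≤ _ := by gcongr
          · rw [div_le_div_iff₀ hQ (by positivity)]
            nlinarith
  refine hmono.trans ?_
  rw [hFTC]
  have a1 := Real.arctan_lt_pi_div_two (m ^ 3 * (R - m ^ 2))
  have a2 := Real.neg_pi_div_two_lt_arctan (m ^ 3 * (0 - m ^ 2))
  have a3 : ((0 + m ^ 2) ^ 2)⁻¹ ≤ 1 := by
    rw [zero_add]
    exact inv_le_one_of_one_le₀ (one_le_pow₀ hm2)
  have a4 : 0 ≤ ((R + m ^ 2) ^ 2)⁻¹ := by positivity
  have hm0 : 0 < m := by linarith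
  nlinarith

/-- The same splitting of `S²`, with `2 |s| m³ ≤ 1 + s² m⁶` for the term near the stationary point.
Uniformity in `ξ` makes the boundary terms of the partial integration harmless. -/
theorem weight_boundary_le {m ξ : ℝ} (hm : 1 ≤ m) (hξ : 0 ≤ ξ) :
    |ξ - m ^ 2| * (ξ + m ^ 2) ^ 2 / (1 + (ξ - m ^ 2) ^ 2 * (ξ + m ^ 2) ^ 3) ≤ 6 * m := by
  have hm0 : 0 < m := by linarith
  have hm2 : 1 ≤ m ^ 2 := one_le_pow₀ hm
  set s := ξ - m ^ 2 with hs
  set S := ξ + m ^ 2 with hSdef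
  have hS : m ^ 2 ≤ S := by rw [hSdef]; linarith
  have hS0 : 0 < S := by linarith
  have hSs : S ^ 2 ≤ 8 * m ^ 4 + 2 * s ^ 2 := by
    have : S = s + 2 * m ^ 2 := by rw [hs, hSdef]; ring
    rw [this]
    nlinarith [sq_nonneg (s - 2 * m ^ 2)]
  have hsS : |s| ≤ S := by rw [abs_le]; constructor <;> (rw [hs, hSdef]; linarith)
  have hQ : 0 < 1 + s ^ 2 * S ^ 3 := by positivity
  rw [div_le_iff₀ hQ]
  have hS3 : m ^ 6 ≤ S ^ 3 := by
    calc m ^ 6 = (m ^ 2) ^ 3 := by ring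
      _ ≤ S ^ 3 := by gcongr
  have e0 : 0 ≤ |s| := abs_nonneg s
  have esq : s ^ 2 = |s| ^ 2 := (sq_abs s).symm
  rw [esq] at hSs ⊢
  set a := |s|
  have e1 : a * S ^ 2 ≤ 8 * m ^ 4 * a + 2 * a ^ 3 := by nlinarith
  have e2 : 8 * m ^ 4 * a ≤ 4 * m * (1 + a ^ 2 * m ^ 6) := by
    nlinarith [mul_nonneg hm0.le (sq_nonneg (a * m ^ 3 - 1))]
  have e3 : a ^ 2 * m ^ 6 ≤ a ^ 2 * S ^ 3 := by gcongr
  have e4 : a ^ 3 ≤ a ^ 2 * S ^ 3 := by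
    have : a ≤ S ^ 3 := hsS.trans (by
      calc S = S ^ 1 := (pow_one S).symm
        _ ≤ S ^ 3 := pow_le_pow_right₀ (by linarith) (by norm_num))
    calc a ^ 3 = a ^ 2 * a := by ring
      _ ≤ _ := by gcongr
  have e5 : 4 * m * (1 + a ^ 2 * m ^ 6) ≤ 4 * m * (1 + a ^ 2 * S ^ 3) := by gcongr
  have e6 : a ^ 2 * S ^ 3 ≤ m * (1 + a ^ 2 * S ^ 3) := by
    nlinarith [mul_nonneg (sq_nonneg a) (by positivity : 0 ≤ S ^ 3)]
  nlinarith

/-- This reduces every power `j ≤ 2` to the weight with `S²`, at the price of `m^{2j-4}`. -/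
theorem pow_weight_le {m S : ℝ} {j : ℕ} (hj : j ≤ 2) (hm : 1 ≤ m) (hS : m ^ 2 ≤ S) :
    S ^ j ≤ m ^ (2 * j) / m ^ 4 * S ^ 2 := by
  have hm0 : 0 < m := by linarith
  rw [div_mul_eq_mul_div, le_div_iff₀ (by positivity)]
  have hS0 : 0 < S := lt_of_lt_of_le (by positivity) hS
  interval_cases j
  · simp only [pow_zero, mul_zero, one_mul]
    calc m ^ 4 = (m ^ 2) ^ 2 := by ring
      _ ≤ S ^ 2 := by gcongr
  · simp only [pow_one, mul_one]
    calc S * m ^ 4 = m ^ 2 * S * m ^ 2 := by ring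
      _ ≤ m ^ 2 * S * S := by gcongr
      _ = m ^ 2 * S ^ 2 := by ring
  · apply le_of_eq; ring

theorem hasDerivAt_oscDen (l x ξ : ℝ) : HasDerivAt (oscDen l x)
    (Complex.I * (((x + 5 * ξ ^ 4) + (ξ - l) * (20 * ξ ^ 3) : ℝ) : ℂ)) ξ := by
  have h : HasDerivAt (fun ξ : ℝ => (ξ - l) * (x + 5 * ξ ^ 4))
      ((x + 5 * ξ ^ 4) + (ξ - l) * (20 * ξ ^ 3)) ξ := by
    have h1 : HasDerivAt (fun ξ : ℝ => ξ - l) 1 ξ := (hasDerivAt_id' ξ).sub_const l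
    have h2 : HasDerivAt (fun ξ : ℝ => x + 5 * ξ ^ 4) (20 * ξ ^ 3) ξ := by
      refine (((hasDerivAt_pow 4 ξ).const_mul 5).const_add x).congr_deriv ?_
      norm_num; ring
    refine (h1.mul h2).congr_deriv ?_
    ring
  exact (h.ofReal_comp.const_mul Complex.I).const_add 1

/-- The oscillation `e^{i (x ξ + ξ⁵)}`. -/
def osc (x ξ : ℝ) : ℂ := Complex.exp (Complex.I * ((x * ξ + ξ ^ 5 : ℝ) : ℂ))

theorem norm_osc (x ξ : ℝ) : ‖osc x ξ‖ = 1 := by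
  rw [osc, mul_comm, Complex.norm_exp_ofReal_mul_I]

theorem continuous_osc (x : ℝ) : Continuous (osc x) := by
  unfold osc; fun_prop

theorem hasDerivAt_shift_mul_osc (l x ξ : ℝ) :
    HasDerivAt (fun ξ : ℝ => ((ξ - l : ℝ) : ℂ) * osc x ξ) (osc x ξ * oscDen l x ξ) ξ := by
  have h1 : HasDerivAt (fun ξ : ℝ => ((ξ - l : ℝ) : ℂ)) ((1 : ℝ) : ℂ) ξ :=
    ((hasDerivAt_id' ξ).sub_const l).ofReal_comp
  have h2 : HasDerivAt (fun ξ : ℝ => x * ξ + ξ ^ 5) (x + 5 * ξ ^ 4) ξ := by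
    refine (((hasDerivAt_id' ξ).const_mul x).add (hasDerivAt_pow 5 ξ)).congr_deriv ?_
    norm_num
  have h3 := (h2.ofReal_comp.const_mul Complex.I).cexp
  refine (h1.mul h3).congr_deriv ?_
  simp only [osc, oscDen]
  push_cast
  ring

/-- Pointwise bound for the derivative of `ξ ^ j G / D` weighted by `ξ - l`. -/
theorem norm_shift_mul_deriv_le {l x ξ N : ℝ} {j : ℕ} {g g' : ℂ} (hj : j ≤ 2) (hl : 1 ≤ l)
    (hξ : 0 ≤ ξ) (h : |x| = 5 * l ^ 4 ∨ (l = 1 ∧ |x| ≤ 5)) (hg : ‖g‖ ≤ N) :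
    ‖((ξ - l : ℝ) : ℂ) * ((((j : ℂ) * (ξ : ℂ) ^ (j - 1) * g + (ξ : ℂ) ^ j * g') * oscDen l x ξ -
      (ξ : ℂ) ^ j * g * (Complex.I * (((x + 5 * ξ ^ 4) + (ξ - l) * (20 * ξ ^ 3) : ℝ) : ℂ))) /
        oscDen l x ξ ^ 2)‖ ≤
    (563 * N * (ξ + l) ^ j + |ξ - l| * (ξ + l) ^ j * ‖g'‖) *
      (28 / (1 + (ξ - l) ^ 2 * (ξ + l) ^ 3)) := by
  have hD1 := one_le_norm_oscDen l x ξ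
  have hDP := abs_le_norm_oscDen l x ξ
  have hDQ := one_add_le_norm_oscDen hl hξ h
  have hne := oscDen_ne_zero l x ξ
  set D := oscDen l x ξ
  have hS : 0 < ξ + l := by linarith
  have hab : |ξ - l| ≤ ξ + l := by rw [abs_le]; constructor <;> linarith
  have hξS : ξ ≤ ξ + l := by linarith
  have hN : 0 ≤ N := (norm_nonneg _).trans hg
  have hQ : 0 < 1 + (ξ - l) ^ 2 * (ξ + l) ^ 3 := by positivity
  have hDpos : 0 < ‖D‖ := by linarith
  have hDinv : 1 / ‖D‖ ≤ 28 / (1 + (ξ - l) ^ 2 * (ξ + l) ^ 3) := by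
    rw [div_le_div_iff₀ hDpos hQ]; linarith
  -- The vector field `(ξ - l) ∂` costs nothing on `D`: the first part is the imaginary part of `D`,
  -- the second is at most `20 · 28 ‖D‖`, and `561 = 1 + 20 · 28`.
  have hD' : |ξ - l| * |(x + 5 * ξ ^ 4) + (ξ - l) * (20 * ξ ^ 3)| ≤ 561 * ‖D‖ := by
    rw [← abs_mul]
    have e : (ξ - l) * ((x + 5 * ξ ^ 4) + (ξ - l) * (20 * ξ ^ 3)) =
      (ξ - l) * (x + 5 * ξ ^ 4) + 20 * ((ξ - l) ^ 2 * ξ ^ 3) := by ring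
    rw [e]
    refine (abs_add_le _ _).trans ?_
    have e2 : |20 * ((ξ - l) ^ 2 * ξ ^ 3)| ≤ 20 * ((ξ - l) ^ 2 * (ξ + l) ^ 3) := by
      rw [abs_of_nonneg (by positivity)]
      gcongr
    linarith
  have e : ((ξ - l : ℝ) : ℂ) * ((((j : ℂ) * (ξ : ℂ) ^ (j - 1) * g + (ξ : ℂ) ^ j * g') * D -
      (ξ : ℂ) ^ j * g * (Complex.I * (((x + 5 * ξ ^ 4) + (ξ - l) * (20 * ξ ^ 3) : ℝ) : ℂ))) /
        D ^ 2) = (((ξ - l : ℝ) : ℂ) * ((j : ℂ) * (ξ : ℂ) ^ (j - 1)) * g +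
          ((ξ - l : ℝ) : ℂ) * (ξ : ℂ) ^ j * g') / D -
        (ξ : ℂ) ^ j * g * (Complex.I * (((ξ - l : ℝ) : ℂ) *
          (((x + 5 * ξ ^ 4) + (ξ - l) * (20 * ξ ^ 3) : ℝ) : ℂ))) / D ^ 2 := by
    field_simp
  rw [e]
  have hj1 : |ξ - l| * (j * ξ ^ (j - 1)) ≤ 2 * (ξ + l) ^ j := by
    interval_cases j
    · simp
    · simp; linarith
    · simp
      nlinarith [abs_nonneg (ξ - l)]
  have hcast : ‖(ξ : ℂ) ^ j‖ = ξ ^ j := by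
    rw [norm_pow, Complex.norm_real, Real.norm_of_nonneg hξ]
  have hpow : ξ ^ j ≤ (ξ + l) ^ j := by gcongr
  have b1 : ‖(((ξ - l : ℝ) : ℂ) * ((j : ℂ) * (ξ : ℂ) ^ (j - 1)) * g +
          ((ξ - l : ℝ) : ℂ) * (ξ : ℂ) ^ j * g') / D‖ ≤
      (2 * (ξ + l) ^ j * N + |ξ - l| * (ξ + l) ^ j * ‖g'‖) * (1 / ‖D‖) := by
    rw [norm_div, div_eq_mul_one_div]
    gcongr
    refine (norm_add_le _ _).trans (add_le_add ?_ ?_)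
    · rw [norm_mul, norm_mul, norm_mul, norm_pow, Complex.norm_real, Complex.norm_real,
        Complex.norm_natCast, Real.norm_eq_abs, Real.norm_of_nonneg hξ]
      gcongr
    · rw [norm_mul, norm_mul, hcast, Complex.norm_real, Real.norm_eq_abs]
      gcongr
  have b2 : ‖(ξ : ℂ) ^ j * g * (Complex.I * (((ξ - l : ℝ) : ℂ) *
          (((x + 5 * ξ ^ 4) + (ξ - l) * (20 * ξ ^ 3) : ℝ) : ℂ))) / D ^ 2‖ ≤
      561 * N * (ξ + l) ^ j * (1 / ‖D‖) := by
    rw [norm_div, norm_mul, norm_mul, norm_mul, norm_mul, hcast, Complex.norm_I, one_mul,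
      Complex.norm_real, Complex.norm_real, Real.norm_eq_abs, Real.norm_eq_abs, norm_pow]
    have : ξ ^ j * ‖g‖ * (|ξ - l| * |(x + 5 * ξ ^ 4) + (ξ - l) * (20 * ξ ^ 3)|) ≤
        (ξ + l) ^ j * N * (561 * ‖D‖) := by gcongr
    rw [div_le_iff₀ (by positivity)]
    refine this.trans (le_of_eq ?_)
    field_simp
  refine (norm_sub_le _ _).trans ?_
  calc _ ≤ (2 * (ξ + l) ^ j * N + |ξ - l| * (ξ + l) ^ j * ‖g'‖) * (1 / ‖D‖) +
        561 * N * (ξ + l) ^ j * (1 / ‖D‖) := add_le_add b1 b2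
    _ = (563 * N * (ξ + l) ^ j + |ξ - l| * (ξ + l) ^ j * ‖g'‖) * (1 / ‖D‖) := by ring
    _ ≤ _ := by gcongr

end FifthKdV
end

/-! ### Integration by parts around the stationary point -/

noncomputable section
namespace FifthKdV

/-- Only the `L²` norm of `G'` is available, so the term linear in `y = |G'|` is split by the
arithmetic-geometric mean. The weights are balanced so that, after integration with `∫ y² ≤ N²` and
the weight integral `≲ m`, both halves are of size `N m^{2j-3}`. The constant is `563 · 28 + 392 =
16156`. -/
theorem weighted_deriv_le {m ξ N y : ℝ} {j : ℕ} (hj : j ≤ 2) (hm : 1 ≤ m) (hξ : 0 ≤ ξ)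
    (hN : 0 < N) :
    (563 * N * (ξ + m ^ 2) ^ j + |ξ - m ^ 2| * (ξ + m ^ 2) ^ j * y) *
      (28 / (1 + (ξ - m ^ 2) ^ 2 * (ξ + m ^ 2) ^ 3)) ≤
    16156 * N * (m ^ (2 * j) / m ^ 4) *
      ((ξ + m ^ 2) ^ 2 / (1 + (ξ - m ^ 2) ^ 2 * (ξ + m ^ 2) ^ 3)) +
      m ^ (2 * j) / m ^ 3 / (2 * N) * y ^ 2 := by
  have hm0 : 0 < m := by linarith
  have hS : m ^ 2 ≤ ξ + m ^ 2 := by linarith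
  have hp := pow_weight_le hj hm hS
  have hS0 : 0 < ξ + m ^ 2 := lt_of_lt_of_le (by positivity) hS
  set S := ξ + m ^ 2
  set s := ξ - m ^ 2
  set Sj := S ^ j
  have hSj : 0 < Sj := by positivity
  have hc : 0 < m ^ (2 * j) := by positivity
  set c := m ^ (2 * j)
  have hQ : 0 < 1 + s ^ 2 * S ^ 3 := by positivity
  set q := 1 + s ^ 2 * S ^ 3 with hq
  set a := 28 * |s| * Sj / q with ha
  -- One factor `s² S³ ≤ q` cancels one of the two denominators; the surplus `S ≤ m S²` merely
  -- brings the bound into the form of the integrable weight.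
  have ha2 : a ^ 2 ≤ 784 * (c ^ 2 / m ^ 7) * (S ^ 2 / q) := by
    have h1 : Sj ^ 2 ≤ (c / m ^ 4 * S ^ 2) ^ 2 := by gcongr
    have h2 : s ^ 2 * S ^ 3 ≤ q := by rw [hq]; linarith
    have h3 : a ^ 2 = 784 * (s ^ 2 * Sj ^ 2) / q ^ 2 := by
      rw [ha, div_pow, mul_pow, mul_pow, sq_abs]; ring
    rw [h3]
    have h4 : s ^ 2 * Sj ^ 2 ≤ c ^ 2 / m ^ 8 * S * q := by
      calc s ^ 2 * Sj ^ 2 ≤ s ^ 2 * (c / m ^ 4 * S ^ 2) ^ 2 := by gcongr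
        _ = c ^ 2 / m ^ 8 * S * (s ^ 2 * S ^ 3) := by field_simp
        _ ≤ _ := by gcongr
    have h5 : c ^ 2 / m ^ 8 * S ≤ c ^ 2 / m ^ 7 * S ^ 2 := by
      have : S ≤ m * S ^ 2 := by
        have h6 : 1 ≤ S := le_trans (one_le_pow₀ hm) hS
        nlinarith [mul_le_mul hm h6 (by norm_num) hm0.le]
      calc c ^ 2 / m ^ 8 * S ≤ c ^ 2 / m ^ 8 * (m * S ^ 2) := by gcongr
        _ = _ := by field_simp
    rw [div_le_iff₀ (by positivity)]
    calc 784 * (s ^ 2 * Sj ^ 2) ≤ 784 * (c ^ 2 / m ^ 7 * S ^ 2 * q) := by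
          have := mul_le_mul_of_nonneg_right h5 hQ.le
          linarith
      _ = _ := by field_simp
  have hamgm : a * y ≤ N * (m ^ 3 / c) * a ^ 2 / 2 + c / m ^ 3 / (2 * N) * y ^ 2 := by
    have h : 0 ≤ (N * (m ^ 3 / c) * a - y) ^ 2 / (2 * (N * (m ^ 3 / c))) := by positivity
    have e : (N * (m ^ 3 / c) * a - y) ^ 2 / (2 * (N * (m ^ 3 / c))) =
      N * (m ^ 3 / c) * a ^ 2 / 2 + c / m ^ 3 / (2 * N) * y ^ 2 - a * y := by
      field_simp
      ring
    linarith
  have hsecond : N * (m ^ 3 / c) * a ^ 2 / 2 ≤ 392 * N * (c / m ^ 4) * (S ^ 2 / q) := by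
    calc N * (m ^ 3 / c) * a ^ 2 / 2
        ≤ N * (m ^ 3 / c) * (784 * (c ^ 2 / m ^ 7) * (S ^ 2 / q)) / 2 := by gcongr
      _ = _ := by field_simp; norm_num
  have hfirst : 563 * N * Sj * (28 / q) ≤ 15764 * N * (c / m ^ 4) * (S ^ 2 / q) := by
    calc 563 * N * Sj * (28 / q) ≤ 563 * N * (c / m ^ 4 * S ^ 2) * (28 / q) := by gcongr
      _ = _ := by ring
  calc (563 * N * Sj + |s| * Sj * y) * (28 / q) = 563 * N * Sj * (28 / q) + a * y := by
        rw [ha]; ring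
    _ ≤ _ := by linarith

theorem shift_boundary_le {x m ξ N : ℝ} {j : ℕ} {g : ℂ} (hj : j ≤ 2) (hm : 1 ≤ m)
    (h : |x| = 5 * (m ^ 2) ^ 4 ∨ (m ^ 2 = 1 ∧ |x| ≤ 5)) (hξ : 0 ≤ ξ) (hN : 0 < N) (hg : ‖g‖ ≤ N) :
    ‖((ξ - m ^ 2 : ℝ) : ℂ) * osc x ξ * ((ξ : ℂ) ^ j * g / oscDen (m ^ 2) x ξ)‖ ≤
      168 * N * (m ^ (2 * j) / m ^ 3) := by
  have hm0 : 0 < m := by linarith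
  have hD1 := one_le_norm_oscDen (m ^ 2) x ξ
  have hDQ := one_add_le_norm_oscDen (one_le_pow₀ hm) hξ h
  have hb := weight_boundary_le hm hξ
  have hS : m ^ 2 ≤ ξ + m ^ 2 := by linarith
  have hp := pow_weight_le hj hm hS
  rw [norm_mul, norm_mul, norm_osc, mul_one, norm_div, norm_mul, norm_pow, Complex.norm_real,
    Complex.norm_real, Real.norm_eq_abs, Real.norm_of_nonneg hξ]
  set D := ‖oscDen (m ^ 2) x ξ‖
  have hDpos : 0 < D := by linarith
  have hS0 : 0 < ξ + m ^ 2 := lt_of_lt_of_le (by positivity) hS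
  have hQ : 0 < 1 + (ξ - m ^ 2) ^ 2 * (ξ + m ^ 2) ^ 3 := by positivity
  have hDinv : 1 / D ≤ 28 / (1 + (ξ - m ^ 2) ^ 2 * (ξ + m ^ 2) ^ 3) := by
    rw [div_le_div_iff₀ hDpos hQ]; linarith
  have hpow : ξ ^ j ≤ m ^ (2 * j) / m ^ 4 * (ξ + m ^ 2) ^ 2 :=
    le_trans (pow_le_pow_left₀ hξ (by nlinarith) j) hp
  calc |ξ - m ^ 2| * (ξ ^ j * ‖g‖ / D) = |ξ - m ^ 2| * (ξ ^ j * ‖g‖) * (1 / D) := by ring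
    _ ≤ |ξ - m ^ 2| * (m ^ (2 * j) / m ^ 4 * (ξ + m ^ 2) ^ 2 * N) *
        (28 / (1 + (ξ - m ^ 2) ^ 2 * (ξ + m ^ 2) ^ 3)) := by gcongr
    _ = 28 * N * (m ^ (2 * j) / m ^ 4) * (|ξ - m ^ 2| * (ξ + m ^ 2) ^ 2 /
        (1 + (ξ - m ^ 2) ^ 2 * (ξ + m ^ 2) ^ 3)) := by ring
    _ ≤ 28 * N * (m ^ (2 * j) / m ^ 4) * (6 * m) := by gcongr
    _ = _ := by field_simp; norm_num

/-- Since `∂_ξ ((ξ - l) e^{iφ}) = e^{iφ} D` with `l = m²`, one integrates by parts after writing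
`e^{iφ} = ∂_ξ((ξ - l) e^{iφ}) / D`. This treats the stationary and the non-stationary region in one
stroke and gives the van der Corput size `l^{j - 3/2}`, uniformly in the sharp cutoff `R`, with `G'
∈ L²` only. -/
theorem norm_integral_osc_le {G G' : ℝ → ℂ} {N m x R : ℝ} {j : ℕ} (hj : j ≤ 2) (hm : 1 ≤ m)
    (h : |x| = 5 * (m ^ 2) ^ 4 ∨ (m ^ 2 = 1 ∧ |x| ≤ 5)) (hR : 0 ≤ R) (hN : 0 < N)
    (hG : ∀ ξ, HasDerivAt G (G' ξ) ξ) (hG' : Continuous G') (hGN : ∀ ξ, ‖G ξ‖ ≤ N)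
    (hint : Integrable fun ξ => ‖G' ξ‖ ^ 2) (hG'N : ∫ ξ, ‖G' ξ‖ ^ 2 ≤ N ^ 2) :
    ‖∫ ξ in (0 : ℝ)..R, osc x ξ * ((ξ : ℂ) ^ j * G ξ)‖ * m ^ 3 ≤
      (337 + 16156 * (8 * Real.pi + 1)) * N * m ^ (2 * j) := by
  have hm0 : 0 < m := by linarith
  have hGc : Continuous G := continuous_iff_continuousAt.2 fun ξ => (hG ξ).continuousAt
  have hDc : Continuous (oscDen (m ^ 2) x) := by unfold oscDen; fun_prop
  set Ψ : ℝ → ℂ := fun ξ => ((ξ - m ^ 2 : ℝ) : ℂ) * osc x ξ with hΨ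
  set Ψ' : ℝ → ℂ := fun ξ => osc x ξ * oscDen (m ^ 2) x ξ with hΨ'
  set H : ℝ → ℂ := fun ξ => (ξ : ℂ) ^ j * G ξ / oscDen (m ^ 2) x ξ with hH
  set H' : ℝ → ℂ := fun ξ => (((j : ℂ) * (ξ : ℂ) ^ (j - 1) * G ξ + (ξ : ℂ) ^ j * G' ξ) *
      oscDen (m ^ 2) x ξ - (ξ : ℂ) ^ j * G ξ * (Complex.I *
        (((x + 5 * ξ ^ 4) + (ξ - m ^ 2) * (20 * ξ ^ 3) : ℝ) : ℂ))) / oscDen (m ^ 2) x ξ ^ 2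
    with hH'
  have dΨ : ∀ ξ ∈ Set.uIcc 0 R, HasDerivAt Ψ (Ψ' ξ) ξ := fun ξ _ => hasDerivAt_shift_mul_osc _ _ _
  have dH : ∀ ξ ∈ Set.uIcc 0 R, HasDerivAt H (H' ξ) ξ := by
    intro ξ _
    have h1 : HasDerivAt (fun ξ : ℝ => (ξ : ℂ) ^ j) ((j : ℂ) * (ξ : ℂ) ^ (j - 1)) ξ := by
      have := (hasDerivAt_id' ξ).ofReal_comp.fun_pow j
      simpa using this
    exact (h1.mul (hG ξ)).div (hasDerivAt_oscDen _ _ _) (oscDen_ne_zero _ _ _)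
  have cΨ' : Continuous Ψ' := (continuous_osc x).mul hDc
  have cH' : Continuous H' := by
    refine Continuous.div (by fun_prop) (by fun_prop) fun ξ => pow_ne_zero _ (oscDen_ne_zero _ _ _)
  have hΨc : Continuous Ψ := by
    have := continuous_osc x
    fun_prop
  have ibp := intervalIntegral.integral_deriv_mul_eq_sub dΨ dH
    (cΨ'.intervalIntegrable 0 R) (cH'.intervalIntegrable 0 R)
  have hHc : Continuous H := Continuous.div (by fun_prop) hDc fun ξ => oscDen_ne_zero _ _ _
  have hadd : ∫ ξ in (0 : ℝ)..R, (Ψ' ξ * H ξ + Ψ ξ * H' ξ) =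
      (∫ ξ in (0 : ℝ)..R, Ψ' ξ * H ξ) + ∫ ξ in (0 : ℝ)..R, Ψ ξ * H' ξ :=
    intervalIntegral.integral_add ((cΨ'.mul hHc).intervalIntegrable 0 R)
      ((hΨc.mul cH').intervalIntegrable 0 R)
  rw [hadd] at ibp
  have hI : ∫ ξ in (0 : ℝ)..R, osc x ξ * ((ξ : ℂ) ^ j * G ξ) = ∫ ξ in (0 : ℝ)..R, Ψ' ξ * H ξ := by
    congr 1
    ext ξ
    have := oscDen_ne_zero (m ^ 2) x ξ
    simp only [hΨ', hH]
    field_simp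
  set c := m ^ (2 * j) with hc
  have hcpos : 0 < c := by positivity
  have hbd : ∀ ξ, 0 ≤ ξ → ‖Ψ ξ * H ξ‖ ≤ 168 * N * (c / m ^ 3) := fun ξ hξ =>
    shift_boundary_le hj hm h hξ hN (hGN ξ)
  have hw : Continuous fun ξ : ℝ => ‖G' ξ‖ ^ 2 := by fun_prop
  have hmain : ‖∫ ξ in (0 : ℝ)..R, Ψ ξ * H' ξ‖ ≤
      ∫ ξ in (0 : ℝ)..R, (16156 * N * (c / m ^ 4) *
      ((ξ + m ^ 2) ^ 2 / (1 + (ξ - m ^ 2) ^ 2 * (ξ + m ^ 2) ^ 3)) +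
      c / m ^ 3 / (2 * N) * ‖G' ξ‖ ^ 2) := by
    refine intervalIntegral.norm_integral_le_of_norm_le hR ?_ ?_
    · refine ae_of_all _ fun ξ hξ => ?_
      have hξ0 : 0 ≤ ξ := hξ.1.le
      refine le_trans ?_ (weighted_deriv_le hj hm hξ0 hN)
      refine le_trans (le_of_eq ?_)
        (norm_shift_mul_deriv_le (g' := G' ξ) hj (one_le_pow₀ hm) hξ0 h (hGN ξ))
      simp only [hΨ, hH', norm_mul, norm_osc, mul_one]
    · refine ContinuousOn.intervalIntegrable ?_
      rw [Set.uIcc_of_le hR]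
      refine ContinuousOn.add (ContinuousOn.mul (by fun_prop) ?_) (by fun_prop)
      refine ContinuousOn.div (by fun_prop) (by fun_prop) fun ξ hξ => ?_
      have : 0 < ξ + m ^ 2 := by have := hξ.1; positivity
      positivity
  have hwint : IntervalIntegrable (fun ξ : ℝ => (ξ + m ^ 2) ^ 2 /
      (1 + (ξ - m ^ 2) ^ 2 * (ξ + m ^ 2) ^ 3)) volume 0 R := by
    refine ContinuousOn.intervalIntegrable ?_
    rw [Set.uIcc_of_le hR]
    refine ContinuousOn.div (by fun_prop) (by fun_prop) fun ξ hξ => ?_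
    have : 0 < ξ + m ^ 2 := by have := hξ.1; positivity
    positivity
  rw [intervalIntegral.integral_add (hwint.const_mul _) ((hw.intervalIntegrable 0 R).const_mul _),
    intervalIntegral.integral_const_mul, intervalIntegral.integral_const_mul] at hmain
  have hK := integral_weight_le hm hR
  have hG2 : ∫ ξ in (0 : ℝ)..R, ‖G' ξ‖ ^ 2 ≤ N ^ 2 := by
    rw [intervalIntegral.integral_of_le hR]
    exact (setIntegral_le_integral hint (ae_of_all _ fun ξ => by positivity)).trans hG'N
  have hmain2 : ‖∫ ξ in (0 : ℝ)..R, Ψ ξ * H' ξ‖ ≤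
      (16156 * (8 * Real.pi + 1) + 1 / 2) * N * (c / m ^ 3) := by
    refine hmain.trans ?_
    calc _ ≤ 16156 * N * (c / m ^ 4) * ((8 * Real.pi + 1) * m) +
          c / m ^ 3 / (2 * N) * N ^ 2 := by gcongr
      _ = _ := by field_simp
  rw [hI, eq_sub_of_add_eq ibp]
  have htri : ‖Ψ R * H R - Ψ 0 * H 0 - ∫ ξ in (0 : ℝ)..R, Ψ ξ * H' ξ‖ ≤
      168 * N * (c / m ^ 3) + 168 * N * (c / m ^ 3) +
        (16156 * (8 * Real.pi + 1) + 1 / 2) * N * (c / m ^ 3) :=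
    (norm_sub_le _ _).trans (add_le_add ((norm_sub_le _ _).trans
      (add_le_add (hbd R hR) (hbd 0 le_rfl))) hmain2)
  calc _ ≤ (168 * N * (c / m ^ 3) + 168 * N * (c / m ^ 3) +
        (16156 * (8 * Real.pi + 1) + 1 / 2) * N * (c / m ^ 3)) * m ^ 3 := by gcongr
    _ = (336 + 1 / 2 + 16156 * (8 * Real.pi + 1)) * N * c := by field_simp; ring
    _ ≤ _ := by
      gcongr
      norm_num

end FifthKdV
end

noncomputable section
namespace FifthKdV

/-! ### Fourier transform on `L¹ ∩ L²` -/

-- The `L²` transform agrees with that of tempered distributions, which is defined by this duality.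
open scoped SchwartzMap in
theorem integral_mul_fourier_Lp (f : Lp ℂ 2 (volume : Measure ℝ)) (g : 𝓢(ℝ, ℂ)) :
    ∫ x, g x * (𝓕 f : Lp ℂ 2 (volume : Measure ℝ)) x = ∫ x, (𝓕 g : 𝓢(ℝ, ℂ)) x * f x := by
  have h := congrArg (fun T => T g) (Lp.fourier_toTemperedDistribution_eq f)
  simp only [TemperedDistribution.fourier_apply, Lp.toTemperedDistribution_apply,
    smul_eq_mul] at h
  exact h.symm

open scoped SchwartzMap in
theorem integral_mul_fourierInv_Lp (f : Lp ℂ 2 (volume : Measure ℝ)) (g : 𝓢(ℝ, ℂ)) :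
    ∫ x, g x * (𝓕⁻ f : Lp ℂ 2 (volume : Measure ℝ)) x = ∫ x, (𝓕⁻ g : 𝓢(ℝ, ℂ)) x * f x := by
  have h := congrArg (fun T => T g) (Lp.fourierInv_toTemperedDistribution_eq f)
  simp only [TemperedDistribution.fourierInv_apply, Lp.toTemperedDistribution_apply,
    smul_eq_mul] at h
  exact h.symm

theorem integral_fourier_mul {f g : ℝ → ℂ} (hf : Integrable f) (hg : Integrable g) :
    ∫ ξ, 𝓕 f ξ * g ξ = ∫ x, f x * 𝓕 g x := by
  have := VectorFourier.integral_fourierIntegral_smul_eq_flip (𝕜 := ℝ) (e := Real.fourierChar)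
    (μ := volume) (ν := volume) (L := innerₗ ℝ) (f := f) (g := g) Real.continuous_fourierChar
    continuous_inner hf hg
  rw [flip_innerₗ] at this
  exact this

theorem fourier_sub_apply {f g : ℝ → ℂ} (hf : Integrable f) (hg : Integrable g) (η : ℝ) :
    𝓕 (fun x => f x - g x) η = 𝓕 f η - 𝓕 g η := by
  rw [Real.fourier_eq, Real.fourier_eq, Real.fourier_eq, ← integral_sub]
  · simp only [smul_sub]
  · exact (Real.fourierIntegral_convergent_iff η).2 hf
  · exact (Real.fourierIntegral_convergent_iff η).2 hg

theorem continuous_fourier {f : ℝ → ℂ} (hf : Integrable f) : Continuous (𝓕 f) :=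
  VectorFourier.fourierIntegral_continuous Real.continuous_fourierChar continuous_inner hf

theorem norm_fourier_le {f : ℝ → ℂ} (ξ : ℝ) : ‖𝓕 f ξ‖ ≤ ∫ x, ‖f x‖ :=
  VectorFourier.norm_fourierIntegral_le_integral_norm _ _ _ _ _

theorem fourierInv_eq_fourier_neg' (f : ℝ → ℂ) : 𝓕⁻ f = 𝓕 (fun x => f (-x)) :=
  Real.fourierInv_eq_fourier_comp_neg f

theorem continuous_fourierInv {f : ℝ → ℂ} (hf : Integrable f) : Continuous (𝓕⁻ f) := by
  rw [fourierInv_eq_fourier_neg']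
  exact continuous_fourier hf.comp_neg

theorem norm_fourierInv_le {f : ℝ → ℂ} (ξ : ℝ) : ‖𝓕⁻ f ξ‖ ≤ ∫ x, ‖f x‖ := by
  rw [fourierInv_eq_fourier_neg']
  refine (norm_fourier_le ξ).trans (le_of_eq ?_)
  exact integral_neg_eq_self (fun x => ‖f x‖) volume

theorem integral_fourierInv_mul {f g : ℝ → ℂ} (hf : Integrable f) (hg : Integrable g) :
    ∫ ξ, 𝓕⁻ f ξ * g ξ = ∫ x, f x * 𝓕⁻ g x := by
  rw [fourierInv_eq_fourier_neg', integral_fourier_mul hf.comp_neg hg,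
    ← integral_neg_eq_self (fun x => f x * 𝓕⁻ g x)]
  simp only [Real.fourierInv_eq_fourier_neg, neg_neg]

-- Smooth compactly supported functions are Schwartz and separate locally integrable functions; the
-- restriction to compact support lets later tests carry polynomial factors.
open scoped SchwartzMap in
theorem ae_eq_of_integral_schwartz_mul {f g : ℝ → ℂ} (hf : LocallyIntegrable f)
    (hg : LocallyIntegrable g)
    (h : ∀ ψ : 𝓢(ℝ, ℂ), HasCompactSupport ψ → ∫ x, ψ x * f x = ∫ x, ψ x * g x) :
    f =ᵐ[volume] g := by
  refine ae_eq_of_integral_contDiff_smul_eq hf hg fun φ hφ hc => ?_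
  have hc' : HasCompactSupport (fun x => (φ x : ℂ)) := hc.comp_left (g := fun y : ℝ => (y : ℂ)) rfl
  have hφ' : ContDiff ℝ ∞ (fun x => (φ x : ℂ)) := Complex.ofRealCLM.contDiff.comp hφ
  have := h (hc'.toSchwartzMap hφ') hc'
  simpa using! this

theorem locallyIntegrable_Lp (f : Lp ℂ 2 (volume : Measure ℝ)) : LocallyIntegrable f :=
  (Lp.memLp f).locallyIntegrable (by norm_num)

/-- Both sides obey the same multiplication formula against test functions. This is the bridge
between the abstract `L²` transform and the Fourier integral. -/
theorem fourier_toLp_ae {f : ℝ → ℂ} (hf : Integrable f) (hf2 : MemLp f 2) :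
    (𝓕 (hf2.toLp f) : Lp ℂ 2 (volume : Measure ℝ)) =ᵐ[volume] 𝓕 f := by
  refine ae_eq_of_integral_schwartz_mul (locallyIntegrable_Lp _)
    (continuous_fourier hf).locallyIntegrable fun ψ _ => ?_
  rw [integral_mul_fourier_Lp]
  have : ∫ x, ψ x * 𝓕 f x = ∫ x, 𝓕 (ψ : ℝ → ℂ) x * f x :=
    (integral_fourier_mul ψ.integrable hf).symm
  rw [this]
  refine integral_congr_ae ?_
  filter_upwards [hf2.coeFn_toLp] with x hx
  rw [hx, SchwartzMap.fourier_coe]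

theorem fourierInv_toLp_ae {f : ℝ → ℂ} (hf : Integrable f) (hf2 : MemLp f 2) :
    (𝓕⁻ (hf2.toLp f) : Lp ℂ 2 (volume : Measure ℝ)) =ᵐ[volume] 𝓕⁻ f := by
  refine ae_eq_of_integral_schwartz_mul (locallyIntegrable_Lp _)
    (continuous_fourierInv hf).locallyIntegrable fun ψ _ => ?_
  rw [integral_mul_fourierInv_Lp]
  have : ∫ x, ψ x * 𝓕⁻ f x = ∫ x, 𝓕⁻ (ψ : ℝ → ℂ) x * f x :=
    (integral_fourierInv_mul ψ.integrable hf).symm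
  rw [this]
  refine integral_congr_ae ?_
  filter_upwards [hf2.coeFn_toLp] with x hx
  rw [hx, SchwartzMap.fourierInv_coe]

theorem memLp_fourier {f : ℝ → ℂ} (hf : Integrable f) (hf2 : MemLp f 2) : MemLp (𝓕 f) 2 :=
  (memLp_congr_ae (fourier_toLp_ae hf hf2)).1 (Lp.memLp _)

theorem memLp_fourierInv {f : ℝ → ℂ} (hf : Integrable f) (hf2 : MemLp f 2) : MemLp (𝓕⁻ f) 2 :=
  (memLp_congr_ae (fourierInv_toLp_ae hf hf2)).1 (Lp.memLp _)

theorem integral_norm_sq_Lp (f : Lp ℂ 2 (volume : Measure ℝ)) : ∫ x, ‖f x‖ ^ 2 = ‖f‖ ^ 2 := by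
  have h := @inner_self_eq_norm_sq_to_K ℂ _ _ _ _ f
  rw [L2.inner_def] at h
  have h2 : ∀ x, inner ℂ (f x) (f x) = (((‖f x‖ ^ 2 : ℝ)) : ℂ) := fun x => by
    rw [inner_self_eq_norm_sq_to_K]; simp
  simp_rw [h2] at h
  rw [integral_complex_ofReal] at h
  refine Complex.ofReal_injective (h.trans ?_)
  push_cast
  rfl

theorem integral_norm_sq_fourier {f : ℝ → ℂ} (hf : Integrable f) (hf2 : MemLp f 2) :
    ∫ x, ‖𝓕 f x‖ ^ 2 = ∫ x, ‖f x‖ ^ 2 := by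
  have h1 : ∫ x, ‖𝓕 f x‖ ^ 2 =
      ∫ x, ‖(𝓕 (hf2.toLp f) : Lp ℂ 2 (volume : Measure ℝ)) x‖ ^ 2 := by
    refine integral_congr_ae ?_
    filter_upwards [fourier_toLp_ae hf hf2] with x hx
    rw [hx]
  have h2 : ∫ x, ‖f x‖ ^ 2 = ∫ x, ‖hf2.toLp f x‖ ^ 2 := by
    refine integral_congr_ae ?_
    filter_upwards [hf2.coeFn_toLp] with x hx
    rw [hx]
  rw [h1, h2, integral_norm_sq_Lp, integral_norm_sq_Lp, Lp.norm_fourier_eq]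

theorem integral_norm_sq_fourierInv {f : ℝ → ℂ} (hf : Integrable f) (hf2 : MemLp f 2) :
    ∫ x, ‖𝓕⁻ f x‖ ^ 2 = ∫ x, ‖f x‖ ^ 2 := by
  have h2 : MemLp (fun x => f (-x)) 2 :=
    hf2.comp_measurePreserving (Measure.measurePreserving_neg volume)
  rw [fourierInv_eq_fourier_neg', integral_norm_sq_fourier hf.comp_neg h2]
  exact integral_neg_eq_self (fun x => ‖f x‖ ^ 2) volume

/-- Parseval's identity, in the form that only needs integrability. -/
theorem integral_conj_mul_fourier {V Q : ℝ → ℂ} (hV : Integrable V) (hQ : Integrable Q) :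
    ∫ η, (starRingEnd ℂ) (V η) * 𝓕 Q η = ∫ x, (starRingEnd ℂ) (𝓕⁻ V x) * Q x := by
  have hV' : Integrable fun η => (starRingEnd ℂ) (V η) := by
    simpa using! (Complex.conjCLE.toContinuousLinearMap.integrable_comp hV)
  have h : ∀ x, (starRingEnd ℂ) (𝓕⁻ V x) = 𝓕 (fun η => (starRingEnd ℂ) (V η)) x := by
    intro x
    rw [Real.fourierInv_eq', Real.fourier_eq', ← integral_conj]
    congr 1
    ext η
    simp only [smul_eq_mul, map_mul, ← Complex.exp_conj, Complex.conj_ofReal, Complex.conj_I]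
    congr 2
    push_cast
    ring
  simp_rw [h]
  exact (integral_fourier_mul hV' hQ).symm

theorem integrable_norm_sq {f : ℝ → ℂ} (hf : MemLp f 2) : Integrable fun x => ‖f x‖ ^ 2 :=
  (memLp_two_iff_integrable_sq_norm hf.1).1 hf

end FifthKdV
end

noncomputable section
namespace FifthKdV

/-! ### Dispersive decay -/

/-- The weight `(1 + |y|)^{1/8}`. -/
def wt (y : ℝ) : ℝ := (1 + |y|) ^ (1 / 8 : ℝ)

theorem one_le_wt (y : ℝ) : 1 ≤ wt y :=
  Real.one_le_rpow (by linarith [abs_nonneg y]) (by norm_num)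

theorem wt_pos (y : ℝ) : 0 < wt y := lt_of_lt_of_le one_pos (one_le_wt y)

theorem wt_pow_eight (y : ℝ) : wt y ^ 8 = 1 + |y| := by
  rw [wt, ← Real.rpow_natCast, ← Real.rpow_mul (by positivity)]
  norm_num

/-- The scale is `m = l^{1/2}` with `5 l⁴ = |y|`, so `m⁸ = |y| / 5`, and `m = 1` when `|y| ≤ 5`.
Being comparable to the smooth weight `wt y`, it can be eliminated from the estimates. -/
theorem exists_stationary_scale (y : ℝ) : ∃ m : ℝ, 1 ≤ m ∧ m ≤ wt y ∧ wt y ≤ 6 * m ∧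
    (|y| = 5 * (m ^ 2) ^ 4 ∨ (m ^ 2 = 1 ∧ |y| ≤ 5)) := by
  have h8 := wt_pow_eight y
  have hw := one_le_wt y
  by_cases hy : |y| ≤ 5
  · refine ⟨1, le_rfl, hw, ?_, Or.inr ⟨by norm_num, hy⟩⟩
    by_contra! hcon
    have : (6 * 1 : ℝ) ^ 8 ≤ wt y ^ 8 := pow_le_pow_left₀ (by norm_num) hcon.le 8
    rw [h8] at this
    norm_num at this
    linarith
  · have hy5 : 1 ≤ |y| / 5 := by linarith
    set m := (|y| / 5) ^ (1 / 8 : ℝ) with hm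
    have hm1 : 1 ≤ m := Real.one_le_rpow hy5 (by norm_num)
    have hm8 : m ^ 8 = |y| / 5 := by
      rw [hm, ← Real.rpow_natCast, ← Real.rpow_mul (by positivity)]
      norm_num
    refine ⟨m, hm1, ?_, ?_, Or.inl ?_⟩
    · refine le_of_pow_le_pow_left₀ (n := 8) (by norm_num) (by positivity) ?_
      rw [h8, hm8]; linarith
    · refine le_of_pow_le_pow_left₀ (n := 8) (by norm_num) (by positivity) ?_
      rw [h8, mul_pow, hm8]; norm_num; linarith
    · rw [← pow_mul, hm8]; ring

/-- The constant of the dispersive estimate. -/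
def dispConst : ℝ := 432 * (337 + 16156 * (8 * Real.pi + 1))

theorem dispConst_pos : 0 < dispConst := by
  have := Real.pi_pos
  unfold dispConst; positivity

theorem norm_integral_osc_half_le {G G' : ℝ → ℂ} {N y R : ℝ} {j : ℕ} (hj : j ≤ 2)
    (hR : 0 ≤ R) (hN : 0 < N)
    (hG : ∀ ξ, HasDerivAt G (G' ξ) ξ) (hG' : Continuous G') (hGN : ∀ ξ, ‖G ξ‖ ≤ N)
    (hint : Integrable fun ξ => ‖G' ξ‖ ^ 2) (hG'N : ∫ ξ, ‖G' ξ‖ ^ 2 ≤ N ^ 2) :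
    ‖∫ ξ in (0 : ℝ)..R, osc y ξ * ((ξ : ℂ) ^ j * G ξ)‖ * wt y ^ 3 ≤
      dispConst / 2 * N * wt y ^ (2 * j) := by
  obtain ⟨m, hm1, hmw, hwm, h⟩ := exists_stationary_scale y
  have h1 := norm_integral_osc_le hj hm1 h hR hN hG hG' hGN hint hG'N
  set I := ‖∫ ξ in (0 : ℝ)..R, osc y ξ * ((ξ : ℂ) ^ j * G ξ)‖
  have hI : 0 ≤ I := norm_nonneg _
  have hpi := Real.pi_pos
  have hw0 := wt_pos y
  calc I * wt y ^ 3 ≤ I * (6 * m) ^ 3 := by gcongr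
    _ = 216 * (I * m ^ 3) := by ring
    _ ≤ 216 * ((337 + 16156 * (8 * Real.pi + 1)) * N * m ^ (2 * j)) := by gcongr
    _ ≤ 216 * ((337 + 16156 * (8 * Real.pi + 1)) * N * wt y ^ (2 * j)) := by gcongr
    _ = _ := by unfold dispConst; ring

/-- The phase is odd, so conjugation and `ξ ↦ -ξ` turn the negative half line into the positive one
with amplitude `(-1)^j conj (G (-ξ))`, which obeys the same bounds. -/
theorem norm_integral_osc_symm_le {G G' : ℝ → ℂ} {N y R : ℝ} {j : ℕ} (hj : j ≤ 2)
    (hR : 0 ≤ R) (hN : 0 < N)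
    (hG : ∀ ξ, HasDerivAt G (G' ξ) ξ) (hG' : Continuous G') (hGN : ∀ ξ, ‖G ξ‖ ≤ N)
    (hint : Integrable fun ξ => ‖G' ξ‖ ^ 2) (hG'N : ∫ ξ, ‖G' ξ‖ ^ 2 ≤ N ^ 2) :
    ‖∫ ξ in (-R)..R, osc y ξ * ((ξ : ℂ) ^ j * G ξ)‖ * wt y ^ 3 ≤
      dispConst * N * wt y ^ (2 * j) := by
  have hGc : Continuous G := continuous_iff_continuousAt.2 fun ξ => (hG ξ).continuousAt
  have hosc := continuous_osc y
  have hc : Continuous fun ξ : ℝ => osc y ξ * ((ξ : ℂ) ^ j * G ξ) := by fun_prop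
  have hsplit := intervalIntegral.integral_add_adjacent_intervals
    (hc.intervalIntegrable (μ := volume) (-R) 0) (hc.intervalIntegrable 0 R)
  have hpos := norm_integral_osc_half_le (y := y) hj hR hN hG hG' hGN hint hG'N
  set K : ℝ → ℂ := fun ξ => (-1) ^ j * (starRingEnd ℂ) (G (-ξ)) with hK
  set K' : ℝ → ℂ := fun ξ => (-1) ^ j * (starRingEnd ℂ) (-G' (-ξ)) with hK'
  have hKd : ∀ ξ, HasDerivAt K (K' ξ) ξ := by
    intro ξ
    have h1 : HasDerivAt (fun ξ => G (-ξ)) (-G' (-ξ)) ξ := by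
      have := (hG (-ξ)).scomp ξ (hasDerivAt_neg ξ)
      simpa using! this
    have h2 := (Complex.conjCLE.toContinuousLinearMap.hasFDerivAt.comp_hasDerivAt ξ h1)
    exact HasDerivAt.const_mul ((-1 : ℂ) ^ j) (by simpa using! h2)
  have hK'c : Continuous K' :=
    continuous_const.mul (Complex.continuous_conj.comp ((hG'.comp continuous_neg).neg))
  have hnK : ∀ ξ, ‖K ξ‖ = ‖G (-ξ)‖ := fun ξ => by simp [hK]
  have hnK' : ∀ ξ, ‖K' ξ‖ = ‖G' (-ξ)‖ := fun ξ => by simp [hK']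
  have hKint : Integrable fun ξ => ‖K' ξ‖ ^ 2 := by
    simp only [hnK']; exact hint.comp_neg
  have hKN : ∫ ξ, ‖K' ξ‖ ^ 2 ≤ N ^ 2 := by
    simp only [hnK']
    rw [integral_neg_eq_self (fun ξ => ‖G' ξ‖ ^ 2)]
    exact hG'N
  have hneg := norm_integral_osc_half_le (y := y) hj hR hN hKd hK'c
    (fun ξ => (hnK ξ).trans_le (hGN _)) hKint hKN
  have hflip : ‖∫ ξ in (-R)..0, osc y ξ * ((ξ : ℂ) ^ j * G ξ)‖ =
      ‖∫ ξ in (0 : ℝ)..R, osc y ξ * ((ξ : ℂ) ^ j * K ξ)‖ := by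
    have h1 := intervalIntegral.integral_comp_neg (a := 0) (b := R)
      (fun ξ : ℝ => osc y ξ * ((ξ : ℂ) ^ j * G ξ))
    rw [neg_zero] at h1
    rw [← h1, intervalIntegral.integral_of_le hR, intervalIntegral.integral_of_le hR,
      ← RCLike.norm_conj, ← integral_conj]
    congr 1
    refine integral_congr_ae (ae_of_all _ fun ξ => ?_)
    have : (starRingEnd ℂ) (osc y (-ξ)) = osc y ξ := by
      simp only [osc, ← Complex.exp_conj, map_mul, Complex.conj_I, Complex.conj_ofReal]
      congr 1
      push_cast
      ring
    simp only [map_mul, map_pow, this, hK, map_neg, Complex.conj_ofReal,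
      Complex.ofReal_neg]
    rw [neg_pow]
    ring
  rw [← hsplit]
  rw [← hflip] at hneg
  have hw := wt_pos y
  calc _ ≤ (‖∫ ξ in (-R)..0, osc y ξ * ((ξ : ℂ) ^ j * G ξ)‖ +
        ‖∫ ξ in (0 : ℝ)..R, osc y ξ * ((ξ : ℂ) ^ j * G ξ)‖) * wt y ^ 3 := by
        gcongr; exact norm_add_le _ _
    _ ≤ _ := by linarith

/-- Substitute `ξ = τ η`. The squared `L²` norm of the derivative of `G(· / τ)` is `τ⁻¹` times that
of `G`, which is why the hypothesis allows growth like `N² τ`. -/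
theorem norm_integral_osc_scaled_le {G G' : ℝ → ℂ} {N y R τ : ℝ} {j : ℕ} (hj : j ≤ 2)
    (hR : 0 ≤ R) (hN : 0 < N) (hτ : 0 < τ)
    (hG : ∀ ξ, HasDerivAt G (G' ξ) ξ) (hG' : Continuous G') (hGN : ∀ ξ, ‖G ξ‖ ≤ N)
    (hint : Integrable fun ξ => ‖G' ξ‖ ^ 2) (hG'N : ∫ ξ, ‖G' ξ‖ ^ 2 ≤ N ^ 2 * τ) :
    ‖∫ η in (-R)..R, osc y (τ * η) * ((η : ℂ) ^ j * G η)‖ * τ ^ (j + 1) * wt y ^ 3 ≤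
      dispConst * N * wt y ^ (2 * j) := by
  have hd : ∀ ξ, HasDerivAt (fun ξ => G (ξ / τ)) (((1 / τ : ℝ) : ℂ) * G' (ξ / τ)) ξ := by
    intro ξ
    have h1 : HasDerivAt (fun ξ : ℝ => ξ / τ) (1 / τ) ξ := (hasDerivAt_id' ξ).div_const τ
    have := (hG (ξ / τ)).scomp ξ h1
    simpa using! this
  have hn : ∀ ξ, ‖((1 / τ : ℝ) : ℂ) * G' (ξ / τ)‖ ^ 2 = (1 / τ) ^ 2 * ‖G' (ξ / τ)‖ ^ 2 := by
    intro ξ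
    rw [norm_mul, mul_pow, Complex.norm_real, Real.norm_of_nonneg (by positivity)]
  have hsub : ∫ ξ, ‖G' (ξ / τ)‖ ^ 2 = τ * ∫ ξ, ‖G' ξ‖ ^ 2 := by
    have := Measure.integral_comp_div (fun ξ => ‖G' ξ‖ ^ 2) τ
    rw [this, abs_of_pos hτ, smul_eq_mul]
  have h := norm_integral_osc_symm_le (y := y) (R := τ * R) hj (by positivity) hN hd
    (continuous_const.mul (hG'.comp (continuous_id.div_const τ))) (fun ξ => hGN _)
    (by
      simp only [hn]
      exact (hint.comp_div hτ.ne').const_mul _)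
    (by
      simp only [hn]
      rw [integral_const_mul, hsub]
      calc (1 / τ) ^ 2 * (τ * ∫ ξ, ‖G' ξ‖ ^ 2) ≤ (1 / τ) ^ 2 * (τ * (N ^ 2 * τ)) := by gcongr
        _ = N ^ 2 := by field_simp)
  have hcv : ∫ ξ in (-(τ * R))..(τ * R), osc y ξ * ((ξ : ℂ) ^ j * G (ξ / τ)) =
      ((τ ^ (j + 1) : ℝ) : ℂ) * ∫ η in (-R)..R, osc y (τ * η) * ((η : ℂ) ^ j * G η) := by
    have h1 := intervalIntegral.integral_comp_mul_left (a := -R) (b := R)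
      (fun ξ : ℝ => osc y ξ * ((ξ : ℂ) ^ j * G (ξ / τ))) hτ.ne'
    rw [mul_neg] at h1
    have h2 : ∫ η in (-R)..R, osc y (τ * η) * (((τ * η : ℝ) : ℂ) ^ j * G (τ * η / τ)) =
        ((τ ^ j : ℝ) : ℂ) * ∫ η in (-R)..R, osc y (τ * η) * ((η : ℂ) ^ j * G η) := by
      rw [← intervalIntegral.integral_const_mul]
      congr 1
      ext η
      rw [mul_div_cancel_left₀ _ hτ.ne']
      push_cast
      ring
    rw [h2] at h1
    rw [pow_succ', Complex.ofReal_mul, mul_assoc, h1, ← Complex.real_smul, smul_smul,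
      mul_inv_cancel₀ hτ.ne', one_smul]
  rw [hcv, norm_mul, Complex.norm_real, Real.norm_of_nonneg (by positivity)] at h
  calc _ = _ := by ring
    _ ≤ _ := h

/-- Dispersive decay, for a profile with integrable `f` and square integrable `x f`. -/
theorem norm_integral_osc_fourier_le {f : ℝ → ℂ} {N y R τ : ℝ} {j : ℕ} (hj : j ≤ 2)
    (hR : 0 ≤ R) (hN : 0 < N) (hτ : 0 < τ) (hf : Integrable f)
    (hxf : MemLp (fun x : ℝ => (x : ℂ) * f x) 2) (hFN : ∀ η, ‖𝓕 f η‖ ≤ N)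
    (hXN : (2 * Real.pi) ^ 2 * ∫ x : ℝ, ‖(x : ℂ) * f x‖ ^ 2 ≤ N ^ 2 * τ) :
    ‖∫ η in (-R)..R, osc y (τ * η) * ((η : ℂ) ^ j * 𝓕 f η)‖ * τ ^ (j + 1) * wt y ^ 3 ≤
      dispConst * N * wt y ^ (2 * j) := by
  -- From `f ∈ L¹` and `x f ∈ L²` the transform is merely of class `H¹`. Cutting `f` off makes it
  -- `C¹`; the sup bound `N` deteriorates by the `L¹` error `e n`, which tends to zero.
  set fn : ℕ → ℝ → ℂ := fun n => Set.indicator (Set.Icc (-(n : ℝ)) n) f with hfn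
  have hmeas : ∀ n : ℕ, MeasurableSet (Set.Icc (-(n : ℝ)) n) := fun n => measurableSet_Icc
  have hfni : ∀ n, Integrable (fn n) := fun n => hf.indicator (hmeas n)
  have hfnx : ∀ n, (fun x : ℝ => (x : ℂ) * fn n x) =
      Set.indicator (Set.Icc (-(n : ℝ)) n) (fun x => (x : ℂ) * f x) := by
    intro n
    ext x
    by_cases hx : x ∈ Set.Icc (-(n : ℝ)) n
    · simp only [hfn, Set.indicator_of_mem hx]
    · simp only [hfn, Set.indicator_of_notMem hx, mul_zero]
  have hxi : ∀ n, Integrable (fun x : ℝ => (x : ℂ) * fn n x) := by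
    intro n
    rw [hfnx]
    refine ((hxf.locallyIntegrable (by norm_num)).integrableOn_isCompact
      isCompact_Icc).integrable_indicator (hmeas n)
  have hx2 : ∀ n, MemLp (fun x : ℝ => (x : ℂ) * fn n x) 2 := by
    intro n
    rw [hfnx]
    exact hxf.indicator (hmeas n)
  set e : ℕ → ℝ := fun n => ∫ x, ‖f x - fn n x‖ with he
  have he0 : ∀ n, 0 ≤ e n := fun n => integral_nonneg fun x => norm_nonneg _
  have hlim : Tendsto e atTop (𝓝 0) := by
    have : (0 : ℝ) = ∫ x : ℝ, (0 : ℝ) := by simp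
    rw [this]
    refine tendsto_integral_of_dominated_convergence (fun x => ‖f x‖)
      (fun n => (hf.sub (hfni n)).norm.1) hf.norm (fun n => ae_of_all _ fun x => ?_)
      (ae_of_all _ fun x => ?_)
    · rw [norm_norm]
      by_cases hx : x ∈ Set.Icc (-(n : ℝ)) n
      · simp only [hfn, Set.indicator_of_mem hx, sub_self, norm_zero]; positivity
      · simp only [hfn, Set.indicator_of_notMem hx, sub_zero]; exact le_rfl
    · refine tendsto_const_nhds.congr' ?_
      filter_upwards [eventually_ge_atTop ⌈|x|⌉₊] with n hn
      have hx : x ∈ Set.Icc (-(n : ℝ)) n := by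
        rw [Set.mem_Icc, ← abs_le]
        exact (Nat.le_ceil _).trans (by exact_mod_cast hn)
      simp only [hfn, Set.indicator_of_mem hx, sub_self, norm_zero]
  have hdiff : ∀ n η, ‖𝓕 f η - 𝓕 (fn n) η‖ ≤ e n := by
    intro n η
    rw [← fourier_sub_apply hf (hfni n)]
    exact norm_fourier_le η
  have hbound : ∀ n, ‖∫ η in (-R)..R, osc y (τ * η) * ((η : ℂ) ^ j * 𝓕 (fn n) η)‖ *
      τ ^ (j + 1) * wt y ^ 3 ≤ dispConst * (N + e n) * wt y ^ (2 * j) := by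
    intro n
    have hd : ∀ w, HasDerivAt (𝓕 (fn n))
        (𝓕 (fun x : ℝ => (-2 * Real.pi * Complex.I * x) • fn n x) w) w :=
      fun w => Real.hasDerivAt_fourier (hfni n) (by simpa using! hxi n) w
    have heq : (fun x : ℝ => (-2 * Real.pi * Complex.I * x) • fn n x) =
        fun x : ℝ => (-2 * Real.pi * Complex.I) * ((x : ℂ) * fn n x) := by
      ext x; rw [smul_eq_mul]; ring
    rw [heq] at hd
    have hi' := (hxi n).const_mul (-2 * Real.pi * Complex.I)
    have h2' := (hx2 n).const_mul (-2 * Real.pi * Complex.I)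
    refine norm_integral_osc_scaled_le hj hR (by linarith [he0 n]) hτ hd
      (continuous_fourier hi') (fun ξ => ?_) (integrable_norm_sq (memLp_fourier hi' h2')) ?_
    · have := norm_sub_norm_le (𝓕 (fn n) ξ) (𝓕 f ξ)
      rw [norm_sub_rev] at this
      linarith [hdiff n ξ, hFN ξ]
    · rw [integral_norm_sq_fourier hi' h2']
      have h3 : ∀ x : ℝ, ‖(-2 * Real.pi * Complex.I) * ((x : ℂ) * fn n x)‖ ^ 2 =
          (2 * Real.pi) ^ 2 * ‖(x : ℂ) * fn n x‖ ^ 2 := by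
        intro x
        rw [norm_mul, mul_pow]
        congr 2
        simp [abs_of_pos Real.pi_pos]
      simp only [h3]
      rw [integral_const_mul]
      have h4 : ∫ x : ℝ, ‖(x : ℂ) * fn n x‖ ^ 2 ≤ ∫ x : ℝ, ‖(x : ℂ) * f x‖ ^ 2 := by
        refine integral_mono (integrable_norm_sq (hx2 n)) (integrable_norm_sq hxf) fun x => ?_
        have := congrFun (hfnx n) x
        dsimp only at this ⊢
        rw [this]
        exact pow_le_pow_left₀ (norm_nonneg _) (norm_indicator_le_norm_self _ _) 2
      calc _ ≤ (2 * Real.pi) ^ 2 * ∫ x : ℝ, ‖(x : ℂ) * f x‖ ^ 2 := by gcongr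
        _ ≤ N ^ 2 * τ := hXN
        _ ≤ _ := by
          gcongr
          linarith [he0 n]
  have hconv : Tendsto (fun n => ∫ η in (-R)..R, osc y (τ * η) * ((η : ℂ) ^ j * 𝓕 (fn n) η))
      atTop (𝓝 (∫ η in (-R)..R, osc y (τ * η) * ((η : ℂ) ^ j * 𝓕 f η))) := by
    have hosc : Continuous fun η => osc y (τ * η) := (continuous_osc y).comp (by fun_prop)
    refine intervalIntegral.tendsto_integral_filter_of_dominated_convergence
      (fun η => |η| ^ j * ∫ x, ‖f x‖) (Eventually.of_forall fun n => ?_)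
      (Eventually.of_forall fun n => ae_of_all _ fun η _ => ?_)
      (Continuous.intervalIntegrable (by fun_prop) _ _) (ae_of_all _ fun η _ => ?_)
    · have := continuous_fourier (hfni n)
      exact Continuous.aestronglyMeasurable (by fun_prop)
    · rw [norm_mul, norm_osc, one_mul, norm_mul, norm_pow, Complex.norm_real, Real.norm_eq_abs]
      refine mul_le_mul_of_nonneg_left ((norm_fourier_le η).trans ?_) (by positivity)
      exact integral_mono (hfni n).norm hf.norm fun x => norm_indicator_le_norm_self _ _
    · refine ((tendsto_const_nhds).mul ((tendsto_const_nhds).mul ?_))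
      rw [tendsto_iff_norm_sub_tendsto_zero]
      refine squeeze_zero (fun n => norm_nonneg _) (fun n => ?_) hlim
      rw [norm_sub_rev]
      exact hdiff n η
  have hL := ((hconv.norm.mul_const (τ ^ (j + 1))).mul_const (wt y ^ 3))
  have hRt : Tendsto (fun n => dispConst * (N + e n) * wt y ^ (2 * j)) atTop
      (𝓝 (dispConst * (N + 0) * wt y ^ (2 * j))) :=
    ((hlim.const_add N).const_mul _).mul_const _
  rw [add_zero] at hRt
  exact le_of_tendsto_of_tendsto' hL hRt hbound

end FifthKdV
end

noncomputable section
namespace FifthKdV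

/-! ### Regular representatives of `H²` functions -/

theorem integral_norm_sq_eq_eLpNorm {f : ℝ → ℂ} (hf : MemLp f 2) :
    ∫ x, ‖f x‖ ^ 2 = (eLpNorm f 2 volume).toReal ^ 2 := by
  rw [← Lp.norm_toLp f hf, ← integral_norm_sq_Lp]
  refine integral_congr_ae ?_
  filter_upwards [hf.coeFn_toLp] with x hx
  rw [hx]

/-- The Cauchy–Schwarz inequality for integrals of real functions. -/
theorem integral_mul_le_sqrt {a b : ℝ → ℝ} (ha : MemLp a 2) (hb : MemLp b 2)
    (ha0 : ∀ x, 0 ≤ a x) (hb0 : ∀ x, 0 ≤ b x) :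
    ∫ x, a x * b x ≤ √(∫ x, a x ^ 2) * √(∫ x, b x ^ 2) := by
  have h := integral_mul_le_Lp_mul_Lq_of_nonneg (μ := volume) Real.HolderConjugate.two_two
    (ae_of_all _ ha0) (ae_of_all _ hb0) (by simpa using ha) (by simpa using hb)
  simpa [Real.sqrt_eq_rpow] using h

/-- The Fourier transform of a real `L²` function, in the variable `η = ξ / 2π`. -/
def hat (g : Lp ℝ 2 (volume : Measure ℝ)) : ℝ → ℂ :=
  (𝓕 (toComplex g) : Lp ℂ 2 (volume : Measure ℝ))

/-- The continuous representative of a function of class `H²`. -/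
def rep (g : Lp ℝ 2 (volume : Measure ℝ)) (x : ℝ) : ℝ := (𝓕⁻ (hat g) x).re

/-- The derivative of `rep g`. -/
def repDeriv (g : Lp ℝ 2 (volume : Measure ℝ)) (x : ℝ) : ℝ :=
  (𝓕⁻ (fun η : ℝ => 2 * Real.pi * Complex.I * η * hat g η) x).re

/-- The `H²` norm as a real number. -/
def h2Real (g : Lp ℝ 2 (volume : Measure ℝ)) : ℝ := (h2Norm g).toReal

theorem h2Real_nonneg (g : Lp ℝ 2 (volume : Measure ℝ)) : 0 ≤ h2Real g := ENNReal.toReal_nonneg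

theorem memLp_hat (g : Lp ℝ 2 (volume : Measure ℝ)) : MemLp (hat g) 2 := Lp.memLp _

theorem integrable_inv_weight : Integrable fun η : ℝ => (1 + (2 * Real.pi * η) ^ 2)⁻¹ := by
  have := (integrable_inv_one_add_sq).comp_mul_left' (R := 2 * Real.pi)
    (by have := Real.pi_pos; positivity)
  exact this

/-- The constant of the embedding of `H²` into `C¹`. -/
def sobConst : ℝ := √(∫ η : ℝ, (1 + (2 * Real.pi * η) ^ 2)⁻¹)

theorem sobConst_nonneg : 0 ≤ sobConst := Real.sqrt_nonneg _

variable {g h : Lp ℝ 2 (volume : Measure ℝ)}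

theorem memLp_weight_mul_hat (hg : h2Norm g < ⊤) :
    MemLp (fun η : ℝ => ((1 + (2 * Real.pi * η) ^ 2 : ℝ) : ℂ) * hat g η) 2 :=
  ⟨(Continuous.aestronglyMeasurable (by fun_prop)).mul (memLp_hat g).1, hg⟩

theorem integral_weight_mul_hat (hg : h2Norm g < ⊤) :
    ∫ η : ℝ, ‖((1 + (2 * Real.pi * η) ^ 2 : ℝ) : ℂ) * hat g η‖ ^ 2 = h2Real g ^ 2 :=
  integral_norm_sq_eq_eLpNorm (memLp_weight_mul_hat hg)

theorem norm_mul_hat_le {q : ℝ → ℂ} (hq : ∀ η, ‖q η‖ ^ 2 ≤ 1 + (2 * Real.pi * η) ^ 2) (η : ℝ) :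
    ‖q η * hat g η‖ ≤ ‖((1 + (2 * Real.pi * η) ^ 2 : ℝ) : ℂ) * hat g η‖ := by
  rw [norm_mul, norm_mul, Complex.norm_real, Real.norm_of_nonneg (by positivity)]
  gcongr
  have h1 := hq η
  have h2 : (1 : ℝ) ≤ 1 + (2 * Real.pi * η) ^ 2 := by nlinarith [sq_nonneg (2 * Real.pi * η)]
  nlinarith [norm_nonneg (q η)]

theorem memLp_mul_hat {q : ℝ → ℂ} (hg : h2Norm g < ⊤) (hqc : Continuous q)
    (hq : ∀ η, ‖q η‖ ^ 2 ≤ 1 + (2 * Real.pi * η) ^ 2) :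
    MemLp (fun η => q η * hat g η) 2 :=
  (memLp_weight_mul_hat hg).of_le (hqc.aestronglyMeasurable.mul (memLp_hat g).1)
    (ae_of_all _ fun η => norm_mul_hat_le hq η)

theorem integral_sq_mul_hat_le {q : ℝ → ℂ} (hg : h2Norm g < ⊤) (hqc : Continuous q)
    (hq : ∀ η, ‖q η‖ ^ 2 ≤ 1 + (2 * Real.pi * η) ^ 2) :
    ∫ η, ‖q η * hat g η‖ ^ 2 ≤ h2Real g ^ 2 := by
  rw [← integral_weight_mul_hat hg]
  refine integral_mono (integrable_norm_sq (memLp_mul_hat hg hqc hq))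
    (integrable_norm_sq (memLp_weight_mul_hat hg)) fun η => ?_
  exact pow_le_pow_left₀ (norm_nonneg _) (norm_mul_hat_le hq η) 2

/-- Cauchy–Schwarz: a symbol of order at most one, divided by `1 + (2πη)²`, is still square
integrable. With `q = 1` and `q = 2πiη` this gives sup bounds of `u` and `∂ₓu`. -/
theorem integrable_mul_hat {q : ℝ → ℂ} (hg : h2Norm g < ⊤) (hqc : Continuous q)
    (hq : ∀ η, ‖q η‖ ^ 2 ≤ 1 + (2 * Real.pi * η) ^ 2) :
    Integrable (fun η => q η * hat g η) ∧ ∫ η, ‖q η * hat g η‖ ≤ sobConst * h2Real g := by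
  set a : ℝ → ℝ := fun η => ‖q η‖ * (1 + (2 * Real.pi * η) ^ 2)⁻¹ with ha
  have hpos : ∀ η : ℝ, 0 < 1 + (2 * Real.pi * η) ^ 2 := fun η => by positivity
  have hac : Continuous a := by
    refine hqc.norm.mul (Continuous.inv₀ (by fun_prop) fun η => (hpos η).ne')
  have ha2 : ∀ η, a η ^ 2 ≤ (1 + (2 * Real.pi * η) ^ 2)⁻¹ := by
    intro η
    rw [ha, mul_pow, inv_pow, ← div_eq_mul_inv, div_le_iff₀ (pow_pos (hpos η) 2), pow_two (1 + _),
      ← mul_assoc, inv_mul_cancel₀ (hpos η).ne', one_mul]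
    exact hq η
  have ha0 : ∀ η, 0 ≤ a η := fun η => mul_nonneg (norm_nonneg _) (inv_nonneg.2 (hpos η).le)
  have haI : Integrable fun η => a η ^ 2 :=
    integrable_inv_weight.mono' (by fun_prop) (ae_of_all _ fun η => by
      rw [Real.norm_of_nonneg (by positivity)]; exact ha2 η)
  have haL : MemLp a 2 := (memLp_two_iff_integrable_sq hac.aestronglyMeasurable).2 haI
  have hW := memLp_weight_mul_hat hg
  have heq : ∀ η, ‖q η * hat g η‖ =
      a η * ‖((1 + (2 * Real.pi * η) ^ 2 : ℝ) : ℂ) * hat g η‖ := by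
    intro η
    rw [norm_mul, norm_mul, Complex.norm_real, Real.norm_of_nonneg (hpos η).le, ha]
    have := (hpos η).ne'
    field_simp
  constructor
  · have := haL.integrable_mul hW.norm
    refine this.mono' (hqc.aestronglyMeasurable.mul (memLp_hat g).1) (ae_of_all _ fun η => ?_)
    exact (heq η).le
  · simp_rw [heq]
    refine (integral_mul_le_sqrt haL hW.norm ha0 fun η => norm_nonneg _).trans ?_
    rw [integral_weight_mul_hat hg, Real.sqrt_sq (h2Real_nonneg g)]
    refine mul_le_mul_of_nonneg_right (Real.sqrt_le_sqrt ?_) (h2Real_nonneg g)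
    exact integral_mono haI integrable_inv_weight ha2

theorem one_weight : ∀ η : ℝ, ‖(1 : ℂ)‖ ^ 2 ≤ 1 + (2 * Real.pi * η) ^ 2 := fun η => by
  rw [norm_one]; nlinarith [sq_nonneg (2 * Real.pi * η)]

theorem norm_two_pi_I (η : ℝ) : ‖2 * Real.pi * Complex.I * η‖ = |2 * Real.pi * η| := by
  simp [abs_mul, abs_of_pos Real.pi_pos]

theorem deriv_weight : ∀ η : ℝ, ‖2 * Real.pi * Complex.I * η‖ ^ 2 ≤ 1 + (2 * Real.pi * η) ^ 2 :=
  fun η => by rw [norm_two_pi_I, sq_abs]; linarith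

theorem integrable_hat (hg : h2Norm g < ⊤) : Integrable (hat g) := by
  simpa using (integrable_mul_hat hg (q := fun _ => 1) continuous_const one_weight).1

theorem integrable_deriv_hat (hg : h2Norm g < ⊤) :
    Integrable fun η : ℝ => 2 * Real.pi * Complex.I * η * hat g η :=
  (integrable_mul_hat hg (by fun_prop) deriv_weight).1

theorem memLp_deriv_hat (hg : h2Norm g < ⊤) :
    MemLp (fun η : ℝ => 2 * Real.pi * Complex.I * η * hat g η) 2 :=
  memLp_mul_hat hg (by fun_prop) deriv_weight

theorem fourierInv_hat_ae (hg : h2Norm g < ⊤) :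
    ∀ᵐ x, 𝓕⁻ (hat g) x = ((g x : ℝ) : ℂ) := by
  have h1 := fourierInv_toLp_ae (integrable_hat hg) (memLp_hat g)
  have h2 : (memLp_hat g).toLp (hat g) = 𝓕 (toComplex g) := Lp.toLp_coeFn _ _
  rw [h2, FourierPair.fourierInv_fourier_eq] at h1
  filter_upwards [h1, Complex.ofRealCLM.coeFn_compLp g] with x hx1 hx2
  rw [← hx1, toComplex, hx2]
  rfl

/-- The imaginary part of the inversion integral vanishes almost everywhere because `g` is real, and
it is continuous. -/
theorem ofReal_rep (hg : h2Norm g < ⊤) (x : ℝ) : (rep g x : ℂ) = 𝓕⁻ (hat g) x := by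
  have hc := continuous_fourierInv (integrable_hat hg)
  have him : (fun x => (𝓕⁻ (hat g) x).im) = fun _ => (0 : ℝ) := by
    refine (Continuous.ae_eq_iff_eq volume (Complex.continuous_im.comp hc) continuous_const).1 ?_
    filter_upwards [fourierInv_hat_ae hg] with x hx
    rw [Function.comp, hx, Complex.ofReal_im]
  refine Complex.ext rfl ?_
  rw [Complex.ofReal_im]
  exact (congrFun him x).symm

theorem rep_ae (hg : h2Norm g < ⊤) : ∀ᵐ x, rep g x = g x := by
  filter_upwards [fourierInv_hat_ae hg] with x hx
  rw [rep, hx, Complex.ofReal_re]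

theorem hasDerivAt_fourierInv {f : ℝ → ℂ} (hf : Integrable f)
    (hf' : Integrable fun η : ℝ => 2 * Real.pi * Complex.I * η * f η) (x : ℝ) :
    HasDerivAt (𝓕⁻ f) (𝓕⁻ (fun η : ℝ => 2 * Real.pi * Complex.I * η * f η) x) x := by
  rw [fourierInv_eq_fourier_neg', fourierInv_eq_fourier_neg']
  have hne : (2 * Real.pi * Complex.I : ℂ) ≠ 0 := Complex.two_pi_I_ne_zero
  have h1 : Integrable fun η : ℝ => η • f (-η) := by
    have := (hf'.comp_neg).const_mul (-(2 * Real.pi * Complex.I : ℂ)⁻¹)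
    refine this.congr (ae_of_all _ fun η => ?_)
    simp only [Complex.ofReal_neg, Complex.real_smul]
    field_simp
  refine (Real.hasDerivAt_fourier hf.comp_neg h1 x).congr_deriv ?_
  refine congrFun (congrArg _ (funext fun η => ?_)) x
  simp only [smul_eq_mul, Complex.ofReal_neg]
  ring

theorem hasDerivAt_complex_rep (hg : h2Norm g < ⊤) (x : ℝ) :
    HasDerivAt (fun x => (rep g x : ℂ))
      (𝓕⁻ (fun η : ℝ => 2 * Real.pi * Complex.I * η * hat g η) x) x := by
  have : (fun x => (rep g x : ℂ)) = 𝓕⁻ (hat g) := funext (ofReal_rep hg)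
  rw [this]
  exact hasDerivAt_fourierInv (integrable_hat hg) (integrable_deriv_hat hg) x

theorem hasDerivAt_rep (hg : h2Norm g < ⊤) (x : ℝ) : HasDerivAt (rep g) (repDeriv g x) x := by
  have := hasDerivAt_fourierInv (integrable_hat hg) (integrable_deriv_hat hg) x
  exact Complex.reCLM.hasFDerivAt.comp_hasDerivAt x this

theorem ofReal_repDeriv (hg : h2Norm g < ⊤) (x : ℝ) :
    (repDeriv g x : ℂ) = 𝓕⁻ (fun η : ℝ => 2 * Real.pi * Complex.I * η * hat g η) x :=
  ((hasDerivAt_rep hg x).ofReal_comp).unique (hasDerivAt_complex_rep hg x)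

theorem continuous_rep (hg : h2Norm g < ⊤) : Continuous (rep g) :=
  Complex.continuous_re.comp (continuous_fourierInv (integrable_hat hg))

theorem continuous_repDeriv (hg : h2Norm g < ⊤) : Continuous (repDeriv g) :=
  Complex.continuous_re.comp (continuous_fourierInv (integrable_deriv_hat hg))

theorem abs_rep_le (hg : h2Norm g < ⊤) (x : ℝ) : |rep g x| ≤ sobConst * h2Real g := by
  have h1 := (integrable_mul_hat hg (q := fun _ => 1) continuous_const one_weight).2
  simp only [one_mul] at h1
  exact (Complex.abs_re_le_norm _).trans ((norm_fourierInv_le x).trans h1)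

theorem abs_repDeriv_le (hg : h2Norm g < ⊤) (x : ℝ) : |repDeriv g x| ≤ sobConst * h2Real g := by
  have h1 := (integrable_mul_hat hg (by fun_prop) deriv_weight).2
  exact (Complex.abs_re_le_norm _).trans ((norm_fourierInv_le x).trans h1)

theorem memLp_two_real {f : ℝ → ℝ} (hf : MemLp (fun x => (f x : ℂ)) 2) : MemLp f 2 := by
  have := hf.re
  simpa using! this

theorem memLp_rep (hg : h2Norm g < ⊤) : MemLp (rep g) 2 := by
  refine memLp_two_real ?_
  simp_rw [ofReal_rep hg]
  exact memLp_fourierInv (integrable_hat hg) (memLp_hat g)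

theorem memLp_repDeriv (hg : h2Norm g < ⊤) : MemLp (repDeriv g) 2 := by
  refine memLp_two_real ?_
  simp_rw [ofReal_repDeriv hg]
  exact memLp_fourierInv (integrable_deriv_hat hg) (memLp_deriv_hat hg)

theorem integral_rep_sq (hg : h2Norm g < ⊤) : ∫ x, rep g x ^ 2 = ∫ η, ‖hat g η‖ ^ 2 := by
  rw [← integral_norm_sq_fourierInv (integrable_hat hg) (memLp_hat g)]
  congr 1; ext x
  rw [← ofReal_rep hg, Complex.norm_real, Real.norm_eq_abs, sq_abs]

theorem integral_repDeriv_sq (hg : h2Norm g < ⊤) :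
    ∫ x, repDeriv g x ^ 2 = ∫ η : ℝ, ‖2 * Real.pi * Complex.I * η * hat g η‖ ^ 2 := by
  rw [← integral_norm_sq_fourierInv (integrable_deriv_hat hg) (memLp_deriv_hat hg)]
  congr 1; ext x
  rw [← ofReal_repDeriv hg, Complex.norm_real, Real.norm_eq_abs, sq_abs]

theorem integral_rep_sq_le (hg : h2Norm g < ⊤) : ∫ x, rep g x ^ 2 ≤ h2Real g ^ 2 := by
  rw [integral_rep_sq hg]
  simpa using integral_sq_mul_hat_le hg (q := fun _ => 1) continuous_const one_weight

theorem integral_repDeriv_sq_le (hg : h2Norm g < ⊤) : ∫ x, repDeriv g x ^ 2 ≤ h2Real g ^ 2 := by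
  rw [integral_repDeriv_sq hg]
  exact integral_sq_mul_hat_le hg (by fun_prop) deriv_weight

theorem hat_sub_ae (g h : Lp ℝ 2 (volume : Measure ℝ)) :
    hat (g - h) =ᵐ[volume] fun η => hat g η - hat h η := by
  have h1 : toComplex (g - h) = toComplex g - toComplex h := by
    have := (Complex.ofRealCLM.compLpL 2 (volume : Measure ℝ)).map_sub g h
    exact this
  have h2 : (𝓕 (toComplex g - toComplex h) : Lp ℂ 2 (volume : Measure ℝ)) =
      𝓕 (toComplex g) - 𝓕 (toComplex h) := by
    have := (Lp.fourierTransformₗᵢ ℝ ℂ).map_sub (toComplex g) (toComplex h)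
    exact this
  rw [hat, h1, h2]
  exact Lp.coeFn_sub _ _

theorem fourierInv_sub_apply {f g : ℝ → ℂ} (hf : Integrable f) (hg : Integrable g) (η : ℝ) :
    𝓕⁻ (fun x => f x - g x) η = 𝓕⁻ f η - 𝓕⁻ g η := by
  rw [fourierInv_eq_fourier_neg', fourierInv_eq_fourier_neg', fourierInv_eq_fourier_neg']
  exact fourier_sub_apply hf.comp_neg hg.comp_neg η

theorem rep_sub (hg : h2Norm g < ⊤) (hh : h2Norm h < ⊤) (x : ℝ) :
    rep (g - h) x = rep g x - rep h x := by
  rw [rep, Real.fourierInv_congr_ae (hat_sub_ae g h),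
    fourierInv_sub_apply (integrable_hat hg) (integrable_hat hh), Complex.sub_re]
  rfl

theorem repDeriv_sub (hg : h2Norm g < ⊤) (hh : h2Norm h < ⊤) (x : ℝ) :
    repDeriv (g - h) x = repDeriv g x - repDeriv h x := by
  have : (fun η : ℝ => 2 * Real.pi * Complex.I * η * hat (g - h) η) =ᵐ[volume]
      fun η : ℝ => 2 * Real.pi * Complex.I * η * hat g η -
        2 * Real.pi * Complex.I * η * hat h η := by
    filter_upwards [hat_sub_ae g h] with η hη
    rw [hη, mul_sub]
  rw [repDeriv, Real.fourierInv_congr_ae this,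
    fourierInv_sub_apply (integrable_deriv_hat hg) (integrable_deriv_hat hh), Complex.sub_re]
  rfl

end FifthKdV
end

noncomputable section
namespace FifthKdV

/-! ### Continuity in time -/

section
variable {g h : Lp ℝ 2 (volume : Measure ℝ)}

theorem h2Norm_le_add (g h : Lp ℝ 2 (volume : Measure ℝ)) :
    h2Norm g ≤ h2Norm h + h2Norm (g - h) := by
  have hae : (fun η : ℝ => ((1 + (2 * Real.pi * η) ^ 2 : ℝ) : ℂ) * hat g η) =ᵐ[volume]
      (fun η : ℝ => ((1 + (2 * Real.pi * η) ^ 2 : ℝ) : ℂ) * hat h η) +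
      fun η : ℝ => ((1 + (2 * Real.pi * η) ^ 2 : ℝ) : ℂ) * hat (g - h) η := by
    filter_upwards [hat_sub_ae g h] with η hη
    rw [Pi.add_apply, hη]; ring
  have hm : ∀ k : Lp ℝ 2 (volume : Measure ℝ), AEStronglyMeasurable
      (fun η : ℝ => ((1 + (2 * Real.pi * η) ^ 2 : ℝ) : ℂ) * hat k η) volume := fun k =>
    (Continuous.aestronglyMeasurable (by fun_prop)).mul (memLp_hat k).1
  change eLpNorm (fun η : ℝ => ((1 + (2 * Real.pi * η) ^ 2 : ℝ) : ℂ) * hat g η) 2 volume ≤ _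
  rw [eLpNorm_congr_ae hae]
  exact eLpNorm_add_le (hm h) (hm _) (by norm_num)

theorem h2Norm_sub_lt_top (hg : h2Norm g < ⊤) (hh : h2Norm h < ⊤) : h2Norm (g - h) < ⊤ := by
  have hm := (memLp_weight_mul_hat hg).sub (memLp_weight_mul_hat hh)
  have hae : (fun η : ℝ => ((1 + (2 * Real.pi * η) ^ 2 : ℝ) : ℂ) * hat (g - h) η) =ᵐ[volume]
      (fun η : ℝ => ((1 + (2 * Real.pi * η) ^ 2 : ℝ) : ℂ) * hat g η) -
      fun η : ℝ => ((1 + (2 * Real.pi * η) ^ 2 : ℝ) : ℂ) * hat h η := by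
    filter_upwards [hat_sub_ae g h] with η hη
    rw [Pi.sub_apply, hη]; ring
  exact ((memLp_congr_ae hae).2 hm).2

theorem h2Real_le_add (hg : h2Norm g < ⊤) (hh : h2Norm h < ⊤) :
    h2Real g ≤ h2Real h + h2Real (g - h) := by
  have hs := h2Norm_sub_lt_top hg hh
  rw [h2Real, h2Real, h2Real, ← ENNReal.toReal_add hh.ne hs.ne]
  exact ENNReal.toReal_mono (ENNReal.add_lt_top.2 ⟨hh, hs⟩).ne (h2Norm_le_add g h)

end

section
variable {u : ℝ → Lp ℝ 2 (volume : Measure ℝ)}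

theorem tendsto_h2Real_sub (hu : ContinuousInH2 u) (t₀ : ℝ) :
    Tendsto (fun t => h2Real (u t - u t₀)) (𝓝 t₀) (𝓝 0) := by
  have := (ENNReal.tendsto_toReal ENNReal.zero_ne_top).comp (hu.2 t₀)
  simpa using! this

theorem h2Norm_sub_comm (g h : Lp ℝ 2 (volume : Measure ℝ)) : h2Norm (g - h) = h2Norm (h - g) := by
  change eLpNorm (fun η : ℝ => ((1 + (2 * Real.pi * η) ^ 2 : ℝ) : ℂ) * hat (g - h) η) 2 volume =
    eLpNorm (fun η : ℝ => ((1 + (2 * Real.pi * η) ^ 2 : ℝ) : ℂ) * hat (h - g) η) 2 volume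
  refine eLpNorm_congr_norm_ae ?_
  filter_upwards [hat_sub_ae g h, hat_sub_ae h g] with η h1 h2
  rw [h1, h2, norm_mul, norm_mul, norm_sub_rev]

theorem continuous_h2Real (hu : ContinuousInH2 u) : Continuous fun t => h2Real (u t) := by
  refine continuous_iff_continuousAt.2 fun t₀ => ?_
  rw [ContinuousAt, tendsto_iff_norm_sub_tendsto_zero]
  refine squeeze_zero (fun t => norm_nonneg _) (fun t => ?_) (tendsto_h2Real_sub hu t₀)
  have h1 := h2Real_le_add (hu.1 t) (hu.1 t₀)
  have h2 := h2Real_le_add (hu.1 t₀) (hu.1 t)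
  have h3 : h2Real (u t₀ - u t) = h2Real (u t - u t₀) := by rw [h2Real, h2Norm_sub_comm, h2Real]
  rw [Real.norm_eq_abs, abs_le]
  constructor <;> linarith

theorem abs_rep_sub_le (hu : ContinuousInH2 u) (t s x : ℝ) :
    |rep (u t) x - rep (u s) x| ≤ sobConst * h2Real (u t - u s) := by
  rw [← rep_sub (hu.1 t) (hu.1 s)]
  exact abs_rep_le (h2Norm_sub_lt_top (hu.1 t) (hu.1 s)) x

theorem abs_repDeriv_sub_le (hu : ContinuousInH2 u) (t s x : ℝ) :
    |repDeriv (u t) x - repDeriv (u s) x| ≤ sobConst * h2Real (u t - u s) := by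
  rw [← repDeriv_sub (hu.1 t) (hu.1 s)]
  exact abs_repDeriv_le (h2Norm_sub_lt_top (hu.1 t) (hu.1 s)) x

theorem continuous_rep_time (hu : ContinuousInH2 u) (x : ℝ) : Continuous fun t => rep (u t) x := by
  refine continuous_iff_continuousAt.2 fun t₀ => ?_
  rw [ContinuousAt, tendsto_iff_norm_sub_tendsto_zero]
  refine squeeze_zero (fun t => norm_nonneg _) (fun t => abs_rep_sub_le hu t t₀ x) ?_
  simpa using (tendsto_h2Real_sub hu t₀).const_mul sobConst

theorem exists_h2Real_bound (hu : ContinuousInH2 u) (a b : ℝ) :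
    ∃ M, 0 ≤ M ∧ ∀ t ∈ Set.uIcc a b, h2Real (u t) ≤ M := by
  obtain ⟨M, hM⟩ := isCompact_uIcc.bddAbove_image (continuous_h2Real hu).continuousOn (K := Set.uIcc a b)
  refine ⟨M, (h2Real_nonneg _).trans (hM ⟨a, Set.left_mem_uIcc, rfl⟩), fun t ht => hM ⟨t, ht, rfl⟩⟩

/-! ### The nonlinearity -/

/-- Keeping one factor `|a| + |b|` out of the sup bound leaves a product of two `L²` functions, so
the difference of fifth powers can be estimated in `L¹`. -/
theorem abs_pow_five_sub_le {a b M : ℝ} (ha : |a| ≤ M) (hb : |b| ≤ M) :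
    |a ^ 5 - b ^ 5| ≤ 5 * M ^ 3 * (|a - b| * (|a| + |b|)) := by
  have e : a ^ 5 - b ^ 5 = (a - b) * (a ^ 4 + a ^ 3 * b + a ^ 2 * b ^ 2 + a * b ^ 3 + b ^ 4) := by
    ring
  rw [e, abs_mul]
  have hM : 0 ≤ M := (abs_nonneg a).trans ha
  have h1 : |a ^ 4 + a ^ 3 * b + a ^ 2 * b ^ 2 + a * b ^ 3 + b ^ 4| ≤ 5 * M ^ 3 * (|a| + |b|) := by
    have e1 : |a ^ 4| ≤ M ^ 3 * |a| := by
      rw [abs_pow, pow_succ]; gcongr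
    have e2 : |a ^ 3 * b| ≤ M ^ 3 * |b| := by
      rw [abs_mul, abs_pow]; gcongr
    have e3 : |a ^ 2 * b ^ 2| ≤ M ^ 3 * |b| := by
      rw [abs_mul, abs_pow, abs_pow, pow_two |b|, ← mul_assoc, pow_succ M 2]; gcongr
    have e4 : |a * b ^ 3| ≤ M ^ 3 * |a| := by
      rw [abs_mul, abs_pow, mul_comm]; gcongr
    have e5 : |b ^ 4| ≤ M ^ 3 * |b| := by
      rw [abs_pow, pow_succ]; gcongr
    have hM3 : 0 ≤ M ^ 3 := by positivity
    have f1 := abs_add_le (a ^ 4 + a ^ 3 * b + a ^ 2 * b ^ 2 + a * b ^ 3) (b ^ 4)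
    have f2 := abs_add_le (a ^ 4 + a ^ 3 * b + a ^ 2 * b ^ 2) (a * b ^ 3)
    have f3 := abs_add_le (a ^ 4 + a ^ 3 * b) (a ^ 2 * b ^ 2)
    have f4 := abs_add_le (a ^ 4) (a ^ 3 * b)
    nlinarith [mul_nonneg hM3 (abs_nonneg a), mul_nonneg hM3 (abs_nonneg b)]
  calc |a - b| * _ ≤ |a - b| * (5 * M ^ 3 * (|a| + |b|)) := by gcongr
    _ = _ := by ring

theorem integrable_pow_five {f : ℝ → ℝ} {M : ℝ} (hf : MemLp f 2) (hM : ∀ x, |f x| ≤ M) :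
    Integrable fun x => f x ^ 5 := by
  have h2 := (memLp_two_iff_integrable_sq hf.1).1 hf
  refine (h2.const_mul (M ^ 3)).mono' (hf.1.pow 5) (ae_of_all _ fun x => ?_)
  rw [Real.norm_eq_abs, abs_pow, ← sq_abs (f x), pow_succ |f x| 4, pow_succ |f x| 3, mul_assoc,
    ← pow_two]
  have := pow_le_pow_left₀ (abs_nonneg (f x)) (hM x) 3
  gcongr

theorem integrable_rep_pow_five {g : Lp ℝ 2 (volume : Measure ℝ)} (hg : h2Norm g < ⊤) :
    Integrable fun x => ((rep g x ^ 5 : ℝ) : ℂ) :=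
  (integrable_pow_five (memLp_rep hg) (abs_rep_le hg)).ofReal

theorem memLp_pow_five {f : ℝ → ℝ} {M : ℝ} (hf : MemLp f 2) (hM : ∀ x, |f x| ≤ M) :
    MemLp (fun x => f x ^ 5) 2 := by
  refine (hf.const_mul (M ^ 4)).of_le (hf.1.pow 5) (ae_of_all _ fun x => ?_)
  have hM0 : 0 ≤ M := (abs_nonneg _).trans (hM x)
  have := pow_le_pow_left₀ (abs_nonneg (f x)) (hM x) 4
  rw [Real.norm_eq_abs, Real.norm_eq_abs, abs_mul, abs_pow, abs_of_nonneg (pow_nonneg hM0 4),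
    pow_succ]
  gcongr

/-- Continuity of `t ↦ u(t)⁵` into `L¹` makes the transform of `u⁵` jointly continuous in time and
frequency, which is what permits differentiating the Duhamel integral at every single frequency. -/
theorem tendsto_integral_pow_five_sub (hu : ContinuousInH2 u) (t₀ : ℝ) :
    Tendsto (fun t => ∫ x, ‖((rep (u t) x ^ 5 : ℝ) : ℂ) - ((rep (u t₀) x ^ 5 : ℝ) : ℂ)‖)
      (𝓝 t₀) (𝓝 0) := by
  set M := fun t => sobConst * (h2Real (u t) + h2Real (u t₀)) with hM
  have hle : ∀ t, ∫ x, ‖((rep (u t) x ^ 5 : ℝ) : ℂ) - ((rep (u t₀) x ^ 5 : ℝ) : ℂ)‖ ≤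
      5 * M t ^ 3 * (h2Real (u t - u t₀) * (h2Real (u t) + h2Real (u t₀))) := by
    intro t
    have hs := h2Norm_sub_lt_top (hu.1 t) (hu.1 t₀)
    have hc := sobConst_nonneg
    have h1 := h2Real_nonneg (u t)
    have h2 := h2Real_nonneg (u t₀)
    have hd : MemLp (fun x => |rep (u t - u t₀) x|) 2 := (memLp_rep hs).norm
    have ha : MemLp (fun x => |rep (u t) x|) 2 := (memLp_rep (hu.1 t)).norm
    have hb : MemLp (fun x => |rep (u t₀) x|) 2 := (memLp_rep (hu.1 t₀)).norm
    have hda := integral_mul_le_sqrt hd ha (fun x => abs_nonneg _) fun x => abs_nonneg _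
    have hdb := integral_mul_le_sqrt hd hb (fun x => abs_nonneg _) fun x => abs_nonneg _
    simp only [sq_abs] at hda hdb
    have s1 : √(∫ x, rep (u t - u t₀) x ^ 2) ≤ h2Real (u t - u t₀) :=
      Real.sqrt_le_iff.2 ⟨h2Real_nonneg _, integral_rep_sq_le hs⟩
    have s2 : √(∫ x, rep (u t) x ^ 2) ≤ h2Real (u t) :=
      Real.sqrt_le_iff.2 ⟨h2Real_nonneg _, integral_rep_sq_le (hu.1 t)⟩
    have s3 : √(∫ x, rep (u t₀) x ^ 2) ≤ h2Real (u t₀) :=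
      Real.sqrt_le_iff.2 ⟨h2Real_nonneg _, integral_rep_sq_le (hu.1 t₀)⟩
    have hM0 : 0 ≤ M t := by positivity
    have hint := ((hd.integrable_mul ha).add (hd.integrable_mul hb)).const_mul (5 * M t ^ 3)
    calc _ ≤ ∫ x, 5 * M t ^ 3 * (|rep (u t - u t₀) x| * |rep (u t) x| +
          |rep (u t - u t₀) x| * |rep (u t₀) x|) := by
          refine integral_mono
            ((integrable_rep_pow_five (hu.1 t)).sub (integrable_rep_pow_five (hu.1 t₀))).norm
            hint fun x => ?_
          dsimp only
          rw [← Complex.ofReal_sub, Complex.norm_real, Real.norm_eq_abs, rep_sub (hu.1 t) (hu.1 t₀),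
            ← mul_add]
          refine abs_pow_five_sub_le ?_ ?_
          · exact (abs_rep_le (hu.1 t) x).trans (mul_le_mul_of_nonneg_left (by linarith) hc)
          · exact (abs_rep_le (hu.1 t₀) x).trans (mul_le_mul_of_nonneg_left (by linarith) hc)
      _ = 5 * M t ^ 3 * ((∫ x, |rep (u t - u t₀) x| * |rep (u t) x|) +
          ∫ x, |rep (u t - u t₀) x| * |rep (u t₀) x|) := by
          rw [integral_const_mul]
          congr 1
          exact integral_add (hd.integrable_mul ha) (hd.integrable_mul hb)
      _ ≤ 5 * M t ^ 3 * (h2Real (u t - u t₀) * h2Real (u t) +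
          h2Real (u t - u t₀) * h2Real (u t₀)) := by
          have := h2Real_nonneg (u t - u t₀)
          gcongr
          · exact hda.trans (by gcongr)
          · exact hdb.trans (by gcongr)
      _ = _ := by ring
  have hcont := continuous_h2Real hu
  have hlim : Tendsto (fun t => 5 * M t ^ 3 *
      (h2Real (u t - u t₀) * (h2Real (u t) + h2Real (u t₀)))) (𝓝 t₀)
      (𝓝 (5 * M t₀ ^ 3 * (0 * (h2Real (u t₀) + h2Real (u t₀))))) := by
    have hMc : Continuous M := by rw [hM]; fun_prop
    refine Tendsto.mul (Continuous.tendsto (by fun_prop) t₀) ?_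
    exact (tendsto_h2Real_sub hu t₀).mul (Continuous.tendsto (by fun_prop) t₀)
  rw [zero_mul, mul_zero] at hlim
  exact squeeze_zero (fun t => integral_nonneg fun x => norm_nonneg _) hle hlim

/-- The Fourier transform is jointly continuous along an `L¹` continuous family. -/
theorem continuous_fourier_family {Q : ℝ → ℝ → ℂ} (hQ : ∀ t, Integrable (Q t))
    (hlim : ∀ t₀, Tendsto (fun t => ∫ x, ‖Q t x - Q t₀ x‖) (𝓝 t₀) (𝓝 0)) :
    Continuous fun z : ℝ × ℝ => 𝓕 (Q z.1) z.2 := by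
  refine continuous_iff_continuousAt.2 fun ⟨t₀, η₀⟩ => ?_
  have h1 : Tendsto (fun z : ℝ × ℝ => 𝓕 (Q z.1) z.2 - 𝓕 (Q t₀) z.2) (𝓝 (t₀, η₀)) (𝓝 0) := by
    refine squeeze_zero_norm (fun z => ?_) ((hlim t₀).comp (continuous_fst.tendsto (t₀, η₀)))
    rw [← fourier_sub_apply (hQ _) (hQ _)]
    exact norm_fourier_le _
  have h2 : Tendsto (fun z : ℝ × ℝ => 𝓕 (Q t₀) z.2) (𝓝 (t₀, η₀)) (𝓝 (𝓕 (Q t₀) η₀)) :=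
    ((continuous_fourier (hQ t₀)).comp continuous_snd).tendsto (t₀, η₀)
  have := h1.add h2
  simpa [ContinuousAt] using this

/-- The Fourier transform of `u⁵`. -/
def quinticHat (u : ℝ → Lp ℝ 2 (volume : Measure ℝ)) (t η : ℝ) : ℂ :=
  𝓕 (fun x => ((rep (u t) x ^ 5 : ℝ) : ℂ)) η

theorem continuous_quinticHat (hu : ContinuousInH2 u) :
    Continuous fun z : ℝ × ℝ => quinticHat u z.1 z.2 :=
  continuous_fourier_family (fun t => integrable_rep_pow_five (hu.1 t))
    (tendsto_integral_pow_five_sub hu)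

/-- The Fourier transform of `-e^{-t∂ₓ⁵} u⁵ / 5`. -/
def duhamelDensity (u : ℝ → Lp ℝ 2 (volume : Measure ℝ)) (t η : ℝ) : ℂ :=
  -(1 / 5) * propagatorSymbol t η * quinticHat u t η

theorem continuous_propagatorSymbol : Continuous fun z : ℝ × ℝ => propagatorSymbol z.1 z.2 := by
  unfold propagatorSymbol; fun_prop

theorem continuous_duhamelDensity (hu : ContinuousInH2 u) :
    Continuous fun z : ℝ × ℝ => duhamelDensity u z.1 z.2 := by
  have h1 := continuous_quinticHat hu
  have h2 := continuous_propagatorSymbol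
  unfold duhamelDensity
  fun_prop

end

end FifthKdV
end

noncomputable section
namespace FifthKdV

/-! ### The weak equation for Schwartz test functions -/

theorem natCast_le_infty (k : ℕ) : (k : ℕ∞ω) ≤ (∞ : ℕ∞ω) := by exact_mod_cast le_top

/-- A smooth cutoff equal to `1` near the origin. -/
def cutoff : ContDiffBump (0 : ℝ) := ⟨1, 2, by norm_num, by norm_num⟩

/-- The cutoff at scale `n + 1`. -/
def cutoffAt (n : ℕ) (x : ℝ) : ℝ := cutoff (((n : ℝ) + 1)⁻¹ * x)

theorem contDiff_cutoffAt (n : ℕ) : ContDiff ℝ ∞ (cutoffAt n) :=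
  cutoff.contDiff.comp (contDiff_const.mul contDiff_id)

theorem hasCompactSupport_cutoffAt (n : ℕ) : HasCompactSupport (cutoffAt n) := by
  have h : ((n : ℝ) + 1)⁻¹ ≠ 0 := by positivity
  exact cutoff.hasCompactSupport.comp_homeomorph (Homeomorph.mulLeft₀ _ h)

theorem cutoffAt_eventuallyEq_one (x : ℝ) :
    ∀ᶠ n : ℕ in atTop, cutoffAt n =ᶠ[𝓝 x] fun _ => 1 := by
  filter_upwards [eventually_ge_atTop ⌈|x| + 1⌉₊] with n hn
  have hn' : |x| + 1 ≤ n := (Nat.le_ceil _).trans (by exact_mod_cast hn)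
  filter_upwards [Metric.ball_mem_nhds x one_pos] with y hy
  refine cutoff.one_of_mem_closedBall ?_
  rw [Metric.mem_ball, Real.dist_eq] at hy
  rw [mem_closedBall_zero_iff, Real.norm_eq_abs, abs_mul,
    abs_of_nonneg (by positivity : (0 : ℝ) ≤ ((n : ℝ) + 1)⁻¹)]
  have : |y| ≤ |x| + 1 := by
    have := abs_sub_abs_le_abs_sub y x
    linarith
  have hle : |y| ≤ (n : ℝ) + 1 := by linarith
  change _ ≤ (1 : ℝ)
  rw [inv_mul_le_iff₀ (by positivity)]
  linarith

/-- Widening the cutoff multiplies its `i`-th derivative by `(n + 1)^{-i} ≤ 1`, so the bound at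
scale one serves all scales. -/
theorem exists_cutoffAt_bound (i : ℕ) : ∃ B : ℝ, 0 ≤ B ∧
    ∀ (n : ℕ) (x : ℝ), ‖iteratedFDeriv ℝ i (cutoffAt n) x‖ ≤ B := by
  have hc : Continuous (iteratedDeriv i cutoff) :=
    (cutoff.contDiff (n := ⊤)).continuous_iteratedDeriv i (natCast_le_infty _)
  have hs : HasCompactSupport (iteratedDeriv i cutoff) := by
    rw [iteratedDeriv_eq_iterate]
    induction i with
    | zero => simpa using cutoff.hasCompactSupport
    | succ k ih =>
      rw [Function.iterate_succ_apply']
      refine (ih ?_).deriv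
      exact (cutoff.contDiff (n := ⊤)).continuous_iteratedDeriv k (natCast_le_infty _)
  obtain ⟨B, hB⟩ := hs.exists_bound_of_continuous hc
  refine ⟨B, (norm_nonneg _).trans (hB 0), fun n x => ?_⟩
  rw [norm_iteratedFDeriv_eq_norm_iteratedDeriv]
  have h1 := congrFun (iteratedDeriv_comp_const_mul (n := i)
    (cutoff.contDiff (n := (i : ℕ∞))) (((n : ℝ) + 1)⁻¹)) x
  have h2 : iteratedDeriv i (cutoffAt n) x =
      (((n : ℝ) + 1)⁻¹) ^ i * iteratedDeriv i cutoff (((n : ℝ) + 1)⁻¹ * x) := by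
    simpa using! h1
  rw [h2, norm_mul, norm_pow]
  have h3 : ‖((n : ℝ) + 1)⁻¹‖ ≤ 1 := by
    rw [norm_inv, Real.norm_of_nonneg (by positivity)]
    exact inv_le_one_of_one_le₀ (by linarith [(Nat.cast_nonneg n : (0 : ℝ) ≤ n)])
  calc _ ≤ 1 ^ i * B := by gcongr; exact hB _
    _ = B := by simp

/-- Smooth functions all of whose derivatives are dominated by integrable functions. -/
structure IsTest (φ : ℝ → ℝ) : Prop where
  contDiff : ContDiff ℝ ∞ φ
  integrable : ∀ k, Integrable (fun x => ‖iteratedFDeriv ℝ k φ x‖)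

theorem IsTest.exists_dominated {φ : ℝ → ℝ} (hφ : IsTest φ) (k : ℕ) :
    ∃ D : ℝ → ℝ, Integrable D ∧ (∀ n x, |iteratedDeriv k (fun x => cutoffAt n x * φ x) x| ≤ D x) ∧
      ∀ x, |iteratedDeriv k φ x| ≤ D x := by
  choose B hB0 hB using exists_cutoffAt_bound
  set D : ℝ → ℝ := fun x => ‖iteratedFDeriv ℝ k φ x‖ + ∑ i ∈ Finset.range (k + 1),
    (k.choose i : ℝ) * B i * ‖iteratedFDeriv ℝ (k - i) φ x‖ with hD
  refine ⟨D, (hφ.integrable k).add (integrable_finsetSum _ fun i _ =>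
    (hφ.integrable _).const_mul _), fun n x => ?_, fun x => ?_⟩
  · rw [← Real.norm_eq_abs, ← norm_iteratedFDeriv_eq_norm_iteratedDeriv]
    refine (norm_iteratedFDeriv_mul_le (contDiff_cutoffAt n) hφ.contDiff x
      (natCast_le_infty k)).trans ?_
    have : ∑ i ∈ Finset.range (k + 1), (k.choose i : ℝ) * ‖iteratedFDeriv ℝ i (cutoffAt n) x‖ *
        ‖iteratedFDeriv ℝ (k - i) φ x‖ ≤ ∑ i ∈ Finset.range (k + 1),
    (k.choose i : ℝ) * B i * ‖iteratedFDeriv ℝ (k - i) φ x‖ := by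
      refine Finset.sum_le_sum fun i _ => ?_
      gcongr
      exact hB i n x
    refine this.trans ?_
    simp only [hD]
    linarith [norm_nonneg (iteratedFDeriv ℝ k φ x)]
  · rw [← Real.norm_eq_abs, ← norm_iteratedFDeriv_eq_norm_iteratedDeriv]
    simp only [hD]
    have : 0 ≤ ∑ i ∈ Finset.range (k + 1),
      (k.choose i : ℝ) * B i * ‖iteratedFDeriv ℝ (k - i) φ x‖ :=
      Finset.sum_nonneg fun i _ => by have := hB0 i; positivity
    linarith

theorem tendsto_iteratedDeriv_cutoffAt_mul (φ : ℝ → ℝ) (k : ℕ) (x : ℝ) :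
    Tendsto (fun n : ℕ => iteratedDeriv k (fun x => cutoffAt n x * φ x) x) atTop
      (𝓝 (iteratedDeriv k φ x)) := by
  refine tendsto_const_nhds.congr' ?_
  filter_upwards [cutoffAt_eventuallyEq_one x] with n hn
  have : (fun x => cutoffAt n x * φ x) =ᶠ[𝓝 x] φ := by
    filter_upwards [hn] with y hy
    rw [hy, one_mul]
  exact (this.iteratedDeriv_eq k).symm

variable {u : ℝ → Lp ℝ 2 (volume : Measure ℝ)} {u₀ : Lp ℝ 2 (volume : Measure ℝ)}

/-- The right-hand side of the weak equation. -/
def weakRhs (u : ℝ → Lp ℝ 2 (volume : Measure ℝ)) (φ : ℝ → ℝ) (t : ℝ) : ℝ :=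
  ∫ x, (-(rep (u t) x * iteratedDeriv 5 φ x) + rep (u t) x ^ 5 / 5 * iteratedDeriv 1 φ x)

theorem abs_weak_integrand_le {v a b A B M : ℝ} (hv : |v| ≤ M) (ha : |a| ≤ A) (hb : |b| ≤ B) :
    |-(v * a) + v ^ 5 / 5 * b| ≤ M * A + M ^ 5 * B := by
  have hM : 0 ≤ M := (abs_nonneg v).trans hv
  refine (abs_add_le _ _).trans (add_le_add ?_ ?_)
  · rw [abs_neg, abs_mul]; gcongr
  · rw [abs_mul, abs_div, abs_pow, abs_of_nonneg (by norm_num : (0 : ℝ) ≤ 5)]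
    have h1 : |v| ^ 5 ≤ M ^ 5 := by gcongr
    have h2 : |v| ^ 5 / 5 ≤ M ^ 5 := by
      have : 0 ≤ |v| ^ 5 := by positivity
      linarith
    gcongr

theorem continuous_weakRhs (hu : ContinuousInH2 u) {φ : ℝ → ℝ} (hφ : IsTest φ) :
    Continuous (weakRhs u φ) := by
  refine continuous_iff_continuousAt.2 fun t₀ => ?_
  obtain ⟨M, hM0, hM⟩ := exists_h2Real_bound hu (t₀ - 1) (t₀ + 1)
  have hc := sobConst_nonneg
  have h5 := hφ.contDiff.continuous_iteratedDeriv 5 (natCast_le_infty _)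
  have h1 := hφ.contDiff.continuous_iteratedDeriv 1 (natCast_le_infty _)
  refine continuousAt_of_dominated (bound := fun x => (sobConst * M) *
    ‖iteratedFDeriv ℝ 5 φ x‖ + (sobConst * M) ^ 5 * ‖iteratedFDeriv ℝ 1 φ x‖) ?_ ?_ ?_ ?_
  · refine Eventually.of_forall fun t => ?_
    have := continuous_rep (hu.1 t)
    exact Continuous.aestronglyMeasurable (by fun_prop)
  · filter_upwards [Icc_mem_nhds (by linarith : t₀ - 1 < t₀) (by linarith : t₀ < t₀ + 1)] with t ht
    refine ae_of_all _ fun x => ?_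
    rw [Real.norm_eq_abs]
    refine abs_weak_integrand_le ?_ ?_ ?_
    · refine (abs_rep_le (hu.1 t) x).trans ?_
      gcongr
      exact hM t (by rwa [Set.uIcc_of_le (by linarith)])
    · rw [norm_iteratedFDeriv_eq_norm_iteratedDeriv, Real.norm_eq_abs]
    · rw [norm_iteratedFDeriv_eq_norm_iteratedDeriv, Real.norm_eq_abs]
  · exact ((hφ.integrable 5).const_mul _).add ((hφ.integrable 1).const_mul _)
  · refine ae_of_all _ fun x => ?_
    have := continuous_rep_time hu x
    exact Continuous.continuousAt (by fun_prop)

theorem isTest_of_compactSupport {φ : ℝ → ℝ} (h : ContDiff ℝ ∞ φ) (hc : HasCompactSupport φ) :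
    IsTest φ := by
  refine ⟨h, fun k => Integrable.norm ?_⟩
  exact (h.continuous_iteratedFDeriv (m := k) (natCast_le_infty _)).integrable_of_hasCompactSupport
    (hc.iteratedFDeriv k)

theorem hasDerivAt_weak_of_compactSupport (hu : IsSolution u₀ u) {φ : ℝ → ℝ}
    (h : ContDiff ℝ ∞ φ) (hc : HasCompactSupport φ) (t : ℝ) :
    HasDerivAt (fun s => ∫ x, rep (u s) x * φ x) (weakRhs u φ t) t := by
  have he := hu.equation φ h hc t
  have h1 : (fun s : ℝ => ∫ x, u s x * φ x) = fun s => ∫ x, rep (u s) x * φ x := by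
    ext s
    refine integral_congr_ae ?_
    filter_upwards [rep_ae (hu.continuousInH2.1 s)] with x hx
    rw [hx]
  rw [h1] at he
  refine he.congr_deriv (integral_congr_ae ?_)
  filter_upwards [rep_ae (hu.continuousInH2.1 t)] with x hx
  rw [hx, iteratedDeriv_one]

/-- Derivatives in time do not pass to the limit of the cutoffs, but the integrated equation does,
by dominated convergence. As the limiting right-hand side is continuous in time, the integral
identity can be differentiated again. -/
theorem hasDerivAt_weak (hu : IsSolution u₀ u) {φ : ℝ → ℝ} (hφ : IsTest φ) (t : ℝ) :
    HasDerivAt (fun s => ∫ x, rep (u s) x * φ x) (weakRhs u φ t) t := by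
  have huc := hu.continuousInH2
  have hcs := sobConst_nonneg
  set φn : ℕ → ℝ → ℝ := fun n x => cutoffAt n x * φ x with hφn
  have hnC : ∀ n, ContDiff ℝ ∞ (φn n) := fun n => (contDiff_cutoffAt n).mul hφ.contDiff
  have hns : ∀ n, HasCompactSupport (φn n) := fun n => (hasCompactSupport_cutoffAt n).mul_right
  have hnT : ∀ n, IsTest (φn n) := fun n => isTest_of_compactSupport (hnC n) (hns n)
  obtain ⟨D0, hD0i, hD0n, hD0⟩ := hφ.exists_dominated 0
  obtain ⟨D5, hD5i, hD5n, hD5⟩ := hφ.exists_dominated 5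
  obtain ⟨D1, hD1i, hD1n, hD1⟩ := hφ.exists_dominated 1
  simp only [iteratedDeriv_zero] at hD0n hD0
  have hmeas : ∀ n k t, AEStronglyMeasurable (fun x => rep (u t) x * iteratedDeriv k (φn n) x)
      volume := fun n k t =>
    ((continuous_rep (huc.1 t)).mul
      ((hnC n).continuous_iteratedDeriv k (natCast_le_infty _))).aestronglyMeasurable
  have hlim0 : ∀ s, Tendsto (fun n => ∫ x, rep (u s) x * φn n x) atTop
      (𝓝 (∫ x, rep (u s) x * φ x)) := by
    intro s
    refine tendsto_integral_of_dominated_convergence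
      (fun x => sobConst * h2Real (u s) * D0 x) (fun n => by simpa using hmeas n 0 s)
      (hD0i.const_mul _) (fun n => ae_of_all _ fun x => ?_) (ae_of_all _ fun x => ?_)
    · rw [norm_mul, Real.norm_eq_abs, Real.norm_eq_abs]
      have := h2Real_nonneg (u s)
      exact mul_le_mul (abs_rep_le (huc.1 s) x) (hD0n n x) (abs_nonneg _) (by positivity)
    · exact (by simpa using tendsto_iteratedDeriv_cutoffAt_mul φ 0 x :
        Tendsto (fun n => φn n x) atTop (𝓝 (φ x))).const_mul _
  have hbd : ∀ s n, ∀ x, ‖-(rep (u s) x * iteratedDeriv 5 (φn n) x) +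
      rep (u s) x ^ 5 / 5 * iteratedDeriv 1 (φn n) x‖ ≤
      sobConst * h2Real (u s) * D5 x + (sobConst * h2Real (u s)) ^ 5 * D1 x := fun s n x =>
    abs_weak_integrand_le (abs_rep_le (huc.1 s) x) (hD5n n x) (hD1n n x)
  have hlimR : ∀ s, Tendsto (fun n => weakRhs u (φn n) s) atTop (𝓝 (weakRhs u φ s)) := by
    intro s
    refine tendsto_integral_of_dominated_convergence _ (fun n => ?_)
      ((hD5i.const_mul _).add (hD1i.const_mul _)) (fun n => ae_of_all _ (hbd s n))
      (ae_of_all _ fun x => ?_)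
    · have h0 := continuous_rep (huc.1 s)
      have h5 := (hnC n).continuous_iteratedDeriv 5 (natCast_le_infty _)
      have h1 := (hnC n).continuous_iteratedDeriv 1 (natCast_le_infty _)
      exact Continuous.aestronglyMeasurable (by fun_prop)
    · exact ((tendsto_iteratedDeriv_cutoffAt_mul φ 5 x).const_mul _).neg.add
        ((tendsto_iteratedDeriv_cutoffAt_mul φ 1 x).const_mul _)
  have hcont := continuous_weakRhs huc hφ
  have hFTC : ∀ s, (∫ x, rep (u s) x * φ x) =
      (∫ x, rep (u 0) x * φ x) + ∫ r in (0 : ℝ)..s, weakRhs u φ r := by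
    intro s
    obtain ⟨M, hM0, hM⟩ := exists_h2Real_bound huc 0 s
    have hn : ∀ n, (∫ x, rep (u s) x * φn n x) - (∫ x, rep (u 0) x * φn n x) =
        ∫ r in (0 : ℝ)..s, weakRhs u (φn n) r := fun n =>
      (intervalIntegral.integral_eq_sub_of_hasDerivAt
        (fun r _ => hasDerivAt_weak_of_compactSupport hu (hnC n) (hns n) r)
        ((continuous_weakRhs huc (hnT n)).intervalIntegrable 0 s)).symm
    have hL := (hlim0 s).sub (hlim0 0)
    have hR : Tendsto (fun n => ∫ r in (0 : ℝ)..s, weakRhs u (φn n) r) atTop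
        (𝓝 (∫ r in (0 : ℝ)..s, weakRhs u φ r)) := by
      refine intervalIntegral.tendsto_integral_filter_of_dominated_convergence
        (fun _ => ∫ x, (sobConst * M * D5 x + (sobConst * M) ^ 5 * D1 x))
        (Eventually.of_forall fun n =>
          (continuous_weakRhs huc (hnT n)).aestronglyMeasurable)
        (Eventually.of_forall fun n => ae_of_all _ fun r hr => ?_)
        intervalIntegrable_const (ae_of_all _ fun r _ => hlimR r)
      refine norm_integral_le_of_norm_le ((hD5i.const_mul _).add (hD1i.const_mul _))
        (ae_of_all _ fun x => (hbd r n x).trans ?_)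
      have hr' := hM r (Set.uIoc_subset_uIcc hr)
      have h5 : 0 ≤ D5 x := (abs_nonneg _).trans (hD5 x)
      have h1 : 0 ≤ D1 x := (abs_nonneg _).trans (hD1 x)
      have hh := h2Real_nonneg (u r)
      gcongr
    simp_rw [hn] at hL
    have := tendsto_nhds_unique hL hR
    linarith
  have hd := (intervalIntegral.integral_hasDerivAt_right (hcont.intervalIntegrable 0 t)
    (hcont.stronglyMeasurableAtFilter _ _) hcont.continuousAt).const_add (∫ x, rep (u 0) x * φ x)
  exact hd.congr_of_eventuallyEq (Eventually.of_forall hFTC)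

-- Real and imaginary parts are treated at once by composing with a real-linear functional `L` on
-- `ℂ` that commutes with real factors.
open scoped SchwartzMap in
theorem hasDerivAt_weak_schwartz (hu : IsSolution u₀ u) (ψ : 𝓢(ℝ, ℂ)) (t : ℝ) :
    HasDerivAt (fun s => ∫ x, (rep (u s) x : ℂ) * ψ x)
      (∫ x, (-((rep (u t) x : ℂ) * iteratedDeriv 5 ψ x) +
        ((rep (u t) x ^ 5 : ℝ) : ℂ) / 5 * iteratedDeriv 1 ψ x)) t := by
  have hu2 := hu.continuousInH2.1
  have hψ := ψ.smooth ⊤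
  have hψi : ∀ k, Integrable (fun x => ‖iteratedFDeriv ℝ k ψ x‖) := fun k => by
    have := ψ.integrable_pow_mul_iteratedFDeriv volume 0 k
    simpa only [pow_zero, one_mul] using this
  have key : ∀ L : ℂ →L[ℝ] ℝ, IsTest (fun x => L (ψ x)) ∧ ∀ k x,
      iteratedDeriv k (fun x => L (ψ x)) x = L (iteratedDeriv k ψ x) := by
    intro L
    have hF : ∀ k x, iteratedFDeriv ℝ k (fun x => L (ψ x)) x =
        L.compContinuousMultilinearMap (iteratedFDeriv ℝ k ψ x) := fun k x =>
      L.iteratedFDeriv_comp_left (hψ.contDiffAt (x := x)) (natCast_le_infty _)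
    refine ⟨⟨L.contDiff.comp hψ, fun k => ?_⟩, fun k x => ?_⟩
    · refine ((hψi k).const_mul ‖L‖).mono'
        ((L.contDiff.comp hψ).continuous_iteratedFDeriv
          (natCast_le_infty _)).norm.aestronglyMeasurable (ae_of_all _ fun x => ?_)
      rw [norm_norm]
      exact (congrArg norm (hF k x)).le.trans (L.norm_compContinuousMultilinearMap_le _)
    · rw [iteratedDeriv, iteratedDeriv, hF]
      rfl
  have hi5 : ∀ s, Integrable fun x => (rep (u s) x : ℂ) * iteratedDeriv 5 ψ x := fun s => by
    have h5 : Integrable (iteratedDeriv 5 ψ) := by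
      have := hψi 5
      simp_rw [norm_iteratedFDeriv_eq_norm_iteratedDeriv] at this
      exact (integrable_norm_iff (hψ.continuous_iteratedDeriv 5
        (natCast_le_infty _)).aestronglyMeasurable).1 this
    refine h5.bdd_mul (c := sobConst * h2Real (u s)) (Complex.continuous_ofReal.comp
      (continuous_rep (hu2 s))).aestronglyMeasurable (ae_of_all _ fun x => ?_)
    rw [Complex.norm_real]; exact abs_rep_le (hu2 s) x
  have hi0 : ∀ s, Integrable fun x => (rep (u s) x : ℂ) * ψ x := fun s => by
    refine ψ.integrable.bdd_mul (c := sobConst * h2Real (u s)) (Complex.continuous_ofReal.comp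
      (continuous_rep (hu2 s))).aestronglyMeasurable (ae_of_all _ fun x => ?_)
    rw [Complex.norm_real]; exact abs_rep_le (hu2 s) x
  have hi1 : ∀ s, Integrable fun x => ((rep (u s) x ^ 5 : ℝ) : ℂ) / 5 * iteratedDeriv 1 ψ x :=
    fun s => by
    have h1 : Integrable (iteratedDeriv 1 ψ) := by
      have := hψi 1
      simp_rw [norm_iteratedFDeriv_eq_norm_iteratedDeriv] at this
      exact (integrable_norm_iff (hψ.continuous_iteratedDeriv 1
        (natCast_le_infty _)).aestronglyMeasurable).1 this
    refine h1.bdd_mul (c := (sobConst * h2Real (u s)) ^ 5)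
      (Continuous.aestronglyMeasurable (by
        have := continuous_rep (hu2 s); fun_prop)) (ae_of_all _ fun x => ?_)
    rw [norm_div, Complex.norm_real, norm_pow]
    have h6 := pow_le_pow_left₀ (abs_nonneg _) (abs_rep_le (hu2 s) x) 5
    have h7 : (0 : ℝ) ≤ ‖rep (u s) x‖ ^ 5 := by positivity
    rw [← Real.norm_eq_abs] at h6
    simp only [Real.norm_eq_abs] at h6 h7 ⊢
    norm_num
    linarith
  have hL : ∀ L : ℂ →L[ℝ] ℝ, (∀ (r : ℝ) z, L ((r : ℂ) * z) = r * L z) →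
      HasDerivAt (fun s => L (∫ x, (rep (u s) x : ℂ) * ψ x))
      (L (∫ x, (-((rep (u t) x : ℂ) * iteratedDeriv 5 ψ x) +
        ((rep (u t) x ^ 5 : ℝ) : ℂ) / 5 * iteratedDeriv 1 ψ x))) t := by
    intro L hLr
    obtain ⟨hT, hk⟩ := key L
    have := hasDerivAt_weak hu hT t
    have e1 : (fun s => L (∫ x, (rep (u s) x : ℂ) * ψ x)) =
        fun s => ∫ x, rep (u s) x * L (ψ x) := by
      ext s
      rw [← L.integral_comp_comm (hi0 s)]
      simp only [hLr]
    have e2 : L (∫ x, (-((rep (u t) x : ℂ) * iteratedDeriv 5 ψ x) +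
        ((rep (u t) x ^ 5 : ℝ) : ℂ) / 5 * iteratedDeriv 1 ψ x)) =
        weakRhs u (fun x => L (ψ x)) t := by
      refine (L.integral_comp_comm ((hi5 t).neg.add (hi1 t))).symm.trans ?_
      rw [weakRhs]
      congr 1
      ext x
      have h5 : ((rep (u t) x ^ 5 : ℝ) : ℂ) / 5 = ((rep (u t) x ^ 5 / 5 : ℝ) : ℂ) := by
        push_cast; rfl
      simp only [Pi.add_apply, Pi.neg_apply]
      rw [map_add, map_neg, hLr, h5, hLr, hk, hk]
    rw [e1, e2]
    exact this
  have hre := hL Complex.reCLM (by simp)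
  have him := hL Complex.imCLM (by simp)
  have hcomb := (hre.ofReal_comp).add ((him.ofReal_comp).mul_const Complex.I)
  simp only [Complex.reCLM_apply, Complex.imCLM_apply, Complex.re_add_im] at hcomb
  refine hcomb.congr_of_eventuallyEq (Eventually.of_forall fun s => ?_)
  exact (Complex.re_add_im _).symm

end FifthKdV
end

noncomputable section
namespace FifthKdV

/-! ### Duhamel's formula on the Fourier side -/

theorem propagatorSymbol_eq (t η : ℝ) :
    propagatorSymbol t η = Complex.exp (Complex.I * ((-t * (2 * Real.pi * η) ^ 5 : ℝ) : ℂ)) := by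
  have h5 : Complex.I ^ 5 = Complex.I := by
    rw [show (5 : ℕ) = 4 + 1 from rfl, pow_add, Complex.I_pow_four]; simp
  rw [propagatorSymbol, mul_pow, h5]
  congr 1; push_cast; ring

theorem propagatorSymbol_add (s t η : ℝ) :
    propagatorSymbol (s + t) η = propagatorSymbol s η * propagatorSymbol t η := by
  rw [propagatorSymbol, propagatorSymbol, propagatorSymbol, ← Complex.exp_add]
  congr 1; push_cast; ring

theorem propagatorSymbol_zero (η : ℝ) : propagatorSymbol 0 η = 1 := by simp [propagatorSymbol]

theorem hasDerivAt_propagatorSymbol (t η : ℝ) :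
    HasDerivAt (fun s => propagatorSymbol s η)
      (-(2 * Real.pi * Complex.I * η) ^ 5 * propagatorSymbol t η) t := by
  have h1 : HasDerivAt (fun s : ℝ => -(s : ℂ) * (Complex.I * ((2 * Real.pi * η : ℝ) : ℂ)) ^ 5)
      (-1 * (Complex.I * ((2 * Real.pi * η : ℝ) : ℂ)) ^ 5) t :=
    (Complex.ofRealCLM.hasDerivAt.neg).mul_const _
  refine h1.cexp.congr_deriv ?_
  rw [propagatorSymbol, mul_comm]; push_cast; ring

theorem norm_propagatorSymbol_sub_le (s t η : ℝ) :
    ‖propagatorSymbol s η - propagatorSymbol t η‖ ≤ |2 * Real.pi * η| ^ 5 * |s - t| := by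
  have h : propagatorSymbol s η - propagatorSymbol t η =
      propagatorSymbol t η * (propagatorSymbol (s - t) η - 1) := by
    rw [mul_sub, ← propagatorSymbol_add, add_sub_cancel, mul_one]
  rw [h, norm_mul, norm_propagatorSymbol, one_mul, propagatorSymbol_eq]
  refine Real.norm_exp_I_mul_ofReal_sub_one_le.trans (le_of_eq ?_)
  rw [Real.norm_eq_abs, abs_mul, abs_neg, abs_pow, mul_comm]

variable {u : ℝ → Lp ℝ 2 (volume : Measure ℝ)} {u₀ : Lp ℝ 2 (volume : Measure ℝ)}

theorem integral_norm_hat_sub_le (hu : ContinuousInH2 u) (t s : ℝ) :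
    ∫ η, ‖hat (u t) η - hat (u s) η‖ ≤ sobConst * h2Real (u t - u s) := by
  have h := (integrable_mul_hat (h2Norm_sub_lt_top (hu.1 t) (hu.1 s)) (q := fun _ => 1)
    continuous_const one_weight).2
  refine (le_of_eq (integral_congr_ae ?_)).trans h
  filter_upwards [hat_sub_ae (u t) (u s)] with η hη
  rw [hη, one_mul]

open scoped SchwartzMap in
theorem integral_rep_mul_fourier {g : Lp ℝ 2 (volume : Measure ℝ)} (hg : h2Norm g < ⊤)
    (q : 𝓢(ℝ, ℂ)) : ∫ x, (rep g x : ℂ) * 𝓕 (q : ℝ → ℂ) x = ∫ η, hat g η * q η := by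
  simp_rw [ofReal_rep hg]
  rw [← SchwartzMap.fourier_coe, integral_fourierInv_mul (integrable_hat hg)
    (SchwartzMap.integrable _), ← SchwartzMap.fourierInv_coe, FourierTransform.fourierInv_fourier_eq]

-- Test the equation with `𝓕ψ`: its derivatives are transforms of polynomial multiples of `ψ`, and
-- the multiplication formula moves the transforms onto `u` and `u⁵`. Compact support of `ψ` tames
-- the polynomials.
open scoped SchwartzMap in
theorem hasDerivAt_integral_hat_mul (hu : IsSolution u₀ u) {ψ : ℝ → ℂ} (hψ : ContDiff ℝ ∞ ψ)
    (hc : HasCompactSupport ψ) (t : ℝ) :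
    HasDerivAt (fun s => ∫ η, hat (u s) η * ψ η)
      ((∫ η, hat (u t) η * ((2 * Real.pi * Complex.I * η) ^ 5 * ψ η)) -
        1 / 5 * ∫ η, quinticHat u t η * (2 * Real.pi * Complex.I * η * ψ η)) t := by
  have hu2 := hu.continuousInH2.1
  have hq : ∀ k : ℕ, ContDiff ℝ ∞ (fun x : ℝ => (-2 * Real.pi * Complex.I * x) ^ k * ψ x) :=
    fun k => ContDiff.mul ((contDiff_const.mul Complex.ofRealCLM.contDiff).pow k) hψ
  have hqc : ∀ k : ℕ, HasCompactSupport (fun x : ℝ => (-2 * Real.pi * Complex.I * x) ^ k * ψ x) :=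
    fun k => hc.mul_left
  set q : ℕ → 𝓢(ℝ, ℂ) := fun k => (hqc k).toSchwartzMap (hq k) with hqdef
  set p : 𝓢(ℝ, ℂ) := hc.toSchwartzMap hψ with hp
  have hqx : ∀ k (x : ℝ), q k x = (-2 * Real.pi * Complex.I * x) ^ k * ψ x := fun k x => rfl
  have hder : ∀ k : ℕ, iteratedDeriv k (𝓕 p : 𝓢(ℝ, ℂ)) = 𝓕 (q k : ℝ → ℂ) := by
    intro k
    rw [SchwartzMap.fourier_coe, Real.iteratedDeriv_fourier (N := ⊤) (fun n _ => ?_) le_top]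
    · congr 1
    · refine Continuous.integrable_of_hasCompactSupport ?_ hc.smul_left
      have := p.continuous
      fun_prop
  have h := hasDerivAt_weak_schwartz hu (𝓕 p) t
  simp_rw [hder] at h
  have e0 : (fun s => ∫ x, (rep (u s) x : ℂ) * (𝓕 p : 𝓢(ℝ, ℂ)) x) =
      fun s => ∫ η, hat (u s) η * ψ η := by
    ext s
    rw [SchwartzMap.fourier_coe, integral_rep_mul_fourier (hu2 s)]
    rfl
  rw [e0] at h
  refine h.congr_deriv ?_
  have hF : ∀ k, Integrable (𝓕 (q k : ℝ → ℂ)) := fun k => by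
    rw [← SchwartzMap.fourier_coe]; exact SchwartzMap.integrable _
  have hi1 : Integrable fun x => (rep (u t) x : ℂ) * 𝓕 (q 5 : ℝ → ℂ) x :=
    (hF 5).bdd_mul (c := sobConst * h2Real (u t)) (Complex.continuous_ofReal.comp
      (continuous_rep (hu2 t))).aestronglyMeasurable (ae_of_all _ fun x => by
        rw [Complex.norm_real]; exact abs_rep_le (hu2 t) x)
  have hFc : ∀ k, Continuous (𝓕 (q k : ℝ → ℂ)) := fun k => continuous_fourier (q k).integrable
  have hi2 : Integrable fun x => ((rep (u t) x ^ 5 : ℝ) : ℂ) * 𝓕 (q 1 : ℝ → ℂ) x := by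
    refine (integrable_rep_pow_five (hu2 t)).mul_bdd (c := ∫ x, ‖q 1 x‖)
      (hFc 1).aestronglyMeasurable (ae_of_all _ fun x => norm_fourier_le x)
  have e1 : (fun x => -((rep (u t) x : ℂ) * 𝓕 (q 5 : ℝ → ℂ) x) +
      ((rep (u t) x ^ 5 : ℝ) : ℂ) / 5 * 𝓕 (q 1 : ℝ → ℂ) x) = fun x =>
      -((rep (u t) x : ℂ) * 𝓕 (q 5 : ℝ → ℂ) x) +
      1 / 5 * (((rep (u t) x ^ 5 : ℝ) : ℂ) * 𝓕 (q 1 : ℝ → ℂ) x) := by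
    ext x; ring
  rw [e1]
  refine (integral_add hi1.neg (hi2.const_mul (1 / 5))).trans ?_
  simp only [Pi.neg_apply]
  rw [integral_neg, integral_const_mul, integral_rep_mul_fourier (hu2 t),
    ← integral_fourier_mul (integrable_rep_pow_five (hu2 t)) (q 1).integrable, sub_eq_add_neg,
    ← mul_neg, ← integral_neg, ← integral_neg]
  congr 1
  · refine integral_congr_ae (ae_of_all _ fun η => ?_)
    simp only [hqx]; ring
  · congr 1
    refine integral_congr_ae (ae_of_all _ fun η => ?_)
    simp only [hqx, quinticHat]; ring

/-- A product rule for two factors depending on time. The fifth-order terms coming from `u` and from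
the propagator cancel, which is the reason for passing to the profile. -/
theorem hasDerivAt_integral_hat_mul_propagator (hu : IsSolution u₀ u) {ψ : ℝ → ℂ}
    (hψ : ContDiff ℝ ∞ ψ) (hc : HasCompactSupport ψ) (t : ℝ) :
    HasDerivAt (fun s => ∫ η, hat (u s) η * (propagatorSymbol s η * ψ η))
      (∫ η, 2 * Real.pi * Complex.I * η * duhamelDensity u t η * ψ η) t := by
  have hu2 := hu.continuousInH2.1
  have hcont : ∀ s, Continuous fun η => propagatorSymbol s η := fun s => by
    unfold propagatorSymbol; fun_prop
  have hsm : ContDiff ℝ ∞ fun η => propagatorSymbol t η * ψ η := by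
    refine ContDiff.mul ?_ hψ
    unfold propagatorSymbol
    refine ContDiff.cexp (contDiff_const.mul ((contDiff_const.mul ?_).pow 5))
    exact Complex.ofRealCLM.contDiff.comp (contDiff_const.mul contDiff_id)
  have hcs : HasCompactSupport fun η => propagatorSymbol t η * ψ η := hc.mul_left
  have hψc : Continuous ψ := hψ.continuous
  -- a bound for the weighted test function
  have hbc : Continuous fun η : ℝ => |2 * Real.pi * η| ^ 5 * ‖ψ η‖ := by fun_prop
  have hbs : HasCompactSupport fun η : ℝ => |2 * Real.pi * η| ^ 5 * ‖ψ η‖ := hc.norm.mul_left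
  obtain ⟨B, hB⟩ := hbs.exists_bound_of_continuous hbc
  obtain ⟨B', hB'⟩ := hc.exists_bound_of_continuous hψc
  have hB0 : 0 ≤ B := (norm_nonneg _).trans (hB 0)
  have hdiff : ∀ s η, ‖(propagatorSymbol s η - propagatorSymbol t η) * ψ η‖ ≤ B * |s - t| := by
    intro s η
    rw [norm_mul]
    have h1 := norm_propagatorSymbol_sub_le s t η
    have h2 := (le_abs_self _).trans (hB η)
    calc _ ≤ |2 * Real.pi * η| ^ 5 * |s - t| * ‖ψ η‖ := by gcongr
      _ = (|2 * Real.pi * η| ^ 5 * ‖ψ η‖) * |s - t| := by ring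
      _ ≤ _ := by gcongr
  have hI : ∀ s r, Integrable fun η => hat (u s) η * (propagatorSymbol r η * ψ η) := by
    intro s r
    refine (integrable_hat (hu2 s)).mul_bdd (c := B') ((hcont r).mul hψc).aestronglyMeasurable
      (ae_of_all _ fun η => ?_)
    rw [norm_mul, norm_propagatorSymbol, one_mul]; exact hB' η
  have hA := hasDerivAt_integral_hat_mul hu hsm hcs t
  have hM : HasDerivAt (fun s => ∫ η, hat (u t) η * (propagatorSymbol s η * ψ η))
      (∫ η, hat (u t) η * (-(2 * Real.pi * Complex.I * η) ^ 5 * propagatorSymbol t η * ψ η)) t := by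
    refine (hasDerivAt_integral_of_dominated_loc_of_deriv_le (s := Set.univ)
      (bound := fun η => ‖hat (u t) η‖ * B) (F' := fun s η =>
      hat (u t) η * (-(2 * Real.pi * Complex.I * η) ^ 5 * propagatorSymbol s η * ψ η)) univ_mem
      (Eventually.of_forall fun s => (hI t s).1) (hI t t) ?_ (ae_of_all _ fun η s _ => ?_)
      ((integrable_hat (hu2 t)).norm.mul_const B) (ae_of_all _ fun η s _ => ?_)).2
    · have := hcont t
      exact (integrable_hat (hu2 t)).1.mul (Continuous.aestronglyMeasurable (by fun_prop))
    · rw [norm_mul, norm_mul, norm_mul, norm_neg, norm_pow, norm_two_pi_I, norm_propagatorSymbol,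
        mul_one]
      gcongr
      exact (le_abs_self _).trans (hB η)
    · exact ((hasDerivAt_propagatorSymbol s η).mul_const _).const_mul _
  -- The product of the two increments is `o(|s - t|)`: the propagator increment is `O(|s - t|)` on
  -- the support of `ψ`, and the increment of `hat u` tends to zero in `L¹`.
  have hE : HasDerivAt (fun s => ∫ η, (hat (u s) η - hat (u t) η) *
      ((propagatorSymbol s η - propagatorSymbol t η) * ψ η)) 0 t := by
    rw [hasDerivAt_iff_isLittleO]
    have hb : ∀ s, ‖∫ η, (hat (u s) η - hat (u t) η) *
        ((propagatorSymbol s η - propagatorSymbol t η) * ψ η)‖ ≤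
        (sobConst * h2Real (u s - u t) * B) * |s - t| := by
      intro s
      have hi := ((integrable_hat (hu2 s)).sub (integrable_hat (hu2 t))).norm
      refine (norm_integral_le_of_norm_le (hi.mul_const (B * |s - t|)) (ae_of_all _ fun η => ?_)).trans ?_
      · rw [norm_mul]
        exact mul_le_mul_of_nonneg_left (hdiff s η) (norm_nonneg _)
      · rw [integral_mul_const, mul_assoc _ B]
        exact mul_le_mul_of_nonneg_right (integral_norm_hat_sub_le hu.continuousInH2 s t)
          (by positivity)
    rw [Asymptotics.isLittleO_iff]
    intro c hcpos
    have hlim : Tendsto (fun s => sobConst * h2Real (u s - u t) * B) (𝓝 t) (𝓝 0) := by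
      simpa using ((tendsto_h2Real_sub hu.continuousInH2 t).const_mul sobConst).mul_const B
    filter_upwards [hlim.eventually (gt_mem_nhds hcpos)] with s hs
    simp only [sub_self, smul_zero, sub_zero, zero_mul, mul_zero, integral_zero]
    refine (hb s).trans ?_
    rw [Real.norm_eq_abs]
    gcongr
  have hsum := (hA.add hM).add hE
  have hfun : (fun s => ∫ η, hat (u s) η * (propagatorSymbol s η * ψ η)) =
      fun s => ((∫ η, hat (u s) η * (propagatorSymbol t η * ψ η)) +
        (∫ η, hat (u t) η * (propagatorSymbol s η * ψ η)) +
        ∫ η, (hat (u s) η - hat (u t) η) *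
      ((propagatorSymbol s η - propagatorSymbol t η) * ψ η)) -
        ∫ η, hat (u t) η * (propagatorSymbol t η * ψ η) := by
    ext s
    have hi3 : Integrable fun η => (hat (u s) η - hat (u t) η) *
        ((propagatorSymbol s η - propagatorSymbol t η) * ψ η) := by
      refine (((hI s s).sub (hI t s)).sub ((hI s t).sub (hI t t))).congr (ae_of_all _ fun η => ?_)
      simp only [Pi.sub_apply]; ring
    have h1 := integral_add (hI s t) (hI t s)
    have h2 := integral_add ((hI s t).add (hI t s)) hi3
    have h3 := integral_sub (((hI s t).add (hI t s)).add hi3) (hI t t)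
    simp only [Pi.add_apply] at h2 h3
    rw [← h1, ← h2, ← h3]
    refine integral_congr_ae (ae_of_all _ fun η => ?_)
    ring
  rw [hfun]
  refine (hsum.sub_const _).congr_deriv ?_
  have hi4 : Integrable fun η => hat (u t) η * ((2 * Real.pi * Complex.I * η) ^ 5 *
      (propagatorSymbol t η * ψ η)) := by
    have := hcont t
    refine (integrable_hat (hu2 t)).mul_bdd (c := B) (Continuous.aestronglyMeasurable (by fun_prop))
      (ae_of_all _ fun η => ?_)
    rw [norm_mul, norm_mul, norm_pow, norm_two_pi_I, norm_propagatorSymbol, one_mul]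
    exact (le_abs_self _).trans (hB η)
  have e : (∫ η, hat (u t) η * (-(2 * Real.pi * Complex.I * η) ^ 5 * propagatorSymbol t η * ψ η)) =
      -∫ η, hat (u t) η * ((2 * Real.pi * Complex.I * η) ^ 5 * (propagatorSymbol t η * ψ η)) := by
    rw [← integral_neg]
    refine integral_congr_ae (ae_of_all _ fun η => ?_)
    dsimp only; ring
  rw [e, add_zero, ← integral_const_mul]
  have : ∀ a b : ℂ, a - b + -a = -b := fun a b => by ring
  rw [this, ← integral_neg]
  refine integral_congr_ae (ae_of_all _ fun η => ?_)
  simp only [duhamelDensity]; ring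

/-- The time integral of the Duhamel density. -/
def duhamelIntegral (u : ℝ → Lp ℝ 2 (volume : Measure ℝ)) (t η : ℝ) : ℂ :=
  ∫ s in (0 : ℝ)..t, duhamelDensity u s η

theorem continuous_duhamelIntegral (hu : ContinuousInH2 u) :
    Continuous fun z : ℝ × ℝ => duhamelIntegral u z.1 z.2 := by
  have h : Continuous (Function.uncurry fun (z : ℝ × ℝ) s => duhamelDensity u s z.2) :=
    (continuous_duhamelDensity hu).comp (g := fun z : ℝ × ℝ => duhamelDensity u z.1 z.2)
      (f := fun w : (ℝ × ℝ) × ℝ => (w.2, w.1.2)) (by fun_prop)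
  exact intervalIntegral.continuous_parametric_intervalIntegral_of_continuous h continuous_fst

theorem hasDerivAt_duhamelIntegral (hu : ContinuousInH2 u) (t η : ℝ) :
    HasDerivAt (fun s => duhamelIntegral u s η) (duhamelDensity u t η) t := by
  have hc : Continuous fun s => duhamelDensity u s η :=
    (continuous_duhamelDensity hu).comp (g := fun z : ℝ × ℝ => duhamelDensity u z.1 z.2)
      (f := fun s : ℝ => (s, η)) (by fun_prop)
  exact intervalIntegral.integral_hasDerivAt_right (hc.intervalIntegrable 0 t)
    (hc.stronglyMeasurableAtFilter _ _) hc.continuousAt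

/-- Duhamel's formula: integrate the previous derivative in time, exchange integrals on the compact
support of `ψ`, and let `ψ` vary. The factor `2πiη` stays outside, so `duhamelIntegral` is the
transform of a primitive of `f(t) - u(0)`; the scaling argument works with that primitive. -/
theorem propagator_mul_hat_ae (hu : IsSolution u₀ u) (t : ℝ) :
    ∀ᵐ η, propagatorSymbol t η * hat (u t) η =
      hat (u 0) η + 2 * Real.pi * Complex.I * η * duhamelIntegral u t η := by
  have hu2 := hu.continuousInH2.1
  have hcd := continuous_duhamelDensity hu.continuousInH2
  have hci := continuous_duhamelIntegral hu.continuousInH2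
  have hcont : ∀ s, Continuous fun η => propagatorSymbol s η := fun s => by
    unfold propagatorSymbol; fun_prop
  have hcit : Continuous fun η => duhamelIntegral u t η :=
    hci.comp (g := fun z : ℝ × ℝ => duhamelIntegral u z.1 z.2) (f := fun η : ℝ => (t, η))
      (by fun_prop)
  have hPI : ∀ s, Integrable fun η => propagatorSymbol s η * hat (u s) η := fun s =>
    (integrable_hat (hu2 s)).bdd_mul (c := 1) (hcont s).aestronglyMeasurable
      (ae_of_all _ fun η => (norm_propagatorSymbol s η).le)
  refine ae_eq_of_integral_schwartz_mul (hPI t).locallyIntegrable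
    ((integrable_hat (hu2 0)).locallyIntegrable.add
      (Continuous.locallyIntegrable (by fun_prop))) fun ψ hc => ?_
  have hψc := ψ.continuous
  have hder := fun s => hasDerivAt_integral_hat_mul_propagator hu (ψ.smooth ⊤) hc s
  set K := tsupport ψ
  have hK : IsCompact K := hc
  have hK0 : ∀ η, η ∉ K → ψ η = 0 := fun η hη => image_eq_zero_of_notMem_tsupport hη
  have hrestr : ∀ s, ∫ η, 2 * Real.pi * Complex.I * η * duhamelDensity u s η * ψ η =
      ∫ η in K, 2 * Real.pi * Complex.I * η * duhamelDensity u s η * ψ η := fun s =>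
    (setIntegral_eq_integral_of_forall_compl_eq_zero fun η hη => by rw [hK0 η hη, mul_zero]).symm
  have hjoint : Continuous (Function.uncurry fun s η : ℝ =>
      2 * Real.pi * Complex.I * η * duhamelDensity u s η * ψ η) := by
    change Continuous fun z : ℝ × ℝ => 2 * Real.pi * Complex.I * z.2 * duhamelDensity u z.1 z.2 * ψ z.2
    fun_prop
  have hrc : Continuous fun s => ∫ η, 2 * Real.pi * Complex.I * η * duhamelDensity u s η * ψ η := by
    simp_rw [hrestr]
    exact continuous_parametric_integral_of_continuous hjoint hK
  have hftc := intervalIntegral.integral_eq_sub_of_hasDerivAt (a := 0) (b := t)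
    (fun s _ => hder s) (hrc.intervalIntegrable 0 t)
  have hswap : ∫ s in (0 : ℝ)..t, ∫ η, 2 * Real.pi * Complex.I * η * duhamelDensity u s η * ψ η =
      ∫ η, 2 * Real.pi * Complex.I * η * duhamelIntegral u t η * ψ η := by
    simp_rw [hrestr]
    rw [intervalIntegral_integral_swap]
    · rw [setIntegral_eq_integral_of_forall_compl_eq_zero]
      · refine integral_congr_ae (ae_of_all _ fun η => ?_)
        simp only [intervalIntegral.integral_mul_const, intervalIntegral.integral_const_mul,
          duhamelIntegral]
      · intro η hη
        simp [hK0 η hη]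
    · rw [Measure.prod_restrict]
      refine IntegrableOn.mono_set (t := Set.uIcc 0 t ×ˢ K) ?_
        (Set.prod_mono_left Set.uIoc_subset_uIcc)
      exact hjoint.continuousOn.integrableOn_compact (isCompact_uIcc.prod hK)
  rw [hswap] at hftc
  have hψI : ∀ s, Integrable fun η => hat (u s) η * (propagatorSymbol s η * ψ η) := by
    intro s
    obtain ⟨B', hB'⟩ := hc.exists_bound_of_continuous hψc
    refine (integrable_hat (hu2 s)).mul_bdd (c := B') ((hcont s).mul hψc).aestronglyMeasurable
      (ae_of_all _ fun η => ?_)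
    rw [norm_mul, norm_propagatorSymbol, one_mul]; exact hB' η
  have e1 : ∫ η, ψ η * (propagatorSymbol t η * hat (u t) η) =
      ∫ η, hat (u t) η * (propagatorSymbol t η * ψ η) :=
    integral_congr_ae (ae_of_all _ fun η => by dsimp only; ring)
  rw [e1]
  have hi2 : Integrable fun η => 2 * Real.pi * Complex.I * η * duhamelIntegral u t η * ψ η := by
    refine Continuous.integrable_of_hasCompactSupport (by fun_prop) hc.mul_left
  have e2 : ∫ η, ψ η * (hat (u 0) η + 2 * Real.pi * Complex.I * η * duhamelIntegral u t η) =
      (∫ η, hat (u 0) η * (propagatorSymbol 0 η * ψ η)) +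
      ∫ η, 2 * Real.pi * Complex.I * η * duhamelIntegral u t η * ψ η := by
    rw [← integral_add (hψI 0) hi2]
    refine integral_congr_ae (ae_of_all _ fun η => ?_)
    simp only [propagatorSymbol_zero]; ring
  rw [hftc] at e2
  refine Eq.trans ?_ e2.symm
  ring

end FifthKdV
end

noncomputable section
namespace FifthKdV

/-! ### Energy estimates -/

/-- `∫ a X X' = -½ ∫ a' X²`. -/
theorem abs_integral_mul_mul_deriv_le {a a' X X' : ℝ → ℝ} {A L : ℝ}
    (ha : ∀ x, HasDerivAt a (a' x) x) (hX : ∀ x, HasDerivAt X (X' x) x)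
    (haA : ∀ x, |a x| ≤ A) (haL : ∀ x, |a' x| ≤ L) (hac : Continuous a')
    (hX2 : MemLp X 2) (hX'2 : MemLp X' 2) :
    |∫ x, a x * X x * X' x| ≤ L / 2 * ∫ x, X x ^ 2 := by
  have hcont : Continuous a := continuous_iff_continuousAt.2 fun x => (ha x).continuousAt
  have hXX : Integrable fun x => X x * X' x := hX2.integrable_mul hX'2
  have hsq : Integrable fun x => X x ^ 2 := (memLp_two_iff_integrable_sq hX2.1).1 hX2
  have h1 : Integrable fun x => a x * X x * X' x := by
    have := hXX.bdd_mul (c := A) hcont.aestronglyMeasurable (ae_of_all _ haA)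
    simpa only [mul_assoc] using this
  have h2 : Integrable fun x => a' x * X x ^ 2 :=
    hsq.bdd_mul (c := L) hac.aestronglyMeasurable (ae_of_all _ haL)
  have h3 : Integrable fun x => a x * X x ^ 2 :=
    hsq.bdd_mul (c := A) hcont.aestronglyMeasurable (ae_of_all _ haA)
  have hd : ∀ x, HasDerivAt (fun x => a x * X x ^ 2)
      (a' x * X x ^ 2 + 2 * (a x * X x * X' x)) x := fun x => by
    refine ((ha x).mul ((hX x).pow 2)).congr_deriv ?_
    simp only [Nat.cast_ofNat, Pi.pow_apply]; ring
  have h0 := integral_eq_zero_of_hasDerivAt_of_integrable hd (h2.add (h1.const_mul 2)) h3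
  rw [integral_add h2 (h1.const_mul 2), integral_const_mul] at h0
  have h4 : |∫ x, a' x * X x ^ 2| ≤ L * ∫ x, X x ^ 2 := by
    rw [← integral_const_mul, ← Real.norm_eq_abs]
    refine norm_integral_le_of_norm_le (hsq.const_mul L) (ae_of_all _ fun x => ?_)
    rw [Real.norm_eq_abs, abs_mul, abs_of_nonneg (sq_nonneg (X x))]
    exact mul_le_mul_of_nonneg_right (haL x) (sq_nonneg _)
  rw [abs_le] at h4 ⊢
  constructor <;> linarith [h4.1, h4.2]

/-- The integral of the squared deviation from the mean is nonnegative. -/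
theorem sq_integral_le_mul_integral_sq {f : ℝ → ℝ} {a b : ℝ} (hab : a ≤ b) (hf : Continuous f) :
    (∫ s in a..b, f s) ^ 2 ≤ (b - a) * ∫ s in a..b, f s ^ 2 := by
  rcases hab.eq_or_lt with rfl | hlt
  · simp
  have hpos : 0 < b - a := sub_pos.2 hlt
  set I := ∫ s in a..b, f s with hI
  have h0 : 0 ≤ ∫ s in a..b, (f s - I / (b - a)) ^ 2 :=
    intervalIntegral.integral_nonneg hab fun s _ => sq_nonneg _
  have h1 : ∀ s, (f s - I / (b - a)) ^ 2 = f s ^ 2 - 2 * (I / (b - a)) * f s + (I / (b - a)) ^ 2 :=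
    fun s => by ring
  simp_rw [h1] at h0
  rw [intervalIntegral.integral_add (Continuous.intervalIntegrable (by fun_prop) _ _)
      (Continuous.intervalIntegrable (by fun_prop) _ _),
    intervalIntegral.integral_sub (Continuous.intervalIntegrable (by fun_prop) _ _)
      (Continuous.intervalIntegrable (by fun_prop) _ _), intervalIntegral.integral_const_mul,
    intervalIntegral.integral_const, ← hI, smul_eq_mul] at h0
  have h2 : (b - a) * ((∫ s in a..b, f s ^ 2) - 2 * (I / (b - a)) * I + (b - a) * (I / (b - a)) ^ 2) =
      (b - a) * (∫ s in a..b, f s ^ 2) - I ^ 2 := by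
    field_simp; ring
  have h3 := mul_nonneg hpos.le h0
  rw [h2] at h3
  linarith

theorem integrable_prod_of_forall_integral_le {E : Type*} [NormedAddCommGroup E]
    {f : ℝ → ℝ → E} {a b M : ℝ}
    (hm : AEStronglyMeasurable (Function.uncurry f) ((volume.restrict (Set.Ioc a b)).prod volume))
    (h : ∀ s ∈ Set.Ioc a b, Integrable (f s) ∧ ∫ x, ‖f s x‖ ≤ M) :
    Integrable (Function.uncurry f) ((volume.restrict (Set.Ioc a b)).prod volume) := by
  rw [integrable_prod_iff hm]
  refine ⟨(ae_restrict_mem measurableSet_Ioc).mono fun s hs => (h s hs).1, ?_⟩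
  refine Integrable.mono' (g := fun _ => M) (integrable_const M) hm.norm.integral_prod_right' ?_
  filter_upwards [ae_restrict_mem measurableSet_Ioc] with s hs
  rw [Real.norm_of_nonneg (integral_nonneg fun _ => norm_nonneg _)]
  exact (h s hs).2

variable {g : ℝ → ℝ → ℂ}

theorem continuous_intervalIntegral_family (hg : Continuous (Function.uncurry g)) (a : ℝ) :
    Continuous fun z : ℝ × ℝ => ∫ s in a..z.1, g s z.2 := by
  have h : Continuous (Function.uncurry fun (z : ℝ × ℝ) s => g s z.2) :=
    hg.comp (f := fun w : (ℝ × ℝ) × ℝ => (w.2, w.1.2)) (by fun_prop)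
  exact intervalIntegral.continuous_parametric_intervalIntegral_of_continuous h continuous_fst

/-- The `L²` norm of a time integral of a continuous `L²` family. -/
theorem memLp_intervalIntegral_of_bound {a b M : ℝ} (hab : a ≤ b)
    (hg : Continuous (Function.uncurry g))
    (h : ∀ s ∈ Set.Icc a b, MemLp (g s) 2 ∧ ∫ x, ‖g s x‖ ^ 2 ≤ M) :
    MemLp (fun x => ∫ s in a..b, g s x) 2 ∧
      (∫ x, ‖∫ s in a..b, g s x‖ ^ 2 ≤ (b - a) * ∫ s in a..b, ∫ x, ‖g s x‖ ^ 2) ∧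
      IntervalIntegrable (fun s => ∫ x, ‖g s x‖ ^ 2) volume a b := by
  have hcs : ∀ x, Continuous fun s => g s x := fun x =>
    hg.comp (f := fun s : ℝ => (s, x)) (by fun_prop)
  have hprod : Integrable (Function.uncurry fun s x => ‖g s x‖ ^ 2)
      ((volume.restrict (Set.Ioc a b)).prod volume) :=
    integrable_prod_of_forall_integral_le (M := M)
      (Continuous.aestronglyMeasurable (hg.norm.pow 2)) fun s hs => by
        obtain ⟨h1, h2⟩ := h s (Set.Ioc_subset_Icc_self hs)
        refine ⟨integrable_norm_sq h1, ?_⟩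
        simpa only [norm_pow, norm_norm] using h2
  have hpt : ∀ x, ‖∫ s in a..b, g s x‖ ^ 2 ≤ (b - a) * ∫ s in a..b, ‖g s x‖ ^ 2 := fun x => by
    refine (pow_le_pow_left₀ (norm_nonneg _)
      (intervalIntegral.norm_integral_le_integral_norm hab) 2).trans ?_
    exact sq_integral_le_mul_integral_sq hab (hcs x).norm
  have hI : Integrable fun x => (b - a) * ∫ s in a..b, ‖g s x‖ ^ 2 := by
    refine Integrable.const_mul ?_ _
    simp_rw [intervalIntegral.integral_of_le hab]
    exact hprod.integral_prod_right
  have hc : Continuous fun x => ∫ s in a..b, g s x :=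
    (continuous_intervalIntegral_family hg a).comp (f := fun x : ℝ => (b, x)) (by fun_prop)
  have hI2 : Integrable fun x => ‖∫ s in a..b, g s x‖ ^ 2 :=
    hI.mono' (hc.norm.pow 2).aestronglyMeasurable (ae_of_all _ fun x => by
      rw [Real.norm_of_nonneg (by positivity)]; exact hpt x)
  refine ⟨(memLp_two_iff_integrable_sq_norm hc.aestronglyMeasurable).2 hI2, ?_, ?_⟩
  · refine (integral_mono hI2 hI hpt).trans ?_
    rw [integral_const_mul, ← intervalIntegral_integral_swap (by rwa [Set.uIoc_of_le hab])]
  · rw [intervalIntegrable_iff_integrableOn_Ioc_of_le hab]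
    exact hprod.integral_prod_left

/-- Minkowski's inequality for time integrals of a continuous `L²` family. -/
theorem memLp_intervalIntegral {a b M : ℝ} (hab : a ≤ b) (hg : Continuous (Function.uncurry g))
    (h : ∀ s ∈ Set.Icc a b, MemLp (g s) 2 ∧ ∫ x, ‖g s x‖ ^ 2 ≤ M) :
    MemLp (fun x => ∫ s in a..b, g s x) 2 ∧
      ∫ x, ‖∫ s in a..b, g s x‖ ^ 2 ≤ (b - a) ^ 2 * M := by
  obtain ⟨h1, h2, h3⟩ := memLp_intervalIntegral_of_bound hab hg h
  refine ⟨h1, h2.trans ?_⟩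
  rw [pow_two, mul_assoc]
  refine mul_le_mul_of_nonneg_left ?_ (sub_nonneg.2 hab)
  calc _ ≤ ∫ s in a..b, M :=
        intervalIntegral.integral_mono_on hab h3 intervalIntegrable_const fun s hs => (h s hs).2
    _ = _ := by simp

/-- Grönwall's inequality in integral form. -/
theorem le_mul_exp_of_le_add_integral {y β : ℝ → ℝ} {T : ℝ} (hT : 0 ≤ T) (hy : Continuous y)
    (hβ : Continuous β) (hβ0 : ∀ s, 0 ≤ β s)
    (h : ∀ t ∈ Set.Icc 0 T, y t ≤ y 0 + ∫ s in (0 : ℝ)..t, β s * y s) :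
    y T ≤ y 0 * Real.exp (∫ s in (0 : ℝ)..T, β s) := by
  set z : ℝ → ℝ := fun t => y 0 + ∫ s in (0 : ℝ)..t, β s * y s with hz
  set b : ℝ → ℝ := fun t => ∫ s in (0 : ℝ)..t, β s with hb
  have hzd : ∀ t, HasDerivAt z (β t * y t) t := fun t =>
    (intervalIntegral.integral_hasDerivAt_right ((hβ.mul hy).intervalIntegrable 0 t)
      ((hβ.mul hy).stronglyMeasurableAtFilter _ _) (hβ.mul hy).continuousAt).const_add _
  have hbd : ∀ t, HasDerivAt b (β t) t := fun t =>
    intervalIntegral.integral_hasDerivAt_right (hβ.intervalIntegrable 0 t)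
      (hβ.stronglyMeasurableAtFilter _ _) hβ.continuousAt
  have hd : ∀ t, HasDerivAt (fun t => z t * Real.exp (-b t))
      -- With `z` the right-hand side of the hypothesis, `z e^{-b}` is nonincreasing precisely
      -- because `y ≤ z`.
      (β t * y t * Real.exp (-b t) + z t * (Real.exp (-b t) * -β t)) t := fun t =>
    (hzd t).mul (hbd t).neg.exp
  have hanti : AntitoneOn (fun t => z t * Real.exp (-b t)) (Set.Icc 0 T) := by
    refine antitoneOn_of_deriv_nonpos (convex_Icc 0 T)
      (fun t _ => (hd t).continuousAt.continuousWithinAt)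
      (fun t _ => (hd t).differentiableAt.differentiableWithinAt) fun t ht => ?_
    rw [interior_Icc] at ht
    rw [(hd t).deriv]
    have h1 := h t ⟨ht.1.le, ht.2.le⟩
    have : β t * y t * Real.exp (-b t) + z t * (Real.exp (-b t) * -β t) =
        -(β t * Real.exp (-b t) * (z t - y t)) := by ring
    rw [this, neg_nonpos]
    exact mul_nonneg (mul_nonneg (hβ0 t) (Real.exp_pos _).le) (sub_nonneg.2 h1)
  have h1 := hanti (Set.left_mem_Icc.2 hT) (Set.right_mem_Icc.2 hT) hT
  have e0 : z 0 * Real.exp (-b 0) = y 0 := by simp [hz, hb]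
  dsimp only at h1
  rw [e0, Real.exp_neg, mul_inv_le_iff₀ (Real.exp_pos _)] at h1
  exact (h T (Set.right_mem_Icc.2 hT)).trans h1

/-- The energy method for `∂ₜ w = g` on the Fourier side. -/
theorem integral_norm_sq_le_of_energy {w₀ : ℝ → ℂ} {w : ℝ → ℝ → ℂ} {β : ℝ → ℝ} {M T : ℝ}
    (hT : 0 ≤ T) (hw₀ : MemLp w₀ 2) (hg : Continuous (Function.uncurry g))
    (hgL : ∀ s ∈ Set.Icc 0 T, MemLp (g s) 2 ∧ ∫ x, ‖g s x‖ ^ 2 ≤ M)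
    (hw : ∀ t x, w t x = w₀ x + ∫ s in (0 : ℝ)..t, g s x)
    (hβ : Continuous β) (hβ0 : ∀ s, 0 ≤ β s)
    (hE : ∀ s ∈ Set.Icc 0 T, 2 * (∫ x, (starRingEnd ℂ) (w s x) * g s x).re ≤
      β s * ∫ x, ‖w s x‖ ^ 2) :
    ∫ x, ‖w T x‖ ^ 2 ≤ (∫ x, ‖w₀ x‖ ^ 2) * Real.exp (∫ s in (0 : ℝ)..T, β s) := by
  have hcs : ∀ x, Continuous fun s => g s x := fun x =>
    hg.comp (f := fun s : ℝ => (s, x)) (by fun_prop)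
  have hM0 : 0 ≤ M := (integral_nonneg fun _ => by positivity).trans
    (hgL 0 (Set.left_mem_Icc.2 hT)).2
  have hGL : ∀ t ∈ Set.Icc 0 T, MemLp (fun x => ∫ s in (0 : ℝ)..t, g s x) 2 ∧
      ∫ x, ‖∫ s in (0 : ℝ)..t, g s x‖ ^ 2 ≤ T ^ 2 * M := fun t ht => by
    obtain ⟨h1, h2⟩ := memLp_intervalIntegral ht.1 hg
      fun s hs => hgL s ⟨hs.1, hs.2.trans ht.2⟩
    refine ⟨h1, h2.trans ?_⟩
    rw [sub_zero]
    have := ht.1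
    have := ht.2
    gcongr
  have hwL : ∀ t ∈ Set.Icc 0 T, MemLp (w t) 2 ∧
      ∫ x, ‖w t x‖ ^ 2 ≤ 2 * (∫ x, ‖w₀ x‖ ^ 2) + 2 * (T ^ 2 * M) := fun t ht => by
    obtain ⟨h1, h2⟩ := hGL t ht
    have hm : MemLp (w t) 2 := by
      rw [show w t = fun x => w₀ x + ∫ s in (0 : ℝ)..t, g s x from funext (hw t)]
      exact hw₀.add h1
    refine ⟨hm, ?_⟩
    calc ∫ x, ‖w t x‖ ^ 2 ≤ ∫ x, (2 * ‖w₀ x‖ ^ 2 + 2 * ‖∫ s in (0 : ℝ)..t, g s x‖ ^ 2) := by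
          refine integral_mono (integrable_norm_sq hm) (((integrable_norm_sq hw₀).const_mul 2).add
            ((integrable_norm_sq h1).const_mul 2)) fun x => ?_
          dsimp only
          rw [hw]
          have := norm_add_le (w₀ x) (∫ s in (0 : ℝ)..t, g s x)
          nlinarith [norm_nonneg (w₀ x + ∫ s in (0 : ℝ)..t, g s x),
            sq_nonneg (‖w₀ x‖ - ‖∫ s in (0 : ℝ)..t, g s x‖)]
      _ = 2 * (∫ x, ‖w₀ x‖ ^ 2) + 2 * ∫ x, ‖∫ s in (0 : ℝ)..t, g s x‖ ^ 2 := by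
          rw [integral_add ((integrable_norm_sq hw₀).const_mul 2)
            ((integrable_norm_sq h1).const_mul 2), integral_const_mul, integral_const_mul]
      _ ≤ _ := by linarith
  set k : ℝ → ℝ → ℝ := fun s x => 2 * ((starRingEnd ℂ) (w s x) * g s x).re with hk
  have hwm : ∀ t, AEStronglyMeasurable (Function.uncurry w)
      ((volume.restrict (Set.Ioc 0 t)).prod volume) := fun t => by
    have : Function.uncurry w = fun z : ℝ × ℝ => w₀ z.2 + ∫ s in (0 : ℝ)..z.1, g s z.2 := by
      ext z; exact hw _ _
    rw [this]
    exact (hw₀.1.comp_snd).add (continuous_intervalIntegral_family hg 0).aestronglyMeasurable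
  have hkm : ∀ t, AEStronglyMeasurable (Function.uncurry k)
      ((volume.restrict (Set.Ioc 0 t)).prod volume) := fun t => by
    refine AEStronglyMeasurable.const_mul ?_ 2
    exact Complex.continuous_re.comp_aestronglyMeasurable
      ((Complex.continuous_conj.comp_aestronglyMeasurable (hwm t)).mul hg.aestronglyMeasurable)
  have hkle : ∀ s x, ‖k s x‖ ≤ ‖w s x‖ ^ 2 + ‖g s x‖ ^ 2 := fun s x => by
    rw [hk, norm_mul, Real.norm_eq_abs, Real.norm_eq_abs, abs_two]
    have h1 := Complex.abs_re_le_norm ((starRingEnd ℂ) (w s x) * g s x)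
    rw [norm_mul, RCLike.norm_conj] at h1
    nlinarith [sq_nonneg (‖w s x‖ - ‖g s x‖)]
  have hmul : ∀ s ∈ Set.Icc 0 T, Integrable fun x => (starRingEnd ℂ) (w s x) * g s x :=
    fun s hs => by
      have : MemLp (fun x => (starRingEnd ℂ) (w s x)) 2 := (hwL s hs).1.star
      exact this.integrable_mul (hgL s hs).1
  have hkI : ∀ s ∈ Set.Icc 0 T, Integrable (k s) := fun s hs => ((hmul s hs).re).const_mul 2
  have hkprod : ∀ t ≤ T,
      Integrable (Function.uncurry k) ((volume.restrict (Set.Ioc 0 t)).prod volume) := fun t ht => by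
    refine integrable_prod_of_forall_integral_le
      (M := 2 * (∫ x, ‖w₀ x‖ ^ 2) + 2 * (T ^ 2 * M) + M) (hkm t) fun s hs => ?_
    have hs' : s ∈ Set.Icc 0 T := ⟨hs.1.le, hs.2.trans ht⟩
    obtain ⟨h1, h2⟩ := hwL s hs'
    obtain ⟨h3, h4⟩ := hgL s hs'
    refine ⟨hkI s hs', ?_⟩
    refine (integral_mono (hkI s hs').norm ((integrable_norm_sq h1).add (integrable_norm_sq h3))
      (hkle s)).trans ?_
    refine (integral_add (integrable_norm_sq h1) (integrable_norm_sq h3)).le.trans ?_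
    linarith
  set h : ℝ → ℝ := fun s => ∫ x, k s x with hh
  have hhI : IntegrableOn h (Set.Ioc 0 T) := (hkprod T le_rfl).integral_prod_left
  -- the energy identity
  have hpt : ∀ t x, ‖w t x‖ ^ 2 = ‖w₀ x‖ ^ 2 + ∫ s in (0 : ℝ)..t, k s x := by
    intro t x
    have hwc : ∀ s, HasDerivAt (fun s => w s x) (g s x) s := fun s => by
      have := (intervalIntegral.integral_hasDerivAt_right ((hcs x).intervalIntegrable 0 s)
        ((hcs x).stronglyMeasurableAtFilter _ _) (hcs x).continuousAt).const_add (w₀ x)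
      exact this.congr_of_eventuallyEq (Eventually.of_forall fun s => hw s x)
    have hwcont : Continuous fun s => w s x :=
      continuous_iff_continuousAt.2 fun s => (hwc s).continuousAt
    have hd : ∀ s, HasDerivAt (fun s => ‖w s x‖ ^ 2) (k s x) s := fun s => by
      have := (hwc s).norm_sq
      refine this.congr_deriv ?_
      rw [hk, Complex.inner, mul_comm (g s x)]
    have hkc : Continuous fun s => k s x := by
      have := hcs x
      exact continuous_const.mul (Complex.continuous_re.comp
        ((Complex.continuous_conj.comp hwcont).mul this))
    have := intervalIntegral.integral_eq_sub_of_hasDerivAt (fun s _ => hd s)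
      (hkc.intervalIntegrable 0 t)
    have e0 : w 0 x = w₀ x := by rw [hw]; simp
    rw [this, e0]; ring
  set y : ℝ → ℝ := fun t => ∫ x, ‖w t x‖ ^ 2 with hy
  have hyT : ∀ t ∈ Set.Icc 0 T, y t = (∫ x, ‖w₀ x‖ ^ 2) + ∫ s in (0 : ℝ)..t, h s := by
    intro t ht
    have hk' : Integrable (Function.uncurry k) ((volume.restrict (Set.uIoc 0 t)).prod volume) := by
      rw [Set.uIoc_of_le ht.1]
      exact hkprod t ht.2
    rw [hh, intervalIntegral_integral_swap hk', ← integral_add (integrable_norm_sq hw₀)]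
    · exact integral_congr_ae (ae_of_all _ (hpt t))
    · have := hk'.integral_prod_right
      rw [Set.uIoc_of_le ht.1] at this
      simp_rw [intervalIntegral.integral_of_le ht.1]
      exact this
  -- extend `y` continuously
  set z : ℝ → ℝ := fun t => (∫ x, ‖w₀ x‖ ^ 2) +
    ∫ s in (0 : ℝ)..t, Set.indicator (Set.Ioc 0 T) h s with hz
  have hind : Integrable (Set.indicator (Set.Ioc 0 T) h) := hhI.integrable_indicator measurableSet_Ioc
  have hzc : Continuous z :=
    continuous_const.add (intervalIntegral.continuous_primitive (fun a b => hind.intervalIntegrable) 0)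
  have hzy : ∀ t ∈ Set.Icc 0 T, z t = y t := fun t ht => by
    rw [hyT t ht, hz]
    dsimp only
    congr 1
    refine intervalIntegral.integral_congr_ae (ae_of_all _ fun s hs => ?_)
    rw [Set.uIoc_of_le ht.1] at hs
    exact Set.indicator_of_mem (Set.Ioc_subset_Ioc_right ht.2 hs) h
  have h0 : z 0 = ∫ x, ‖w₀ x‖ ^ 2 := by simp [hz]
  rw [← h0]
  have hfin : y T = z T := (hzy T (Set.right_mem_Icc.2 hT)).symm
  change y T ≤ _
  rw [hfin]
  refine le_mul_exp_of_le_add_integral hT hzc hβ hβ0 fun t ht => ?_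
  have e1 : z t = z 0 + ∫ s in (0 : ℝ)..t, h s := by rw [hzy t ht, hyT t ht, h0]
  rw [e1]
  refine add_le_add_right (intervalIntegral.integral_mono_on ht.1 ?_
    ((hβ.mul hzc).intervalIntegrable 0 t) fun s hs => ?_) _
  · rw [intervalIntegrable_iff_integrableOn_Ioc_of_le ht.1]
    exact hhI.mono_set (Set.Ioc_subset_Ioc_right ht.2)
  · have hs' : s ∈ Set.Icc 0 T := ⟨hs.1, hs.2.trans ht.2⟩
    change h s ≤ β s * z s
    rw [hzy s hs']
    refine le_trans (le_of_eq ?_) (hE s hs')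
    rw [hh, hk]
    dsimp only
    rw [integral_const_mul]
    congr 1
    exact integral_re (hmul s hs')

end FifthKdV
end

noncomputable section
namespace FifthKdV

/-! ### Sup norms of the solution -/

/-- The sup norm of `u(t)`. -/
def supRep (u : ℝ → Lp ℝ 2 (volume : Measure ℝ)) (t : ℝ) : ℝ := ⨆ x, |rep (u t) x|

/-- The sup norm of `∂ₓu(t)`. -/
def supDeriv (u : ℝ → Lp ℝ 2 (volume : Measure ℝ)) (t : ℝ) : ℝ := ⨆ x, |repDeriv (u t) x|

variable {u : ℝ → Lp ℝ 2 (volume : Measure ℝ)} {u₀ : Lp ℝ 2 (volume : Measure ℝ)}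

theorem abs_rep_le_supRep (hu : ContinuousInH2 u) (t x : ℝ) : |rep (u t) x| ≤ supRep u t :=
  le_ciSup (f := fun x => |rep (u t) x|)
    ⟨sobConst * h2Real (u t), by rintro _ ⟨y, rfl⟩; exact abs_rep_le (hu.1 t) y⟩ x

theorem abs_repDeriv_le_supDeriv (hu : ContinuousInH2 u) (t x : ℝ) :
    |repDeriv (u t) x| ≤ supDeriv u t :=
  le_ciSup (f := fun x => |repDeriv (u t) x|)
    ⟨sobConst * h2Real (u t), by rintro _ ⟨y, rfl⟩; exact abs_repDeriv_le (hu.1 t) y⟩ x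

theorem supRep_nonneg (u : ℝ → Lp ℝ 2 (volume : Measure ℝ)) (t : ℝ) : 0 ≤ supRep u t :=
  Real.iSup_nonneg fun _ => abs_nonneg _

theorem supDeriv_nonneg (u : ℝ → Lp ℝ 2 (volume : Measure ℝ)) (t : ℝ) : 0 ≤ supDeriv u t :=
  Real.iSup_nonneg fun _ => abs_nonneg _

theorem supRep_le (u : ℝ → Lp ℝ 2 (volume : Measure ℝ)) {t B : ℝ} (h : ∀ x, |rep (u t) x| ≤ B) :
    supRep u t ≤ B := ciSup_le h

theorem supDeriv_le (u : ℝ → Lp ℝ 2 (volume : Measure ℝ)) {t B : ℝ}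
    (h : ∀ x, |repDeriv (u t) x| ≤ B) : supDeriv u t ≤ B := ciSup_le h

theorem continuous_of_abs_sub_le_h2Real (hu : ContinuousInH2 u) {f : ℝ → ℝ} {c : ℝ}
    (h : ∀ t s, f t - f s ≤ c * h2Real (u t - u s)) : Continuous f := by
  refine continuous_iff_continuousAt.2 fun t₀ => ?_
  rw [ContinuousAt, tendsto_iff_norm_sub_tendsto_zero]
  refine squeeze_zero (fun t => norm_nonneg _) (fun t => ?_)
    (by simpa using (tendsto_h2Real_sub hu t₀).const_mul c)
  have h3 : h2Real (u t₀ - u t) = h2Real (u t - u t₀) := by rw [h2Real, h2Norm_sub_comm, h2Real]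
  have h1 := h t t₀
  have h2 := h t₀ t
  rw [h3] at h2
  rw [Real.norm_eq_abs, abs_le]
  constructor <;> linarith

theorem continuous_supRep (hu : ContinuousInH2 u) : Continuous (supRep u) := by
  refine continuous_of_abs_sub_le_h2Real hu (c := sobConst) fun t s => ?_
  rw [sub_le_iff_le_add]
  refine supRep_le u fun x => ?_
  have h1 := abs_rep_sub_le hu t s x
  have h2 := abs_rep_le_supRep hu s x
  have h3 := abs_sub_abs_le_abs_sub (rep (u t) x) (rep (u s) x)
  linarith

theorem continuous_supDeriv (hu : ContinuousInH2 u) : Continuous (supDeriv u) := by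
  refine continuous_of_abs_sub_le_h2Real hu (c := sobConst) fun t s => ?_
  rw [sub_le_iff_le_add]
  refine supDeriv_le u fun x => ?_
  have h1 := abs_repDeriv_sub_le hu t s x
  have h2 := abs_repDeriv_le_supDeriv hu s x
  have h3 := abs_sub_abs_le_abs_sub (repDeriv (u t) x) (repDeriv (u s) x)
  linarith

/-- The growth exponent `∫₀ᵗ 2 ‖u‖∞³ ‖∂ₓu‖∞`. -/
def energyExponent (u : ℝ → Lp ℝ 2 (volume : Measure ℝ)) (t : ℝ) : ℝ :=
  ∫ s in (0 : ℝ)..t, 2 * supRep u s ^ 3 * supDeriv u s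

/-! ### The quintic nonlinearity -/

/-- `(a⁵ - b⁵) / (a - b)`. -/
def quarticSum (a b : ℝ) : ℝ := a ^ 4 + a ^ 3 * b + a ^ 2 * b ^ 2 + a * b ^ 3 + b ^ 4

theorem quarticSum_mul_sub (a b : ℝ) : quarticSum a b * (a - b) = a ^ 5 - b ^ 5 := by
  rw [quarticSum]; ring

/-- The derivative of `quarticSum` along a curve. -/
def quarticSumDeriv (a b a' b' : ℝ) : ℝ :=
  4 * a ^ 3 * a' + (3 * a ^ 2 * a' * b + a ^ 3 * b') + (2 * a * a' * b ^ 2 + a ^ 2 * (2 * b * b')) +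
    (a' * b ^ 3 + a * (3 * b ^ 2 * b')) + 4 * b ^ 3 * b'

theorem hasDerivAt_quarticSum {A B : ℝ → ℝ} {A' B' x : ℝ} (hA : HasDerivAt A A' x)
    (hB : HasDerivAt B B' x) :
    HasDerivAt (fun x => quarticSum (A x) (B x)) (quarticSumDeriv (A x) (B x) A' B') x := by
  have := ((((hA.pow 4).add ((hA.pow 3).mul hB)).add ((hA.pow 2).mul (hB.pow 2))).add
    (hA.mul (hB.pow 3))).add (hB.pow 4)
  refine this.congr_deriv ?_
  simp only [quarticSumDeriv, Pi.pow_apply]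
  push_cast; ring

theorem abs_mul_pow_le {a b S : ℝ} (ha : |a| ≤ S) (hb : |b| ≤ S) (i j : ℕ) :
    |a ^ i * b ^ j| ≤ S ^ (i + j) := by
  have : 0 ≤ S := (abs_nonneg _).trans ha
  rw [abs_mul, abs_pow, abs_pow, pow_add]
  gcongr

theorem abs_quarticSum_le {a b S : ℝ} (ha : |a| ≤ S) (hb : |b| ≤ S) :
    |quarticSum a b| ≤ 5 * S ^ 4 := by
  have h := abs_mul_pow_le ha hb
  have e : quarticSum a b = a ^ 4 * b ^ 0 + a ^ 3 * b ^ 1 + a ^ 2 * b ^ 2 + a ^ 1 * b ^ 3 +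
      a ^ 0 * b ^ 4 := by rw [quarticSum]; ring
  have h0 := abs_le.1 (h 4 0)
  have h1 := abs_le.1 (h 3 1)
  have h2 := abs_le.1 (h 2 2)
  have h3 := abs_le.1 (h 1 3)
  have h4 := abs_le.1 (h 0 4)
  simp only [Nat.reduceAdd] at h0 h1 h2 h3 h4
  rw [e, abs_le]
  constructor <;> linarith [h0.1, h1.1, h2.1, h3.1, h4.1, h0.2, h1.2, h2.2, h3.2, h4.2]

theorem abs_quarticSumDeriv_le {a b a' b' S L : ℝ} (ha : |a| ≤ S) (hb : |b| ≤ S)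
    (ha' : |a'| ≤ L) (hb' : |b'| ≤ L) : |quarticSumDeriv a b a' b'| ≤ 20 * S ^ 3 * L := by
  have h := abs_mul_pow_le ha hb
  have hS : 0 ≤ S := (abs_nonneg _).trans ha
  have key : ∀ i j : ℕ, i + j = 3 → ∀ c', |c'| ≤ L → |a ^ i * b ^ j * c'| ≤ S ^ 3 * L := by
    intro i j hij c' hc'
    rw [abs_mul]
    have := h i j
    rw [hij] at this
    gcongr
  have e : quarticSumDeriv a b a' b' = 4 * (a ^ 3 * b ^ 0 * a') + 3 * (a ^ 2 * b ^ 1 * a') +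
      a ^ 3 * b ^ 0 * b' + 2 * (a ^ 1 * b ^ 2 * a') + 2 * (a ^ 2 * b ^ 1 * b') +
      a ^ 0 * b ^ 3 * a' + 3 * (a ^ 1 * b ^ 2 * b') + 4 * (a ^ 0 * b ^ 3 * b') := by
    rw [quarticSumDeriv]; ring
  have k1 := abs_le.1 (key 3 0 rfl a' ha')
  have k2 := abs_le.1 (key 2 1 rfl a' ha')
  have k3 := abs_le.1 (key 3 0 rfl b' hb')
  have k4 := abs_le.1 (key 1 2 rfl a' ha')
  have k5 := abs_le.1 (key 2 1 rfl b' hb')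
  have k6 := abs_le.1 (key 0 3 rfl a' ha')
  have k7 := abs_le.1 (key 1 2 rfl b' hb')
  have k8 := abs_le.1 (key 0 3 rfl b' hb')
  rw [e, abs_le]
  constructor <;> linarith [k1.1, k2.1, k3.1, k4.1, k5.1, k6.1, k7.1, k8.1,
    k1.2, k2.2, k3.2, k4.2, k5.2, k6.2, k7.2, k8.2]

section
variable {g : Lp ℝ 2 (volume : Measure ℝ)}

/-- `u⁴ ∂ₓu`. -/
def quarticDeriv (g : Lp ℝ 2 (volume : Measure ℝ)) (x : ℝ) : ℝ := rep g x ^ 4 * repDeriv g x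

theorem continuous_quarticDeriv (hg : h2Norm g < ⊤) : Continuous (quarticDeriv g) :=
  ((continuous_rep hg).pow 4).mul (continuous_repDeriv hg)

theorem integrable_quarticDeriv (hg : h2Norm g < ⊤) : Integrable (quarticDeriv g) := by
  have h := ((memLp_rep hg).integrable_mul (memLp_repDeriv hg)).bdd_mul
    (c := (sobConst * h2Real g) ^ 3) ((continuous_rep hg).pow 3).aestronglyMeasurable
    (ae_of_all _ fun x => by
      rw [Pi.pow_apply, Real.norm_eq_abs, abs_pow]
      exact pow_le_pow_left₀ (abs_nonneg _) (abs_rep_le hg x) 3)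
  refine h.congr (ae_of_all _ fun x => ?_)
  simp only [quarticDeriv, Pi.mul_apply, Pi.pow_apply]; ring

theorem memLp_quarticDeriv (hg : h2Norm g < ⊤) : MemLp (quarticDeriv g) 2 ∧
    ∀ S, (∀ x, |rep g x| ≤ S) →
      ∫ x, quarticDeriv g x ^ 2 ≤ S ^ 8 * ∫ x, repDeriv g x ^ 2 := by
  have hle : ∀ S, (∀ x, |rep g x| ≤ S) → ∀ x, quarticDeriv g x ^ 2 ≤ S ^ 8 * repDeriv g x ^ 2 := by
    intro S hS x
    have h1 : rep g x ^ 8 ≤ S ^ 8 := by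
      have := pow_le_pow_left₀ (abs_nonneg _) (hS x) 8
      rwa [Even.pow_abs (by decide)] at this
    calc quarticDeriv g x ^ 2 = rep g x ^ 8 * repDeriv g x ^ 2 := by rw [quarticDeriv]; ring
      _ ≤ _ := by gcongr
  have hsq := (memLp_two_iff_integrable_sq (memLp_repDeriv hg).1).1 (memLp_repDeriv hg)
  have hI : Integrable fun x => quarticDeriv g x ^ 2 :=
    (hsq.const_mul ((sobConst * h2Real g) ^ 8)).mono'
      ((continuous_quarticDeriv hg).pow 2).aestronglyMeasurable (ae_of_all _ fun x => by
        rw [Real.norm_of_nonneg (by positivity)]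
        exact hle _ (abs_rep_le hg) x)
  refine ⟨(memLp_two_iff_integrable_sq (continuous_quarticDeriv hg).aestronglyMeasurable).2 hI,
    fun S hS => ?_⟩
  rw [← integral_const_mul]
  exact integral_mono hI (hsq.const_mul _) (hle S hS)

theorem hasDerivAt_rep_pow_five (hg : h2Norm g < ⊤) (x : ℝ) :
    HasDerivAt (fun x => ((rep g x ^ 5 : ℝ) : ℂ)) ((5 * quarticDeriv g x : ℝ) : ℂ) x := by
  refine HasDerivAt.ofReal_comp (((hasDerivAt_rep hg x).pow 5).congr_deriv ?_)
  simp only [quarticDeriv]; push_cast; ring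

theorem fourier_rep_pow_five_mul (hg : h2Norm g < ⊤) (η : ℝ) :
    2 * Real.pi * Complex.I * η * 𝓕 (fun x => ((rep g x ^ 5 : ℝ) : ℂ)) η =
      5 * 𝓕 (fun x => (quarticDeriv g x : ℂ)) η := by
  have hd : deriv (fun x => ((rep g x ^ 5 : ℝ) : ℂ)) = fun x => 5 * (quarticDeriv g x : ℂ) := by
    ext x; rw [(hasDerivAt_rep_pow_five hg x).deriv]; push_cast; rfl
  have h := congrFun (Real.fourier_deriv (integrable_rep_pow_five hg)
    (fun x => (hasDerivAt_rep_pow_five hg x).differentiableAt)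
    (by rw [hd]; exact (integrable_quarticDeriv hg).ofReal.const_mul 5)) η
  rw [hd, smul_eq_mul] at h
  rw [← h]
  rw [Real.fourier_eq, Real.fourier_eq, ← integral_const_mul]
  congr 1; ext x
  rw [mul_smul_comm]

end

/-- Absorbing `2πiη` as a derivative of `u⁵` shows that the time derivative of the profile is
bounded in frequency (by the `L¹` norm of `u⁴ uₓ`) and square integrable. -/
theorem mul_duhamelDensity_eq (hu : ContinuousInH2 u) (t η : ℝ) :
    2 * Real.pi * Complex.I * η * duhamelDensity u t η =
      -(propagatorSymbol t η * 𝓕 (fun x => (quarticDeriv (u t) x : ℂ)) η) := by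
  have h := fourier_rep_pow_five_mul (hu.1 t) η
  rw [duhamelDensity, quinticHat]
  calc _ = -(1 / 5) * propagatorSymbol t η * (2 * Real.pi * Complex.I * η *
        𝓕 (fun x => ((rep (u t) x ^ 5 : ℝ) : ℂ)) η) := by ring
    _ = _ := by rw [h]; ring

theorem norm_mul_duhamelDensity_le (hu : ContinuousInH2 u) (t η : ℝ) :
    ‖2 * Real.pi * Complex.I * η * duhamelDensity u t η‖ ≤ ∫ x, |quarticDeriv (u t) x| := by
  rw [mul_duhamelDensity_eq hu, norm_neg, norm_mul, norm_propagatorSymbol, one_mul]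
  refine (norm_fourier_le η).trans (le_of_eq ?_)
  simp only [Complex.norm_real, Real.norm_eq_abs]

theorem memLp_mul_duhamelDensity (hu : ContinuousInH2 u) (t : ℝ) :
    MemLp (fun η : ℝ => 2 * Real.pi * Complex.I * η * duhamelDensity u t η) 2 ∧
    ∫ η : ℝ, ‖2 * Real.pi * Complex.I * η * duhamelDensity u t η‖ ^ 2 =
      ∫ x, quarticDeriv (u t) x ^ 2 := by
  have hI := (integrable_quarticDeriv (hu.1 t)).ofReal (𝕜 := ℂ)
  have h2 := (memLp_quarticDeriv (hu.1 t)).1.ofReal (K := ℂ)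
  have hp : Continuous fun η => propagatorSymbol t η := by unfold propagatorSymbol; fun_prop
  have hn : ∀ η : ℝ, ‖2 * Real.pi * Complex.I * η * duhamelDensity u t η‖ =
      ‖𝓕 (fun x => (quarticDeriv (u t) x : ℂ)) η‖ := fun η => by
    rw [mul_duhamelDensity_eq hu, norm_neg, norm_mul, norm_propagatorSymbol, one_mul]
  have hm := memLp_fourier hI h2
  constructor
  · refine (memLp_congr_norm ?_ hm.1 (ae_of_all _ hn)).2 hm
    have : (fun η : ℝ => 2 * Real.pi * Complex.I * η * duhamelDensity u t η) = fun η =>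
        -(propagatorSymbol t η * 𝓕 (fun x => (quarticDeriv (u t) x : ℂ)) η) :=
      funext (mul_duhamelDensity_eq hu t)
    rw [this]
    exact (hp.aestronglyMeasurable.mul hm.1).neg
  · simp_rw [hn]
    refine (integral_norm_sq_fourier hI h2).trans ?_
    simp only [RCLike.norm_ofReal, sq_abs]

/-- A locally uniform bound for the nonlinearity in `L²`. -/
theorem exists_quarticDeriv_bound (hu : ContinuousInH2 u) (a b : ℝ) :
    ∃ M, 0 ≤ M ∧ ∀ t ∈ Set.uIcc a b, ∫ x, quarticDeriv (u t) x ^ 2 ≤ M := by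
  obtain ⟨H, hH0, hH⟩ := exists_h2Real_bound hu a b
  have hc := sobConst_nonneg
  refine ⟨(sobConst * H) ^ 8 * H ^ 2, by positivity, fun t ht => ?_⟩
  have hHt := hH t ht
  have h0 := h2Real_nonneg (u t)
  refine ((memLp_quarticDeriv (hu.1 t)).2 (sobConst * H) fun x =>
    (abs_rep_le (hu.1 t) x).trans (by gcongr)).trans ?_
  have := (integral_repDeriv_sq_le (hu.1 t)).trans (pow_le_pow_left₀ h0 hHt 2)
  gcongr

end FifthKdV
end

noncomputable section
namespace FifthKdV

/-! ### Energy estimates for translation differences -/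

/-- The character `e^{2πihη}`. -/
def shiftChar (h η : ℝ) : ℂ := Complex.exp (2 * Real.pi * Complex.I * h * η)

theorem shiftChar_eq (h η : ℝ) :
    shiftChar h η = Complex.exp (Complex.I * ((2 * Real.pi * η * h : ℝ) : ℂ)) := by
  rw [shiftChar]; congr 1; push_cast; ring

theorem norm_shiftChar (h η : ℝ) : ‖shiftChar h η‖ = 1 := by
  rw [shiftChar_eq, mul_comm, Complex.norm_exp_ofReal_mul_I]

theorem continuous_shiftChar (h : ℝ) : Continuous (shiftChar h) := by
  unfold shiftChar; fun_prop

theorem real_inner_eq_mul (a b : ℝ) : inner ℝ a b = a * b := by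
  rw [RCLike.inner_apply, conj_trivial, mul_comm]

theorem fourier_comp_add (f : ℝ → ℂ) (h η : ℝ) :
    𝓕 (fun x => f (x + h)) η = shiftChar h η * 𝓕 f η := by
  rw [Real.fourier_eq', Real.fourier_eq',
    ← integral_add_right_eq_self (fun v => Complex.exp (((-2 * Real.pi * inner ℝ v η : ℝ) : ℂ) *
      Complex.I) • f v) h, ← integral_const_mul]
  refine integral_congr_ae (ae_of_all _ fun x => ?_)
  simp only [smul_eq_mul, shiftChar]
  rw [← mul_assoc, ← Complex.exp_add]
  congr 2
  simp only [real_inner_eq_mul]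
  push_cast; ring

theorem fourierInv_shiftChar_mul (V : ℝ → ℂ) (h x : ℝ) :
    𝓕⁻ (fun η => shiftChar h η * V η) x = 𝓕⁻ V (x + h) := by
  rw [Real.fourierInv_eq', Real.fourierInv_eq']
  refine integral_congr_ae (ae_of_all _ fun η => ?_)
  simp only [smul_eq_mul, shiftChar]
  rw [← mul_assoc, ← Complex.exp_add]
  congr 2
  simp only [real_inner_eq_mul]
  push_cast; ring

variable {u : ℝ → Lp ℝ 2 (volume : Measure ℝ)} {u₀ : Lp ℝ 2 (volume : Measure ℝ)}

section
variable {g : Lp ℝ 2 (volume : Measure ℝ)}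

theorem fourierInv_shift_sub {V : ℝ → ℂ} (hV : Integrable V) (h c x : ℝ) :
    𝓕⁻ (fun η => (shiftChar h η - c) * V η) x = 𝓕⁻ V (x + h) - c * 𝓕⁻ V x := by
  have h1 : Integrable fun η => shiftChar h η * V η :=
    hV.bdd_mul (c := 1) (continuous_shiftChar h).aestronglyMeasurable
      (ae_of_all _ fun η => (norm_shiftChar h η).le)
  have h2 : Integrable fun η => (c : ℂ) * V η := hV.const_mul _
  have e : (fun η => (shiftChar h η - c) * V η) = fun η => shiftChar h η * V η - c * V η := by
    ext η; ring
  rw [e, fourierInv_sub_apply h1 h2, fourierInv_shiftChar_mul]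
  congr 1
  rw [Real.fourierInv_eq, Real.fourierInv_eq, ← integral_const_mul]
  congr 1; ext η
  rw [mul_smul_comm]

theorem fourier_shift_sub {Q : ℝ → ℂ} (hQ : Integrable Q) (h c η : ℝ) :
    𝓕 (fun x => Q (x + h) - c * Q x) η = (shiftChar h η - c) * 𝓕 Q η := by
  rw [fourier_sub_apply (hQ.comp_add_right h) (hQ.const_mul _), fourier_comp_add, sub_mul]
  congr 1
  rw [Real.fourier_eq, Real.fourier_eq, ← integral_const_mul]
  congr 1; ext x
  rw [mul_smul_comm]

theorem norm_shift_sub_le {c : ℝ} (hc : |c| ≤ 1) (h η : ℝ) : ‖shiftChar h η - c‖ ≤ 2 := by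
  refine (norm_sub_le _ _).trans ?_
  rw [norm_shiftChar, Complex.norm_real, Real.norm_eq_abs]; linarith

/-- The symmetrised energy identity for a difference of translates. -/
theorem re_integral_conj_mul_le (hg : h2Norm g < ⊤) {h c S L : ℝ} (hc5 : c ^ 5 = c)
    (hc1 : |c| ≤ 1) (hS : ∀ x, |rep g x| ≤ S) (hL : ∀ x, |repDeriv g x| ≤ L) :
    |(∫ η : ℝ, (starRingEnd ℂ) ((shiftChar h η - c) * (2 * Real.pi * Complex.I * η * hat g η)) *
      ((shiftChar h η - c) * 𝓕 (fun x => ((rep g x ^ 5 : ℝ) : ℂ)) η)).re| ≤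
      10 * S ^ 3 * L * ∫ η : ℝ, ‖(shiftChar h η - c) * hat g η‖ ^ 2 := by
  have hkc : Continuous fun η => shiftChar h η - c := (continuous_shiftChar h).sub continuous_const
  have hk2 := norm_shift_sub_le hc1 h
  set A : ℝ → ℝ := fun x => rep g (x + h) with hA
  set B : ℝ → ℝ := fun x => c * rep g x with hB
  have hAd : ∀ x, HasDerivAt A (repDeriv g (x + h)) x := fun x =>
    (hasDerivAt_rep hg (x + h)).comp_add_const x h
  have hBd : ∀ x, HasDerivAt B (c * repDeriv g x) x := fun x => (hasDerivAt_rep hg x).const_mul c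
  have hcle : ∀ {r M : ℝ}, |r| ≤ M → |c * r| ≤ M := fun {r M} hr => by
    rw [abs_mul]
    calc |c| * |r| ≤ 1 * M := by gcongr
      _ = M := one_mul M
  have hAS : ∀ x, |A x| ≤ S := fun x => hS _
  have hBS : ∀ x, |B x| ≤ S := fun x => hcle (hS x)
  have hI1 : Integrable fun η : ℝ => (shiftChar h η - c) *
      (2 * Real.pi * Complex.I * η * hat g η) :=
    (integrable_deriv_hat hg).bdd_mul (c := 2) hkc.aestronglyMeasurable (ae_of_all _ hk2)
  have hI0 : Integrable fun η : ℝ => (shiftChar h η - c) * hat g η :=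
    (integrable_hat hg).bdd_mul (c := 2) hkc.aestronglyMeasurable (ae_of_all _ hk2)
  have hm0 : MemLp (fun η : ℝ => (shiftChar h η - c) * hat g η) 2 := by
    refine ((memLp_hat g).const_mul (2 : ℂ)).of_le (hkc.aestronglyMeasurable.mul (memLp_hat g).1)
      (ae_of_all _ fun η => ?_)
    rw [norm_mul, norm_mul, Complex.norm_two]
    exact mul_le_mul_of_nonneg_right (hk2 η) (norm_nonneg _)
  have hQ := integrable_rep_pow_five hg
  have hsq : ∫ η : ℝ, ‖(shiftChar h η - c) * hat g η‖ ^ 2 = ∫ x, (A x - B x) ^ 2 := by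
    rw [← integral_norm_sq_fourierInv hI0 hm0]
    refine integral_congr_ae (ae_of_all _ fun x => ?_)
    dsimp only
    rw [fourierInv_shift_sub (integrable_hat hg), ← ofReal_rep hg, ← ofReal_rep hg,
      ← Complex.ofReal_mul, ← Complex.ofReal_sub, Complex.norm_real, Real.norm_eq_abs, sq_abs]
  -- Here `c⁵ = c` enters: `c u⁵ = (c u)⁵`, so the difference of nonlinearities is again a
  -- difference of fifth powers and factors through `quarticSum`.
  have e1 : ∀ η : ℝ, (shiftChar h η - c) * 𝓕 (fun x => ((rep g x ^ 5 : ℝ) : ℂ)) η =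
      𝓕 (fun x => ((A x ^ 5 - B x ^ 5 : ℝ) : ℂ)) η := fun η => by
    rw [← fourier_shift_sub hQ]
    refine congrFun (congrArg _ (funext fun x => ?_)) η
    simp only [hA, hB, mul_pow, hc5]; push_cast; ring
  have hQ' : Integrable fun x => ((A x ^ 5 - B x ^ 5 : ℝ) : ℂ) := by
    refine ((hQ.comp_add_right h).sub (hQ.const_mul (c : ℂ))).congr (ae_of_all _ fun x => ?_)
    simp only [hA, hB, mul_pow, hc5, Pi.sub_apply]; push_cast; ring
  simp_rw [e1]
  rw [integral_conj_mul_fourier hI1 hQ']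
  have e2 : ∀ x, (starRingEnd ℂ) (𝓕⁻ (fun η : ℝ => (shiftChar h η - c) *
      (2 * Real.pi * Complex.I * η * hat g η)) x) * ((A x ^ 5 - B x ^ 5 : ℝ) : ℂ) =
      ((quarticSum (A x) (B x) * (A x - B x) * (repDeriv g (x + h) - c * repDeriv g x) : ℝ) : ℂ) :=
    fun x => by
    rw [fourierInv_shift_sub (integrable_deriv_hat hg), ← ofReal_repDeriv hg, ← ofReal_repDeriv hg,
      ← Complex.ofReal_mul, ← Complex.ofReal_sub, Complex.conj_ofReal, ← Complex.ofReal_mul,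
      quarticSum_mul_sub, mul_comm]
  simp_rw [e2]
  rw [integral_complex_ofReal, Complex.ofReal_re, hsq]
  have hrc := continuous_rep hg
  have hdc := continuous_repDeriv hg
  have hsh : ∀ {f : ℝ → ℝ}, MemLp f 2 → MemLp (fun x => f (x + h)) 2 := fun hf =>
    hf.comp_measurePreserving (measurePreserving_add_right volume h)
  -- With `X = A - B` the integrand is `a X X'`, so the derivative falls on the coefficient
  -- `quarticSum` and none is lost on `X`.
  refine (abs_integral_mul_mul_deriv_le (a := fun x => quarticSum (A x) (B x))
    (fun x => hasDerivAt_quarticSum (hAd x) (hBd x))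
    (fun x => (hAd x).sub (hBd x)) (fun x => abs_quarticSum_le (hAS x) (hBS x))
    (fun x => abs_quarticSumDeriv_le (hAS x) (hBS x) (hL (x + h)) (hcle (hL x))) ?_
    ((hsh (memLp_rep hg)).sub ((memLp_rep hg).const_mul c))
    ((hsh (memLp_repDeriv hg)).sub ((memLp_repDeriv hg).const_mul c))).trans (le_of_eq ?_)
  · simp only [hA, hB, quarticSumDeriv]; fun_prop
  · simp only [Pi.sub_apply]; ring

end

/-- One energy estimate for `u(· + h) - c u`: the choice `c = 0` gives the `L²` norm, and `c = 1`
gives translation differences. The rate is `2 · (1/5) · 10 ‖u‖_∞³ ‖uₓ‖_∞`. -/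
theorem integral_shift_sub_mul_hat_le (hu : IsSolution u₀ u) {h c T : ℝ} (hc5 : c ^ 5 = c)
    (hc1 : |c| ≤ 1) (hT : 0 ≤ T) :
    ∫ η : ℝ, ‖(shiftChar h η - c) * hat (u T) η‖ ^ 2 ≤
      (∫ η : ℝ, ‖(shiftChar h η - c) * hat (u 0) η‖ ^ 2) * Real.exp (2 * energyExponent u T) := by
  have huc := hu.continuousInH2
  have hkc : Continuous fun η => shiftChar h η - c := (continuous_shiftChar h).sub continuous_const
  have hk2 := norm_shift_sub_le hc1 h
  obtain ⟨M, hM0, hM⟩ := exists_quarticDeriv_bound huc 0 T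
  rw [Set.uIcc_of_le hT] at hM
  set w : ℝ → ℝ → ℂ := fun t η => (shiftChar h η - c) * hat (u 0) η +
    ∫ s in (0 : ℝ)..t, (shiftChar h η - c) * (2 * Real.pi * Complex.I * η * duhamelDensity u s η)
    with hw
  have hwe : ∀ t η, w t η = (shiftChar h η - c) *
      (hat (u 0) η + 2 * Real.pi * Complex.I * η * duhamelIntegral u t η) := fun t η => by
    simp only [hw, intervalIntegral.integral_const_mul, duhamelIntegral]; ring
  have hwae : ∀ t, ∀ᵐ η, w t η = (shiftChar h η - c) * (propagatorSymbol t η * hat (u t) η) :=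
    fun t => by
    filter_upwards [propagator_mul_hat_ae hu t] with η hη
    rw [hwe, hη]
  have hwn : ∀ t, ∫ η, ‖w t η‖ ^ 2 = ∫ η : ℝ, ‖(shiftChar h η - c) * hat (u t) η‖ ^ 2 := fun t => by
    refine integral_congr_ae ?_
    filter_upwards [hwae t] with η hη
    rw [hη, norm_mul, norm_mul, norm_propagatorSymbol, one_mul, ← norm_mul]
  have hk0 : MemLp (fun η => (shiftChar h η - c) * hat (u 0) η) 2 := by
    refine ((memLp_hat (u 0)).const_mul (2 : ℂ)).of_le
      (hkc.aestronglyMeasurable.mul (memLp_hat (u 0)).1) (ae_of_all _ fun η => ?_)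
    rw [norm_mul, norm_mul, Complex.norm_two]
    exact mul_le_mul_of_nonneg_right (hk2 η) (norm_nonneg _)
  have hcd := continuous_duhamelDensity huc
  have hs0c := continuous_supRep huc
  have hs1c := continuous_supDeriv huc
  have key := integral_norm_sq_le_of_energy (w := w) (β := fun s => 4 * supRep u s ^ 3 * supDeriv u s)
    (M := 4 * M) hT hk0
    (g := fun s η => (shiftChar h η - c) * (2 * Real.pi * Complex.I * η * duhamelDensity u s η))
    ?_ ?_ (fun t x => rfl) (by fun_prop) (fun s => by
      have := supRep_nonneg u s
      have := supDeriv_nonneg u s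
      positivity) ?_
  · rw [hwn] at key
    refine key.trans (le_of_eq ?_)
    congr 2
    rw [energyExponent, ← intervalIntegral.integral_const_mul]
    congr 1; ext s; ring
  · change Continuous fun z : ℝ × ℝ => (shiftChar h z.2 - c) *
      (2 * Real.pi * Complex.I * z.2 * duhamelDensity u z.1 z.2)
    have : Continuous fun z : ℝ × ℝ => shiftChar h z.2 := (continuous_shiftChar h).comp continuous_snd
    fun_prop
  · intro s hs
    obtain ⟨h1, h2⟩ := memLp_mul_duhamelDensity huc s
    have hle : ∀ η : ℝ, ‖(shiftChar h η - c) * (2 * Real.pi * Complex.I * η * duhamelDensity u s η)‖ ≤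
        ‖(2 : ℂ) * (2 * Real.pi * Complex.I * η * duhamelDensity u s η)‖ := fun η => by
      rw [norm_mul, norm_mul 2, Complex.norm_two]
      exact mul_le_mul_of_nonneg_right (hk2 η) (norm_nonneg _)
    have h3 := (h1.const_mul (2 : ℂ)).of_le (hkc.aestronglyMeasurable.mul h1.1) (ae_of_all _ hle)
    refine ⟨h3, ?_⟩
    calc _ ≤ ∫ η : ℝ, ‖(2 : ℂ) * (2 * Real.pi * Complex.I * η * duhamelDensity u s η)‖ ^ 2 :=
          integral_mono (integrable_norm_sq h3) (integrable_norm_sq (h1.const_mul 2)) fun η =>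
            pow_le_pow_left₀ (norm_nonneg _) (hle η) 2
      _ = 4 * ∫ x, quarticDeriv (u s) x ^ 2 := by
          rw [← h2, ← integral_const_mul]
          refine integral_congr_ae (ae_of_all _ fun η => ?_)
          dsimp only
          rw [norm_mul 2, Complex.norm_two]; ring
      _ ≤ _ := by linarith [hM s hs]
  · intro s _
    have h1 := re_integral_conj_mul_le (huc.1 s) (h := h) hc5 hc1 (abs_rep_le_supRep huc s)
      (abs_repDeriv_le_supDeriv huc s)
    -- The propagators cancel by unimodularity, and moving `2πiη` under the conjugation reverses the
    -- sign of `-1/5`.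
    have e : ∫ η : ℝ, (starRingEnd ℂ) (w s η) * ((shiftChar h η - c) *
        (2 * Real.pi * Complex.I * η * duhamelDensity u s η)) = (1 / 5 : ℝ) *
        ∫ η : ℝ, (starRingEnd ℂ) ((shiftChar h η - c) *
          (2 * Real.pi * Complex.I * η * hat (u s) η)) *
      ((shiftChar h η - c) * 𝓕 (fun x => ((rep (u s) x ^ 5 : ℝ) : ℂ)) η) := by
      rw [← integral_const_mul]
      refine integral_congr_ae ?_
      filter_upwards [hwae s] with η hη
      have hp : (starRingEnd ℂ) (propagatorSymbol s η) * propagatorSymbol s η = 1 := by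
        rw [← Complex.normSq_eq_conj_mul_self, Complex.normSq_eq_norm_sq, norm_propagatorSymbol]
        simp
      rw [hη, duhamelDensity, quinticHat]
      simp only [map_mul, Complex.conj_I, Complex.conj_ofReal, map_ofNat]
      simp only [Complex.ofReal_div, Complex.ofReal_one, Complex.ofReal_ofNat]
      linear_combination (-(1 / 5 : ℂ) * (starRingEnd ℂ) (shiftChar h η - c) *
        (starRingEnd ℂ) (hat (u s) η) * (shiftChar h η - c) *
        (2 * Real.pi * Complex.I * η) * 𝓕 (fun x => ((rep (u s) x ^ 5 : ℝ) : ℂ)) η) * hp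
    rw [e, Complex.re_ofReal_mul, hwn]
    have := le_abs_self (∫ η : ℝ, (starRingEnd ℂ) ((shiftChar h η - c) *
          (2 * Real.pi * Complex.I * η * hat (u s) η)) *
      ((shiftChar h η - c) * 𝓕 (fun x => ((rep (u s) x ^ 5 : ℝ) : ℂ)) η)).re
    linarith

theorem integral_rep_sq_growth (hu : IsSolution u₀ u) {T : ℝ} (hT : 0 ≤ T) :
    ∫ x, rep (u T) x ^ 2 ≤ (∫ x, rep (u 0) x ^ 2) * Real.exp (2 * energyExponent u T) := by
  have hu2 := hu.continuousInH2.1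
  have h := integral_shift_sub_mul_hat_le hu (h := 0) (c := 0) (by norm_num) (by norm_num) hT
  have e : ∀ η, shiftChar 0 η - ((0 : ℝ) : ℂ) = 1 := fun η => by simp [shiftChar]
  simp only [e, one_mul] at h
  rwa [integral_rep_sq (hu2 T), integral_rep_sq (hu2 0)]

/-- Divide the estimate for translation differences by `h²` and let `h → 0`. Domination by `|2πη|²
|û|²` holds for every `h`, and the equation never has to be differentiated. -/
theorem integral_repDeriv_sq_growth (hu : IsSolution u₀ u) {T : ℝ} (hT : 0 ≤ T) :
    ∫ x, repDeriv (u T) x ^ 2 ≤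
      (∫ x, repDeriv (u 0) x ^ 2) * Real.exp (2 * energyExponent u T) := by
  have hu2 := hu.continuousInH2.1
  rw [integral_repDeriv_sq (hu2 T), integral_repDeriv_sq (hu2 0)]
  have hkle : ∀ h η : ℝ, ‖shiftChar h η - ((1 : ℝ) : ℂ)‖ ≤ |2 * Real.pi * η| * |h| := fun h η => by
    rw [shiftChar_eq, Complex.ofReal_one]
    refine Real.norm_exp_I_mul_ofReal_sub_one_le.trans (le_of_eq ?_)
    rw [Real.norm_eq_abs, abs_mul]
  have hle : ∀ t h η, ‖(shiftChar h η - ((1 : ℝ) : ℂ)) * hat (u t) η‖ ^ 2 ≤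
      h ^ 2 * ‖2 * Real.pi * Complex.I * η * hat (u t) η‖ ^ 2 := fun t h η => by
    rw [norm_mul, norm_mul, norm_two_pi_I, ← sq_abs h, ← mul_pow]
    refine pow_le_pow_left₀ (by positivity) ?_ 2
    calc _ ≤ |2 * Real.pi * η| * |h| * ‖hat (u t) η‖ := by gcongr; exact hkle h η
      _ = _ := by ring
  have hI : ∀ t, Integrable fun η : ℝ => ‖2 * Real.pi * Complex.I * η * hat (u t) η‖ ^ 2 :=
    fun t => integrable_norm_sq (memLp_deriv_hat (hu2 t))
  have hcm : ∀ t h, AEStronglyMeasurable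
      (fun η => ‖(shiftChar h η - ((1 : ℝ) : ℂ)) * hat (u t) η‖ ^ 2) volume := fun t h =>
    ((((continuous_shiftChar h).sub continuous_const).aestronglyMeasurable.mul
      (memLp_hat _).1).norm.pow 2)
  set hn : ℕ → ℝ := fun n => 1 / ((n : ℝ) + 1) with hhn
  have hn0 : ∀ n, 0 < hn n := fun n => by simp only [hhn]; positivity
  have hlim : Tendsto hn atTop (𝓝 0) := tendsto_one_div_add_atTop_nhds_zero_nat
  have hT1 : Tendsto (fun n => ∫ η, (hn n ^ 2)⁻¹ *
      ‖(shiftChar (hn n) η - ((1 : ℝ) : ℂ)) * hat (u T) η‖ ^ 2) atTop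
      (𝓝 (∫ η : ℝ, ‖2 * Real.pi * Complex.I * η * hat (u T) η‖ ^ 2)) := by
    refine tendsto_integral_of_dominated_convergence
      (fun η => ‖2 * Real.pi * Complex.I * η * hat (u T) η‖ ^ 2)
      (fun n => (hcm T _).const_mul _) (hI T) (fun n => ae_of_all _ fun η => ?_)
      (ae_of_all _ fun η => ?_)
    · rw [Real.norm_of_nonneg (by positivity), inv_mul_le_iff₀ (pow_pos (hn0 n) 2)]
      exact hle T _ η
    · have hd : HasDerivAt (fun h : ℝ => shiftChar h η) (2 * Real.pi * Complex.I * η) 0 := by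
        have h1 : HasDerivAt (fun h : ℝ => 2 * Real.pi * Complex.I * (h : ℂ) * η)
            (2 * Real.pi * Complex.I * 1 * η) 0 :=
          ((Complex.ofRealCLM.hasDerivAt (x := (0 : ℝ))).const_mul _).mul_const _
        refine h1.cexp.congr_deriv ?_
        simp
      have hs := hd.tendsto_slope_zero_right.comp
        (tendsto_nhdsWithin_iff.2 ⟨hlim, Eventually.of_forall hn0⟩)
      have h2 := ((hs.mul_const (hat (u T) η)).norm.pow 2)
      refine h2.congr fun n => ?_
      have e0 : shiftChar 0 η = 1 := by simp [shiftChar]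
      simp only [Function.comp_apply, zero_add, e0, Complex.ofReal_one]
      rw [norm_mul, norm_smul, norm_mul, norm_inv, Real.norm_of_nonneg (hn0 n).le]
      ring
  refine le_of_tendsto hT1 (Eventually.of_forall fun n => ?_)
  rw [integral_const_mul, inv_mul_le_iff₀ (pow_pos (hn0 n) 2)]
  refine (integral_shift_sub_mul_hat_le hu (c := 1) (by norm_num) (by norm_num) hT).trans ?_
  rw [← mul_assoc]
  refine mul_le_mul_of_nonneg_right ?_ (Real.exp_pos _).le
  rw [← integral_const_mul]
  exact integral_mono_of_nonneg (ae_of_all _ fun η => by positivity) ((hI 0).const_mul _)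
    (ae_of_all _ (hle 0 (hn n)))

end FifthKdV
end

noncomputable section
namespace FifthKdV

/-! ### Square integrable functions on the line -/

theorem sqrt_integral_norm_sq_eq {f : ℝ → ℂ} (hf : MemLp f 2) :
    √(∫ x, ‖f x‖ ^ 2) = (eLpNorm f 2 volume).toReal := by
  rw [integral_norm_sq_eq_eLpNorm hf, Real.sqrt_sq ENNReal.toReal_nonneg]

theorem sqrt_integral_norm_sq_add_le {f g : ℝ → ℂ} (hf : MemLp f 2) (hg : MemLp g 2) :
    √(∫ x, ‖f x + g x‖ ^ 2) ≤ √(∫ x, ‖f x‖ ^ 2) + √(∫ x, ‖g x‖ ^ 2) := by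
  rw [sqrt_integral_norm_sq_eq hf, sqrt_integral_norm_sq_eq hg,
    sqrt_integral_norm_sq_eq (f := fun x => f x + g x) (hf.add hg),
    ← ENNReal.toReal_add hf.2.ne hg.2.ne]
  exact ENNReal.toReal_mono (ENNReal.add_lt_top.2 ⟨hf.2, hg.2⟩).ne
    (eLpNorm_add_le hf.1 hg.1 (by norm_num))

/-- Fatou's lemma in `L²`. -/
theorem memLp_of_tendsto {f : ℕ → ℝ → ℂ} {F : ℝ → ℂ} {B : ℕ → ℝ} {C : ℝ}
    (hf : ∀ n, MemLp (f n) 2) (hF : AEStronglyMeasurable F volume)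
    (hlim : ∀ x, Tendsto (fun n => f n x) atTop (𝓝 (F x)))
    (hB : ∀ n, √(∫ x, ‖f n x‖ ^ 2) ≤ B n) (hBC : Tendsto B atTop (𝓝 C)) :
    MemLp F 2 ∧ √(∫ x, ‖F x‖ ^ 2) ≤ C := by
  have hle : eLpNorm F 2 volume ≤ ENNReal.ofReal C := by
    refine (Lp.eLpNorm_lim_le_liminf_eLpNorm (fun n => (hf n).1) F (ae_of_all _ hlim)).trans ?_
    have h1 : ∀ n, eLpNorm (f n) 2 volume ≤ ENNReal.ofReal (B n) := fun n => by
      rw [← ENNReal.ofReal_toReal (hf n).2.ne, ← sqrt_integral_norm_sq_eq (hf n)]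
      exact ENNReal.ofReal_le_ofReal (hB n)
    calc _ ≤ atTop.liminf fun n => ENNReal.ofReal (B n) :=
          liminf_le_liminf (Eventually.of_forall h1)
      _ = _ := (ENNReal.tendsto_ofReal hBC).liminf_eq
  have hm : MemLp F 2 := ⟨hF, hle.trans_lt ENNReal.ofReal_lt_top⟩
  refine ⟨hm, ?_⟩
  have hC : 0 ≤ C := ge_of_tendsto hBC (Eventually.of_forall fun n => (Real.sqrt_nonneg _).trans (hB n))
  rw [sqrt_integral_norm_sq_eq hm]
  exact ENNReal.toReal_le_of_le_ofReal hC hle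

/-- A weighted `L²` function is integrable. -/
theorem integrable_of_memLp_weight {f : ℝ → ℂ} (hf : MemLp f 2)
    (hxf : MemLp (fun x : ℝ => (x : ℂ) * f x) 2) :
    Integrable f ∧ ∫ x, ‖f x‖ ≤
      √Real.pi * (√(∫ x, ‖f x‖ ^ 2) + √(∫ x : ℝ, ‖(x : ℂ) * f x‖ ^ 2)) := by
  set a : ℝ → ℝ := fun x => √((1 + x ^ 2)⁻¹) with ha
  set b : ℝ → ℝ := fun x => √(1 + x ^ 2) * ‖f x‖ with hb
  have hac : Continuous a := by
    refine Real.continuous_sqrt.comp (Continuous.inv₀ (by fun_prop) fun x => by positivity)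
  have ha2 : ∀ x, a x ^ 2 = (1 + x ^ 2)⁻¹ := fun x => Real.sq_sqrt (by positivity)
  have hb2 : ∀ x, b x ^ 2 = ‖f x‖ ^ 2 + ‖(x : ℂ) * f x‖ ^ 2 := fun x => by
    rw [hb, mul_pow, Real.sq_sqrt (by positivity), norm_mul, Complex.norm_real, mul_pow,
      Real.norm_eq_abs, sq_abs]; ring
  have haL : MemLp a 2 := (memLp_two_iff_integrable_sq hac.aestronglyMeasurable).2 (by
    simp_rw [ha2]; exact integrable_inv_one_add_sq)
  have hbm : AEStronglyMeasurable b volume :=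
    (Continuous.aestronglyMeasurable (by fun_prop)).mul hf.1.norm
  have hI1 := integrable_norm_sq hf
  have hI2 := integrable_norm_sq hxf
  have hbL : MemLp b 2 := (memLp_two_iff_integrable_sq hbm).2 (by
    simp_rw [hb2]; exact hI1.add hI2)
  have hab : ∀ x, a x * b x = ‖f x‖ := fun x => by
    rw [ha, hb]
    dsimp only
    rw [← mul_assoc, ← Real.sqrt_mul (by positivity), inv_mul_cancel₀ (by positivity),
      Real.sqrt_one, one_mul]
  have hint : Integrable fun x => ‖f x‖ := (haL.integrable_mul hbL).congr (ae_of_all _ hab)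
  refine ⟨(integrable_norm_iff hf.1).1 hint, ?_⟩
  have h := integral_mul_le_sqrt haL hbL (fun x => Real.sqrt_nonneg _) fun x => by positivity
  simp_rw [hab, ha2, hb2] at h
  rw [integral_univ_inv_one_add_sq, integral_add hI1 hI2] at h
  refine h.trans (mul_le_mul_of_nonneg_left ?_ (Real.sqrt_nonneg _))
  refine Real.sqrt_le_iff.2 ⟨by positivity, ?_⟩
  have e1 := Real.sq_sqrt (integral_nonneg fun x => by positivity : 0 ≤ ∫ x, ‖f x‖ ^ 2)
  have e2 := Real.sq_sqrt (integral_nonneg fun x => by positivity :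
    0 ≤ ∫ x : ℝ, ‖(x : ℂ) * f x‖ ^ 2)
  have e3 : 0 ≤ √(∫ x, ‖f x‖ ^ 2) * √(∫ x : ℝ, ‖(x : ℂ) * f x‖ ^ 2) := by positivity
  nlinarith

/-- Near the origin `L²` is contained in `L¹`; away from it the factor `|2πη|` exceeds one. -/
theorem integrable_of_integrable_mul {f : ℝ → ℂ} (hf : MemLp f 2)
    (hd : Integrable fun η : ℝ => 2 * Real.pi * Complex.I * η * f η) : Integrable f := by
  have h1 : IntegrableOn f (Set.Icc (-1) 1) := by
    have : IsFiniteMeasure (volume.restrict (Set.Icc (-1 : ℝ) 1)) := by infer_instance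
    exact (hf.restrict _).integrable (by norm_num)
  have h2 : Integrable (Set.indicator (Set.Icc (-1) 1) f) := h1.integrable_indicator measurableSet_Icc
  refine Integrable.mono' (h2.norm.add hd.norm) hf.1 (ae_of_all _ fun η => ?_)
  by_cases hη : η ∈ Set.Icc (-1 : ℝ) 1
  · simp only [Pi.add_apply]
    rw [Set.indicator_of_mem hη]
    exact le_add_of_nonneg_right (norm_nonneg _)
  · simp only [Pi.add_apply]
    rw [Set.indicator_of_notMem hη, norm_zero, zero_add, norm_mul, norm_two_pi_I, abs_mul]
    have h3 : 1 ≤ |η| := by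
      by_contra hlt
      exact hη (abs_le.1 (not_le.1 hlt).le)
    have h4 : 1 ≤ |2 * Real.pi| := by
      rw [abs_of_pos Real.two_pi_pos]; linarith [Real.pi_gt_three]
    have h5 : 1 ≤ |2 * Real.pi| * |η| := one_le_mul_of_one_le_of_one_le h4 h3
    exact le_mul_of_one_le_left (norm_nonneg _) h5

/-! ### Dilations -/

theorem quasiMeasurePreserving_mul_left {c : ℝ} (hc : c ≠ 0) :
    Measure.QuasiMeasurePreserving (fun x : ℝ => c * x) volume volume := by
  refine ⟨measurable_const_mul c, ?_⟩
  rw [Real.map_volume_mul_left hc]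
  exact Measure.smul_absolutelyContinuous

theorem memLp_comp_mul_left {E : Type*} [NormedAddCommGroup E] {f : ℝ → E} {c : ℝ} (hc : c ≠ 0)
    (hf : MemLp f 2) : MemLp (fun x => f (c * x)) 2 := by
  have hm : AEStronglyMeasurable (fun x => f (c * x)) volume :=
    hf.1.comp_quasiMeasurePreserving (quasiMeasurePreserving_mul_left hc)
  rw [memLp_two_iff_integrable_sq_norm hm]
  exact ((memLp_two_iff_integrable_sq_norm hf.1).1 hf).comp_mul_left' hc

theorem integral_norm_sq_comp_mul_left {f : ℝ → ℂ} {c : ℝ} (hc : 0 < c) :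
    ∫ x, ‖f (c * x)‖ ^ 2 = c⁻¹ * ∫ x, ‖f x‖ ^ 2 := by
  rw [Measure.integral_comp_mul_left (fun x => ‖f x‖ ^ 2), abs_of_pos (inv_pos.2 hc), smul_eq_mul]

theorem fourier_comp_mul_left (f : ℝ → ℂ) {c : ℝ} (hc : 0 < c) (η : ℝ) :
    𝓕 (fun x => f (c * x)) η = (c⁻¹ : ℝ) * 𝓕 f (c⁻¹ * η) := by
  rw [Real.fourier_eq', Real.fourier_eq']
  have h := Measure.integral_comp_mul_left (fun v : ℝ =>
    Complex.exp (((-2 * Real.pi * inner ℝ v (c⁻¹ * η) : ℝ) : ℂ) * Complex.I) • f v) c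
  rw [abs_of_pos (inv_pos.2 hc), Complex.real_smul] at h
  rw [← h]
  refine integral_congr_ae (ae_of_all _ fun x => ?_)
  simp only [real_inner_eq_mul]
  congr 5
  have := hc.ne'
  field_simp

theorem fourierInv_comp_mul_left (f : ℝ → ℂ) {c : ℝ} (hc : 0 < c) (x : ℝ) :
    𝓕⁻ (fun η => f (c * η)) x = (c⁻¹ : ℝ) * 𝓕⁻ f (c⁻¹ * x) := by
  rw [fourierInv_eq_fourier_neg', fourierInv_eq_fourier_neg']
  have := fourier_comp_mul_left (fun η => f (-η)) hc x
  rw [← this]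
  simp only [mul_neg]

open scoped SchwartzMap in
/-- The Fourier transform of a square integrable primitive. -/
theorem mul_fourier_toLp_ae {H H' : ℝ → ℂ} (hd : ∀ x, HasDerivAt H (H' x) x) (hH : MemLp H 2)
    (hH' : Integrable H') :
    ∀ᵐ η : ℝ, 2 * Real.pi * Complex.I * η * (𝓕 (hH.toLp H) : Lp ℂ 2 (volume : Measure ℝ)) η =
      𝓕 H' η := by
  have hwm : MemLp (𝓕 (hH.toLp H) : Lp ℂ 2 (volume : Measure ℝ)) 2 := Lp.memLp _
  refine ae_eq_of_integral_schwartz_mul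
    (f := fun η : ℝ => 2 * Real.pi * Complex.I * η *
      (𝓕 (hH.toLp H) : Lp ℂ 2 (volume : Measure ℝ)) η) ?_
    (continuous_fourier hH').locallyIntegrable fun ψ hc => ?_
  · have hl : LocallyIntegrable (𝓕 (hH.toLp H) : Lp ℂ 2 (volume : Measure ℝ)) :=
      locallyIntegrable_Lp _
    rw [← locallyIntegrableOn_univ] at hl ⊢
    exact hl.continuousOn_mul (g := fun η : ℝ => 2 * Real.pi * Complex.I * (η : ℂ)) (by fun_prop)
      isOpen_univ.isLocallyClosed
  have hq : ContDiff ℝ ∞ (fun x : ℝ => 2 * Real.pi * Complex.I * x * ψ x) :=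
    ContDiff.mul (contDiff_const.mul Complex.ofRealCLM.contDiff) (ψ.smooth ⊤)
  obtain ⟨q, hqx⟩ : ∃ q : 𝓢(ℝ, ℂ), ∀ x : ℝ, q x = 2 * Real.pi * Complex.I * x * ψ x :=
    ⟨HasCompactSupport.toSchwartzMap (f := fun x : ℝ => 2 * Real.pi * Complex.I * x * ψ x)
      hc.mul_left hq, fun x => rfl⟩
  have e1 : ∫ η : ℝ, ψ η * (2 * Real.pi * Complex.I * η *
      (𝓕 (hH.toLp H) : Lp ℂ 2 (volume : Measure ℝ)) η) =
      ∫ η : ℝ, q η * (𝓕 (hH.toLp H) : Lp ℂ 2 (volume : Measure ℝ)) η :=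
    integral_congr_ae (ae_of_all _ fun η => by simp only [hqx]; ring)
  rw [e1, integral_mul_fourier_Lp]
  have e2 : ∫ x, (𝓕 q : 𝓢(ℝ, ℂ)) x * (hH.toLp H : Lp ℂ 2 (volume : Measure ℝ)) x =
      ∫ x, H x * (𝓕 q : 𝓢(ℝ, ℂ)) x := by
    refine integral_congr_ae ?_
    filter_upwards [hH.coeFn_toLp] with x hx
    rw [hx, mul_comm]
  rw [e2]
  -- the derivative of the transformed test function
  have hψd : ∀ x : ℝ, HasDerivAt (𝓕 ψ : 𝓢(ℝ, ℂ)) (-(𝓕 q : 𝓢(ℝ, ℂ)) x) x := fun x => by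
    rw [SchwartzMap.fourier_coe, SchwartzMap.fourier_coe]
    have hi : Integrable fun x : ℝ => x • ψ x := by
      refine (q.integrable.const_mul (2 * Real.pi * Complex.I)⁻¹).congr (ae_of_all _ fun x => ?_)
      dsimp only
      rw [hqx, Complex.real_smul, mul_assoc (2 * Real.pi * Complex.I : ℂ), ← mul_assoc,
        inv_mul_cancel₀ Complex.two_pi_I_ne_zero, one_mul]
    refine (Real.hasDerivAt_fourier ψ.integrable hi x).congr_deriv ?_
    rw [Real.fourier_eq, Real.fourier_eq, ← integral_neg]
    refine integral_congr_ae (ae_of_all _ fun y => ?_)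
    simp only [hqx, smul_eq_mul]
    rw [← smul_neg]
    congr 1; ring
  have hS : ∀ r : 𝓢(ℝ, ℂ), MemLp r 2 := fun r => r.memLp 2
  have hF2 := hS (𝓕 ψ)
  have hq2 := hS (𝓕 q)
  have hb : ∀ x, ‖(𝓕 ψ : 𝓢(ℝ, ℂ)) x‖ ≤ ∫ y, ‖ψ y‖ := fun x => by
    rw [SchwartzMap.fourier_coe]; exact norm_fourier_le x
  have hibp := integral_mul_deriv_eq_deriv_mul_of_integrable (u := H) (u' := H')
    (v := (𝓕 ψ : 𝓢(ℝ, ℂ))) (v' := fun x => -(𝓕 q : 𝓢(ℝ, ℂ)) x) (fun x _ => hd x)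
    (fun x _ => hψd x) (hH.integrable_mul hq2.neg)
    (hH'.mul_bdd (c := ∫ y, ‖ψ y‖) (𝓕 ψ : 𝓢(ℝ, ℂ)).continuous.aestronglyMeasurable
      (ae_of_all _ hb)) (hH.integrable_mul hF2)
  simp only [mul_neg, integral_neg, neg_inj] at hibp
  rw [hibp, SchwartzMap.fourier_coe, ← integral_fourier_mul hH' ψ.integrable]
  exact integral_congr_ae (ae_of_all _ fun η => mul_comm _ _)

end FifthKdV
end

noncomputable section
namespace FifthKdV

/-! ### The energy estimate for dilation differences -/

theorem hat_ae_fourier_rep {g : Lp ℝ 2 (volume : Measure ℝ)} (hg : h2Norm g < ⊤)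
    (hi : Integrable (rep g)) : hat g =ᵐ[volume] 𝓕 (fun x => (rep g x : ℂ)) := by
  have hm : MemLp (fun x => (rep g x : ℂ)) 2 := (memLp_rep hg).ofReal
  have e : toComplex g = hm.toLp _ := by
    refine Lp.ext ?_
    filter_upwards [Complex.ofRealCLM.coeFn_compLp g, hm.coeFn_toLp, rep_ae hg] with x h1 h2 h3
    rw [toComplex, h1, h2, h3]; rfl
  rw [hat, e]
  exact fourier_toLp_ae hi.ofReal hm

/-- `∫ₓ^{cx} v`. -/
def dilationDiff (v : ℝ → ℝ) (c x : ℝ) : ℂ := ((∫ y in x..c * x, v y : ℝ) : ℂ)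

theorem hasDerivAt_dilationDiff {v : ℝ → ℝ} (hv : Continuous v) (c x : ℝ) :
    HasDerivAt (dilationDiff v c) ((c : ℂ) * (v (c * x) : ℂ) - (v x : ℂ)) x := by
  have h : HasDerivAt (fun x => (∫ y in (0 : ℝ)..c * x, v y) - ∫ y in (0 : ℝ)..x, v y)
      (v (c * x) * (c * 1) - v x) x := by
    have h1 : ∀ z, HasDerivAt (fun x => ∫ y in (0 : ℝ)..x, v y) (v z) z := fun z =>
      intervalIntegral.integral_hasDerivAt_right (hv.intervalIntegrable 0 z)
        (hv.stronglyMeasurableAtFilter _ _) hv.continuousAt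
    exact ((h1 (c * x)).comp x ((hasDerivAt_id x).const_mul c)).sub (h1 x)
  have e : dilationDiff v c = fun x =>
      (((∫ y in (0 : ℝ)..c * x, v y) - ∫ y in (0 : ℝ)..x, v y : ℝ) : ℂ) := by
    ext x
    rw [dilationDiff, intervalIntegral.integral_interval_sub_left (hv.intervalIntegrable _ _)
      (hv.intervalIntegrable _ _)]
  rw [e]
  refine h.ofReal_comp.congr_deriv ?_
  push_cast; ring

/-- Write the integral from `x` to `c x` as `∫₁^c x v(s x) ds` and use Minkowski. Each slice has
norm at most `‖x v‖` because `s ≥ 1`, and the length of the interval supplies the factor `c - 1`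
that survives division later. -/
theorem memLp_dilationDiff {v : ℝ → ℝ} (hv : Continuous v) (hx : MemLp (fun x => x * v x) 2)
    {c : ℝ} (hc : 1 ≤ c) :
    MemLp (dilationDiff v c) 2 ∧
      √(∫ x, ‖dilationDiff v c x‖ ^ 2) ≤ (c - 1) * √(∫ x, (x * v x) ^ 2) := by
  set G : ℝ → ℝ → ℂ := fun s x => ((x * v (s * x) : ℝ) : ℂ) with hG
  have hGc : Continuous (Function.uncurry G) := by
    change Continuous fun z : ℝ × ℝ => ((z.2 * v (z.1 * z.2) : ℝ) : ℂ)
    fun_prop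
  have e : dilationDiff v c = fun x => ∫ s in (1 : ℝ)..c, G s x := by
    ext x
    simp only [hG]
    rw [intervalIntegral.integral_ofReal, intervalIntegral.integral_const_mul, dilationDiff]
    have := intervalIntegral.smul_integral_comp_mul_right (a := 1) (b := c) v x
    rw [smul_eq_mul, one_mul] at this
    rw [this]
  have hxc : MemLp (fun x => ((x * v x : ℝ) : ℂ)) 2 := hx.ofReal
  have hE : ∫ x, ‖((x * v x : ℝ) : ℂ)‖ ^ 2 = ∫ x, (x * v x) ^ 2 := by
    simp only [Complex.norm_real, Real.norm_eq_abs, sq_abs]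
  have hE0 : 0 ≤ ∫ x, (x * v x) ^ 2 := integral_nonneg fun x => sq_nonneg _
  have hs : ∀ s ∈ Set.Icc 1 c, MemLp (G s) 2 ∧ ∫ x, ‖G s x‖ ^ 2 ≤ ∫ x, (x * v x) ^ 2 := by
    intro s hs
    have hs0 : 0 < s := by linarith [hs.1]
    have eG : G s = fun x => ((s⁻¹ : ℝ) : ℂ) * (fun x => ((x * v x : ℝ) : ℂ)) (s * x) := by
      ext x
      simp only [hG]
      rw [← Complex.ofReal_mul]
      congr 1
      field_simp
    have hinv : s⁻¹ ≤ 1 := inv_le_one_of_one_le₀ hs.1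
    refine ⟨by rw [eG]; exact (memLp_comp_mul_left hs0.ne' hxc).const_mul _, ?_⟩
    have eI : ∫ x, ‖G s x‖ ^ 2 =
        s⁻¹ ^ 2 * ∫ x, ‖(fun x => ((x * v x : ℝ) : ℂ)) (s * x)‖ ^ 2 := by
      rw [eG, ← integral_const_mul]
      refine integral_congr_ae (ae_of_all _ fun x => ?_)
      dsimp only
      rw [norm_mul, mul_pow, Complex.norm_real s⁻¹, Real.norm_of_nonneg (inv_nonneg.2 hs0.le)]
    rw [eI, integral_norm_sq_comp_mul_left (f := fun x => ((x * v x : ℝ) : ℂ)) hs0, hE, ← mul_assoc]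
    have h1 : s⁻¹ ^ 2 * s⁻¹ ≤ 1 := by
      have h0 := inv_nonneg.2 hs0.le
      calc s⁻¹ ^ 2 * s⁻¹ = s⁻¹ ^ 3 := by ring
        _ ≤ 1 := pow_le_one₀ h0 hinv
    calc _ ≤ 1 * ∫ x, (x * v x) ^ 2 := mul_le_mul_of_nonneg_right h1 hE0
      _ = _ := one_mul _
  obtain ⟨h1, h2⟩ := memLp_intervalIntegral hc hGc hs
  rw [e]
  refine ⟨h1, ?_⟩
  rw [← Real.sqrt_sq (sub_nonneg.2 hc), ← Real.sqrt_mul (sq_nonneg _)]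
  exact Real.sqrt_le_sqrt h2

variable {u : ℝ → Lp ℝ 2 (volume : Measure ℝ)} {u₀ : Lp ℝ 2 (volume : Measure ℝ)}

/-- The time derivative of the difference of rescaled Duhamel integrals. -/
def dilationDensity (u : ℝ → Lp ℝ 2 (volume : Measure ℝ)) (c s η : ℝ) : ℂ :=
  (c : ℂ) ^ 4 * duhamelDensity u (c ^ 5 * s) (c⁻¹ * η) - duhamelDensity u s η

/-- The growth exponent for the dilation difference. -/
def dilationExponent (u : ℝ → Lp ℝ 2 (volume : Measure ℝ)) (c t : ℝ) : ℝ :=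
  ∫ s in (0 : ℝ)..t, 2 * max (supRep u s) (c * supRep u (c ^ 5 * s)) ^ 3 *
    max (supDeriv u s) (c ^ 2 * supDeriv u (c ^ 5 * s))

/-- The linear flow is invariant under `(t, x) ↦ (c⁵ t, c x)`. -/
theorem propagatorSymbol_dilation {c : ℝ} (hc : 0 < c) (s η : ℝ) :
    propagatorSymbol (c ^ 5 * s) (c⁻¹ * η) = propagatorSymbol s η := by
  rw [propagatorSymbol_eq, propagatorSymbol_eq]
  have : -(c ^ 5 * s) * (2 * Real.pi * (c⁻¹ * η)) ^ 5 = -s * (2 * Real.pi * η) ^ 5 := by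
    field_simp
  rw [this]

theorem continuous_dilationDensity (hu : ContinuousInH2 u) (c : ℝ) :
    Continuous (Function.uncurry (dilationDensity u c)) := by
  have h := continuous_duhamelDensity hu
  have h1 : Continuous fun z : ℝ × ℝ => duhamelDensity u (c ^ 5 * z.1) (c⁻¹ * z.2) :=
    h.comp (g := fun z : ℝ × ℝ => duhamelDensity u z.1 z.2)
      (f := fun z : ℝ × ℝ => (c ^ 5 * z.1, c⁻¹ * z.2)) (by fun_prop)
  exact (continuous_const.mul h1).sub h

/-- The difference of the rescaled quintic nonlinearities. -/
def quinticDiff (u : ℝ → Lp ℝ 2 (volume : Measure ℝ)) (c s x : ℝ) : ℝ :=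
  (c * rep (u (c ^ 5 * s)) (c * x)) ^ 5 - rep (u s) x ^ 5

theorem integrable_quinticDiff (hu : ContinuousInH2 u) {c : ℝ} (hc : 0 < c) (s : ℝ) :
    Integrable (quinticDiff u c s) ∧ MemLp (quinticDiff u c s) 2 := by
  have hg := hu.1 (c ^ 5 * s)
  have hA2 : MemLp (fun x => c * rep (u (c ^ 5 * s)) (c * x)) 2 :=
    (memLp_comp_mul_left hc.ne' (memLp_rep hg)).const_mul c
  have hAb : ∀ x, |c * rep (u (c ^ 5 * s)) (c * x)| ≤ c * (sobConst * h2Real (u (c ^ 5 * s))) :=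
    fun x => by
      rw [abs_mul, abs_of_pos hc]
      exact mul_le_mul_of_nonneg_left (abs_rep_le hg _) hc.le
  exact ⟨(integrable_pow_five hA2 hAb).sub
      (integrable_pow_five (memLp_rep (hu.1 s)) (abs_rep_le (hu.1 s))),
    (memLp_pow_five hA2 hAb).sub (memLp_pow_five (memLp_rep (hu.1 s)) (abs_rep_le (hu.1 s)))⟩

/-- Scaling symmetry: `c u(c⁵ t, c x)` solves the same equation, so the rescaled density is that of
the dilated solution. The power `c⁴` is `c⁵` from the time change times `c⁻¹` from the spatial
primitive. -/
theorem dilationDensity_eq (hu : ContinuousInH2 u) {c : ℝ} (hc : 0 < c) (s η : ℝ) :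
    dilationDensity u c s η =
      -(1 / 5) * propagatorSymbol s η * 𝓕 (fun x => (quinticDiff u c s x : ℂ)) η := by
  have hg := hu.1 (c ^ 5 * s)
  have h5 := integrable_rep_pow_five hg
  have e1 : (fun x => (quinticDiff u c s x : ℂ)) = fun x =>
      (c : ℂ) ^ 5 * ((rep (u (c ^ 5 * s)) (c * x) ^ 5 : ℝ) : ℂ) - ((rep (u s) x ^ 5 : ℝ) : ℂ) := by
    ext x; rw [quinticDiff]; push_cast; ring
  have h5c : Integrable fun x => ((rep (u (c ^ 5 * s)) (c * x) ^ 5 : ℝ) : ℂ) :=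
    h5.comp_mul_left' hc.ne'
  rw [e1, fourier_sub_apply (h5c.const_mul _) (integrable_rep_pow_five (hu.1 s))]
  have e2 : 𝓕 (fun x => (c : ℂ) ^ 5 * ((rep (u (c ^ 5 * s)) (c * x) ^ 5 : ℝ) : ℂ)) η =
      (c : ℂ) ^ 4 * quinticHat u (c ^ 5 * s) (c⁻¹ * η) := by
    have e3 : 𝓕 (fun x => (c : ℂ) ^ 5 * ((rep (u (c ^ 5 * s)) (c * x) ^ 5 : ℝ) : ℂ)) η =
        (c : ℂ) ^ 5 * 𝓕 (fun x => ((rep (u (c ^ 5 * s)) (c * x) ^ 5 : ℝ) : ℂ)) η := by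
      rw [Real.fourier_eq, Real.fourier_eq, ← integral_const_mul]
      congr 1; ext x
      rw [mul_smul_comm]
    rw [e3, fourier_comp_mul_left (fun x => ((rep (u (c ^ 5 * s)) x ^ 5 : ℝ) : ℂ)) hc, quinticHat]
    have : (c : ℂ) ≠ 0 := by exact_mod_cast hc.ne'
    push_cast
    field_simp
  rw [e2, dilationDensity, duhamelDensity, duhamelDensity, propagatorSymbol_dilation hc]
  rw [show 𝓕 (fun x => ((rep (u s) x ^ 5 : ℝ) : ℂ)) η = quinticHat u s η from rfl]
  ring

theorem memLp_fourier_mul_propagator {q : ℝ → ℝ} (hq : Integrable q) (hq2 : MemLp q 2) (s : ℝ)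
    (a : ℂ) :
    MemLp (fun η => a * propagatorSymbol s η * 𝓕 (fun x => (q x : ℂ)) η) 2 ∧
    ∫ η, ‖a * propagatorSymbol s η * 𝓕 (fun x => (q x : ℂ)) η‖ ^ 2 = ‖a‖ ^ 2 * ∫ x, q x ^ 2 := by
  have hI := hq.ofReal (𝕜 := ℂ)
  have h2 := hq2.ofReal (K := ℂ)
  have hp : Continuous fun η => propagatorSymbol s η := by unfold propagatorSymbol; fun_prop
  have hm := memLp_fourier hI h2
  have hn : ∀ η, ‖a * propagatorSymbol s η * 𝓕 (fun x => (q x : ℂ)) η‖ =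
      ‖a * 𝓕 (fun x => (q x : ℂ)) η‖ := fun η => by
    rw [norm_mul, norm_mul, norm_propagatorSymbol, mul_one, norm_mul]
  constructor
  · exact (memLp_congr_norm ((continuous_const.mul hp).aestronglyMeasurable.mul hm.1)
      (hm.const_mul a).1 (ae_of_all _ hn)).2 (hm.const_mul a)
  · simp_rw [hn, norm_mul, mul_pow]
    rw [integral_const_mul]
    congr 1
    refine (integral_norm_sq_fourier hI h2).trans ?_
    simp only [RCLike.norm_ofReal, sq_abs]

/-- `‖u(t)⁵‖²` in `L²`. -/
def tenthMoment (u : ℝ → Lp ℝ 2 (volume : Measure ℝ)) (t : ℝ) : ℝ := ∫ x, (rep (u t) x ^ 5) ^ 2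

theorem tenthMoment_nonneg (u : ℝ → Lp ℝ 2 (volume : Measure ℝ)) (t : ℝ) : 0 ≤ tenthMoment u t :=
  integral_nonneg fun _ => sq_nonneg _

theorem continuous_tenthMoment (hu : ContinuousInH2 u) : Continuous (tenthMoment u) := by
  refine continuous_iff_continuousAt.2 fun t₀ => ?_
  obtain ⟨H, hH0, hH⟩ := exists_h2Real_bound hu (t₀ - 1) (t₀ + 1)
  have hc := sobConst_nonneg
  set M := sobConst * H with hM
  have hI : ∀ t, Integrable fun x => (rep (u t) x ^ 5) ^ 2 := fun t =>
    (memLp_two_iff_integrable_sq (memLp_pow_five (memLp_rep (hu.1 t)) (abs_rep_le (hu.1 t))).1).1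
      (memLp_pow_five (memLp_rep (hu.1 t)) (abs_rep_le (hu.1 t)))
  have hb : ∀ t ∈ Set.Icc (t₀ - 1) (t₀ + 1), ∀ x, |rep (u t) x ^ 5| ≤ M ^ 5 := fun t ht x => by
    rw [abs_pow]
    refine pow_le_pow_left₀ (abs_nonneg _) ((abs_rep_le (hu.1 t) x).trans ?_) 5
    rw [hM]
    gcongr
    exact hH t (by rwa [Set.uIcc_of_le (by linarith)])
  rw [ContinuousAt, tendsto_iff_norm_sub_tendsto_zero]
  have hlim := (tendsto_integral_pow_five_sub hu t₀).const_mul (2 * M ^ 5)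
  rw [mul_zero] at hlim
  refine squeeze_zero' (Eventually.of_forall fun t => norm_nonneg _) ?_ hlim
  filter_upwards [Icc_mem_nhds (by linarith : t₀ - 1 < t₀) (by linarith : t₀ < t₀ + 1)] with t ht
  rw [tenthMoment, tenthMoment, ← integral_sub (hI t) (hI t₀), ← integral_const_mul]
  refine norm_integral_le_of_norm_le
    (((integrable_rep_pow_five (hu.1 t)).sub (integrable_rep_pow_five (hu.1 t₀))).norm.const_mul _)
    (ae_of_all _ fun x => ?_)
  rw [← Complex.ofReal_sub, Complex.norm_real, Real.norm_eq_abs, Real.norm_eq_abs, sq_sub_sq,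
    abs_mul]
  have h1 := hb t ht x
  have h2 := hb t₀ ⟨by linarith, by linarith⟩ x
  refine mul_le_mul_of_nonneg_right ((abs_add_le _ _).trans (by linarith)) (abs_nonneg _)

theorem memLp_duhamelDensity (hu : ContinuousInH2 u) (t : ℝ) :
    MemLp (duhamelDensity u t) 2 ∧
      ∫ η, ‖duhamelDensity u t η‖ ^ 2 = 1 / 25 * tenthMoment u t := by
  obtain ⟨h1, h2⟩ := memLp_fourier_mul_propagator
    (integrable_pow_five (memLp_rep (hu.1 t)) (abs_rep_le (hu.1 t)))
    (memLp_pow_five (memLp_rep (hu.1 t)) (abs_rep_le (hu.1 t))) t (-(1 / 5))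
  refine ⟨h1, h2.trans ?_⟩
  rw [tenthMoment]
  norm_num

theorem integral_dilationDensity (hu : ContinuousInH2 u) {c : ℝ} (hc : 0 < c) (t η : ℝ) :
    ∫ s in (0 : ℝ)..t, dilationDensity u c s η =
      (c⁻¹ : ℝ) * duhamelIntegral u (c ^ 5 * t) (c⁻¹ * η) - duhamelIntegral u t η := by
  have hcs : ∀ η, Continuous fun s => duhamelDensity u s η := fun η =>
    (continuous_duhamelDensity hu).comp (g := fun z : ℝ × ℝ => duhamelDensity u z.1 z.2)
      (f := fun s : ℝ => (s, η)) (by fun_prop)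
  have hcs' : Continuous fun s => duhamelDensity u (c ^ 5 * s) (c⁻¹ * η) :=
    (hcs (c⁻¹ * η)).comp (continuous_const.mul continuous_id)
  have hc4 : Continuous fun s => (c : ℂ) ^ 4 * duhamelDensity u (c ^ 5 * s) (c⁻¹ * η) :=
    continuous_const.mul hcs'
  simp only [dilationDensity]
  rw [intervalIntegral.integral_sub (hc4.intervalIntegrable _ _)
    ((hcs η).intervalIntegrable _ _), intervalIntegral.integral_const_mul,
    intervalIntegral.integral_comp_mul_left (fun s => duhamelDensity u s (c⁻¹ * η))
      (pow_pos hc 5).ne', mul_zero, Complex.real_smul, ← mul_assoc]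
  rw [duhamelIntegral, duhamelIntegral]
  congr 2
  have : (c : ℂ) ≠ 0 := by exact_mod_cast hc.ne'
  push_cast
  field_simp

end FifthKdV
end

/-! ### The energy estimate for the primitive of a dilation difference -/

noncomputable section
namespace FifthKdV

variable {u : ℝ → Lp ℝ 2 (volume : Measure ℝ)} {u₀ : Lp ℝ 2 (volume : Measure ℝ)}

/-- The symmetrised energy identity for the antiderivative of a difference of solutions. -/
theorem abs_re_integral_conj_mul_quinticDiff_le (hu : ContinuousInH2 u) {c s S L : ℝ} (hc : 0 < c)
    {V : ℝ → ℂ} (hV : MemLp V 2)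
    (hVd : ∀ᵐ η : ℝ, 2 * Real.pi * Complex.I * η * V η =
      hat (u (c ^ 5 * s)) (c⁻¹ * η) - hat (u s) η)
    (hS : ∀ x, |c * rep (u (c ^ 5 * s)) x| ≤ S) (hS' : ∀ x, |rep (u s) x| ≤ S)
    (hL : ∀ x, |c ^ 2 * repDeriv (u (c ^ 5 * s)) x| ≤ L) (hL' : ∀ x, |repDeriv (u s) x| ≤ L) :
    |(∫ η, (starRingEnd ℂ) (V η) * 𝓕 (fun x => (quinticDiff u c s x : ℂ)) η).re| ≤
      10 * S ^ 3 * L * ∫ η, ‖V η‖ ^ 2 := by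
  have hg := hu.1 (c ^ 5 * s)
  have hg' := hu.1 s
  have hci : 0 < c⁻¹ := inv_pos.2 hc
  have hi1 : Integrable fun η => hat (u (c ^ 5 * s)) (c⁻¹ * η) :=
    (integrable_hat hg).comp_mul_left' hci.ne'
  have hdI : Integrable fun η : ℝ => 2 * Real.pi * Complex.I * η * V η :=
    (hi1.sub (integrable_hat hg')).congr (hVd.mono fun η h => h.symm)
  have hVI : Integrable V := integrable_of_integrable_mul hV hdI
  set A : ℝ → ℝ := fun x => c * rep (u (c ^ 5 * s)) (c * x) with hA
  set B : ℝ → ℝ := fun x => rep (u s) x with hB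
  -- The inverse transform of `V` is a primitive of `u_c - u`. Its derivative is real, so only its
  -- real part `X` enters, and `X' = A - B`.
  have hWd : ∀ x, HasDerivAt (𝓕⁻ V) ((A x - B x : ℝ) : ℂ) x := fun x => by
    refine (hasDerivAt_fourierInv hVI hdI x).congr_deriv ?_
    rw [Real.fourierInv_congr_ae hVd, fourierInv_sub_apply hi1 (integrable_hat hg'),
      fourierInv_comp_mul_left _ hci, inv_inv, ← ofReal_rep hg, ← ofReal_rep hg',
      ← Complex.ofReal_mul, ← Complex.ofReal_sub]
  have hW2 := memLp_fourierInv hVI hV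
  set X : ℝ → ℝ := fun x => (𝓕⁻ V x).re with hX
  have hXd : ∀ x, HasDerivAt X (A x - B x) x := fun x =>
    Complex.reCLM.hasFDerivAt.comp_hasDerivAt x (hWd x)
  have hX2 : MemLp X 2 := hW2.re
  have hA2 : MemLp A 2 := (memLp_comp_mul_left hc.ne' (memLp_rep hg)).const_mul c
  have hB2 : MemLp B 2 := memLp_rep hg'
  have hAd : ∀ x, HasDerivAt A (c ^ 2 * repDeriv (u (c ^ 5 * s)) (c * x)) x := fun x => by
    have h1 : HasDerivAt (fun x : ℝ => c * x) (c * 1) x := (hasDerivAt_id x).const_mul c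
    refine (((hasDerivAt_rep hg (c * x)).comp x h1).const_mul c).congr_deriv ?_
    ring
  have hQ := (integrable_quinticDiff hu hc s).1
  have hQc : Integrable fun x => (quinticDiff u c s x : ℂ) := hQ.ofReal
  rw [integral_conj_mul_fourier hVI hQc]
  have hWQ : Integrable fun x => (starRingEnd ℂ) (𝓕⁻ V x) * (quinticDiff u c s x : ℂ) := by
    refine hQc.bdd_mul (c := ∫ x, ‖V x‖)
      (Complex.continuous_conj.comp (continuous_fourierInv hVI)).aestronglyMeasurable
      (ae_of_all _ fun x => ?_)
    rw [RCLike.norm_conj]; exact norm_fourierInv_le x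
  have e1 : (∫ x, (starRingEnd ℂ) (𝓕⁻ V x) * (quinticDiff u c s x : ℂ)).re =
      ∫ x, quarticSum (A x) (B x) * X x * (A x - B x) := by
    refine (integral_re hWQ).symm.trans (integral_congr_ae (ae_of_all _ fun x => ?_))
    simp only [RCLike.re_to_complex, Complex.mul_re, Complex.conj_re, Complex.ofReal_re,
      Complex.conj_im, Complex.ofReal_im, mul_zero, sub_zero]
    have : quinticDiff u c s x = quarticSum (A x) (B x) * (A x - B x) := by
      rw [quarticSum_mul_sub, quinticDiff]
    rw [this]; ring
  rw [e1]
  have hrc := continuous_rep hg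
  have hrc' := continuous_rep hg'
  have hdc := continuous_repDeriv hg
  have hdc' := continuous_repDeriv hg'
  have hAS : ∀ x, |A x| ≤ S := fun x => hS _
  -- At the level of primitives the nonlinearity `A⁵ - B⁵` equals `a X'`, so pairing it with `X`
  -- gives once more `∫ a X X'`.
  have h := abs_integral_mul_mul_deriv_le (a := fun x => quarticSum (A x) (B x))
    (fun x => hasDerivAt_quarticSum (hAd x) (hasDerivAt_rep hg' x)) hXd
    (fun x => abs_quarticSum_le (hAS x) (hS' x))
    (fun x => abs_quarticSumDeriv_le (hAS x) (hS' x) (hL (c * x)) (hL' x))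
    (by simp only [hA, quarticSumDeriv]; fun_prop) hX2 (hA2.sub hB2)
  refine h.trans ?_
  have hSn : 0 ≤ S := (abs_nonneg _).trans (hAS 0)
  have hLn : 0 ≤ L := (abs_nonneg _).trans (hL' 0)
  have h2 : ∫ x, X x ^ 2 ≤ ∫ η, ‖V η‖ ^ 2 := by
    rw [← integral_norm_sq_fourierInv hVI hV]
    refine integral_mono ((memLp_two_iff_integrable_sq hX2.1).1 hX2) (integrable_norm_sq hW2)
      fun x => ?_
    dsimp only
    rw [hX, ← sq_abs]
    exact pow_le_pow_left₀ (abs_nonneg _) (Complex.abs_re_le_norm _) 2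
  calc 20 * S ^ 3 * L / 2 * ∫ x, X x ^ 2 ≤ 20 * S ^ 3 * L / 2 * ∫ η, ‖V η‖ ^ 2 := by gcongr
    _ = _ := by ring

/-- The energy estimate for the antiderivative of `u_c - u`, where `u_c` is the dilated solution. -/
theorem sqrt_integral_dilation_le (hu : IsSolution u₀ u)
    (hx : MemLp (fun x => x * rep (u 0) x) 2) {c T : ℝ} (hc : 1 ≤ c) (hT : 0 ≤ T)
    (hH : MemLp (dilationDiff (rep (u 0)) c) 2) :
    √(∫ η, ‖(𝓕 (hH.toLp _) : Lp ℂ 2 (volume : Measure ℝ)) η +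
      ((c⁻¹ : ℝ) * duhamelIntegral u (c ^ 5 * T) (c⁻¹ * η) - duhamelIntegral u T η)‖ ^ 2) ≤
      (c - 1) * √(∫ x, (x * rep (u 0) x) ^ 2) * Real.exp (dilationExponent u c T) := by
  have huc := hu.continuousInH2
  have hu2 := huc.1
  have hc0 : 0 < c := by linarith
  have hci : 0 < c⁻¹ := inv_pos.2 hc0
  set w₀ : ℝ → ℂ := ((𝓕 (hH.toLp _) : Lp ℂ 2 (volume : Measure ℝ)) : ℝ → ℂ) with hw₀
  have hw₀L : MemLp w₀ 2 := Lp.memLp _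
  set w : ℝ → ℝ → ℂ := fun t η => w₀ η + ∫ s in (0 : ℝ)..t, dilationDensity u c s η with hw
  have hwe : ∀ t η, w t η = w₀ η +
      ((c⁻¹ : ℝ) * duhamelIntegral u (c ^ 5 * t) (c⁻¹ * η) - duhamelIntegral u t η) := fun t η => by
    rw [hw]; dsimp only; rw [integral_dilationDensity huc hc0]
  have hv1 : Integrable (rep (u 0)) := by
    have h1 : MemLp (fun x => (rep (u 0) x : ℂ)) 2 := (memLp_rep (hu2 0)).ofReal
    have h2 : MemLp (fun x : ℝ => (x : ℂ) * (rep (u 0) x : ℂ)) 2 := by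
      simpa using! hx.ofReal (K := ℂ)
    have := (integrable_of_memLp_weight h1 h2).1.re
    simpa using! this
  have hrc := continuous_rep (hu2 0)
  -- the initial datum
  have hinit : ∀ᵐ η : ℝ, 2 * Real.pi * Complex.I * η * w₀ η =
      hat (u 0) (c⁻¹ * η) - hat (u 0) η := by
    have hvc : Integrable fun x => (rep (u 0) x : ℂ) := hv1.ofReal
    have hv1c : Integrable fun x => (rep (u 0) (c * x) : ℂ) := hvc.comp_mul_left' hc0.ne'
    have hH' : Integrable fun x => (c : ℂ) * (rep (u 0) (c * x) : ℂ) - (rep (u 0) x : ℂ) :=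
      (hv1c.const_mul _).sub hvc
    have h1 := mul_fourier_toLp_ae (hasDerivAt_dilationDiff hrc c) hH hH'
    have h2 := hat_ae_fourier_rep (hu2 0) hv1
    have h3 := (quasiMeasurePreserving_mul_left hci.ne').ae h2
    filter_upwards [h1, h2, h3] with η h1 h2 h3
    rw [hw₀, h1, h2, h3, fourier_sub_apply (hv1c.const_mul _) hvc]
    congr 1
    have e3 : 𝓕 (fun x => (c : ℂ) * (rep (u 0) (c * x) : ℂ)) η =
        (c : ℂ) * 𝓕 (fun x => (rep (u 0) (c * x) : ℂ)) η := by
      rw [Real.fourier_eq, Real.fourier_eq, ← integral_const_mul]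
      congr 1; ext x
      rw [mul_smul_comm]
    rw [e3, fourier_comp_mul_left (fun x => (rep (u 0) x : ℂ)) hc0, ← mul_assoc,
      ← Complex.ofReal_mul, mul_inv_cancel₀ hc0.ne', Complex.ofReal_one, one_mul]
  -- Duhamel's formula at the times `t` and `c⁵ t`: undoing the propagator turns `w t` into the
  -- transform of a primitive of the dilated minus the original solution.
  have hwd : ∀ t, ∀ᵐ η : ℝ, 2 * Real.pi * Complex.I * η * (propagatorSymbol (-t) η * w t η) =
      hat (u (c ^ 5 * t)) (c⁻¹ * η) - hat (u t) η := fun t => by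
    have h1 := propagator_mul_hat_ae hu t
    have h2 := (quasiMeasurePreserving_mul_left hci.ne').ae (propagator_mul_hat_ae hu (c ^ 5 * t))
    filter_upwards [h1, h2, hinit] with η h1 h2 h3
    have hp : propagatorSymbol (-t) η * propagatorSymbol t η = 1 := by
      rw [← propagatorSymbol_add, neg_add_cancel, propagatorSymbol_zero]
    rw [propagatorSymbol_dilation hc0] at h2
    rw [hwe]
    push_cast at h2 ⊢
    linear_combination (propagatorSymbol (-t) η) * h3 + propagatorSymbol (-t) η * h1
      - propagatorSymbol (-t) η * h2 +
      (hat (u (c ^ 5 * t)) (c⁻¹ * η) - hat (u t) η) * hp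
  obtain ⟨M₁, hM₁0, hM₁⟩ : ∃ M, 0 ≤ M ∧ ∀ s ∈ Set.Icc 0 T, ∫ x, quinticDiff u c s x ^ 2 ≤ M := by
    have htc := continuous_tenthMoment huc
    have hcont : Continuous fun s => 2 * (c ^ 9 * tenthMoment u (c ^ 5 * s)) + 2 * tenthMoment u s := by
      fun_prop
    obtain ⟨M, hM⟩ := (isCompact_Icc (a := 0) (b := T)).bddAbove_image hcont.continuousOn
    refine ⟨M, ?_, fun s hs => le_trans ?_ (hM ⟨s, hs, rfl⟩)⟩
    · refine le_trans ?_ (hM ⟨0, Set.left_mem_Icc.2 hT, rfl⟩)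
      have h1 := tenthMoment_nonneg u (c ^ 5 * 0)
      have h2 := tenthMoment_nonneg u 0
      positivity
    · have hI : ∀ t, Integrable fun x => (rep (u t) x ^ 5) ^ 2 := fun t =>
        (memLp_two_iff_integrable_sq
          (memLp_pow_five (memLp_rep (hu2 t)) (abs_rep_le (hu2 t))).1).1
          (memLp_pow_five (memLp_rep (hu2 t)) (abs_rep_le (hu2 t)))
      have hIc : Integrable fun x => (rep (u (c ^ 5 * s)) (c * x) ^ 5) ^ 2 :=
        (hI (c ^ 5 * s)).comp_mul_left' hc0.ne'
      have hq := (integrable_quinticDiff huc hc0 s).2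
      have e : c ^ 9 * tenthMoment u (c ^ 5 * s) =
          ∫ x, c ^ 10 * (rep (u (c ^ 5 * s)) (c * x) ^ 5) ^ 2 := by
        rw [integral_const_mul, Measure.integral_comp_mul_left
          (fun x => (rep (u (c ^ 5 * s)) x ^ 5) ^ 2), abs_of_pos hci, smul_eq_mul, tenthMoment]
        field_simp
      dsimp only
      rw [e, tenthMoment, ← integral_const_mul, ← integral_const_mul,
        ← integral_add ((hIc.const_mul _).const_mul 2) ((hI s).const_mul 2)]
      refine integral_mono ((memLp_two_iff_integrable_sq hq.1).1 hq)
        (((hIc.const_mul _).const_mul 2).add ((hI s).const_mul 2)) fun x => ?_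
      dsimp only
      rw [quinticDiff]
      nlinarith [sq_nonneg ((c * rep (u (c ^ 5 * s)) (c * x)) ^ 5 + rep (u s) x ^ 5)]
  have hs0c := continuous_supRep huc
  have hs1c := continuous_supDeriv huc
  have hpn : ∀ s η, (starRingEnd ℂ) (propagatorSymbol s η) = propagatorSymbol (-s) η := fun s η => by
    rw [propagatorSymbol_eq, propagatorSymbol_eq, ← Complex.exp_conj]
    congr 1
    simp only [map_mul, Complex.conj_I, Complex.conj_ofReal]
    push_cast; ring
  have hbig : ∀ s, 0 ≤ max (supRep u s) (c * supRep u (c ^ 5 * s)) := fun s =>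
    (supRep_nonneg u s).trans (le_max_left _ _)
  have hbig' : ∀ s, 0 ≤ max (supDeriv u s) (c ^ 2 * supDeriv u (c ^ 5 * s)) := fun s =>
    (supDeriv_nonneg u s).trans (le_max_left _ _)
  have hgL : ∀ s ∈ Set.Icc 0 T, MemLp (dilationDensity u c s) 2 ∧
      ∫ x, ‖dilationDensity u c s x‖ ^ 2 ≤ M₁ := fun s hs => by
    obtain ⟨hq1, hq2⟩ := integrable_quinticDiff huc hc0 s
    obtain ⟨h1, h2⟩ := memLp_fourier_mul_propagator hq1 hq2 s (-(1 / 5))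
    have e : dilationDensity u c s = fun η => -(1 / 5) * propagatorSymbol s η *
        𝓕 (fun x => (quinticDiff u c s x : ℂ)) η := funext (dilationDensity_eq huc hc0 s)
    rw [e]
    refine ⟨h1, h2.le.trans ?_⟩
    have h3 := hM₁ s hs
    have h4 : ‖(-(1 / 5) : ℂ)‖ ^ 2 ≤ 1 := by norm_num
    calc _ ≤ 1 * M₁ := mul_le_mul h4 h3 (integral_nonneg fun x => sq_nonneg _) zero_le_one
      _ = M₁ := one_mul _
  have hwL : ∀ t ∈ Set.Icc 0 T, MemLp (w t) 2 := fun t ht =>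
    hw₀L.add (memLp_intervalIntegral ht.1 (continuous_dilationDensity huc c)
      fun s hs => hgL s ⟨hs.1, hs.2.trans ht.2⟩).1
  have key := integral_norm_sq_le_of_energy (w := w) (M := M₁)
    (β := fun s => 2 * (2 * max (supRep u s) (c * supRep u (c ^ 5 * s)) ^ 3 *
      max (supDeriv u s) (c ^ 2 * supDeriv u (c ^ 5 * s)))) hT hw₀L
    (continuous_dilationDensity huc c) hgL (fun t x => rfl) (by fun_prop) (fun s => by
      have := hbig s
      have := hbig' s
      positivity) (fun s hs => by
      have hwm : MemLp (fun η => propagatorSymbol (-s) η * w s η) 2 :=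
        (memLp_congr_norm (Continuous.aestronglyMeasurable (by
          unfold propagatorSymbol; fun_prop) |>.mul (hwL s hs).1) (hwL s hs).1
          (ae_of_all _ fun η => by
            rw [Pi.mul_apply, norm_mul, norm_propagatorSymbol, one_mul])).2 (hwL s hs)
      have h1 := abs_re_integral_conj_mul_quinticDiff_le huc hc0 hwm (hwd s)
        (S := max (supRep u s) (c * supRep u (c ^ 5 * s)))
        (L := max (supDeriv u s) (c ^ 2 * supDeriv u (c ^ 5 * s)))
        (fun x => by
          rw [abs_mul, abs_of_pos hc0]
          exact (mul_le_mul_of_nonneg_left (abs_rep_le_supRep huc _ x) hc0.le).trans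
            (le_max_right _ _))
        (fun x => (abs_rep_le_supRep huc s x).trans (le_max_left _ _))
        (fun x => by
          rw [abs_mul, abs_of_pos (pow_pos hc0 2)]
          exact (mul_le_mul_of_nonneg_left (abs_repDeriv_le_supDeriv huc _ x)
            (pow_pos hc0 2).le).trans (le_max_right _ _))
        (fun x => (abs_repDeriv_le_supDeriv huc s x).trans (le_max_left _ _))
      have e1 : ∫ η, (starRingEnd ℂ) (w s η) * dilationDensity u c s η = ((-(1 / 5) : ℝ) : ℂ) *
          ∫ η, (starRingEnd ℂ) (propagatorSymbol (-s) η * w s η) *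
            𝓕 (fun x => (quinticDiff u c s x : ℂ)) η := by
        rw [← integral_const_mul]
        refine integral_congr_ae (ae_of_all _ fun η => ?_)
        dsimp only
        rw [dilationDensity_eq huc hc0, map_mul, hpn, neg_neg]
        push_cast; ring
      have e2 : ∫ η, ‖propagatorSymbol (-s) η * w s η‖ ^ 2 = ∫ η, ‖w s η‖ ^ 2 := by
        simp only [norm_mul, norm_propagatorSymbol, one_mul]
      rw [e2] at h1
      rw [e1, Complex.re_ofReal_mul]
      have h2 := neg_abs_le (∫ η, (starRingEnd ℂ) (propagatorSymbol (-s) η * w s η) *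
            𝓕 (fun x => (quinticDiff u c s x : ℂ)) η).re
      linarith)
  have hini : ∫ η, ‖w₀ η‖ ^ 2 = ∫ x, ‖dilationDiff (rep (u 0)) c x‖ ^ 2 := by
    rw [hw₀, integral_norm_sq_Lp, Lp.norm_fourier_eq, ← integral_norm_sq_Lp]
    refine integral_congr_ae ?_
    filter_upwards [hH.coeFn_toLp] with x hx
    rw [hx]
  -- The energy rate was twice the density of `dilationExponent`; the square root removes the factor
  -- two.
  have hfin : √(∫ η, ‖w T η‖ ^ 2) ≤ √(∫ η, ‖w₀ η‖ ^ 2) * Real.exp (dilationExponent u c T) := by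
    refine Real.sqrt_le_iff.2 ⟨by positivity, ?_⟩
    rw [mul_pow, Real.sq_sqrt (integral_nonneg fun η => by positivity), ← Real.exp_nat_mul]
    refine key.trans (le_of_eq ?_)
    congr 2
    rw [intervalIntegral.integral_const_mul, dilationExponent]
    norm_num
  simp only [hwe] at hfin
  refine hfin.trans (mul_le_mul_of_nonneg_right ?_ (Real.exp_pos _).le)
  rw [hini]
  exact (memLp_dilationDiff hrc hx hc).2

end FifthKdV
end

noncomputable section
namespace FifthKdV

/-! ### The weighted estimate for the profile -/

variable {u : ℝ → Lp ℝ 2 (volume : Measure ℝ)} {u₀ : Lp ℝ 2 (volume : Measure ℝ)}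

/-- The continuous representative of the profile. -/
def profileRep (u : ℝ → Lp ℝ 2 (volume : Measure ℝ)) (t x : ℝ) : ℂ :=
  𝓕⁻ (fun η => propagatorSymbol t η * hat (u t) η) x

theorem continuous_propagatorSymbol_right (t : ℝ) : Continuous fun η => propagatorSymbol t η := by
  unfold propagatorSymbol; fun_prop

theorem integrable_propagator_mul_hat (hu : ContinuousInH2 u) (t : ℝ) :
    Integrable fun η => propagatorSymbol t η * hat (u t) η :=
  (integrable_hat (hu.1 t)).bdd_mul (c := 1) (continuous_propagatorSymbol_right t).aestronglyMeasurable
    (ae_of_all _ fun η => (norm_propagatorSymbol t η).le)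

theorem memLp_propagator_mul_hat (u : ℝ → Lp ℝ 2 (volume : Measure ℝ)) (t : ℝ) :
    MemLp (fun η => propagatorSymbol t η * hat (u t) η) 2 :=
  memLp_propagatorSymbol_mul t _

theorem profile_ae (hu : ContinuousInH2 u) (t : ℝ) : profile u t =ᵐ[volume] profileRep u t :=
  fourierInv_toLp_ae (integrable_propagator_mul_hat hu t) (memLp_propagator_mul_hat u t)

theorem memLp_profileRep (hu : ContinuousInH2 u) (t : ℝ) : MemLp (profileRep u t) 2 :=
  memLp_fourierInv (integrable_propagator_mul_hat hu t) (memLp_propagator_mul_hat u t)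

theorem continuous_profileRep (hu : ContinuousInH2 u) (t : ℝ) : Continuous (profileRep u t) :=
  continuous_fourierInv (integrable_propagator_mul_hat hu t)

theorem exists_duhamelDensity_bound (hu : ContinuousInH2 u) (a b : ℝ) :
    ∃ M, ∀ s ∈ Set.Icc a b, MemLp (duhamelDensity u s) 2 ∧
      ∫ x, ‖duhamelDensity u s x‖ ^ 2 ≤ M := by
  obtain ⟨M, hM⟩ := (isCompact_Icc (a := a) (b := b)).bddAbove_image
    (continuous_tenthMoment hu).continuousOn
  refine ⟨1 / 25 * M, fun s hs => ?_⟩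
  obtain ⟨h1, h2⟩ := memLp_duhamelDensity hu s
  refine ⟨h1, h2.le.trans ?_⟩
  have := hM ⟨s, hs, rfl⟩
  gcongr

theorem memLp_duhamelIntegral (hu : ContinuousInH2 u) {T : ℝ} (hT : 0 ≤ T) :
    MemLp (duhamelIntegral u T) 2 := by
  obtain ⟨M, hM⟩ := exists_duhamelDensity_bound hu 0 T
  exact (memLp_intervalIntegral (g := duhamelDensity u) hT (continuous_duhamelDensity hu) hM).1

theorem integrable_mul_duhamelIntegral (hu : IsSolution u₀ u) (T : ℝ) :
    Integrable fun η : ℝ => 2 * Real.pi * Complex.I * η * duhamelIntegral u T η := by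
  have huc := hu.continuousInH2
  refine ((integrable_propagator_mul_hat huc T).sub (integrable_hat (huc.1 0))).congr ?_
  filter_upwards [propagator_mul_hat_ae hu T] with η h
  rw [Pi.sub_apply, h]; ring

theorem integrable_duhamelIntegral (hu : IsSolution u₀ u) {T : ℝ} (hT : 0 ≤ T) :
    Integrable (duhamelIntegral u T) :=
  integrable_of_integrable_mul (memLp_duhamelIntegral hu.continuousInH2 hT)
    (integrable_mul_duhamelIntegral hu T)

theorem hasDerivAt_fourierInv_duhamelIntegral (hu : IsSolution u₀ u) {T : ℝ} (hT : 0 ≤ T) (x : ℝ) :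
    HasDerivAt (𝓕⁻ (duhamelIntegral u T)) (profileRep u T x - (rep (u 0) x : ℂ)) x := by
  have huc := hu.continuousInH2
  refine (hasDerivAt_fourierInv (integrable_duhamelIntegral hu hT)
    (integrable_mul_duhamelIntegral hu T) x).congr_deriv ?_
  have e : (fun η : ℝ => 2 * Real.pi * Complex.I * η * duhamelIntegral u T η) =ᵐ[volume]
      fun η => propagatorSymbol T η * hat (u T) η - hat (u 0) η := by
    filter_upwards [propagator_mul_hat_ae hu T] with η h
    rw [h]; ring
  rw [Real.fourierInv_congr_ae e, fourierInv_sub_apply (integrable_propagator_mul_hat huc T)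
    (integrable_hat (huc.1 0)), ofReal_rep (huc.1 0), profileRep]

theorem sqrt_integral_norm_sq_const_mul {c : ℝ} (hc : 0 ≤ c) (f : ℝ → ℂ) :
    √(∫ x, ‖(c : ℂ) * f x‖ ^ 2) = c * √(∫ x, ‖f x‖ ^ 2) := by
  simp only [norm_mul, mul_pow, Complex.norm_real, Real.norm_of_nonneg hc]
  rw [integral_const_mul, Real.sqrt_mul (sq_nonneg _), Real.sqrt_sq hc]

/-- The difference between a primitive of the profile and its dilation. -/
def profileDilationDiff (u : ℝ → Lp ℝ 2 (volume : Measure ℝ)) (T c x : ℝ) : ℂ :=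
  dilationDiff (rep (u 0)) c x + (𝓕⁻ (duhamelIntegral u T) (c * x) - 𝓕⁻ (duhamelIntegral u T) x)

/-- The quantity is the integral of `f(T)` from `x` to `c x`. The energy estimate compares the
dilated solution at time `c⁵ T` with the original at `T`; here both profiles are taken at `T`, so a
Duhamel increment over `[T, c⁵ T]` appears, bounded by Cauchy–Schwarz in time. -/
theorem sqrt_integral_profileDilationDiff_le (hu : IsSolution u₀ u)
    (hx : MemLp (fun x => x * rep (u 0) x) 2) {c T : ℝ} (hc : 1 ≤ c) (hT : 0 ≤ T) :
    MemLp (profileDilationDiff u T c) 2 ∧ √(∫ x, ‖profileDilationDiff u T c x‖ ^ 2) ≤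
      (c - 1) * √(∫ x, (x * rep (u 0) x) ^ 2) * Real.exp (dilationExponent u c T) +
      √((c ^ 5 * T - T) * ∫ s in T..c ^ 5 * T, 1 / 25 * tenthMoment u s) := by
  have huc := hu.continuousInH2
  have hc0 : 0 < c := by linarith
  have hci : 0 < c⁻¹ := inv_pos.2 hc0
  set P := duhamelIntegral u T with hP
  set P' := duhamelIntegral u (c ^ 5 * T) with hP'
  have hT' : 0 ≤ c ^ 5 * T := by positivity
  have hTT : T ≤ c ^ 5 * T := by
    have : 1 ≤ c ^ 5 := one_le_pow₀ hc
    nlinarith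
  have hPI : Integrable P := integrable_duhamelIntegral hu hT
  have hP2 : MemLp P 2 := memLp_duhamelIntegral huc hT
  have hP'2 : MemLp P' 2 := memLp_duhamelIntegral huc hT'
  have hrc := continuous_rep (huc.1 0)
  have hH := (memLp_dilationDiff hrc hx hc).1
  set D : ℝ → ℂ := fun η => ((c⁻¹ : ℝ) : ℂ) * P (c⁻¹ * η) - P η with hD
  have hPcI : Integrable fun η => ((c⁻¹ : ℝ) : ℂ) * P (c⁻¹ * η) :=
    (hPI.comp_mul_left' hci.ne').const_mul _
  have hPc2 : MemLp (fun η => ((c⁻¹ : ℝ) : ℂ) * P (c⁻¹ * η)) 2 :=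
    (memLp_comp_mul_left hci.ne' hP2).const_mul _
  have hP'c2 : MemLp (fun η => ((c⁻¹ : ℝ) : ℂ) * P' (c⁻¹ * η)) 2 :=
    (memLp_comp_mul_left hci.ne' hP'2).const_mul _
  have hDI : Integrable D := hPcI.sub hPI
  have hD2 : MemLp D 2 := hPc2.sub hP2
  have hDinv : ∀ x, 𝓕⁻ D x = 𝓕⁻ P (c * x) - 𝓕⁻ P x := fun x => by
    rw [hD, fourierInv_sub_apply hPcI hPI]
    congr 1
    have e : 𝓕⁻ (fun η => ((c⁻¹ : ℝ) : ℂ) * P (c⁻¹ * η)) x =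
        ((c⁻¹ : ℝ) : ℂ) * 𝓕⁻ (fun η => P (c⁻¹ * η)) x := by
      rw [Real.fourierInv_eq, Real.fourierInv_eq, ← integral_const_mul]
      congr 1; ext y
      rw [mul_smul_comm]
    rw [e, fourierInv_comp_mul_left P hci, inv_inv, ← mul_assoc, ← Complex.ofReal_mul,
      inv_mul_cancel₀ hc0.ne', Complex.ofReal_one, one_mul]
  have hE : profileDilationDiff u T c = fun x => dilationDiff (rep (u 0)) c x + 𝓕⁻ D x := by
    ext x; rw [hDinv]; rfl
  have hDi2 := memLp_fourierInv hDI hD2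
  have hm : MemLp (profileDilationDiff u T c) 2 := by rw [hE]; exact hH.add hDi2
  refine ⟨hm, ?_⟩
  set w₀ : Lp ℂ 2 (volume : Measure ℝ) := 𝓕 (hH.toLp _) with hw₀
  have hw₀2 : MemLp w₀ 2 := Lp.memLp _
  -- pass to the Fourier side
  have e1 : ∫ x, ‖profileDilationDiff u T c x‖ ^ 2 = ∫ η, ‖w₀ η + D η‖ ^ 2 := by
    have h1 : ∫ x, ‖profileDilationDiff u T c x‖ ^ 2 =
        ‖hH.toLp _ + (𝓕⁻ (hD2.toLp D) : Lp ℂ 2 (volume : Measure ℝ))‖ ^ 2 := by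
      rw [← integral_norm_sq_Lp]
      refine integral_congr_ae ?_
      filter_upwards [Lp.coeFn_add (hH.toLp _) (𝓕⁻ (hD2.toLp D) : Lp ℂ 2 (volume : Measure ℝ)),
        hH.coeFn_toLp, fourierInv_toLp_ae hDI hD2] with x h1 h2 h3
      rw [h1, Pi.add_apply, h2, h3, hE]
    have h2 : (𝓕 (hH.toLp _ + (𝓕⁻ (hD2.toLp D) : Lp ℂ 2 (volume : Measure ℝ))) :
        Lp ℂ 2 (volume : Measure ℝ)) = w₀ + hD2.toLp D := by
      have := (Lp.fourierTransformₗᵢ ℝ ℂ).map_add (hH.toLp _)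
        (𝓕⁻ (hD2.toLp D) : Lp ℂ 2 (volume : Measure ℝ))
      refine Eq.trans this ?_
      congr 1
      have h : (𝓕 (𝓕⁻ (hD2.toLp D) : Lp ℂ 2 (volume : Measure ℝ)) :
          Lp ℂ 2 (volume : Measure ℝ)) = hD2.toLp D :=
        FourierTransform.fourier_fourierInv_eq _
      exact h
    rw [h1, ← Lp.norm_fourier_eq, h2, ← integral_norm_sq_Lp]
    refine integral_congr_ae ?_
    filter_upwards [Lp.coeFn_add w₀ (hD2.toLp D), hD2.coeFn_toLp] with η h1 h2
    rw [h1, Pi.add_apply, h2]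
  set R : ℝ → ℂ := fun η => P' η - P η with hR
  have hR2 : MemLp R 2 := hP'2.sub hP2
  have hRc2 : MemLp (fun η => ((-c⁻¹ : ℝ) : ℂ) * R (c⁻¹ * η)) 2 :=
    (memLp_comp_mul_left hci.ne' hR2).const_mul _
  -- The first bracket is the quantity of the energy estimate; the last term is the rescaled Duhamel
  -- increment.
  have e2 : ∀ η, w₀ η + D η = (w₀ η + (((c⁻¹ : ℝ) : ℂ) * P' (c⁻¹ * η) - P η)) +
      ((-c⁻¹ : ℝ) : ℂ) * R (c⁻¹ * η) := fun η => by
    simp only [hD, hR]; push_cast; ring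
  rw [e1]
  simp_rw [e2]
  refine (sqrt_integral_norm_sq_add_le (hw₀2.add (hP'c2.sub hP2)) hRc2).trans (add_le_add ?_ ?_)
  · exact sqrt_integral_dilation_le hu hx hc hT hH
  · have e3 : ∫ η, ‖((-c⁻¹ : ℝ) : ℂ) * R (c⁻¹ * η)‖ ^ 2 = c⁻¹ * ∫ η, ‖R η‖ ^ 2 := by
      have : ∀ η, ‖((-c⁻¹ : ℝ) : ℂ) * R (c⁻¹ * η)‖ ^ 2 = c⁻¹ ^ 2 * ‖R (c⁻¹ * η)‖ ^ 2 := fun η => by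
        rw [norm_mul, mul_pow, Complex.norm_real, Real.norm_eq_abs, sq_abs, neg_sq]
      simp_rw [this]
      rw [integral_const_mul, integral_norm_sq_comp_mul_left hci, inv_inv]
      field_simp
    rw [e3]
    refine Real.sqrt_le_sqrt ?_
    have hR0 : 0 ≤ ∫ η, ‖R η‖ ^ 2 := integral_nonneg fun η => by positivity
    have h1 : c⁻¹ * ∫ η, ‖R η‖ ^ 2 ≤ ∫ η, ‖R η‖ ^ 2 :=
      mul_le_of_le_one_left hR0 (inv_le_one_of_one_le₀ hc)
    refine h1.trans ?_
    obtain ⟨M, hM⟩ := exists_duhamelDensity_bound huc T (c ^ 5 * T)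
    have h2 := (memLp_intervalIntegral_of_bound (g := duhamelDensity u) hTT (continuous_duhamelDensity huc) hM).2.1
    simp_rw [(memLp_duhamelDensity huc _).2] at h2
    refine le_trans (le_of_eq ?_) h2
    refine integral_congr_ae (ae_of_all _ fun η => ?_)
    have hcs : Continuous fun s => duhamelDensity u s η :=
      (continuous_duhamelDensity huc).comp (g := fun z : ℝ × ℝ => duhamelDensity u z.1 z.2)
        (f := fun s : ℝ => (s, η)) (by fun_prop)
    simp only [hR, hP, hP', duhamelIntegral]
    rw [intervalIntegral.integral_interval_sub_left (hcs.intervalIntegrable _ _)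
      (hcs.intervalIntegrable _ _)]

theorem continuous_dilationExponent (hu : ContinuousInH2 u) (T : ℝ) :
    Continuous fun c => dilationExponent u c T := by
  have hs0c := continuous_supRep hu
  have hs1c := continuous_supDeriv hu
  refine intervalIntegral.continuous_parametric_intervalIntegral_of_continuous' ?_ 0 T
  change Continuous fun z : ℝ × ℝ => 2 * max (supRep u z.2) (z.1 * supRep u (z.1 ^ 5 * z.2)) ^ 3 *
    max (supDeriv u z.2) (z.1 ^ 2 * supDeriv u (z.1 ^ 5 * z.2))
  fun_prop

/-- The derivative at `c = 1` of the integral of `f` from `x` to `c x` is `x f(x)`. Dividing the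
dilation estimate by `c - 1` and applying Fatou along `c = 1 + 1/(n+1)` therefore bounds `x f`, and
also proves that it is square integrable. This replaces a commutator argument with the scaling
field. -/
theorem memLp_mul_profileRep (hu : IsSolution u₀ u) (hx : MemLp (fun x => x * rep (u 0) x) 2)
    {T : ℝ} (hT : 0 ≤ T) :
    MemLp (fun x : ℝ => (x : ℂ) * profileRep u T x) 2 ∧
      √(∫ x : ℝ, ‖(x : ℂ) * profileRep u T x‖ ^ 2) ≤
        √(∫ x, (x * rep (u 0) x) ^ 2) * Real.exp (energyExponent u T) +
        T * √(tenthMoment u T) := by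
  have huc := hu.continuousInH2
  have hrc := continuous_rep (huc.1 0)
  set X := √(∫ x, (x * rep (u 0) x) ^ 2) with hX
  set c : ℕ → ℝ := fun n => 1 + 1 / ((n : ℝ) + 1) with hc
  have hd0 : ∀ n : ℕ, 0 < 1 / ((n : ℝ) + 1) := fun n => by positivity
  have hc1 : ∀ n, 1 ≤ c n := fun n => by
    have := hd0 n
    simp only [hc]; linarith
  have hdlim : Tendsto (fun n : ℕ => 1 / ((n : ℝ) + 1)) atTop (𝓝[>] 0) :=
    tendsto_nhdsWithin_iff.2 ⟨tendsto_one_div_add_atTop_nhds_zero_nat, Eventually.of_forall hd0⟩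
  have hclim : Tendsto c atTop (𝓝 1) := by
    have := (tendsto_one_div_add_atTop_nhds_zero_nat (𝕜 := ℝ)).const_add (1 : ℝ)
    rwa [add_zero] at this
  -- difference quotients
  have hslope : ∀ {E : Type} [NormedAddCommGroup E] [NormedSpace ℝ E] {f : ℝ → E} {f' : E},
      HasDerivAt f f' 1 → f 1 = 0 →
      Tendsto (fun n : ℕ => (1 / ((n : ℝ) + 1))⁻¹ • f (c n)) atTop (𝓝 f') := by
    intro E _ _ f f' hf hf1
    have := hf.tendsto_slope_zero_right.comp hdlim
    simpa only [Function.comp_def, hf1, sub_zero] using this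
  set a : ℕ → ℝ := fun n => (1 / ((n : ℝ) + 1))⁻¹ with ha
  have ha0 : ∀ n, 0 < a n := fun n => inv_pos.2 (hd0 n)
  have hac : ∀ n, a n * (c n - 1) = 1 := fun n => by
    simp only [ha, hc, add_sub_cancel_left]
    exact inv_mul_cancel₀ (hd0 n).ne'
  have hT5 : HasDerivAt (fun c : ℝ => c ^ 5 * T - T) (5 * T) 1 := by
    have := (((hasDerivAt_id (1 : ℝ)).pow 5).mul_const T).sub_const T
    refine this.congr_deriv ?_
    simp
  have htm := continuous_tenthMoment huc
  have hint : HasDerivAt (fun c : ℝ => ∫ s in T..c ^ 5 * T, 1 / 25 * tenthMoment u s)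
      (1 / 25 * tenthMoment u T * (5 * T)) 1 := by
    have hcont : Continuous fun s => 1 / 25 * tenthMoment u s := continuous_const.mul htm
    have h1 : HasDerivAt (fun z => ∫ s in T..z, 1 / 25 * tenthMoment u s)
        (1 / 25 * tenthMoment u T) ((1 : ℝ) ^ 5 * T) := by
      rw [one_pow, one_mul]
      exact intervalIntegral.integral_hasDerivAt_right (hcont.intervalIntegrable T T)
        (hcont.stronglyMeasurableAtFilter _ _) hcont.continuousAt
    have h2 : HasDerivAt (fun c : ℝ => c ^ 5 * T) (5 * T) 1 := by
      refine (((hasDerivAt_id (1 : ℝ)).pow 5).mul_const T).congr_deriv ?_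
      simp
    exact h1.comp 1 h2
  refine memLp_of_tendsto (f := fun n x => (a n : ℂ) * profileDilationDiff u T (c n) x)
    (B := fun n => X * Real.exp (dilationExponent u (c n) T) +
      √((a n • ((c n) ^ 5 * T - T)) * (a n • ∫ s in T..(c n) ^ 5 * T, 1 / 25 * tenthMoment u s)))
    (fun n => (sqrt_integral_profileDilationDiff_le hu hx (hc1 n) hT).1.const_mul _)
    (Complex.continuous_ofReal.mul (continuous_profileRep huc T)).aestronglyMeasurable
    (fun x => ?_) (fun n => ?_) ?_
  · have hd : HasDerivAt (fun c => profileDilationDiff u T c x) ((x : ℂ) * profileRep u T x) 1 := by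
      have h1 : HasDerivAt (fun c : ℝ => c * x) x 1 := by
        simpa using (hasDerivAt_id (1 : ℝ)).mul_const x
      have h2 : HasDerivAt (fun c => 𝓕⁻ (duhamelIntegral u T) (c * x))
          (x • (profileRep u T x - (rep (u 0) x : ℂ))) 1 := by
        have h3 := hasDerivAt_fourierInv_duhamelIntegral hu hT (1 * x)
        have h4 := HasDerivAt.scomp (1 : ℝ) h3 h1
        rw [one_mul] at h4
        exact h4
      have h5 : HasDerivAt (fun c => dilationDiff (rep (u 0)) c x) ((rep (u 0) x * x : ℝ) : ℂ) 1 := by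
        have h6 : HasDerivAt (fun z => ∫ y in x..z, rep (u 0) y) (rep (u 0) x) (1 * x) := by
          rw [one_mul]
          exact intervalIntegral.integral_hasDerivAt_right (hrc.intervalIntegrable _ _)
            (hrc.stronglyMeasurableAtFilter _ _) hrc.continuousAt
        exact (h6.comp (1 : ℝ) h1).ofReal_comp
      refine (h5.add (h2.sub_const (𝓕⁻ (duhamelIntegral u T) x))).congr_deriv ?_
      rw [Complex.real_smul]; push_cast; ring
    have h1 := hslope hd (by simp [profileDilationDiff, dilationDiff])
    simpa only [Complex.real_smul] using h1
  · have h := (sqrt_integral_profileDilationDiff_le hu hx (hc1 n) hT).2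
    rw [sqrt_integral_norm_sq_const_mul (ha0 n).le]
    refine (mul_le_mul_of_nonneg_left h (ha0 n).le).trans (le_of_eq ?_)
    rw [mul_add]
    congr 1
    · rw [← mul_assoc, ← mul_assoc, hac, one_mul]
    · rw [smul_eq_mul, smul_eq_mul]
      have e : a n * (c n ^ 5 * T - T) * (a n * ∫ s in T..c n ^ 5 * T, 1 / 25 * tenthMoment u s) =
          a n ^ 2 * ((c n ^ 5 * T - T) * ∫ s in T..c n ^ 5 * T, 1 / 25 * tenthMoment u s) := by ring
      rw [e, Real.sqrt_mul (sq_nonneg _), Real.sqrt_sq (ha0 n).le]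
  · have h1 := ((continuous_dilationExponent huc T).tendsto 1).comp hclim
    have e1 : dilationExponent u 1 T = energyExponent u T := by
      simp [dilationExponent, energyExponent]
    rw [e1] at h1
    have h2 := (hslope hT5 (by simp)).mul (hslope hint (by simp))
    -- Both the length `c⁵ T - T` and the time integral have slope proportional to `5 T` at `c = 1`,
    -- which cancels the `1/25`.
    have e2 : T * √(tenthMoment u T) = √(5 * T * (1 / 25 * tenthMoment u T * (5 * T))) := by
      have : 5 * T * (1 / 25 * tenthMoment u T * (5 * T)) = T ^ 2 * tenthMoment u T := by ring
      rw [this, Real.sqrt_mul (sq_nonneg _), Real.sqrt_sq hT]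
    rw [e2]
    exact ((Real.continuous_exp.tendsto _).comp h1 |>.const_mul X).add
      ((Real.continuous_sqrt.tendsto _).comp h2)

end FifthKdV
end

noncomputable section
namespace FifthKdV

/-! ### The Fourier transform of the profile as a continuous function -/

variable {u : ℝ → Lp ℝ 2 (volume : Measure ℝ)} {u₀ : Lp ℝ 2 (volume : Measure ℝ)}

/-- The continuous representative of the Fourier transform of the profile. -/
def profileF (u : ℝ → Lp ℝ 2 (volume : Measure ℝ)) (t η : ℝ) : ℂ :=
  𝓕 (fun x => (rep (u 0) x : ℂ)) η + 2 * Real.pi * Complex.I * η * duhamelIntegral u t η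

theorem memLp_ofReal_mul_rep {g : Lp ℝ 2 (volume : Measure ℝ)}
    (hx : MemLp (fun x => x * rep g x) 2) :
    MemLp (fun x : ℝ => (x : ℂ) * (rep g x : ℂ)) 2 := by
  have := hx.ofReal (K := ℂ)
  refine this.ae_eq (ae_of_all _ fun x => ?_)
  change ((x * rep g x : ℝ) : ℂ) = _
  push_cast; rfl

theorem integrable_rep {g : Lp ℝ 2 (volume : Measure ℝ)} (hg : h2Norm g < ⊤)
    (hx : MemLp (fun x => x * rep g x) 2) :
    Integrable (rep g) ∧ ∫ x, |rep g x| ≤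
      √Real.pi * (√(∫ x, rep g x ^ 2) + √(∫ x, (x * rep g x) ^ 2)) := by
  have hm : MemLp (fun x => (rep g x : ℂ)) 2 := (memLp_rep hg).ofReal
  obtain ⟨h1, h2⟩ := integrable_of_memLp_weight hm (memLp_ofReal_mul_rep hx)
  simp only [norm_mul, Complex.norm_real, Real.norm_eq_abs, sq_abs, mul_pow] at h2
  refine ⟨?_, by simpa only [mul_pow] using h2⟩
  simpa using! h1.re

theorem integrable_profileRep (hu : IsSolution u₀ u) (hx : MemLp (fun x => x * rep (u 0) x) 2)
    {T : ℝ} (hT : 0 ≤ T) : Integrable (profileRep u T) :=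
  (integrable_of_memLp_weight (memLp_profileRep hu.continuousInH2 T)
    (memLp_mul_profileRep hu hx hT).1).1

theorem integrable_profile (hu : IsSolution u₀ u) (hx : MemLp (fun x => x * rep (u 0) x) 2)
    {T : ℝ} (hT : 0 ≤ T) : Integrable (profile u T) :=
  (integrable_profileRep hu hx hT).congr (profile_ae hu.continuousInH2 T).symm

theorem continuous_profileF (hu : ContinuousInH2 u) (hi : Integrable (rep (u 0))) :
    Continuous fun z : ℝ × ℝ => profileF u z.1 z.2 := by
  have h1 := continuous_fourier hi.ofReal (f := fun x => (rep (u 0) x : ℂ))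
  have h2 := continuous_duhamelIntegral hu
  have h3 : Continuous fun z : ℝ × ℝ => 𝓕 (fun x => (rep (u 0) x : ℂ)) z.2 :=
    h1.comp continuous_snd
  unfold profileF
  exact h3.add ((by fun_prop : Continuous fun z : ℝ × ℝ =>
    2 * Real.pi * Complex.I * (z.2 : ℂ)).mul h2)

theorem continuous_profileF_right (hu : ContinuousInH2 u) (hi : Integrable (rep (u 0))) (t : ℝ) :
    Continuous (profileF u t) :=
  (continuous_profileF hu hi).comp (g := fun z : ℝ × ℝ => profileF u z.1 z.2)
    (f := fun η : ℝ => (t, η)) (by fun_prop)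

theorem hasDerivAt_profileF (hu : ContinuousInH2 u) (t η : ℝ) :
    HasDerivAt (fun s => profileF u s η)
      (2 * Real.pi * Complex.I * η * duhamelDensity u t η) t :=
  ((hasDerivAt_duhamelIntegral hu t η).const_mul _).const_add _

theorem propagator_mul_hat_ae_profileF (hu : IsSolution u₀ u) (hi : Integrable (rep (u 0)))
    (t : ℝ) : ∀ᵐ η, propagatorSymbol t η * hat (u t) η = profileF u t η := by
  filter_upwards [propagator_mul_hat_ae hu t, hat_ae_fourier_rep (hu.continuousInH2.1 0) hi]
    with η h1 h2
  rw [h1, profileF, h2]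

theorem fourier_fourierInv_ae {G : ℝ → ℂ} (hG : Integrable G) (hG2 : MemLp G 2)
    (hf : Integrable (𝓕⁻ G)) : 𝓕 (𝓕⁻ G) =ᵐ[volume] G := by
  have hf2 := memLp_fourierInv hG hG2
  have e : hf2.toLp (𝓕⁻ G) = (𝓕⁻ (hG2.toLp G) : Lp ℂ 2 (volume : Measure ℝ)) := by
    refine Lp.ext ?_
    filter_upwards [hf2.coeFn_toLp, fourierInv_toLp_ae hG hG2] with x h1 h2
    rw [h1, h2]
  have e2 : (𝓕 (𝓕⁻ (hG2.toLp G) : Lp ℂ 2 (volume : Measure ℝ)) :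
      Lp ℂ 2 (volume : Measure ℝ)) = hG2.toLp G :=
    FourierTransform.fourier_fourierInv_eq _
  have h3 := fourier_toLp_ae hf hf2
  rw [e, e2] at h3
  exact h3.symm.trans hG2.coeFn_toLp

/-- Fourier inversion gives equality almost everywhere, and both sides are continuous. The pointwise
identity is needed because the conclusions concern every `ξ`. -/
theorem fourier_profileRep (hu : IsSolution u₀ u) (hx : MemLp (fun x => x * rep (u 0) x) 2)
    {T : ℝ} (hT : 0 ≤ T) : 𝓕 (profileRep u T) = profileF u T := by
  have huc := hu.continuousInH2
  have hi := (integrable_rep (huc.1 0) hx).1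
  have hf := integrable_profileRep hu hx hT
  have hc := continuous_profileF_right huc hi T
  refine (Continuous.ae_eq_iff_eq volume (continuous_fourier hf) hc).1 ?_
  have h1 : 𝓕 (profileRep u T) =ᵐ[volume] fun η => propagatorSymbol T η * hat (u T) η :=
    fourier_fourierInv_ae (integrable_propagator_mul_hat huc T)
      (memLp_propagator_mul_hat u T) hf
  have h2 : (fun η => propagatorSymbol T η * hat (u T) η) =ᵐ[volume] profileF u T :=
    propagator_mul_hat_ae_profileF hu hi T
  exact h1.trans h2

theorem profileHat_eq (hu : IsSolution u₀ u) (hx : MemLp (fun x => x * rep (u 0) x) 2)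
    {T : ℝ} (hT : 0 ≤ T) (ξ : ℝ) :
    profileHat u T ξ =
      ((1 / Real.sqrt (2 * Real.pi) : ℝ) : ℂ) * profileF u T (ξ / (2 * Real.pi)) := by
  rw [← fourier_profileRep hu hx hT, profileHat, Real.fourier_eq']
  congr 1
  refine integral_congr_ae ?_
  filter_upwards [profile_ae hu.continuousInH2 T] with x hx
  rw [hx, smul_eq_mul, mul_comm]
  congr 2
  have : -2 * Real.pi * (inner ℝ x (ξ / (2 * Real.pi)) : ℝ) = -(x * ξ) := by
    rw [real_inner_eq_mul]
    field_simp
  rw [this]; push_cast; ring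

theorem hat_ae_profileF (hu : IsSolution u₀ u) (hi : Integrable (rep (u 0))) (t : ℝ) :
    ∀ᵐ η, hat (u t) η = propagatorSymbol (-t) η * profileF u t η := by
  filter_upwards [propagator_mul_hat_ae_profileF hu hi t] with η h
  rw [← h, ← mul_assoc, ← propagatorSymbol_add, neg_add_cancel, propagatorSymbol_zero, one_mul]

/-- Consequences of the smallness of the initial datum. -/
theorem small_data (hu : IsSolution u₀ u) {ε : ℝ} (hε : 0 ≤ ε)
    (h : h2Norm u₀ + weightedNorm u₀ ≤ ENNReal.ofReal ε) :
    h2Real (u 0) ≤ ε ∧ MemLp (fun x => x * rep (u 0) x) 2 ∧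
      √(∫ x, (x * rep (u 0) x) ^ 2) ≤ ε := by
  rw [← hu.initial] at h
  have hg := hu.continuousInH2.1 0
  have hae : (fun x => x * u 0 x) =ᵐ[volume] fun x => x * rep (u 0) x := by
    filter_upwards [rep_ae hg] with x hx
    rw [hx]
  have hw : eLpNorm (fun x => x * rep (u 0) x) 2 volume ≤ ENNReal.ofReal ε := by
    rw [← eLpNorm_congr_ae hae]
    exact le_add_self.trans h
  have hm : MemLp (fun x => x * rep (u 0) x) 2 :=
    ⟨(continuous_id.mul (continuous_rep hg)).aestronglyMeasurable,
      hw.trans_lt ENNReal.ofReal_lt_top⟩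
  refine ⟨ENNReal.toReal_le_of_le_ofReal hε (le_self_add.trans h), hm, ?_⟩
  have h1 := integral_norm_sq_eq_eLpNorm (memLp_ofReal_mul_rep hm)
  have h2 : eLpNorm (fun x : ℝ => (x : ℂ) * (rep (u 0) x : ℂ)) 2 volume =
      eLpNorm (fun x => x * rep (u 0) x) 2 volume :=
    eLpNorm_congr_norm_ae (ae_of_all _ fun x => by simp)
  rw [h2] at h1
  have h3 : ∫ x, (x * rep (u 0) x) ^ 2 =
      ∫ x : ℝ, ‖(x : ℂ) * (rep (u 0) x : ℂ)‖ ^ 2 := by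
    congr 1; ext x
    rw [norm_mul, Complex.norm_real, Complex.norm_real, ← norm_mul, Real.norm_eq_abs, sq_abs]
  rw [h3, h1, Real.sqrt_sq ENNReal.toReal_nonneg]
  exact ENNReal.toReal_le_of_le_ofReal hε hw

end FifthKdV
end

noncomputable section
namespace FifthKdV

/-! ### Frequency-truncated waves and their fifth power -/

/-- The truncated wave `∫_{-R}^R e^{2πixη + is⁵(2πη)⁵} (2πiη)ʲ F(η) dη`. -/
def truncWave (F : ℝ → ℂ) (s R : ℝ) (j : ℕ) (x : ℝ) : ℂ :=
  ∫ η in (-R)..R, osc (x / s) (2 * Real.pi * s * η) * ((2 * Real.pi * Complex.I * η) ^ j * F η)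

theorem hasDerivAt_truncWave {F : ℝ → ℂ} (hF : Continuous F) {s : ℝ} (hs : 0 < s) (R : ℝ)
    (j : ℕ) (x : ℝ) : HasDerivAt (truncWave F s R j) (truncWave F s R (j + 1) x) x := by
  have hc : ∀ (k : ℕ) (x : ℝ), Continuous fun η : ℝ =>
      osc (x / s) (2 * Real.pi * s * η) * ((2 * Real.pi * Complex.I * η) ^ k * F η) := by
    intro k x
    unfold osc; fun_prop
  refine (intervalIntegral.hasDerivAt_integral_of_dominated_loc_of_deriv_le
    (bound := fun η : ℝ => ‖(2 * Real.pi * Complex.I * η) ^ (j + 1) * F η‖)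
    (F' := fun x η => osc (x / s) (2 * Real.pi * s * η) *
      ((2 * Real.pi * Complex.I * η) ^ (j + 1) * F η))
    univ_mem (Eventually.of_forall fun y => (hc j y).aestronglyMeasurable)
    ((hc j x).intervalIntegrable _ _) (hc (j + 1) x).aestronglyMeasurable
    (ae_of_all _ fun η _ y _ => ?_) ?_ (ae_of_all _ fun η _ y _ => ?_)).2
  · rw [norm_mul, norm_osc, one_mul]
  · exact Continuous.intervalIntegrable (by fun_prop) _ _
  · have h1 : HasDerivAt (fun y : ℝ => Complex.I *
        ((y / s * (2 * Real.pi * s * η) + (2 * Real.pi * s * η) ^ 5 : ℝ) : ℂ))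
        (2 * Real.pi * Complex.I * η) y := by
      have h2 : HasDerivAt (fun y : ℝ => y / s * (2 * Real.pi * s * η) +
          (2 * Real.pi * s * η) ^ 5) (2 * Real.pi * η) y := by
        refine ((((hasDerivAt_id y).div_const s).mul_const _).add_const _).congr_deriv ?_
        field_simp
      refine (h2.ofReal_comp.const_mul Complex.I).congr_deriv ?_
      push_cast; ring
    refine ((h1.cexp).mul_const ((2 * Real.pi * Complex.I * η) ^ j * F η)).congr_deriv ?_
    simp only [osc]; ring

theorem norm_truncWave_mul_le {f : ℝ → ℂ} {N s R : ℝ} {j : ℕ} (hj : j ≤ 2) (hR : 0 ≤ R)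
    (hN : 0 < N) (hs : 0 < s) (hf : Integrable f) (hxf : MemLp (fun x : ℝ => (x : ℂ) * f x) 2)
    (hFN : ∀ η, ‖𝓕 f η‖ ≤ N)
    (hXN : (2 * Real.pi) ^ 2 * ∫ x : ℝ, ‖(x : ℂ) * f x‖ ^ 2 ≤ N ^ 2 * (2 * Real.pi * s)) (x : ℝ) :
    ‖truncWave (𝓕 f) s R j x‖ * s ^ (j + 1) * wt (x / s) ^ 3 ≤
      dispConst * N * wt (x / s) ^ (2 * j) := by
  have hpi := Real.two_pi_pos
  have h := norm_integral_osc_fourier_le (y := x / s) hj hR hN (mul_pos hpi hs) hf hxf hFN hXN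
  refine le_trans ?_ h
  have e : truncWave (𝓕 f) s R j x = (2 * Real.pi * Complex.I) ^ j *
      ∫ η in (-R)..R, osc (x / s) (2 * Real.pi * s * η) * ((η : ℂ) ^ j * 𝓕 f η) := by
    rw [truncWave, ← intervalIntegral.integral_const_mul]
    congr 1; ext η
    rw [mul_pow _ (η : ℂ) j]; ring
  have hw := wt_pos (x / s)
  have hn : ‖(2 * Real.pi * Complex.I : ℂ) ^ j‖ = (2 * Real.pi) ^ j := by
    rw [norm_pow]; simp [abs_of_pos Real.pi_pos]
  rw [e, norm_mul, hn]
  set A := ‖∫ η in (-R)..R, osc (x / s) (2 * Real.pi * s * η) * ((η : ℂ) ^ j * 𝓕 f η)‖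
  have hA : 0 ≤ A := norm_nonneg _
  have h1 : (2 * Real.pi) ^ j ≤ (2 * Real.pi) ^ (j + 1) :=
    pow_le_pow_right₀ (by linarith [Real.pi_gt_three]) (Nat.le_succ j)
  -- The dispersive bound is used with `τ = 2πs`; one superfluous factor `2π ≥ 1` is given away.
  calc (2 * Real.pi) ^ j * A * s ^ (j + 1) * wt (x / s) ^ 3
      ≤ (2 * Real.pi) ^ (j + 1) * A * s ^ (j + 1) * wt (x / s) ^ 3 := by gcongr
    _ = A * (2 * Real.pi * s) ^ (j + 1) * wt (x / s) ^ 3 := by rw [mul_pow _ s]; ring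

/-- The exponent is `11/8 > 1`; eleven is the weakest power occurring in the second derivative of
`u⁵`. -/
theorem integrable_inv_wt_pow : Integrable fun y => (wt y ^ 11)⁻¹ := by
  have h := integrable_one_add_norm (E := ℝ) (μ := volume) (r := 11 / 8) (by norm_num)
  refine h.congr (ae_of_all _ fun y => ?_)
  have h0 : 0 ≤ 1 + |y| := by positivity
  change (1 + |y|) ^ (-(11 / 8) : ℝ) = (((1 + |y|) ^ (1 / 8 : ℝ)) ^ 11)⁻¹
  rw [← Real.rpow_natCast, ← Real.rpow_mul h0, ← Real.rpow_neg h0]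
  norm_num

/-- The mass of the spatial weight. -/
def wtMass : ℝ := ∫ y, (wt y ^ 11)⁻¹

theorem wtMass_nonneg : 0 ≤ wtMass :=
  integral_nonneg fun y => by have := wt_pos y; positivity

theorem integrable_inv_wt_div {s : ℝ} (hs : 0 < s) : Integrable fun x => (wt (x / s) ^ 11)⁻¹ :=
  integrable_inv_wt_pow.comp_div hs.ne'

theorem integral_inv_wt_div {s : ℝ} (hs : 0 < s) : ∫ x, (wt (x / s) ^ 11)⁻¹ = s * wtMass := by
  have := Measure.integral_comp_div (fun y => (wt y ^ 11)⁻¹) s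
  rw [this, abs_of_pos hs, smul_eq_mul, wtMass]

/-- Counting weights: `u`, `uₓ`, `uₓₓ` carry `w⁻³`, `w⁻¹`, `w`. Thus `u⁵` gets `w⁻¹⁵`, its first
derivative `w⁻¹³`, and both `u³ uₓ²` and `u⁴ uₓₓ` get `w⁻¹¹`. -/
theorem quintic_wave_bounds {a₀ a₁ a₂ W s w : ℝ} (h₀ : 0 ≤ a₀) (h₁ : 0 ≤ a₁) (h₂ : 0 ≤ a₂)
    (hW : 0 ≤ W) (hs : 0 < s) (hw : 1 ≤ w) (b₀ : a₀ * s * w ^ 3 ≤ W) (b₁ : a₁ * s ^ 2 * w ≤ W)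
    (b₂ : a₂ * s ^ 3 ≤ W * w) :
    a₀ ^ 5 ≤ W ^ 5 / s ^ 5 * (w ^ 11)⁻¹ ∧ 5 * (a₀ ^ 4 * a₁) ≤ 5 * W ^ 5 / s ^ 6 * (w ^ 11)⁻¹ ∧
      20 * (a₀ ^ 3 * a₁ ^ 2) + 5 * (a₀ ^ 4 * a₂) ≤ 25 * W ^ 5 / s ^ 7 * (w ^ 11)⁻¹ := by
  have hw0 : 0 < w := by linarith
  have k₀ : a₀ ≤ W / s * (w ^ 3)⁻¹ := by
    rw [← div_eq_mul_inv, le_div_iff₀ (by positivity), le_div_iff₀ hs]; nlinarith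
  have k₁ : a₁ ≤ W / s ^ 2 * w⁻¹ := by
    rw [← div_eq_mul_inv, le_div_iff₀ (by positivity), le_div_iff₀ (by positivity)]; nlinarith
  have k₂ : a₂ ≤ W / s ^ 3 * w := by
    rw [div_mul_eq_mul_div, le_div_iff₀ (by positivity)]; exact b₂
  have hinv : ∀ n, 11 ≤ n → (w ^ n)⁻¹ ≤ (w ^ 11)⁻¹ := fun n hn => by
    gcongr
  have B₀ : 0 ≤ W / s * (w ^ 3)⁻¹ := by positivity
  have B₁ : 0 ≤ W / s ^ 2 * w⁻¹ := by positivity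
  have B₂ : 0 ≤ W / s ^ 3 * w := by positivity
  refine ⟨?_, ?_, ?_⟩
  · calc a₀ ^ 5 ≤ (W / s * (w ^ 3)⁻¹) ^ 5 := by gcongr
      _ = W ^ 5 / s ^ 5 * (w ^ 15)⁻¹ := by field_simp
      _ ≤ _ := by
        have := hinv 15 (by norm_num)
        gcongr
  · calc 5 * (a₀ ^ 4 * a₁) ≤ 5 * ((W / s * (w ^ 3)⁻¹) ^ 4 * (W / s ^ 2 * w⁻¹)) := by gcongr
      _ = 5 * W ^ 5 / s ^ 6 * (w ^ 13)⁻¹ := by field_simp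
      _ ≤ _ := by
        have := hinv 13 (by norm_num)
        gcongr
  · calc 20 * (a₀ ^ 3 * a₁ ^ 2) + 5 * (a₀ ^ 4 * a₂)
        ≤ 20 * ((W / s * (w ^ 3)⁻¹) ^ 3 * (W / s ^ 2 * w⁻¹) ^ 2) +
          5 * ((W / s * (w ^ 3)⁻¹) ^ 4 * (W / s ^ 3 * w)) := by gcongr
      _ = 25 * W ^ 5 / s ^ 7 * (w ^ 11)⁻¹ := by field_simp; ring

theorem integrable_of_norm_le_inv_wt {g : ℝ → ℂ} (hg : Continuous g) {s M : ℝ} (hs : 0 < s)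
    (h : ∀ x, ‖g x‖ ≤ M * (wt (x / s) ^ 11)⁻¹) :
    Integrable g ∧ ∫ x, ‖g x‖ ≤ M * (s * wtMass) := by
  have hi := (integrable_inv_wt_div hs).const_mul M
  refine ⟨hi.mono' hg.aestronglyMeasurable (ae_of_all _ h), ?_⟩
  rw [← integral_inv_wt_div hs, ← integral_const_mul]
  exact integral_mono_of_nonneg (ae_of_all _ fun x => norm_nonneg _) hi (ae_of_all _ h)

/-- The Fourier transform of the fifth power of a truncated dispersive wave. -/
theorem norm_fourier_truncWave_pow_le {F : ℝ → ℂ} (hF : Continuous F) {W s R : ℝ}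
    (hW : 0 ≤ W) (hs : 0 < s)
    (hb : ∀ j ≤ 2, ∀ x, ‖truncWave F s R j x‖ * s ^ (j + 1) * wt (x / s) ^ 3 ≤
      W * wt (x / s) ^ (2 * j)) (η : ℝ) :
    (2 * Real.pi * η) ^ 2 * ‖𝓕 (fun x => truncWave F s R 0 x ^ 5) η‖ ≤
      25 * W ^ 5 / s ^ 6 * wtMass := by
  set A : ℕ → ℝ → ℂ := fun j => truncWave F s R j with hA
  have hd : ∀ j x, HasDerivAt (A j) (A (j + 1) x) x := fun j x => hasDerivAt_truncWave hF hs R j x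
  have hc : ∀ j, Continuous (A j) := fun j =>
    continuous_iff_continuousAt.2 fun x => (hd j x).continuousAt
  have key : ∀ x, ‖A 0 x‖ ^ 5 ≤ W ^ 5 / s ^ 5 * (wt (x / s) ^ 11)⁻¹ ∧
      5 * (‖A 0 x‖ ^ 4 * ‖A 1 x‖) ≤ 5 * W ^ 5 / s ^ 6 * (wt (x / s) ^ 11)⁻¹ ∧
      20 * (‖A 0 x‖ ^ 3 * ‖A 1 x‖ ^ 2) + 5 * (‖A 0 x‖ ^ 4 * ‖A 2 x‖) ≤
        25 * W ^ 5 / s ^ 7 * (wt (x / s) ^ 11)⁻¹ := by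
    intro x
    have hw := wt_pos (x / s)
    refine quintic_wave_bounds (norm_nonneg _) (norm_nonneg _) (norm_nonneg _) hW hs (one_le_wt _) ?_ ?_ ?_
    · simpa using hb 0 (by norm_num) x
    · have := hb 1 (by norm_num) x
      refine le_of_mul_le_mul_right (a := wt (x / s) ^ 2) ?_ (by positivity)
      calc _ = ‖truncWave F s R 1 x‖ * s ^ (1 + 1) * wt (x / s) ^ 3 := by ring
        _ ≤ _ := this.trans (by norm_num)
    · have := hb 2 (by norm_num) x
      refine le_of_mul_le_mul_right (a := wt (x / s) ^ 3) ?_ (by positivity)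
      calc _ = ‖truncWave F s R 2 x‖ * s ^ (2 + 1) * wt (x / s) ^ 3 := by ring
        _ ≤ _ := this.trans (le_of_eq (by ring))
  set g₁ : ℝ → ℂ := fun x => 5 * (A 0 x ^ 4 * A 1 x) with hg₁
  set g₂ : ℝ → ℂ := fun x => 20 * (A 0 x ^ 3 * A 1 x ^ 2) + 5 * (A 0 x ^ 4 * A 2 x) with hg₂
  have hd0 : ∀ x, HasDerivAt (fun x => A 0 x ^ 5) (g₁ x) x := fun x =>
    ((hd 0 x).pow 5).congr_deriv (by simp only [hg₁]; push_cast; ring)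
  have hd1 : ∀ x, HasDerivAt g₁ (g₂ x) x := fun x =>
    ((((hd 0 x).pow 4).mul (hd 1 x)).const_mul 5).congr_deriv
      (by simp only [hg₂, Pi.pow_apply]; push_cast; ring)
  have hg₀c : Continuous fun x => A 0 x ^ 5 := (hc 0).pow 5
  have hg₁c : Continuous g₁ := by have := hc 0; have := hc 1; fun_prop
  have hg₂c : Continuous g₂ := by have := hc 0; have := hc 1; have := hc 2; fun_prop
  have i0 := (integrable_of_norm_le_inv_wt hg₀c hs fun x => by
    rw [norm_pow]; exact (key x).1).1
  have i1 := (integrable_of_norm_le_inv_wt hg₁c hs fun x => by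
    refine le_trans (le_of_eq ?_) (key x).2.1
    simp [hg₁]).1
  obtain ⟨i2, b2⟩ := integrable_of_norm_le_inv_wt hg₂c hs fun x => by
    refine le_trans ((norm_add_le _ _).trans (le_of_eq ?_)) (key x).2.2
    simp
  have e0 : deriv (fun x => A 0 x ^ 5) = g₁ := funext fun x => (hd0 x).deriv
  have e1 : deriv g₁ = g₂ := funext fun x => (hd1 x).deriv
  have f0 := congrFun (Real.fourier_deriv i0 (fun x => (hd0 x).differentiableAt)
    (by rw [e0]; exact i1)) η
  have f1 := congrFun (Real.fourier_deriv i1 (fun x => (hd1 x).differentiableAt)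
    (by rw [e1]; exact i2)) η
  rw [e0] at f0
  rw [e1, f0, smul_smul, smul_eq_mul] at f1
  have f2 := norm_fourier_le (f := g₂) η
  rw [f1, norm_mul, norm_mul] at f2
  have n1 : ‖(2 * Real.pi * Complex.I * η : ℂ)‖ = |2 * Real.pi * η| := norm_two_pi_I η
  rw [n1, ← sq, sq_abs] at f2
  refine f2.trans (b2.trans (le_of_eq ?_))
  field_simp

end FifthKdV
end

noncomputable section
namespace FifthKdV

/-! ### Dispersive decay of solutions -/

variable {u : ℝ → Lp ℝ 2 (volume : Measure ℝ)} {u₀ : Lp ℝ 2 (volume : Measure ℝ)}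

/-- At time `t = s⁵` the oscillation `osc (x / s) (2πsη)` is `e^{2πixη}` times the inverse
propagator symbol, so the truncated wave is a truncated inversion integral for `u(t)`. -/
theorem tendsto_truncWave (hu : IsSolution u₀ u) (hi : Integrable (rep (u 0))) {s : ℝ}
    (hs : 0 < s) (j : ℕ)
    (hj : Integrable fun η : ℝ => (2 * Real.pi * Complex.I * η) ^ j * hat (u (s ^ 5)) η) (x : ℝ) :
    Tendsto (fun n : ℕ => truncWave (profileF u (s ^ 5)) s n j x) atTop
      (𝓝 (𝓕⁻ (fun η : ℝ => (2 * Real.pi * Complex.I * η) ^ j * hat (u (s ^ 5)) η) x)) := by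
  have hae : (fun η : ℝ => Complex.exp (((2 * Real.pi * (inner ℝ η x : ℝ) : ℝ) : ℂ) * Complex.I) •
      ((2 * Real.pi * Complex.I * η) ^ j * hat (u (s ^ 5)) η)) =ᵐ[volume]
      fun η => osc (x / s) (2 * Real.pi * s * η) *
        ((2 * Real.pi * Complex.I * η) ^ j * profileF u (s ^ 5) η) := by
    filter_upwards [hat_ae_profileF hu hi (s ^ 5)] with η h
    rw [h, smul_eq_mul, real_inner_eq_mul, propagatorSymbol_eq]
    have e : osc (x / s) (2 * Real.pi * s * η) =
        Complex.exp (((2 * Real.pi * (η * x) : ℝ) : ℂ) * Complex.I) *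
          Complex.exp (Complex.I * ((-(-s ^ 5) * (2 * Real.pi * η) ^ 5 : ℝ) : ℂ)) := by
      rw [osc, ← Complex.exp_add]
      congr 1
      have : x / s * (2 * Real.pi * s * η) + (2 * Real.pi * s * η) ^ 5 =
          2 * Real.pi * (η * x) + -(-s ^ 5) * (2 * Real.pi * η) ^ 5 := by
        field_simp
      rw [this]; push_cast; ring
    rw [e]; ring
  have hint : Integrable fun η => osc (x / s) (2 * Real.pi * s * η) *
        ((2 * Real.pi * Complex.I * η) ^ j * profileF u (s ^ 5) η) := by
    refine Integrable.congr ?_ hae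
    simp_rw [smul_eq_mul]
    refine hj.bdd_mul (c := 1) (Continuous.aestronglyMeasurable ?_) (ae_of_all _ fun η => ?_)
    · simp_rw [real_inner_eq_mul]; fun_prop
    · rw [Complex.norm_exp_ofReal_mul_I]
  rw [Real.fourierInv_eq', integral_congr_ae hae]
  exact intervalIntegral_tendsto_integral hint
    (tendsto_neg_atTop_atBot.comp tendsto_natCast_atTop_atTop) tendsto_natCast_atTop_atTop

theorem tendsto_truncWave_rep (hu : IsSolution u₀ u) (hi : Integrable (rep (u 0))) {s : ℝ}
    (hs : 0 < s) (x : ℝ) :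
    Tendsto (fun n : ℕ => truncWave (profileF u (s ^ 5)) s n 0 x) atTop
      (𝓝 (rep (u (s ^ 5)) x : ℂ)) := by
  have hg := hu.continuousInH2.1 (s ^ 5)
  have h := tendsto_truncWave hu hi hs 0 (by simpa using! integrable_hat hg) x
  simp only [pow_zero, one_mul] at h
  rwa [ofReal_rep hg]

theorem tendsto_truncWave_repDeriv (hu : IsSolution u₀ u) (hi : Integrable (rep (u 0))) {s : ℝ}
    (hs : 0 < s) (x : ℝ) :
    Tendsto (fun n : ℕ => truncWave (profileF u (s ^ 5)) s n 1 x) atTop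
      (𝓝 (repDeriv (u (s ^ 5)) x : ℂ)) := by
  have hg := hu.continuousInH2.1 (s ^ 5)
  have h := tendsto_truncWave hu hi hs 1 (by simpa using! integrable_deriv_hat hg) x
  simp only [pow_one] at h
  rwa [ofReal_repDeriv hg]

/-- `N` controls the Fourier transform and the weighted norm of the profile at time `s⁵`. -/
structure ProfileBound (u : ℝ → Lp ℝ 2 (volume : Measure ℝ)) (s N : ℝ) : Prop where
  scale_pos : 0 < s
  pos : 0 < N
  fourier : ∀ η, ‖profileF u (s ^ 5) η‖ ≤ N
  weighted : ∫ x : ℝ, ‖(x : ℂ) * profileRep u (s ^ 5) x‖ ^ 2 ≤ N ^ 2 * s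

/-- The constant of the pointwise dispersive estimate. -/
def waveConst : ℝ := 3 * dispConst

theorem waveConst_pos : 0 < waveConst := mul_pos (by norm_num) dispConst_pos

theorem ProfileBound.norm_truncWave_mul_le {s N : ℝ} (h : ProfileBound u s N)
    (hu : IsSolution u₀ u) (hx : MemLp (fun x => x * rep (u 0) x) 2) (n j : ℕ) (hj : j ≤ 2)
    (x : ℝ) :
    ‖truncWave (profileF u (s ^ 5)) s n j x‖ * s ^ (j + 1) * wt (x / s) ^ 3 ≤
      waveConst * N * wt (x / s) ^ (2 * j) := by
  have hs := h.scale_pos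
  have hN := h.pos
  have ht : 0 ≤ s ^ 5 := by positivity
  have e := fourier_profileRep hu hx ht
  -- Enlarging `N` to `3 N` absorbs the normalisation of the transform, since `2π ≤ 9`; this is the
  -- factor three in `waveConst`.
  have h3 : (2 * Real.pi) ^ 2 * ∫ x : ℝ, ‖(x : ℂ) * profileRep u (s ^ 5) x‖ ^ 2 ≤
      (3 * N) ^ 2 * (2 * Real.pi * s) := by
    calc _ ≤ (2 * Real.pi) ^ 2 * (N ^ 2 * s) := by gcongr; exact h.weighted
      _ = (2 * Real.pi) * (N ^ 2 * (2 * Real.pi * s)) := by ring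
      _ ≤ 9 * (N ^ 2 * (2 * Real.pi * s)) := by
        gcongr
        linarith [Real.pi_lt_four]
      _ = _ := by ring
  have := FifthKdV.norm_truncWave_mul_le (R := n) hj (Nat.cast_nonneg n)
    (by positivity : 0 < 3 * N) hs (integrable_profileRep hu hx ht)
    (memLp_mul_profileRep hu hx ht).1
    (fun η => by rw [e]; linarith [h.fourier η]) h3 x
  rw [e] at this
  refine this.trans (le_of_eq ?_)
  rw [waveConst]; ring

theorem ProfileBound.abs_rep_mul_le {s N : ℝ} (h : ProfileBound u s N)
    (hu : IsSolution u₀ u) (hx : MemLp (fun x => x * rep (u 0) x) 2) (x : ℝ) :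
    |rep (u (s ^ 5)) x| * s * wt (x / s) ^ 3 ≤ waveConst * N := by
  have hi := (integrable_rep (hu.continuousInH2.1 0) hx).1
  have h1 := ((tendsto_truncWave_rep hu hi h.scale_pos x).norm.mul_const s).mul_const
    (wt (x / s) ^ 3)
  rw [Complex.norm_real, Real.norm_eq_abs] at h1
  refine le_of_tendsto h1 (Eventually.of_forall fun n => ?_)
  simpa using h.norm_truncWave_mul_le hu hx n 0 (by norm_num) x

theorem ProfileBound.abs_repDeriv_mul_le {s N : ℝ} (h : ProfileBound u s N)
    (hu : IsSolution u₀ u) (hx : MemLp (fun x => x * rep (u 0) x) 2) (x : ℝ) :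
    |repDeriv (u (s ^ 5)) x| * s ^ 2 * wt (x / s) ≤ waveConst * N := by
  have hi := (integrable_rep (hu.continuousInH2.1 0) hx).1
  have hw := wt_pos (x / s)
  have h1 := ((tendsto_truncWave_repDeriv hu hi h.scale_pos x).norm.mul_const (s ^ 2)).mul_const
    (wt (x / s))
  rw [Complex.norm_real, Real.norm_eq_abs] at h1
  refine le_of_tendsto h1 (Eventually.of_forall fun n => ?_)
  have := h.norm_truncWave_mul_le hu hx n 1 (by norm_num) x
  refine le_of_mul_le_mul_right (a := wt (x / s) ^ 2) ?_ (by positivity)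
  calc _ = ‖truncWave (profileF u (s ^ 5)) s n 1 x‖ * s ^ (1 + 1) * wt (x / s) ^ 3 := by ring
    _ ≤ _ := this.trans (by norm_num)

theorem ProfileBound.supRep_le {s N : ℝ} (h : ProfileBound u s N)
    (hu : IsSolution u₀ u) (hx : MemLp (fun x => x * rep (u 0) x) 2) :
    supRep u (s ^ 5) ≤ waveConst * N / s := by
  have hs := h.scale_pos
  refine FifthKdV.supRep_le u fun x => ?_
  rw [le_div_iff₀ hs]
  have hw : 1 ≤ wt (x / s) ^ 3 := one_le_pow₀ (one_le_wt _)
  exact (le_mul_of_one_le_right (by positivity) hw).trans (h.abs_rep_mul_le hu hx x)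

theorem ProfileBound.supDeriv_le {s N : ℝ} (h : ProfileBound u s N)
    (hu : IsSolution u₀ u) (hx : MemLp (fun x => x * rep (u 0) x) 2) :
    supDeriv u (s ^ 5) ≤ waveConst * N / s ^ 2 := by
  have hs := h.scale_pos
  refine FifthKdV.supDeriv_le u fun x => ?_
  rw [le_div_iff₀ (by positivity)]
  exact (le_mul_of_one_le_right (by positivity) (one_le_wt _)).trans
    (h.abs_repDeriv_mul_le hu hx x)

theorem ProfileBound.abs_rep_pow_five_le {s N : ℝ} (h : ProfileBound u s N)
    (hu : IsSolution u₀ u) (hx : MemLp (fun x => x * rep (u 0) x) 2) (x : ℝ) :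
    |rep (u (s ^ 5)) x| ^ 5 ≤ (waveConst * N) ^ 5 / s ^ 5 * (wt (x / s) ^ 11)⁻¹ := by
  have hW : 0 ≤ waveConst * N := (mul_pos waveConst_pos h.pos).le
  have hw := wt_pos (x / s)
  exact (quintic_wave_bounds (a₁ := 0) (a₂ := 0) (abs_nonneg _) le_rfl le_rfl hW h.scale_pos
    (one_le_wt _) (h.abs_rep_mul_le hu hx x) (by simpa using hW) (by simp; positivity)).1

theorem ProfileBound.tenthMoment_le {s N : ℝ} (h : ProfileBound u s N)
    (hu : IsSolution u₀ u) (hx : MemLp (fun x => x * rep (u 0) x) 2) :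
    tenthMoment u (s ^ 5) ≤ (waveConst * N) ^ 10 / s ^ 9 * wtMass := by
  have hs := h.scale_pos
  have hW : 0 ≤ waveConst * N := (mul_pos waveConst_pos h.pos).le
  have hi := (integrable_inv_wt_div hs).const_mul ((waveConst * N) ^ 10 / s ^ 10)
  refine (integral_mono_of_nonneg (ae_of_all _ fun x => sq_nonneg _) hi
    (ae_of_all _ fun x => ?_)).trans (le_of_eq ?_)
  · have h1 := h.abs_rep_pow_five_le hu hx x
    have hw1 := one_le_wt (x / s)
    have hw : (wt (x / s) ^ 11)⁻¹ ≤ 1 := inv_le_one_of_one_le₀ (one_le_pow₀ hw1)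
    have hw0 : 0 ≤ (wt (x / s) ^ 11)⁻¹ := by
      have := wt_pos (x / s)
      positivity
    calc (rep (u (s ^ 5)) x ^ 5) ^ 2 = (|rep (u (s ^ 5)) x| ^ 5) ^ 2 := by
          rw [← abs_pow, sq_abs]
      _ ≤ ((waveConst * N) ^ 5 / s ^ 5 * (wt (x / s) ^ 11)⁻¹) ^ 2 := by gcongr
      _ = (waveConst * N) ^ 10 / s ^ 10 * ((wt (x / s) ^ 11)⁻¹ * (wt (x / s) ^ 11)⁻¹) := by
          field_simp
      _ ≤ (waveConst * N) ^ 10 / s ^ 10 * ((wt (x / s) ^ 11)⁻¹ * 1) := by gcongr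
      _ = _ := by rw [mul_one]
  · rw [integral_const_mul, integral_inv_wt_div hs]
    field_simp

/-- Integrability of `u⁵` gives the bound at low frequency, and that of `∂ₓ²(u⁵)` the decay `(ξ
s)⁻²`. The second derivative of `u` need not be bounded pointwise, so the decay is proved for
truncated waves, uniformly in the truncation, and passed to the limit. The constant is `26 = 1 +
25`. -/
theorem ProfileBound.norm_quinticHat_le {s N : ℝ} (h : ProfileBound u s N)
    (hu : IsSolution u₀ u) (hx : MemLp (fun x => x * rep (u 0) x) 2) (η : ℝ) :
    (1 + (2 * Real.pi * η * s) ^ 2) * ‖quinticHat u (s ^ 5) η‖ ≤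
      26 * (waveConst * N) ^ 5 / s ^ 4 * wtMass := by
  have hs := h.scale_pos
  have hW : 0 ≤ waveConst * N := (mul_pos waveConst_pos h.pos).le
  have hi := (integrable_rep (hu.continuousInH2.1 0) hx).1
  have hg := hu.continuousInH2.1 (s ^ 5)
  have hFc := continuous_profileF_right hu.continuousInH2 hi (s ^ 5)
  have h0 : ‖quinticHat u (s ^ 5) η‖ ≤ (waveConst * N) ^ 5 / s ^ 4 * wtMass := by
    refine (norm_fourier_le η).trans ?_
    have hc : Continuous fun x => ((rep (u (s ^ 5)) x ^ 5 : ℝ) : ℂ) := by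
      have := continuous_rep hg
      fun_prop
    have := (integrable_of_norm_le_inv_wt hc hs fun x => by
      rw [Complex.norm_real, norm_pow, Real.norm_eq_abs]
      exact h.abs_rep_pow_five_le hu hx x).2
    refine this.trans (le_of_eq ?_)
    field_simp
  have hlim : Tendsto (fun n : ℕ => 𝓕 (fun x => truncWave (profileF u (s ^ 5)) s n 0 x ^ 5) η)
      atTop (𝓝 (quinticHat u (s ^ 5) η)) := by
    rw [quinticHat]
    simp_rw [Real.fourier_eq']
    refine tendsto_integral_of_dominated_convergence
      (fun x => (waveConst * N) ^ 5 / s ^ 5 * (wt (x / s) ^ 11)⁻¹) (fun n => ?_)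
      ((integrable_inv_wt_div hs).const_mul _) (fun n => ae_of_all _ fun x => ?_)
      (ae_of_all _ fun x => ?_)
    · have hc : Continuous (truncWave (profileF u (s ^ 5)) s n 0) :=
        continuous_iff_continuousAt.2 fun x => (hasDerivAt_truncWave hFc hs n 0 x).continuousAt
      refine Continuous.aestronglyMeasurable ?_
      simp_rw [real_inner_eq_mul]
      fun_prop
    · rw [norm_smul, Complex.norm_exp_ofReal_mul_I, one_mul, norm_pow]
      have hw := wt_pos (x / s)
      exact (quintic_wave_bounds (a₁ := 0) (a₂ := 0) (norm_nonneg _) le_rfl le_rfl hW hs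
        (one_le_wt _) (by simpa using h.norm_truncWave_mul_le hu hx n 0 (by norm_num) x)
        (by simpa using hW) (by simp; positivity)).1
    · refine Tendsto.const_smul ?_ _
      rw [Complex.ofReal_pow]
      exact (tendsto_truncWave_rep hu hi hs x).pow 5
  have h2 : (2 * Real.pi * η) ^ 2 * ‖quinticHat u (s ^ 5) η‖ ≤
      25 * (waveConst * N) ^ 5 / s ^ 6 * wtMass :=
    le_of_tendsto (hlim.norm.const_mul _) (Eventually.of_forall fun n =>
      norm_fourier_truncWave_pow_le hFc hW hs
        (fun j hj x => h.norm_truncWave_mul_le hu hx n j hj x) η)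
  calc (1 + (2 * Real.pi * η * s) ^ 2) * ‖quinticHat u (s ^ 5) η‖
      = ‖quinticHat u (s ^ 5) η‖ +
        s ^ 2 * ((2 * Real.pi * η) ^ 2 * ‖quinticHat u (s ^ 5) η‖) := by ring
    _ ≤ (waveConst * N) ^ 5 / s ^ 4 * wtMass +
        s ^ 2 * (25 * (waveConst * N) ^ 5 / s ^ 6 * wtMass) := by gcongr
    _ = _ := by field_simp; ring

/-- The dispersive bound of the time derivative of the profile. -/
theorem ProfileBound.norm_deriv_profileF_le {s N : ℝ} (h : ProfileBound u s N)
    (hu : IsSolution u₀ u) (hx : MemLp (fun x => x * rep (u 0) x) 2) (η : ℝ) :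
    ‖2 * Real.pi * Complex.I * η * duhamelDensity u (s ^ 5) η‖ ≤
      6 * wtMass * (waveConst * N) ^ 5 *
        (|2 * Real.pi * η| * s / (s ^ 5 * (1 + (2 * Real.pi * η * s) ^ 2))) := by
  have hs := h.scale_pos
  have hW : 0 ≤ waveConst * N := (mul_pos waveConst_pos h.pos).le
  have h1 := h.norm_quinticHat_le hu hx η
  have h2 : ‖duhamelDensity u (s ^ 5) η‖ = 1 / 5 * ‖quinticHat u (s ^ 5) η‖ := by
    rw [duhamelDensity, norm_mul, norm_mul, norm_propagatorSymbol]; simp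
  have hm := wtMass_nonneg
  rw [norm_mul, norm_two_pi_I, h2, mul_div_assoc', le_div_iff₀ (by positivity)]
  calc _ = |2 * Real.pi * η| * (1 / 5 * s ^ 5) *
        ((1 + (2 * Real.pi * η * s) ^ 2) * ‖quinticHat u (s ^ 5) η‖) := by ring
    _ ≤ |2 * Real.pi * η| * (1 / 5 * s ^ 5) * (26 * (waveConst * N) ^ 5 / s ^ 4 * wtMass) := by
        gcongr
    _ = 26 / 5 * (wtMass * (waveConst * N) ^ 5 * (|2 * Real.pi * η| * s)) := by
        field_simp
    _ ≤ 6 * (wtMass * (waveConst * N) ^ 5 * (|2 * Real.pi * η| * s)) := by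
        gcongr; norm_num
    _ = _ := by ring

end FifthKdV
end

noncomputable section
namespace FifthKdV

/-! ### Short-time control -/

/-- The continuity method: a continuous quantity that improves itself stays small. -/
theorem le_of_bootstrap {φ : ℝ → ℝ} {a b c c' : ℝ} (hφ : ContinuousOn φ (Set.Icc a b))
    (hc : c' < c) (ha : φ a ≤ c)
    (h : ∀ S ∈ Set.Icc a b, (∀ s ∈ Set.Icc a S, φ s ≤ c) → φ S ≤ c') :
    ∀ s ∈ Set.Icc a b, φ s ≤ c' := by
  have key : ∀ s ∈ Set.Icc a b, φ s ≤ c := by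
    by_contra! hcon
    obtain ⟨s₁, hs₁, hφ₁⟩ := hcon
    have hclosed : IsClosed {s ∈ Set.Icc a b | c ≤ φ s} :=
      hφ.preimage_isClosed_of_isClosed isClosed_Icc isClosed_Ici
    have hcomp : IsCompact {s ∈ Set.Icc a b | c ≤ φ s} :=
      isCompact_Icc.of_isClosed_subset hclosed fun s hs => hs.1
    obtain ⟨s₀, hs₀, hmin⟩ := hcomp.exists_isLeast ⟨s₁, hs₁, hφ₁.le⟩
    have hlt : ∀ s ∈ Set.Ico a s₀, φ s ≤ c := fun s hs => by
      by_contra! hcon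
      exact absurd (hmin ⟨⟨hs.1, hs.2.le.trans hs₀.1.2⟩, hcon.le⟩) (not_le.2 hs.2)
    have hs0 : φ s₀ ≤ c := by
      rcases hs₀.1.1.eq_or_lt with rfl | hlt'
      · exact ha
      · have : (𝓝[Set.Ico a s₀] s₀).NeBot := by
          rw [nhdsWithin_Ico_eq_nhdsLT hlt']; infer_instance
        refine le_of_tendsto ((hφ s₀ hs₀.1).mono_left (nhdsWithin_mono _ fun s hs =>
          ⟨hs.1, hs.2.le.trans hs₀.1.2⟩) : Tendsto φ (𝓝[Set.Ico a s₀] s₀) _) ?_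
        filter_upwards [self_mem_nhdsWithin] with s hs using hlt s hs
    have := h s₀ hs₀.1 fun s hs => hs.2.eq_or_lt.elim (fun e => e ▸ hs0) fun e => hlt s ⟨hs.1, e⟩
    exact absurd (hs₀.2.trans this) (not_le.2 hc)
  exact fun s hs => h s hs fun r hr => key r ⟨hr.1, hr.2.trans hs.2⟩

variable {g : Lp ℝ 2 (volume : Measure ℝ)}

theorem integral_abs_quarticDeriv_le (hg : h2Norm g < ⊤) {S : ℝ} (hS : ∀ x, |rep g x| ≤ S) :
    ∫ x, |quarticDeriv g x| ≤ S ^ 3 * ((∫ x, rep g x ^ 2) + ∫ x, repDeriv g x ^ 2) := by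
  have i1 := (memLp_rep hg).integrable_sq
  have i2 := (memLp_repDeriv hg).integrable_sq
  have hS0 : 0 ≤ S := (abs_nonneg _).trans (hS 0)
  rw [← integral_add i1 i2, ← integral_const_mul]
  refine integral_mono_of_nonneg (ae_of_all _ fun x => abs_nonneg _)
    ((i1.add i2).const_mul _) (ae_of_all _ fun x => ?_)
  have h1 : |rep g x| ^ 3 ≤ S ^ 3 := pow_le_pow_left₀ (abs_nonneg _) (hS x) 3
  have h2 : |rep g x| * |repDeriv g x| ≤ rep g x ^ 2 + repDeriv g x ^ 2 := by
    rw [← sq_abs (rep g x), ← sq_abs (repDeriv g x)]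
    nlinarith [sq_nonneg (|rep g x| - |repDeriv g x|), sq_nonneg (|rep g x| + |repDeriv g x|)]
  calc |quarticDeriv g x| = |rep g x| ^ 3 * (|rep g x| * |repDeriv g x|) := by
        rw [quarticDeriv, abs_mul, abs_pow]; ring
    _ ≤ S ^ 3 * (rep g x ^ 2 + repDeriv g x ^ 2) := by gcongr

/-- The constant of the embedding of `H¹` into bounded functions. -/
def sobConstOne : ℝ := (∫ η : ℝ, (1 + (2 * Real.pi * η) ^ 2)⁻¹) + 8

theorem sobConstOne_pos : 0 < sobConstOne := by
  have : 0 ≤ ∫ η : ℝ, (1 + (2 * Real.pi * η) ^ 2)⁻¹ := integral_nonneg fun η => by positivity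
  rw [sobConstOne]; linarith

/-- The embedding of `H¹` into bounded functions, with `|û| ≤ ε w⁻¹ + ε⁻¹ w |û|²` for `w = 1 +
(2πη)²`. The two energies contribute the `8 = 4 + 4` in `sobConstOne`. -/
theorem abs_rep_le_of_integral_sq_le (hg : h2Norm g < ⊤) {ε : ℝ} (hε : 0 < ε)
    (h0 : ∫ x, rep g x ^ 2 ≤ 4 * ε ^ 2) (h1 : ∫ x, repDeriv g x ^ 2 ≤ 4 * ε ^ 2) (x : ℝ) :
    |rep g x| ≤ sobConstOne * ε := by
  rw [integral_rep_sq hg] at h0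
  rw [integral_repDeriv_sq hg] at h1
  have i0 := integrable_norm_sq (memLp_hat g)
  have i1 := integrable_norm_sq (memLp_deriv_hat hg)
  have hle : ∀ η : ℝ, ‖hat g η‖ ≤ ε * (1 + (2 * Real.pi * η) ^ 2)⁻¹ +
      ε⁻¹ * (‖hat g η‖ ^ 2 + ‖2 * Real.pi * Complex.I * η * hat g η‖ ^ 2) := by
    intro η
    have hw : 0 < 1 + (2 * Real.pi * η) ^ 2 := by positivity
    rw [norm_mul, norm_two_pi_I, mul_pow |2 * Real.pi * η|, sq_abs]
    have e : ε * (1 + (2 * Real.pi * η) ^ 2)⁻¹ +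
        ε⁻¹ * (‖hat g η‖ ^ 2 + (2 * Real.pi * η) ^ 2 * ‖hat g η‖ ^ 2) =
        (ε ^ 2 + ((1 + (2 * Real.pi * η) ^ 2) * ‖hat g η‖) ^ 2) /
          (ε * (1 + (2 * Real.pi * η) ^ 2)) := by
      field_simp
    rw [e, le_div_iff₀ (by positivity)]
    have hn := norm_nonneg (hat g η)
    have hp : 0 ≤ (1 + (2 * Real.pi * η) ^ 2) * ‖hat g η‖ := by positivity
    nlinarith [sq_nonneg (ε - (1 + (2 * Real.pi * η) ^ 2) * ‖hat g η‖),
      mul_nonneg hε.le hp]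
  calc |rep g x| ≤ ‖𝓕⁻ (hat g) x‖ := Complex.abs_re_le_norm _
    _ ≤ ∫ η, ‖hat g η‖ := norm_fourierInv_le x
    _ ≤ ∫ η : ℝ, (ε * (1 + (2 * Real.pi * η) ^ 2)⁻¹ +
        ε⁻¹ * (‖hat g η‖ ^ 2 + ‖2 * Real.pi * Complex.I * η * hat g η‖ ^ 2)) :=
      integral_mono_of_nonneg (ae_of_all _ fun η => norm_nonneg _)
        ((integrable_inv_weight.const_mul _).add ((i0.add i1).const_mul _)) (ae_of_all _ hle)
    _ = ε * (∫ η : ℝ, (1 + (2 * Real.pi * η) ^ 2)⁻¹) + ε⁻¹ * ((∫ η, ‖hat g η‖ ^ 2) +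
        ∫ η : ℝ, ‖2 * Real.pi * Complex.I * η * hat g η‖ ^ 2) := by
      have := integral_add (integrable_inv_weight.const_mul ε) ((i0.add i1).const_mul ε⁻¹)
      refine this.trans ?_
      rw [integral_const_mul, integral_const_mul, ← integral_add i0 i1]; rfl
    _ ≤ ε * (∫ η : ℝ, (1 + (2 * Real.pi * η) ^ 2)⁻¹) + ε⁻¹ * (4 * ε ^ 2 + 4 * ε ^ 2) := by
      gcongr
    _ = sobConstOne * ε := by rw [sobConstOne]; field_simp; ring

variable {u : ℝ → Lp ℝ 2 (volume : Measure ℝ)} {u₀ : Lp ℝ 2 (volume : Measure ℝ)}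

theorem continuous_energyExponent (hu : ContinuousInH2 u) : Continuous (energyExponent u) := by
  have h0 := continuous_supRep hu
  have h1 := continuous_supDeriv hu
  exact intervalIntegral.continuous_primitive
    (fun a b => Continuous.intervalIntegrable (by fun_prop) a b) 0

theorem hasDerivAt_energyExponent (hu : ContinuousInH2 u) (t : ℝ) :
    HasDerivAt (energyExponent u) (2 * supRep u t ^ 3 * supDeriv u t) t := by
  have h0 := continuous_supRep hu
  have h1 := continuous_supDeriv hu
  have hc : Continuous fun s => 2 * supRep u s ^ 3 * supDeriv u s := by fun_prop
  exact intervalIntegral.integral_hasDerivAt_right (hc.intervalIntegrable _ _)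
    hc.stronglyMeasurable.stronglyMeasurableAtFilter hc.continuousAt

/-- The energy exponent in the self-similar time variable. -/
theorem hasDerivAt_energyExponent_pow (hu : ContinuousInH2 u) (s : ℝ) :
    HasDerivAt (fun s => energyExponent u (s ^ 5))
      (10 * s ^ 4 * supRep u (s ^ 5) ^ 3 * supDeriv u (s ^ 5)) s := by
  have h := (hasDerivAt_energyExponent hu (s ^ 5)).comp s (hasDerivAt_pow 5 s)
  refine h.congr_deriv ?_
  push_cast; ring

theorem hasDerivAt_profileF_pow (hu : ContinuousInH2 u) (s η : ℝ) :
    HasDerivAt (fun s => profileF u (s ^ 5) η)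
      ((5 * s ^ 4 : ℝ) • (2 * Real.pi * Complex.I * η * duhamelDensity u (s ^ 5) η)) s := by
  have h := (hasDerivAt_profileF hu (s ^ 5) η).scomp s (hasDerivAt_pow 5 s)
  refine h.congr_deriv ?_
  norm_num

/-- The initial datum is of size `ε` in `H²` and in the weighted space. -/
structure SmallData (u : ℝ → Lp ℝ 2 (volume : Measure ℝ)) (ε : ℝ) : Prop where
  pos : 0 < ε
  h2 : h2Real (u 0) ≤ ε
  memLp : MemLp (fun x => x * rep (u 0) x) 2
  weighted : √(∫ x, (x * rep (u 0) x) ^ 2) ≤ ε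

theorem SmallData.integrable {ε : ℝ} (hd : SmallData u ε) (hu : ContinuousInH2 u) :
    Integrable (rep (u 0)) := (integrable_rep (hu.1 0) hd.memLp).1

theorem SmallData.integral_rep_sq_le {ε : ℝ} (hd : SmallData u ε) (hu : ContinuousInH2 u) :
    ∫ x, rep (u 0) x ^ 2 ≤ ε ^ 2 :=
  (FifthKdV.integral_rep_sq_le (hu.1 0)).trans (pow_le_pow_left₀ (h2Real_nonneg _) hd.h2 2)

theorem SmallData.integral_repDeriv_sq_le {ε : ℝ} (hd : SmallData u ε) (hu : ContinuousInH2 u) :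
    ∫ x, repDeriv (u 0) x ^ 2 ≤ ε ^ 2 :=
  (FifthKdV.integral_repDeriv_sq_le (hu.1 0)).trans (pow_le_pow_left₀ (h2Real_nonneg _) hd.h2 2)

theorem SmallData.norm_profileF_zero_le {ε : ℝ} (hd : SmallData u ε) (hu : ContinuousInH2 u)
    (η : ℝ) : ‖profileF u 0 η‖ ≤ 4 * ε := by
  have h0 : profileF u 0 η = 𝓕 (fun x => (rep (u 0) x : ℂ)) η := by
    simp [profileF, duhamelIntegral]
  have h1 := (integrable_rep (hu.1 0) hd.memLp).2
  have h2 : √(∫ x, rep (u 0) x ^ 2) ≤ ε :=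
    (Real.sqrt_le_sqrt (hd.integral_rep_sq_le hu)).trans (Real.sqrt_sq hd.pos.le).le
  have h3 : √Real.pi ≤ 2 := by
    rw [Real.sqrt_le_left (by norm_num)]
    linarith [Real.pi_lt_four]
  rw [h0]
  refine (norm_fourier_le η).trans ?_
  simp only [Complex.norm_real, Real.norm_eq_abs]
  calc _ ≤ √Real.pi * (ε + ε) := h1.trans (by gcongr; exact hd.weighted)
    _ ≤ 2 * (ε + ε) := by have := hd.pos; gcongr
    _ = 4 * ε := by ring

/-- Bounds that follow from `energyExponent u t ≤ 1 / 2`. -/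
theorem SmallData.energy_bounds {ε : ℝ} (hd : SmallData u ε) (hu : IsSolution u₀ u) {t : ℝ}
    (ht : 0 ≤ t) (hE : energyExponent u t ≤ 1 / 2) :
    ∫ x, rep (u t) x ^ 2 ≤ 4 * ε ^ 2 ∧ (∀ x, |rep (u t) x| ≤ sobConstOne * ε) ∧
      ∫ x, |quarticDeriv (u t) x| ≤ 8 * sobConstOne ^ 3 * ε ^ 5 ∧
      √(tenthMoment u t) ≤ 2 * sobConstOne ^ 4 * ε ^ 5 := by
  have huc := hu.continuousInH2
  -- The squared norms grow by at most `e ≤ 4`, so the bounds keep the form `4 ε²`.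
  have hexp : Real.exp (2 * energyExponent u t) ≤ 4 := by
    refine (Real.exp_le_exp.2 (by linarith : 2 * energyExponent u t ≤ 1)).trans ?_
    linarith [Real.exp_one_lt_d9]
  have hε := hd.pos
  have hc := sobConstOne_pos
  have h0 : ∫ x, rep (u t) x ^ 2 ≤ 4 * ε ^ 2 := by
    refine (integral_rep_sq_growth hu ht).trans ?_
    rw [mul_comm 4]
    exact mul_le_mul (hd.integral_rep_sq_le huc) hexp (Real.exp_pos _).le (by positivity)
  have h1 : ∫ x, repDeriv (u t) x ^ 2 ≤ 4 * ε ^ 2 := by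
    refine (integral_repDeriv_sq_growth hu ht).trans ?_
    rw [mul_comm 4]
    exact mul_le_mul (hd.integral_repDeriv_sq_le huc) hexp (Real.exp_pos _).le (by positivity)
  have hS := abs_rep_le_of_integral_sq_le (huc.1 t) hε h0 h1
  refine ⟨h0, hS, ?_, ?_⟩
  · calc _ ≤ (sobConstOne * ε) ^ 3 * ((∫ x, rep (u t) x ^ 2) + ∫ x, repDeriv (u t) x ^ 2) :=
        integral_abs_quarticDeriv_le (huc.1 t) hS
      _ ≤ (sobConstOne * ε) ^ 3 * (4 * ε ^ 2 + 4 * ε ^ 2) := by gcongr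
      _ = _ := by ring
  · have i0 := (memLp_rep (huc.1 t)).integrable_sq
    have h2 : tenthMoment u t ≤ (2 * sobConstOne ^ 4 * ε ^ 5) ^ 2 := by
      calc tenthMoment u t ≤ ∫ x, (sobConstOne * ε) ^ 8 * rep (u t) x ^ 2 := by
            refine integral_mono_of_nonneg (ae_of_all _ fun x => sq_nonneg _)
              (i0.const_mul _) (ae_of_all _ fun x => ?_)
            have := pow_le_pow_left₀ (abs_nonneg _) (hS x) 8
            rw [show |rep (u t) x| ^ 8 = rep (u t) x ^ 8 from by
              rw [← abs_pow, abs_of_nonneg (by positivity)]] at this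
            calc (rep (u t) x ^ 5) ^ 2 = rep (u t) x ^ 8 * rep (u t) x ^ 2 := by ring
              _ ≤ _ := mul_le_mul_of_nonneg_right this (sq_nonneg _)
        _ = (sobConstOne * ε) ^ 8 * ∫ x, rep (u t) x ^ 2 := integral_const_mul _ _
        _ ≤ (sobConstOne * ε) ^ 8 * (4 * ε ^ 2) := by gcongr
        _ = _ := by ring
    exact (Real.sqrt_le_sqrt h2).trans (Real.sqrt_sq (by positivity)).le

end FifthKdV
end

/-! ### Smallness constants, times up to one, and the supremum of the transformed profile -/

noncomputable section
namespace FifthKdV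

variable {u : ℝ → Lp ℝ 2 (volume : Measure ℝ)} {u₀ : Lp ℝ 2 (volume : Measure ℝ)} {ε : ℝ}

/-- The data are so small that `bootConst * ε ^ 4 ≤ 1`. -/
def bootConst : ℝ :=
  200 * sobConstOne ^ 3 * waveConst + 40 * sobConstOne ^ 3 + 2 * sobConstOne ^ 4 +
    20 * (32 * waveConst) ^ 4 + 4 * (50 * wtMass + √wtMass) * waveConst ^ 5 * 32 ^ 4

theorem bootConst_pos : 0 < bootConst := by
  have h1 := sobConstOne_pos
  have h2 := waveConst_pos
  have h3 := wtMass_nonneg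
  have h4 := Real.sqrt_nonneg wtMass
  rw [bootConst]; positivity

/-- The five uses in order: the energy exponent stays below `1/4` on `[0, 1]`; the profile transform
moves by at most `ε` there; `t ‖u⁵‖ ≤ ε` there; for later times the energy exponent has `s`-slope at
most `1/(2s)`; the continuity argument closes. -/
theorem bootConst_bounds (hsm : bootConst * ε ^ 4 ≤ 1) :
    200 * sobConstOne ^ 3 * waveConst * ε ^ 4 ≤ 1 ∧ 40 * sobConstOne ^ 3 * ε ^ 4 ≤ 1 ∧
      2 * sobConstOne ^ 4 * ε ^ 4 ≤ 1 ∧ 20 * (32 * waveConst) ^ 4 * ε ^ 4 ≤ 1 ∧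
      4 * (50 * wtMass + √wtMass) * waveConst ^ 5 * 32 ^ 4 * ε ^ 4 ≤ 1 := by
  have h1 := sobConstOne_pos
  have h2 := waveConst_pos
  have h3 := wtMass_nonneg
  have h4 := Real.sqrt_nonneg wtMass
  have a1 : 0 ≤ 200 * sobConstOne ^ 3 * waveConst * ε ^ 4 := by positivity
  have a2 : 0 ≤ 40 * sobConstOne ^ 3 * ε ^ 4 := by positivity
  have a3 : 0 ≤ 2 * sobConstOne ^ 4 * ε ^ 4 := by positivity
  have a4 : 0 ≤ 20 * (32 * waveConst) ^ 4 * ε ^ 4 := by positivity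
  have a5 : 0 ≤ 4 * (50 * wtMass + √wtMass) * waveConst ^ 5 * 32 ^ 4 * ε ^ 4 := by positivity
  rw [bootConst, add_mul, add_mul, add_mul, add_mul] at hsm
  exact ⟨by linarith, by linarith, by linarith, by linarith, by linarith⟩

theorem SmallData.profileBound (hd : SmallData u ε) (hu : IsSolution u₀ u) {s N : ℝ}
    (hs : 0 < s) (hN : 0 < N) (hF : ∀ η, ‖profileF u (s ^ 5) η‖ ≤ N)
    (hX : ε * Real.exp (energyExponent u (s ^ 5)) + s ^ 5 * √(tenthMoment u (s ^ 5)) ≤ N * √s) :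
    ProfileBound u s N := by
  refine ⟨hs, hN, hF, ?_⟩
  have h := (memLp_mul_profileRep hu hd.memLp (by positivity : 0 ≤ s ^ 5)).2
  have h1 : √(∫ x : ℝ, ‖(x : ℂ) * profileRep u (s ^ 5) x‖ ^ 2) ≤ N * √s := by
    refine h.trans (le_trans ?_ hX)
    gcongr
    exact hd.weighted
  have h2 := (Real.sqrt_le_left (by positivity)).1 h1
  rwa [mul_pow, Real.sq_sqrt hs.le] at h2

/-- For times up to one no decay is needed: the time derivative of the transform is bounded by the
`L¹` norm of `u⁴ uₓ`, which the `H¹` energy controls. Here `40 = 5 · 8`. -/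
theorem SmallData.norm_profileF_le_short (hd : SmallData u ε) (hu : IsSolution u₀ u)
    (hsm : bootConst * ε ^ 4 ≤ 1) {S : ℝ} (hS : S ∈ Set.Icc (0 : ℝ) 1)
    (hE : ∀ s ∈ Set.Icc 0 S, energyExponent u (s ^ 5) ≤ 1 / 2) (η : ℝ) :
    ‖profileF u (S ^ 5) η‖ ≤ 5 * ε := by
  have huc := hu.continuousInH2
  have hε := hd.pos
  have hc := sobConstOne_pos
  have h := norm_image_sub_le_of_norm_deriv_right_le_segment (a := 0) (b := S)
    (f := fun s => profileF u (s ^ 5) η) (C := 40 * sobConstOne ^ 3 * ε ^ 5)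
    (fun s _ => (hasDerivAt_profileF_pow huc s η).continuousAt.continuousWithinAt)
    (fun s _ => (hasDerivAt_profileF_pow huc s η).hasDerivWithinAt) (fun s hs => ?_)
    S ⟨hS.1, le_rfl⟩
  · have h0 := hd.norm_profileF_zero_le huc η
    have h1 := norm_le_norm_add_norm_sub' (profileF u (S ^ 5) η) (profileF u 0 η)
    simp only [ne_eq, OfNat.ofNat_ne_zero, not_false_eq_true, zero_pow, sub_zero] at h
    have h2 : 40 * sobConstOne ^ 3 * ε ^ 5 * S ≤ ε * 1 := by
      calc 40 * sobConstOne ^ 3 * ε ^ 5 * S = ε * (40 * sobConstOne ^ 3 * ε ^ 4) * S := by ring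
        _ ≤ ε * 1 * 1 := by
          have := hS.1
          gcongr
          · exact (bootConst_bounds hsm).2.1
          · exact hS.2
        _ = _ := by ring
    linarith
  · have hs1 : s ^ 4 ≤ 1 := pow_le_one₀ hs.1 (hs.2.le.trans hS.2)
    have hb := (hd.energy_bounds hu (pow_nonneg hs.1 5) (hE s ⟨hs.1, hs.2.le⟩)).2.2.1
    rw [norm_smul, Real.norm_of_nonneg (by have := hs.1; positivity)]
    calc 5 * s ^ 4 * _ ≤ 5 * 1 * (8 * sobConstOne ^ 3 * ε ^ 5) := by
          gcongr
          exact (norm_mul_duhamelDensity_le huc _ η).trans hb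
      _ = _ := by ring

theorem exp_half_le_two {a : ℝ} (ha : a ≤ 1 / 2) : Real.exp a ≤ 2 := by
  have h1 : Real.exp a ^ 2 ≤ 2 ^ 2 := by
    rw [← Real.exp_nat_mul]
    refine (Real.exp_le_exp.2 (by push_cast; linarith : ((2 : ℕ) : ℝ) * a ≤ 1)).trans ?_
    linarith [Real.exp_one_lt_d9]
  exact (pow_le_pow_iff_left₀ (Real.exp_pos _).le (by norm_num) (by norm_num)).1 h1

theorem SmallData.weighted_le_short (hd : SmallData u ε) (hu : IsSolution u₀ u)
    (hsm : bootConst * ε ^ 4 ≤ 1) {S : ℝ} (hS : S ∈ Set.Icc (0 : ℝ) 1)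
    (hE : energyExponent u (S ^ 5) ≤ 1 / 2) :
    ε * Real.exp (energyExponent u (S ^ 5)) + S ^ 5 * √(tenthMoment u (S ^ 5)) ≤ 3 * ε := by
  have hε := hd.pos
  have h5 : S ^ 5 ≤ 1 := pow_le_one₀ hS.1 hS.2
  have hb := (hd.energy_bounds hu (pow_nonneg hS.1 5) hE).2.2.2
  have h1 := exp_half_le_two hE
  have h2 : S ^ 5 * √(tenthMoment u (S ^ 5)) ≤ 1 * ε := by
    refine mul_le_mul h5 (hb.trans ?_) (Real.sqrt_nonneg _) zero_le_one
    calc 2 * sobConstOne ^ 4 * ε ^ 5 = ε * (2 * sobConstOne ^ 4 * ε ^ 4) := by ring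
      _ ≤ ε * 1 := by gcongr; exact (bootConst_bounds hsm).2.2.1
      _ = ε := mul_one _
  nlinarith

/-- The `H¹` energy bounds `‖u‖_∞` but not `‖uₓ‖_∞`, which is taken from the dispersive estimate
even for small times. That estimate is singular at `s = 0`, but `dt = 5 s⁴ ds` leaves the bounded
rate `s^{3/2}`, and the continuity method improves `1/2` to `1/4`. -/
theorem SmallData.energyExponent_le (hd : SmallData u ε) (hu : IsSolution u₀ u)
    (hsm : bootConst * ε ^ 4 ≤ 1) :
    ∀ s ∈ Set.Icc (0 : ℝ) 1, energyExponent u (s ^ 5) ≤ 1 / 4 := by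
  have huc := hu.continuousInH2
  have hε := hd.pos
  have hc := sobConstOne_pos
  have hw := waveConst_pos
  have hE0 : energyExponent u (0 ^ 5) = 0 := by simp [energyExponent]
  have hEc : Continuous fun s => energyExponent u (s ^ 5) :=
    (continuous_energyExponent huc).comp (continuous_pow 5)
  refine le_of_bootstrap (φ := fun s => energyExponent u (s ^ 5)) (c := 1 / 2) (c' := 1 / 4)
    hEc.continuousOn (by norm_num) (by simp only [hE0]; norm_num) fun S hS hE => ?_
  have h := norm_image_sub_le_of_norm_deriv_right_le_segment (a := 0) (b := S)
    (f := fun s => energyExponent u (s ^ 5)) (C := 50 * sobConstOne ^ 3 * waveConst * ε ^ 4)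
    (fun s _ => (hasDerivAt_energyExponent_pow huc s).continuousAt.continuousWithinAt)
    (fun s _ => (hasDerivAt_energyExponent_pow huc s).hasDerivWithinAt) (fun s hs => ?_)
    S ⟨hS.1, le_rfl⟩
  · rw [hE0, sub_zero, sub_zero, Real.norm_eq_abs] at h
    have h1 := (bootConst_bounds hsm).1
    have h2 : 50 * sobConstOne ^ 3 * waveConst * ε ^ 4 * S ≤
        50 * sobConstOne ^ 3 * waveConst * ε ^ 4 * 1 := by
      gcongr; exact hS.2
    linarith [le_abs_self (energyExponent u (S ^ 5))]
  · rcases hs.1.eq_or_lt with rfl | hs0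
    · simp only [ne_eq, OfNat.ofNat_ne_zero, not_false_eq_true, zero_pow, mul_zero, zero_mul,
        norm_zero]
      positivity
    have hs1 : s ∈ Set.Icc (0 : ℝ) 1 := ⟨hs.1, hs.2.le.trans hS.2⟩
    have hsq : 0 < √s := Real.sqrt_pos.2 hs0
    have hsq1 : √s ≤ 1 := Real.sqrt_le_one.2 hs1.2
    have hEs := hE s ⟨hs.1, hs.2.le⟩
    -- The weighted norm does not shrink as `s → 0`, so `N √s` must stay of size `ε`; this forces
    -- `N` to grow like `s^{-1/2}`.
    have hb : ProfileBound u s (5 * ε / √s) := by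
      refine hd.profileBound hu hs0 (by positivity) (fun η => ?_) ?_
      · refine (hd.norm_profileF_le_short hu hsm hs1
          (fun r hr => hE r ⟨hr.1, hr.2.trans hs.2.le⟩) η).trans ?_
        rw [le_div_iff₀ hsq]
        exact mul_le_of_le_one_right (by positivity) hsq1
      · rw [div_mul_cancel₀ _ hsq.ne']
        exact (hd.weighted_le_short hu hsm hs1 hEs).trans (by linarith)
    have h1 := hb.supDeriv_le hu hd.memLp
    have h0 : supRep u (s ^ 5) ≤ sobConstOne * ε :=
      supRep_le u (hd.energy_bounds hu (pow_nonneg hs.1 5) hEs).2.1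
    have h00 := supRep_nonneg u (s ^ 5)
    have h11 := supDeriv_nonneg u (s ^ 5)
    rw [Real.norm_of_nonneg (by positivity)]
    calc 10 * s ^ 4 * supRep u (s ^ 5) ^ 3 * supDeriv u (s ^ 5)
        ≤ 10 * s ^ 4 * (sobConstOne * ε) ^ 3 * (waveConst * (5 * ε / √s) / s ^ 2) := by gcongr
      _ = 50 * sobConstOne ^ 3 * waveConst * ε ^ 4 * (s * (√s ^ 2 / √s)) := by
          rw [Real.sq_sqrt hs0.le]; field_simp; ring
      _ = 50 * sobConstOne ^ 3 * waveConst * ε ^ 4 * (s * √s) := by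
          rw [sq, mul_div_cancel_right₀ _ hsq.ne']
      _ ≤ 50 * sobConstOne ^ 3 * waveConst * ε ^ 4 * (1 * 1) := by
          gcongr
          exact hs1.2
      _ = _ := by ring

/-- The supremum of the Fourier transform of the profile. -/
def supF (u : ℝ → Lp ℝ 2 (volume : Measure ℝ)) (t : ℝ) : ℝ := ⨆ η, ‖profileF u t η‖

/-- Lipschitz dependence on time, uniform in the frequency, is what makes the supremum over
frequencies continuous in time. -/
theorem exists_norm_profileF_sub_le (hu : ContinuousInH2 u) (a b : ℝ) :
    ∃ M, 0 ≤ M ∧ ∀ t ∈ Set.Icc a b, ∀ t' ∈ Set.Icc a b, ∀ η,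
      ‖profileF u t η - profileF u t' η‖ ≤ M * |t - t'| := by
  obtain ⟨H, hH0, hH⟩ := exists_h2Real_bound hu a b
  have hc := sobConst_nonneg
  refine ⟨(sobConst * H) ^ 3 * (H ^ 2 + H ^ 2), by positivity, fun t ht t' ht' η => ?_⟩
  have := (convex_Icc a b).norm_image_sub_le_of_norm_hasDerivWithin_le
    (f := fun t => profileF u t η) (C := (sobConst * H) ^ 3 * (H ^ 2 + H ^ 2))
    (fun s _ => (hasDerivAt_profileF hu s η).hasDerivWithinAt) (fun s hs => ?_) ht' ht
  · simpa using this
  · have hHs := hH s (Set.Icc_subset_uIcc hs)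
    have h0 := h2Real_nonneg (u s)
    refine (norm_mul_duhamelDensity_le hu s η).trans ?_
    refine (integral_abs_quarticDeriv_le (hu.1 s) (fun x =>
      (abs_rep_le (hu.1 s) x).trans (by gcongr : _ ≤ sobConst * H))).trans ?_
    have h1 := (integral_rep_sq_le (hu.1 s)).trans (pow_le_pow_left₀ h0 hHs 2)
    have h2 := (integral_repDeriv_sq_le (hu.1 s)).trans (pow_le_pow_left₀ h0 hHs 2)
    gcongr

theorem bddAbove_norm_profileF (hu : ContinuousInH2 u) (t : ℝ) :
    BddAbove (Set.range fun η => ‖profileF u t η‖) := by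
  obtain ⟨M, hM0, hM⟩ := exists_norm_profileF_sub_le hu (-|t|) |t|
  refine ⟨(∫ x, |rep (u 0) x|) + M * |t|, ?_⟩
  rintro _ ⟨η, rfl⟩
  have h1 := hM t ⟨neg_abs_le t, le_abs_self t⟩ 0 ⟨by simp, by simp⟩ η
  have h0 : profileF u 0 η = 𝓕 (fun x => (rep (u 0) x : ℂ)) η := by
    simp [profileF, duhamelIntegral]
  have h2 := norm_fourier_le (f := fun x => (rep (u 0) x : ℂ)) η
  simp only [Complex.norm_real, Real.norm_eq_abs] at h2
  have h3 := norm_le_norm_add_norm_sub' (profileF u t η) (profileF u 0 η)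
  rw [sub_zero] at h1
  rw [← h0] at h2
  simp only
  linarith

theorem norm_profileF_le_supF (hu : ContinuousInH2 u) (t η : ℝ) :
    ‖profileF u t η‖ ≤ supF u t := le_ciSup (bddAbove_norm_profileF hu t) η

theorem supF_le {t B : ℝ} (h : ∀ η, ‖profileF u t η‖ ≤ B) : supF u t ≤ B := ciSup_le h

theorem supF_nonneg (hu : ContinuousInH2 u) (t : ℝ) : 0 ≤ supF u t :=
  (norm_nonneg _).trans (norm_profileF_le_supF hu t 0)

theorem continuous_supF (hu : ContinuousInH2 u) : Continuous (supF u) := by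
  refine continuous_iff_continuousAt.2 fun t₀ => ?_
  obtain ⟨M, hM0, hM⟩ := exists_norm_profileF_sub_le hu (t₀ - 1) (t₀ + 1)
  have hmem : Set.Icc (t₀ - 1) (t₀ + 1) ∈ 𝓝 t₀ := Icc_mem_nhds (by linarith) (by linarith)
  have hsub : ∀ t ∈ Set.Icc (t₀ - 1) (t₀ + 1), ∀ t' ∈ Set.Icc (t₀ - 1) (t₀ + 1),
      supF u t ≤ supF u t' + M * |t - t'| := fun t ht t' ht' => supF_le fun η => by
    have h1 := hM t ht t' ht' η
    have h2 := norm_profileF_le_supF hu t' η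
    have h3 := norm_le_norm_add_norm_sub' (profileF u t η) (profileF u t' η)
    linarith
  have h0 : t₀ ∈ Set.Icc (t₀ - 1) (t₀ + 1) := mem_of_mem_nhds hmem
  rw [ContinuousAt, tendsto_iff_norm_sub_tendsto_zero]
  have hlim : Tendsto (fun t => M * |t - t₀|) (𝓝 t₀) (𝓝 0) := by
    have : Continuous fun t => M * |t - t₀| := by fun_prop
    simpa using this.tendsto t₀
  refine squeeze_zero' (Eventually.of_forall fun t => norm_nonneg _) ?_ hlim
  filter_upwards [hmem] with t ht
  have h1 := hsub t ht t₀ h0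
  have h2 := hsub t₀ h0 t ht
  rw [abs_sub_comm t₀ t] at h2
  rw [Real.norm_eq_abs, abs_le]
  constructor <;> linarith

end FifthKdV
end

noncomputable section
namespace FifthKdV

/-! ### Global control -/

variable {u : ℝ → Lp ℝ 2 (volume : Measure ℝ)} {u₀ : Lp ℝ 2 (volume : Measure ℝ)} {ε : ℝ}

/-- The quantity controlled by the continuity argument, in the time variable `s = t^{1/5}`. -/
def profileSize (u : ℝ → Lp ℝ 2 (volume : Measure ℝ)) (ε s : ℝ) : ℝ :=
  supF u (s ^ 5) +
    (ε * Real.exp (energyExponent u (s ^ 5)) + s ^ 5 * √(tenthMoment u (s ^ 5))) / √s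

theorem continuousOn_profileSize (hu : ContinuousInH2 u) :
    ContinuousOn (profileSize u ε) (Set.Ioi 0) := by
  have h1 := continuous_supF hu
  have h2 := continuous_energyExponent hu
  have h3 := continuous_tenthMoment hu
  have h4 : Continuous fun s => supF u (s ^ 5) := by fun_prop
  have h5 : Continuous fun s => ε * Real.exp (energyExponent u (s ^ 5)) +
      s ^ 5 * √(tenthMoment u (s ^ 5)) := by fun_prop
  exact h4.continuousOn.add (h5.continuousOn.div Real.continuous_sqrt.continuousOn
    fun s hs => (Real.sqrt_pos.2 hs).ne')

theorem SmallData.profileBound_of_size (hd : SmallData u ε) (hu : IsSolution u₀ u) {s N : ℝ}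
    (hs : 0 < s) (hN : 0 < N) (h : profileSize u ε s ≤ N) : ProfileBound u s N := by
  have hsq : 0 < √s := Real.sqrt_pos.2 hs
  have hε := hd.pos
  have h1 := supF_nonneg hu.continuousInH2 (s ^ 5)
  have h2 : 0 ≤ (ε * Real.exp (energyExponent u (s ^ 5)) +
      s ^ 5 * √(tenthMoment u (s ^ 5))) / √s := by positivity
  rw [profileSize] at h
  refine hd.profileBound hu hs hN
    (fun η => (norm_profileF_le_supF hu.continuousInH2 _ η).trans (by linarith)) ?_
  rw [← div_le_iff₀ hsq]
  linarith

/-- In the variable `s` the time derivative of the transform is dominated by `|ξ| / (1 + (ξ s)²)`,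
`ξ = 2πη`, the derivative of `arctan (|ξ| s)`. Comparing increments yields at once a bound uniform
in the frequency and the convergence rate. -/
theorem norm_profileF_sub_le_arctan (hu : IsSolution u₀ u)
    (hx : MemLp (fun x => x * rep (u 0) x) 2) {a b N : ℝ} (hab : a ≤ b)
    (hb : ∀ s ∈ Set.Icc a b, ProfileBound u s N) (η : ℝ) :
    ‖profileF u (b ^ 5) η - profileF u (a ^ 5) η‖ ≤
      30 * wtMass * (waveConst * N) ^ 5 *
        (Real.arctan (|2 * Real.pi * η| * b) - Real.arctan (|2 * Real.pi * η| * a)) := by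
  have huc := hu.continuousInH2
  set ξ := |2 * Real.pi * η| with hξ
  set K := 30 * wtMass * (waveConst * N) ^ 5 with hK
  have hB : ∀ s, HasDerivAt (fun s => K * (Real.arctan (ξ * s) - Real.arctan (ξ * a)))
      (K * (1 / (1 + (ξ * s) ^ 2) * ξ)) s := fun s => by
    have h1 : HasDerivAt (fun s => ξ * s) ξ s := by
      simpa using (hasDerivAt_id s).const_mul ξ
    exact ((h1.arctan).sub_const _).const_mul K
  have hf : ∀ s, HasDerivAt (fun s => profileF u (s ^ 5) η - profileF u (a ^ 5) η)
      ((5 * s ^ 4 : ℝ) • (2 * Real.pi * Complex.I * η * duhamelDensity u (s ^ 5) η)) s :=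
    fun s => (hasDerivAt_profileF_pow huc s η).sub_const _
  refine image_norm_le_of_norm_deriv_right_le_deriv_boundary
    (f := fun s => profileF u (s ^ 5) η - profileF u (a ^ 5) η)
    (fun s _ => (hf s).continuousAt.continuousWithinAt)
    (fun s _ => (hf s).hasDerivWithinAt) (by simp) hB (fun s hs => ?_) ⟨hab, le_rfl⟩
  have hbs := hb s ⟨hs.1, hs.2.le⟩
  have hs0 := hbs.scale_pos
  rw [norm_smul, Real.norm_of_nonneg (by positivity)]
  calc 5 * s ^ 4 * _ ≤ 5 * s ^ 4 * (6 * wtMass * (waveConst * N) ^ 5 *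
        (ξ * s / (s ^ 5 * (1 + (2 * Real.pi * η * s) ^ 2)))) := by
        gcongr
        exact hbs.norm_deriv_profileF_le hu hx η
    _ = K * (1 / (1 + (ξ * s) ^ 2) * ξ) := by
        rw [mul_pow ξ s, hξ, sq_abs, ← mul_pow, hK]
        field_simp
        ring

/-- Since `arctan y < π/2`, the difference is at most `π/2 - arctan x = arctan (1/x) ≤ 1/x`. -/
theorem arctan_sub_arctan_le {x y : ℝ} (hx : 0 < x) :
    Real.arctan y - Real.arctan x ≤ x⁻¹ := by
  have h1 := Real.arctan_lt_pi_div_two y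
  have h2 := Real.arctan_inv_of_pos hx
  have h3 : Real.arctan x⁻¹ ≤ x⁻¹ := by
    have h4 : 0 ≤ Real.arctan x⁻¹ := Real.arctan_nonneg.2 (by positivity)
    have := Real.le_tan h4 (Real.arctan_lt_pi_div_two _)
    rwa [Real.tan_arctan] at this
  linarith

/-- The decay `s⁻¹` of `u` and `s⁻²` of `uₓ` makes the `s`-derivative of the exponent `O(N⁴ / s)`;
smallness brings it below `1/(2s)`. Thus `e^E` grows by at most `√s`, the normalisation in
`profileSize`. -/
theorem energyExponent_le_log (hu : IsSolution u₀ u)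
    (hx : MemLp (fun x => x * rep (u 0) x) 2) {S N : ℝ} (hS : 1 ≤ S)
    (hN : 20 * (waveConst * N) ^ 4 ≤ 1) (hb : ∀ s ∈ Set.Icc 1 S, ProfileBound u s N) :
    energyExponent u (S ^ 5) ≤ energyExponent u (1 ^ 5) + Real.log S / 2 := by
  have huc := hu.continuousInH2
  refine image_le_of_deriv_right_le_deriv_boundary
    (f := fun s => energyExponent u (s ^ 5))
    (B := fun s => energyExponent u (1 ^ 5) + Real.log s / 2) (B' := fun s => s⁻¹ / 2)
    (fun s _ => (hasDerivAt_energyExponent_pow huc s).continuousAt.continuousWithinAt)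
    (fun s _ => (hasDerivAt_energyExponent_pow huc s).hasDerivWithinAt) (by simp)
    (fun s hs => ?_) (fun s hs => ?_) (fun s hs => ?_) ⟨hS, le_rfl⟩
  · have h0 : s ≠ 0 := by linarith [hs.1]
    exact (((Real.hasDerivAt_log h0).div_const 2).const_add _).continuousAt.continuousWithinAt
  · have h0 : s ≠ 0 := by linarith [hs.1]
    exact (((Real.hasDerivAt_log h0).div_const 2).const_add _).hasDerivWithinAt
  · have hbs := hb s ⟨hs.1, hs.2.le⟩
    have hs0 := hbs.scale_pos
    have h0 := hbs.supRep_le hu hx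
    have h1 := hbs.supDeriv_le hu hx
    have h00 := supRep_nonneg u (s ^ 5)
    have h11 := supDeriv_nonneg u (s ^ 5)
    have hWN : 0 ≤ waveConst * N := (mul_pos waveConst_pos hbs.pos).le
    calc 10 * s ^ 4 * supRep u (s ^ 5) ^ 3 * supDeriv u (s ^ 5)
        ≤ 10 * s ^ 4 * (waveConst * N / s) ^ 3 * (waveConst * N / s ^ 2) := by gcongr
      _ = 20 * (waveConst * N) ^ 4 * (s⁻¹ / 2) := by field_simp; ring
      _ ≤ 1 * (s⁻¹ / 2) := by gcongr
      _ = s⁻¹ / 2 := one_mul _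

/-- The continuity argument: assuming `32 ε`, one recovers the value at `s = 1`, at most `8 ε`, plus
a quintic correction, also at most `8 ε`. -/
theorem SmallData.profileSize_le (hd : SmallData u ε) (hu : IsSolution u₀ u)
    (hsm : bootConst * ε ^ 4 ≤ 1) {s : ℝ} (hs : 1 ≤ s) : profileSize u ε s ≤ 16 * ε := by
  have huc := hu.continuousInH2
  have hε := hd.pos
  have hw := waveConst_pos
  have hm := wtMass_nonneg
  obtain ⟨-, -, -, hc4, hc5⟩ := bootConst_bounds hsm
  -- The sum of `5 ε` for the transform and `3 ε` for the weighted part.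
  have hone : profileSize u ε 1 ≤ 8 * ε := by
    have hE := hd.energyExponent_le hu hsm
    have h1 : supF u (1 ^ 5) ≤ 5 * ε := supF_le fun η =>
      hd.norm_profileF_le_short hu hsm ⟨zero_le_one, le_rfl⟩
        (fun s hs => (hE s hs).trans (by norm_num)) η
    have h2 := hd.weighted_le_short hu hsm ⟨zero_le_one, le_rfl⟩
      ((hE 1 ⟨zero_le_one, le_rfl⟩).trans (by norm_num))
    rw [profileSize, Real.sqrt_one, div_one]
    linarith
  refine le_of_bootstrap (φ := profileSize u ε) (a := 1) (b := s) (c := 32 * ε)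
    ((continuousOn_profileSize huc).mono fun r hr => lt_of_lt_of_le one_pos hr.1)
    (by linarith) (by linarith) (fun S hS hφ => ?_) s ⟨hs, le_rfl⟩
  have hb : ∀ r ∈ Set.Icc 1 S, ProfileBound u r (32 * ε) := fun r hr =>
    hd.profileBound_of_size hu (lt_of_lt_of_le one_pos hr.1) (by positivity) (hφ r hr)
  have hS0 : 0 < S := lt_of_lt_of_le one_pos hS.1
  have hsq : 0 < √S := Real.sqrt_pos.2 hS0
  have hbS := hb S ⟨hS.1, le_rfl⟩
  set W := (waveConst * (32 * ε)) ^ 5 with hW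
  have hW0 : 0 ≤ W := by positivity
  -- the Fourier transform
  have h1 : supF u (S ^ 5) ≤ supF u (1 ^ 5) + 50 * wtMass * W := supF_le fun η => by
    have k1 := norm_profileF_sub_le_arctan hu hd.memLp hS.1 hb η
    have k2 := norm_profileF_le_supF huc (1 ^ 5) η
    have k3 := norm_le_norm_add_norm_sub' (profileF u (S ^ 5) η) (profileF u (1 ^ 5) η)
    -- Any rational above `π/2` would do; `30 · 5/3 = 50` is the factor in `bootConst`.
    have k4 : Real.arctan (|2 * Real.pi * η| * S) - Real.arctan (|2 * Real.pi * η| * 1) ≤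
        5 / 3 := by
      have := Real.arctan_lt_pi_div_two (|2 * Real.pi * η| * S)
      have := Real.arctan_nonneg.2 (by positivity : 0 ≤ |2 * Real.pi * η| * 1)
      linarith [Real.pi_lt_d2]
    have k5 : 30 * wtMass * W * (Real.arctan (|2 * Real.pi * η| * S) -
        Real.arctan (|2 * Real.pi * η| * 1)) ≤ 30 * wtMass * W * (5 / 3) := by gcongr
    linarith
  -- the energy
  have h2 : Real.exp (energyExponent u (S ^ 5)) ≤ Real.exp (energyExponent u (1 ^ 5)) * √S := by
    have k1 := energyExponent_le_log hu hd.memLp hS.1 (by linarith [hc4,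
      (by ring : 20 * (waveConst * (32 * ε)) ^ 4 = 20 * (32 * waveConst) ^ 4 * ε ^ 4)]) hb
    refine (Real.exp_le_exp.2 k1).trans (le_of_eq ?_)
    rw [Real.exp_add, Real.exp_half, Real.exp_log hS0]
  -- the quintic term
  have h3 : S ^ 5 * √(tenthMoment u (S ^ 5)) ≤ W * √wtMass * √S := by
    have k1 := hbS.tenthMoment_le hu hd.memLp
    have k2 : tenthMoment u (S ^ 5) ≤ (W * √wtMass * √S / S ^ 5) ^ 2 := by
      refine k1.trans (le_of_eq ?_)
      rw [div_pow, mul_pow (W * √wtMass), mul_pow W, Real.sq_sqrt hm, Real.sq_sqrt hS0.le, hW]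
      field_simp
    have k3 := (Real.sqrt_le_sqrt k2).trans (Real.sqrt_sq (by positivity)).le
    calc S ^ 5 * √(tenthMoment u (S ^ 5)) ≤ S ^ 5 * (W * √wtMass * √S / S ^ 5) := by gcongr
      _ = _ := by field_simp
  have h4 : (50 * wtMass + √wtMass) * W ≤ 8 * ε := by
    have : 4 * ((50 * wtMass + √wtMass) * W) =
        32 * ε * (4 * (50 * wtMass + √wtMass) * waveConst ^ 5 * 32 ^ 4 * ε ^ 4) := by
      rw [hW]; ring
    have k : 32 * ε * (4 * (50 * wtMass + √wtMass) * waveConst ^ 5 * 32 ^ 4 * ε ^ 4) ≤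
        32 * ε * 1 := by gcongr
    linarith
  have h5 : profileSize u ε 1 ≥ supF u (1 ^ 5) + ε * Real.exp (energyExponent u (1 ^ 5)) := by
    rw [profileSize, Real.sqrt_one, div_one]
    have : 0 ≤ (1 : ℝ) ^ 5 * √(tenthMoment u (1 ^ 5)) := by positivity
    linarith
  have h6 : (ε * Real.exp (energyExponent u (S ^ 5)) + S ^ 5 * √(tenthMoment u (S ^ 5))) / √S ≤
      ε * Real.exp (energyExponent u (1 ^ 5)) + W * √wtMass := by
    rw [div_le_iff₀ hsq]
    have := mul_le_mul_of_nonneg_left h2 hε.le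
    linarith
  have h7 : 50 * wtMass * W + W * √wtMass ≤ 8 * ε := by
    refine le_trans (le_of_eq ?_) h4
    ring
  rw [profileSize]
  refine (add_le_add h1 h6).trans ?_
  clear_value W
  linarith

theorem SmallData.profileBound_of_one_le (hd : SmallData u ε) (hu : IsSolution u₀ u)
    (hsm : bootConst * ε ^ 4 ≤ 1) {s : ℝ} (hs : 1 ≤ s) : ProfileBound u s (16 * ε) :=
  hd.profileBound_of_size hu (lt_of_lt_of_le one_pos hs) (by have := hd.pos; positivity)
    (hd.profileSize_le hu hsm hs)

/-- The decay constant of the increments of the profile. -/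
def driftConst : ℝ := 30 * wtMass * (waveConst * 16) ^ 5

theorem driftConst_nonneg : 0 ≤ driftConst := by
  have h1 := waveConst_pos
  have h2 := wtMass_nonneg
  rw [driftConst]; positivity

theorem SmallData.norm_profileF_sub_le (hd : SmallData u ε) (hu : IsSolution u₀ u)
    (hsm : bootConst * ε ^ 4 ≤ 1) {a b η : ℝ} (ha : 1 ≤ a) (hab : a ≤ b) (hη : η ≠ 0) :
    ‖profileF u (b ^ 5) η - profileF u (a ^ 5) η‖ ≤
      driftConst * ε ^ 5 * (|2 * Real.pi * η| * a)⁻¹ := by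
  have hpi := Real.pi_pos
  have hw := waveConst_pos
  have hm := wtMass_nonneg
  have hε := hd.pos
  refine (norm_profileF_sub_le_arctan hu hd.memLp hab (fun s hs =>
    hd.profileBound_of_one_le hu hsm (ha.trans hs.1)) η).trans ?_
  have e : 30 * wtMass * (waveConst * (16 * ε)) ^ 5 = driftConst * ε ^ 5 := by
    rw [driftConst]; ring
  rw [e]
  have := driftConst_nonneg
  have hξ : 0 < |2 * Real.pi * η| := by positivity
  gcongr
  exact arctan_sub_arctan_le (by positivity)

end FifthKdV
end

noncomputable section
namespace FifthKdV

/-! ### Asymptotics of the profile -/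

variable {u : ℝ → Lp ℝ 2 (volume : Measure ℝ)} {u₀ : Lp ℝ 2 (volume : Measure ℝ)} {ε : ℝ}

/-- The limit is taken along integer times, so that applied frequency by frequency it exhibits the
limiting function as a pointwise limit of a sequence, hence measurable. -/
theorem exists_limit_of_norm_sub_le {E : Type*} [NormedAddCommGroup E] [CompleteSpace E]
    {H : ℝ → E} {ψ : ℝ → ℝ} (hψ : Tendsto ψ atTop (𝓝 0))
    (h : ∀ a b, 1 ≤ a → a ≤ b → ‖H b - H a‖ ≤ ψ a) :
    ∃ l, Tendsto (fun n : ℕ => H (n + 1)) atTop (𝓝 l) ∧ ∀ a, 1 ≤ a → ‖H a - l‖ ≤ ψ a := by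
  have hn : Tendsto (fun n : ℕ => (n : ℝ) + 1) atTop atTop :=
    tendsto_atTop_add_const_right _ _ tendsto_natCast_atTop_atTop
  have hc : CauchySeq fun n : ℕ => H (n + 1) := by
    refine cauchySeq_of_le_tendsto_0' (fun n : ℕ => ψ (n + 1)) (fun n m hnm => ?_) (hψ.comp hn)
    rw [dist_comm, dist_eq_norm]
    have : (n : ℝ) ≤ m := by exact_mod_cast hnm
    exact h _ _ (by linarith [n.cast_nonneg (α := ℝ)]) (by linarith)
  obtain ⟨l, hl⟩ := cauchySeq_tendsto_of_complete hc
  refine ⟨l, hl, fun a ha => ?_⟩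
  refine le_of_tendsto (hl.const_sub (H a)).norm ?_
  filter_upwards [hn.eventually_ge_atTop a] with n hna
  rw [norm_sub_rev]
  exact h _ _ ha hna

theorem norm_exp_I_mul_sub_le (a b : ℝ) :
    ‖Complex.exp (Complex.I * (a : ℂ)) - Complex.exp (Complex.I * (b : ℂ))‖ ≤ |a - b| := by
  have e : Complex.exp (Complex.I * (a : ℂ)) - Complex.exp (Complex.I * (b : ℂ)) =
      Complex.exp (Complex.I * (b : ℂ)) * (Complex.exp (Complex.I * ((a - b : ℝ) : ℂ)) - 1) := by
    rw [mul_sub, mul_one, ← Complex.exp_add]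
    congr 2; push_cast; ring
  rw [e, norm_mul, Complex.norm_exp_I_mul_ofReal, one_mul]
  exact Real.norm_exp_I_mul_ofReal_sub_one_le

theorem fifth_root_pow {t : ℝ} (ht : 0 ≤ t) : (t ^ (1 / 5 : ℝ)) ^ 5 = t := by
  rw [← Real.rpow_natCast, ← Real.rpow_mul ht]; norm_num

theorem norm_inv_sqrt_two_pi_le : ‖((1 / Real.sqrt (2 * Real.pi) : ℝ) : ℂ)‖ ≤ 1 := by
  rw [Complex.norm_real, Real.norm_of_nonneg (by positivity)]
  refine div_le_one_of_le₀ ?_ (Real.sqrt_nonneg _)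
  rw [Real.one_le_sqrt]
  linarith [Real.pi_gt_three]

theorem SmallData.norm_profileHat_le (hd : SmallData u ε) (hu : IsSolution u₀ u)
    (hsm : bootConst * ε ^ 4 ≤ 1) {t : ℝ} (ht : 1 ≤ t) (ξ : ℝ) :
    ‖profileHat u t ξ‖ ≤ 16 * ε := by
  have h0 : 0 ≤ t := by linarith
  have h1 := (hd.profileBound_of_one_le hu hsm
    (Real.one_le_rpow ht (by norm_num : (0 : ℝ) ≤ 1 / 5))).fourier (ξ / (2 * Real.pi))
  rw [fifth_root_pow h0] at h1
  rw [profileHat_eq hu hd.memLp h0, norm_mul]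
  calc _ ≤ 1 * ‖profileF u t (ξ / (2 * Real.pi))‖ := by
        gcongr; exact norm_inv_sqrt_two_pi_le
    _ ≤ _ := by rw [one_mul]; exact h1

theorem SmallData.norm_profileHat_sub_le (hd : SmallData u ε) (hu : IsSolution u₀ u)
    (hsm : bootConst * ε ^ 4 ≤ 1) {a b : ℝ} (ha : 1 ≤ a) (hab : a ≤ b) (ξ : ℝ) :
    ‖profileHat u b ξ - profileHat u a ξ‖ ≤
      driftConst * ε ^ 5 * (|ξ| * a ^ (1 / 5 : ℝ))⁻¹ := by
  have ha0 : 0 ≤ a := by linarith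
  have hb0 : 0 ≤ b := by linarith
  have hpi := Real.pi_pos
  rw [profileHat_eq hu hd.memLp ha0, profileHat_eq hu hd.memLp hb0, ← mul_sub, norm_mul]
  refine (mul_le_of_le_one_left (norm_nonneg _) norm_inv_sqrt_two_pi_le).trans ?_
  rcases eq_or_ne ξ 0 with rfl | hξ
  · simp [profileF]
  have h := hd.norm_profileF_sub_le hu hsm (η := ξ / (2 * Real.pi))
    (Real.one_le_rpow ha (by norm_num : (0 : ℝ) ≤ 1 / 5))
    (Real.rpow_le_rpow ha0 hab (by norm_num : (0 : ℝ) ≤ 1 / 5)) (by positivity)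
  rwa [fifth_root_pow ha0, fifth_root_pow hb0,
    show 2 * Real.pi * (ξ / (2 * Real.pi)) = ξ by field_simp] at h

theorem SmallData.continuousOn_profileHat (hd : SmallData u ε) (hu : IsSolution u₀ u) (ξ : ℝ) :
    ContinuousOn (fun t => profileHat u t ξ) (Set.Ici 1) := by
  have hc : Continuous fun t => ((1 / Real.sqrt (2 * Real.pi) : ℝ) : ℂ) *
      profileF u t (ξ / (2 * Real.pi)) :=
    continuous_const.mul (continuous_iff_continuousAt.2 fun t =>
      (hasDerivAt_profileF hu.continuousInH2 t _).continuousAt)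
  exact hc.continuousOn.congr fun t ht =>
    profileHat_eq hu hd.memLp (zero_le_one.trans ht) ξ

theorem SmallData.continuous_profileHat (hd : SmallData u ε) (hu : IsSolution u₀ u) {t : ℝ}
    (ht : 0 ≤ t) : Continuous (profileHat u t) := by
  have hc := continuous_profileF_right hu.continuousInH2 (hd.integrable hu.continuousInH2) t
  have e : profileHat u t = fun ξ => ((1 / Real.sqrt (2 * Real.pi) : ℝ) : ℂ) *
      profileF u t (ξ / (2 * Real.pi)) := funext fun ξ => profileHat_eq hu hd.memLp ht ξ
  rw [e]
  fun_prop

theorem SmallData.intervalIntegrable_phase (hd : SmallData u ε) (hu : IsSolution u₀ u) (ξ : ℝ)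
    {a b : ℝ} (ha : 1 ≤ a) (hb : 1 ≤ b) :
    IntervalIntegrable (fun s => ‖profileHat u s ξ‖ ^ 4 / s ^ 2) volume a b := by
  refine ContinuousOn.intervalIntegrable ?_
  have hsub : Set.uIcc a b ⊆ Set.Ici 1 := fun s hs => (le_inf ha hb).trans hs.1
  refine ContinuousOn.div (((hd.continuousOn_profileHat hu ξ).mono hsub).norm.pow 4)
    (continuousOn_pow 2) fun s hs => ?_
  have : 1 ≤ s := hsub hs
  positivity

/-- As `f̂` is bounded, `∫ ds / s²` from `a` on is at most `1/a`, and `|ξ|⁻⁵ a⁻¹ = (|ξ| a^{1/5})⁻⁵`.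
The phase therefore converges faster than the profile. -/
theorem SmallData.abs_phaseB_sub_le (hd : SmallData u ε) (hu : IsSolution u₀ u)
    (hsm : bootConst * ε ^ 4 ≤ 1) {a b : ℝ} (ha : 1 ≤ a) (hab : a ≤ b) (ξ : ℝ) :
    |phaseB u b ξ - phaseB u a ξ| ≤ (16 * ε) ^ 4 * ((|ξ| * a ^ (1 / 5 : ℝ)) ^ 5)⁻¹ := by
  have ha0 : 0 < a := by linarith
  have hb0 : 0 < b := by linarith
  have hε := hd.pos
  have hI := hd.intervalIntegrable_phase hu ξ le_rfl ha
  have hI' := hd.intervalIntegrable_phase hu ξ ha (ha.trans hab)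
  have h1 : phaseB u b ξ - phaseB u a ξ =
      1 / (40 * ξ ^ 5) * ∫ s in a..b, ‖profileHat u s ξ‖ ^ 4 / s ^ 2 := by
    rw [phaseB, phaseB, ← mul_sub, ← intervalIntegral.integral_add_adjacent_intervals hI hI']
    ring
  have h2 : |∫ s in a..b, ‖profileHat u s ξ‖ ^ 4 / s ^ 2| ≤ (16 * ε) ^ 4 * a⁻¹ := by
    have hpow : IntervalIntegrable (fun s : ℝ => (16 * ε) ^ 4 * s ^ (-2 : ℤ)) volume a b := by
      refine ContinuousOn.intervalIntegrable (continuousOn_const.mul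
        (ContinuousOn.zpow₀ continuousOn_id _ fun s hs => Or.inl ?_))
      have : a ⊓ b ≤ s := hs.1
      have : 0 < s := lt_of_lt_of_le (lt_min ha0 hb0) this
      exact this.ne'
    rw [abs_of_nonneg (intervalIntegral.integral_nonneg hab fun s _ => by positivity)]
    calc _ ≤ ∫ s in a..b, (16 * ε) ^ 4 * s ^ (-2 : ℤ) := by
          refine intervalIntegral.integral_mono_on hab hI' hpow fun s hs => ?_
          rw [zpow_neg, div_eq_mul_inv]
          have := hd.norm_profileHat_le hu hsm (ha.trans hs.1) ξ
          have hs0 : 0 < s := ha0.trans_le hs.1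
          gcongr
          exact le_rfl
      _ = (16 * ε) ^ 4 * (a⁻¹ - b⁻¹) := by
          rw [intervalIntegral.integral_const_mul, integral_zpow]
          · norm_num
            left; ring
          · refine Or.inr ⟨by norm_num, fun h => ?_⟩
            rw [Set.uIcc_of_le hab] at h
            linarith [h.1]
      _ ≤ _ := by
          gcongr
          have : 0 < b⁻¹ := by positivity
          linarith
  rw [h1, abs_mul]
  have h3 : (|ξ| * a ^ (1 / 5 : ℝ)) ^ 5 = |ξ| ^ 5 * a := by
    rw [mul_pow, fifth_root_pow ha0.le]
  rw [h3, abs_div, abs_one, abs_mul, abs_pow, mul_inv]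
  have h4 : 1 / (|(40 : ℝ)| * |ξ| ^ 5) ≤ (|ξ| ^ 5)⁻¹ := by
    rw [one_div, mul_inv]
    refine mul_le_of_le_one_left (by positivity) ?_
    norm_num
  calc _ ≤ (|ξ| ^ 5)⁻¹ * ((16 * ε) ^ 4 * a⁻¹) := by gcongr
    _ = _ := by ring

/-- The increments of the profile and of the phase are estimated separately; no cancellation between
them is used. -/
theorem SmallData.norm_modifiedProfile_sub_le (hd : SmallData u ε) (hu : IsSolution u₀ u)
    (hsm : bootConst * ε ^ 4 ≤ 1) {a b : ℝ} (ha : 1 ≤ a) (hab : a ≤ b) (ξ : ℝ) :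
    ‖modifiedProfile u b ξ - modifiedProfile u a ξ‖ ≤
      driftConst * ε ^ 5 * (|ξ| * a ^ (1 / 5 : ℝ))⁻¹ +
        (16 * ε) ^ 5 * ((|ξ| * a ^ (1 / 5 : ℝ)) ^ 5)⁻¹ := by
  have e : modifiedProfile u b ξ - modifiedProfile u a ξ =
      Complex.exp (Complex.I * (phaseB u b ξ : ℂ)) * (profileHat u b ξ - profileHat u a ξ) +
      (Complex.exp (Complex.I * (phaseB u b ξ : ℂ)) -
        Complex.exp (Complex.I * (phaseB u a ξ : ℂ))) * profileHat u a ξ := by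
    rw [modifiedProfile, modifiedProfile]; ring
  rw [e]
  have hε := hd.pos
  refine (norm_add_le _ _).trans (add_le_add ?_ ?_)
  · rw [norm_mul, Complex.norm_exp_I_mul_ofReal, one_mul]
    exact hd.norm_profileHat_sub_le hu hsm ha hab ξ
  · rw [norm_mul]
    have h1 := (norm_exp_I_mul_sub_le (phaseB u b ξ) (phaseB u a ξ)).trans
      (hd.abs_phaseB_sub_le hu hsm ha hab ξ)
    have h2 := hd.norm_profileHat_le hu hsm ha ξ
    refine (mul_le_mul h1 h2 (norm_nonneg _) (by positivity)).trans (le_of_eq ?_)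
    ring

/-- Measurability rather than continuity, because the phase is singular at `ξ = 0`. The time
integral is measurable in `ξ` by Fubini, after replacing the profile by its jointly continuous
formula. -/
theorem SmallData.measurable_modifiedProfile (hd : SmallData u ε) (hu : IsSolution u₀ u) {t : ℝ}
    (ht : 1 ≤ t) : Measurable (modifiedProfile u t) := by
  have hF := continuous_profileF hu.continuousInH2 (hd.integrable hu.continuousInH2)
  have hF' : Continuous fun z : ℝ × ℝ => profileF u z.2 (z.1 / (2 * Real.pi)) :=
    hF.comp (g := fun z : ℝ × ℝ => profileF u z.1 z.2)
      (f := fun z : ℝ × ℝ => (z.2, z.1 / (2 * Real.pi))) (by fun_prop)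
  have hm : Measurable fun z : ℝ × ℝ => ‖((1 / Real.sqrt (2 * Real.pi) : ℝ) : ℂ) *
      profileF u z.2 (z.1 / (2 * Real.pi))‖ ^ 4 / z.2 ^ 2 :=
    Measurable.div ((continuous_const.mul hF').norm.pow 4).measurable (by fun_prop)
  have hint : Measurable fun ξ : ℝ => ∫ s in (1 : ℝ)..t, ‖profileHat u s ξ‖ ^ 4 / s ^ 2 := by
    have h := (hm.stronglyMeasurable.integral_prod_right'
      (ν := (volume : Measure ℝ).restrict (Set.Ioc 1 t))).measurable
    convert h using 2 with ξ
    rw [intervalIntegral.integral_of_le ht]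
    refine setIntegral_congr_fun measurableSet_Ioc fun s hs => ?_
    simp only
    rw [profileHat_eq hu hd.memLp (zero_le_one.trans hs.1.le)]
  have hB : Measurable fun ξ => phaseB u t ξ := by
    unfold phaseB
    exact Measurable.mul (by fun_prop) hint
  have hP := (hd.continuous_profileHat hu (zero_le_one.trans ht)).measurable
  unfold modifiedProfile
  fun_prop

theorem memLp_top_of_tendsto {H : ℝ → ℝ → ℂ} {l : ℝ → ℂ} {M : ℝ}
    (hH : ∀ t, 1 ≤ t → Measurable (H t)) (hM : ∀ t ξ, 1 ≤ t → ‖H t ξ‖ ≤ M)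
    (hl : ∀ ξ, Tendsto (fun n : ℕ => H (n + 1) ξ) atTop (𝓝 (l ξ))) :
    MemLp l ⊤ volume ∧ ∀ ξ, ‖l ξ‖ ≤ M := by
  have h1 : ∀ n : ℕ, (1 : ℝ) ≤ n + 1 := fun n => by linarith [n.cast_nonneg (α := ℝ)]
  have hb : ∀ ξ, ‖l ξ‖ ≤ M := fun ξ =>
    le_of_tendsto (hl ξ).norm (Eventually.of_forall fun n => hM _ ξ (h1 n))
  have hm : Measurable l := measurable_of_tendsto_metrizable (f := fun n : ℕ => H (n + 1))
    (fun n => hH _ (h1 n)) (tendsto_pi_nhds.2 hl)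
  exact ⟨memLp_top_of_bound hm.aestronglyMeasurable M (ae_of_all _ hb), hb⟩

theorem tendsto_inv_mul_fifth_root (ξ : ℝ) :
    Tendsto (fun a : ℝ => (|ξ| * a ^ (1 / 5 : ℝ))⁻¹) atTop (𝓝 0) := by
  have h := (tendsto_rpow_neg_atTop (by norm_num : (0 : ℝ) < 1 / 5)).const_mul |ξ|⁻¹
  rw [mul_zero] at h
  refine h.congr' ?_
  filter_upwards [eventually_ge_atTop 0] with a ha
  rw [Real.rpow_neg ha, mul_inv]

/-- Where `r ≥ 2⁻¹⁰`, a surplus of decay `r^{-(k-p)}` is bounded by `2^{10 (k-p)}` and can be given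
away. -/
theorem inv_pow_le_rpow {r p : ℝ} {k : ℕ} (hr : (2 : ℝ) ^ (-10 : ℝ) ≤ r) (hp : 0 ≤ p)
    (hpk : p ≤ k) : (r ^ k)⁻¹ ≤ 2 ^ (10 * k) * r ^ (-p) := by
  have h2 : (0 : ℝ) < 2 ^ (-10 : ℝ) := by positivity
  have hr0 : 0 < r := h2.trans_le hr
  have e : (r ^ k)⁻¹ = r ^ (-(k - p)) * r ^ (-p) := by
    rw [← Real.rpow_add hr0, ← Real.rpow_natCast, ← Real.rpow_neg hr0.le]
    congr 1; ring
  rw [e]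
  gcongr
  calc r ^ (-(k - p)) ≤ ((2 : ℝ) ^ (-10 : ℝ)) ^ (-(k - p)) :=
        Real.rpow_le_rpow_of_nonpos h2 hr (by linarith)
    _ = (2 : ℝ) ^ (10 * (k - p)) := by
        rw [← Real.rpow_mul (by norm_num)]; congr 1; ring
    _ ≤ (2 : ℝ) ^ ((10 * k : ℕ) : ℝ) := by
        refine Real.rpow_le_rpow_of_exponent_le (by norm_num) ?_
        push_cast; nlinarith
    _ = 2 ^ (10 * k) := Real.rpow_natCast _ _

/-- The constant of the asymptotic expansion. -/
def asymptoticConst : ℝ := 2 ^ 10 * driftConst + 2 ^ 50 * 16 ^ 5 + 1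

theorem asymptoticConst_pos : 0 < asymptoticConst := by
  have := driftConst_nonneg
  rw [asymptoticConst]; positivity

theorem error_le {r p : ℝ} (hε : 0 < ε) (hε1 : ε ≤ 1) (hr : (2 : ℝ) ^ (-10 : ℝ) ≤ r)
    (hp : 0 ≤ p) (hp1 : p ≤ 1) :
    driftConst * ε ^ 5 * r⁻¹ + (16 * ε) ^ 5 * (r ^ 5)⁻¹ ≤ asymptoticConst * ε * r ^ (-p) := by
  have hr0 : 0 < r := lt_of_lt_of_le (by positivity) hr
  have hD := driftConst_nonneg
  have h1 := inv_pow_le_rpow (k := 1) hr hp (by simpa using hp1)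
  have h5 := inv_pow_le_rpow (k := 5) hr hp (hp1.trans (by norm_num))
  rw [pow_one] at h1
  have he : ε ^ 5 ≤ ε := by
    calc ε ^ 5 = ε * ε ^ 4 := by ring
      _ ≤ ε * 1 := by gcongr; exact pow_le_one₀ hε.le hε1
      _ = ε := mul_one _
  have hrp : 0 < r ^ (-p) := by positivity
  calc driftConst * ε ^ 5 * r⁻¹ + (16 * ε) ^ 5 * (r ^ 5)⁻¹
      ≤ driftConst * ε * (2 ^ (10 * 1) * r ^ (-p)) +
        16 ^ 5 * ε * (2 ^ (10 * 5) * r ^ (-p)) := by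
        rw [mul_pow 16 ε]
        gcongr
    _ = (2 ^ 10 * driftConst + 2 ^ 50 * 16 ^ 5) * ε * r ^ (-p) := by ring
    _ ≤ asymptoticConst * ε * r ^ (-p) := by
        refine mul_le_mul_of_nonneg_right (mul_le_mul_of_nonneg_right ?_ hε.le) hrp.le
        rw [asymptoticConst]
        linarith

/-- Of the exponent `γ` only the sign matters: `t^γ ≥ 1` puts the region inside the self-similar
one. -/
theorem le_scale_of_mem_region {t ξ γ : ℝ} (ht : 1 ≤ t) (hγ : 0 ≤ γ)
    (h : (2 : ℝ) ^ (-10 : ℝ) * t ^ (-(1 / 5) + γ) ≤ |ξ|) :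
    (2 : ℝ) ^ (-10 : ℝ) ≤ |ξ| * t ^ (1 / 5 : ℝ) := by
  have ht0 : 0 < t := by linarith
  calc (2 : ℝ) ^ (-10 : ℝ) ≤ (2 : ℝ) ^ (-10 : ℝ) * t ^ γ :=
        le_mul_of_one_le_right (by positivity) (Real.one_le_rpow ht hγ)
    _ = (2 : ℝ) ^ (-10 : ℝ) * t ^ (-(1 / 5) + γ) * t ^ (1 / 5 : ℝ) := by
        rw [mul_assoc, ← Real.rpow_add ht0]
        congr 2; ring
    _ ≤ _ := by gcongr

theorem SmallData.exists_modifiedProfile_limit (hd : SmallData u ε) (hu : IsSolution u₀ u)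
    (hsm : bootConst * ε ^ 4 ≤ 1) :
    ∃ w : ℝ → ℂ, MemLp w ⊤ volume ∧ ∀ t ξ, 1 ≤ t → ‖modifiedProfile u t ξ - w ξ‖ ≤
      driftConst * ε ^ 5 * (|ξ| * t ^ (1 / 5 : ℝ))⁻¹ +
        (16 * ε) ^ 5 * ((|ξ| * t ^ (1 / 5 : ℝ)) ^ 5)⁻¹ := by
  have h : ∀ ξ, ∃ l, Tendsto (fun n : ℕ => modifiedProfile u (n + 1) ξ) atTop (𝓝 l) ∧
      ∀ a, 1 ≤ a → ‖modifiedProfile u a ξ - l‖ ≤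
        driftConst * ε ^ 5 * (|ξ| * a ^ (1 / 5 : ℝ))⁻¹ +
        (16 * ε) ^ 5 * ((|ξ| * a ^ (1 / 5 : ℝ)) ^ 5)⁻¹ := fun ξ => by
    refine exists_limit_of_norm_sub_le (H := fun t => modifiedProfile u t ξ) ?_
      fun a b ha hab => hd.norm_modifiedProfile_sub_le hu hsm ha hab ξ
    have h1 := tendsto_inv_mul_fifth_root ξ
    have h2 := (h1.const_mul (driftConst * ε ^ 5)).add ((h1.pow 5).const_mul ((16 * ε) ^ 5))
    simpa only [mul_zero, add_zero, inv_pow, ne_eq, OfNat.ofNat_ne_zero, not_false_eq_true,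
      zero_pow] using h2
  choose w hw1 hw2 using h
  refine ⟨w, (memLp_top_of_tendsto (M := 16 * ε)
    (fun t ht => hd.measurable_modifiedProfile hu ht) (fun t ξ ht => ?_) hw1).1,
    fun t ξ ht => hw2 ξ t ht⟩
  rw [modifiedProfile, norm_mul, Complex.norm_exp_I_mul_ofReal, one_mul]
  exact hd.norm_profileHat_le hu hsm ht ξ

/-- The function `f` is the plain limit of the profile transform. Inserting the phase factor changes
it by at most `|θ| |f| ≲ ε⁵ (|ξ| t^{1/5})⁻⁵`, which belongs to the error. -/
theorem SmallData.exists_profileHat_limit (hd : SmallData u ε) (hu : IsSolution u₀ u)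
    (hsm : bootConst * ε ^ 4 ≤ 1) :
    ∃ f : ℝ → ℂ, MemLp f ⊤ volume ∧ ∀ t ξ, 1 ≤ t →
      ‖profileHat u t ξ - Complex.exp (Complex.I *
        ((‖f ξ‖ ^ 4 / (40 * t * ξ ^ 5) : ℝ) : ℂ)) * f ξ‖ ≤
      driftConst * ε ^ 5 * (|ξ| * t ^ (1 / 5 : ℝ))⁻¹ +
        (16 * ε) ^ 5 * ((|ξ| * t ^ (1 / 5 : ℝ)) ^ 5)⁻¹ := by
  have hε := hd.pos
  have h : ∀ ξ, ∃ l, Tendsto (fun n : ℕ => profileHat u (n + 1) ξ) atTop (𝓝 l) ∧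
      ∀ a, 1 ≤ a → ‖profileHat u a ξ - l‖ ≤
        driftConst * ε ^ 5 * (|ξ| * a ^ (1 / 5 : ℝ))⁻¹ := fun ξ => by
    refine exists_limit_of_norm_sub_le (H := fun t => profileHat u t ξ) ?_
      fun a b ha hab => hd.norm_profileHat_sub_le hu hsm ha hab ξ
    simpa using (tendsto_inv_mul_fifth_root ξ).const_mul (driftConst * ε ^ 5)
  choose f hf1 hf2 using h
  obtain ⟨hf, hfb⟩ := memLp_top_of_tendsto (M := 16 * ε)
    (fun t ht => (hd.continuous_profileHat hu (zero_le_one.trans ht)).measurable)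
    (fun t ξ ht => hd.norm_profileHat_le hu hsm ht ξ) hf1
  refine ⟨f, hf, fun t ξ ht => ?_⟩
  have ht0 : 0 < t := by linarith
  set θ : ℝ := ‖f ξ‖ ^ 4 / (40 * t * ξ ^ 5) with hθ
  have e : profileHat u t ξ - Complex.exp (Complex.I * (θ : ℂ)) * f ξ =
      (profileHat u t ξ - f ξ) - (Complex.exp (Complex.I * (θ : ℂ)) -
        Complex.exp (Complex.I * ((0 : ℝ) : ℂ))) * f ξ := by
    rw [Complex.ofReal_zero, mul_zero, Complex.exp_zero]; ring
  rw [e]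
  refine (norm_sub_le _ _).trans (add_le_add (hf2 ξ t ht) ?_)
  have h1 := norm_exp_I_mul_sub_le θ 0
  rw [sub_zero] at h1
  have h2 : |θ| ≤ (16 * ε) ^ 4 * ((|ξ| * t ^ (1 / 5 : ℝ)) ^ 5)⁻¹ := by
    rw [hθ, abs_div, abs_mul, abs_mul, abs_of_pos ht0, abs_pow ξ, mul_pow |ξ|, fifth_root_pow ht0.le,
      abs_of_nonneg (by positivity : 0 ≤ ‖f ξ‖ ^ 4), div_eq_mul_inv]
    have h40 : (|(40 : ℝ)| * t * |ξ| ^ 5)⁻¹ ≤ (|ξ| ^ 5 * t)⁻¹ := by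
      rw [mul_assoc, mul_inv, mul_comm t]
      refine mul_le_of_le_one_left (by positivity) ?_
      norm_num
    have := hfb ξ
    gcongr
  rw [norm_mul]
  refine (mul_le_mul (h1.trans h2) (hfb ξ) (norm_nonneg _) (by positivity)).trans (le_of_eq ?_)
  ring

/-- Smallness threshold for the initial data. -/
theorem exists_threshold {C : ℝ} (hC : 0 ≤ C) :
    ∃ εbar : ℝ, 0 < εbar ∧ 0 < gammaExp C εbar ∧ ∀ ε, 0 < ε → ε ≤ εbar →
      ε ≤ 1 ∧ bootConst * ε ^ 4 ≤ 1 ∧ 0 ≤ gammaExp C ε := by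
  have hB := bootConst_pos
  have hc : ContinuousAt (fun ε : ℝ => C * ε ^ (2 / 5 : ℝ)) 0 :=
    continuousAt_const.mul (Real.continuousAt_rpow_const 0 (2 / 5) (Or.inr (by norm_num)))
  have h1 : ∀ᶠ ε in 𝓝[>] (0 : ℝ), C * ε ^ (2 / 5 : ℝ) < 1 / 10 := by
    refine (hc.eventually_lt continuousAt_const ?_).filter_mono nhdsWithin_le_nhds
    norm_num [Real.zero_rpow]
  have h2 : ∀ᶠ ε in 𝓝[>] (0 : ℝ), bootConst * ε ^ 4 < 1 := by
    refine (ContinuousAt.eventually_lt (f := fun ε : ℝ => bootConst * ε ^ 4) (by fun_prop)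
      continuousAt_const ?_).filter_mono nhdsWithin_le_nhds
    norm_num
  have h3 : ∀ᶠ ε in 𝓝[>] (0 : ℝ), ε < 1 :=
    (eventually_lt_nhds one_pos).filter_mono nhdsWithin_le_nhds
  -- All three conditions are monotone in the size of the data, so one admissible threshold serves
  -- every smaller value.
  obtain ⟨e, ⟨⟨h1, h2⟩, h3⟩, he⟩ := ((h1.and h2).and h3).and self_mem_nhdsWithin |>.exists
  have he0 : 0 < e := he
  refine ⟨e, he0, by rw [gammaExp]; linarith, fun ε hε hεe => ⟨hεe.trans h3.le, ?_, ?_⟩⟩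
  · refine le_trans ?_ h2.le
    gcongr
  · have : C * ε ^ (2 / 5 : ℝ) ≤ C * e ^ (2 / 5 : ℝ) := by gcongr
    rw [gammaExp]
    linarith

end FifthKdV
end

/-! ### The main theorem -/

theorem lemma6 (C : ℝ) (hC : 0 ≤ C) :
    ∃ εbar : ℝ, 0 < εbar ∧ 0 < FifthKdV.gammaExp C εbar ∧
    ∃ T : ℝ, 1 ≤ T ∧ ∃ K : ℝ, 0 < K ∧
    ∀ ε₀ : ℝ, 0 < ε₀ → ε₀ ≤ εbar →
    ∀ (u₀ : Lp ℝ 2 (volume : Measure ℝ)) (u : ℝ → Lp ℝ 2 (volume : Measure ℝ)),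
      FifthKdV.h2Norm u₀ + FifthKdV.weightedNorm u₀ ≤ ENNReal.ofReal ε₀ →
      FifthKdV.IsSolution u₀ u →
      -- the Fourier transform of the profile and the phase are given by convergent integrals
      (∀ t : ℝ, 1 ≤ t → Integrable (FifthKdV.profile u t) volume) ∧
      (∀ ξ : ℝ, ContinuousOn (fun t : ℝ => FifthKdV.profileHat u t ξ) (Set.Ici 1)) ∧
      ∀ δ : ℝ, 0 < δ → δ < 1 / 2 →
        (∃ w_inf : ℝ → ℂ, MemLp w_inf ⊤ volume ∧
          ∀ t ξ : ℝ, T ≤ t →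
            (2 : ℝ) ^ (-10 : ℝ) * t ^ (-(1 / 5) + FifthKdV.gammaExp C ε₀) ≤ |ξ| →
            ‖FifthKdV.modifiedProfile u t ξ - w_inf ξ‖ ≤
              K * ε₀ * (|ξ| * t ^ (1 / 5 : ℝ)) ^ (-(1 / 2 - δ))) ∧
        (∃ f_inf : ℝ → ℂ, MemLp f_inf ⊤ volume ∧
          ∀ t ξ : ℝ, T ≤ t →
            (2 : ℝ) ^ (-10 : ℝ) * t ^ (-(1 / 5) + FifthKdV.gammaExp C ε₀) ≤ |ξ| →
            ‖FifthKdV.profileHat u t ξ -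
                Complex.exp (Complex.I * ((‖f_inf ξ‖ ^ 4 / (40 * t * ξ ^ 5) : ℝ) : ℂ)) *
                  f_inf ξ‖ ≤
              K * ε₀ * (|ξ| * t ^ (1 / 5 : ℝ)) ^ (-(1 / 2 - δ))) := by
  obtain ⟨εbar, hεbar, hγbar, hthr⟩ := FifthKdV.exists_threshold hC
  -- The estimates hold from `t = 1` on, and the constant does not depend on `δ`, since both limits
  -- are attained at the faster rate of exponent one.
  refine ⟨εbar, hεbar, hγbar, 1, le_rfl, FifthKdV.asymptoticConst,
    FifthKdV.asymptoticConst_pos, fun ε₀ hε hεle u₀ u hdata hu => ?_⟩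
  obtain ⟨hε1, hsm, hγ⟩ := hthr ε₀ hε hεle
  obtain ⟨hd1, hd2, hd3⟩ := FifthKdV.small_data hu hε.le hdata
  have hd : FifthKdV.SmallData u ε₀ := ⟨hε, hd1, hd2, hd3⟩
  refine ⟨fun t ht => FifthKdV.integrable_profile hu hd2 (zero_le_one.trans ht),
    hd.continuousOn_profileHat hu, fun δ hδ hδ2 => ⟨?_, ?_⟩⟩
  · obtain ⟨w, hw, hwb⟩ := hd.exists_modifiedProfile_limit hu hsm
    exact ⟨w, hw, fun t ξ ht hξ => (hwb t ξ ht).trans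
      (FifthKdV.error_le hε hε1 (FifthKdV.le_scale_of_mem_region ht hγ hξ)
        (by linarith) (by linarith))⟩
  · obtain ⟨f, hf, hfb⟩ := hd.exists_profileHat_limit hu hsm
    exact ⟨f, hf, fun t ξ ht hξ => (hfb t ξ ht).trans
      (FifthKdV.error_le hε hε1 (FifthKdV.le_scale_of_mem_region ht hγ hξ)
        (by linarith) (by linarith))⟩
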